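/- Let $g\ge 0$ and $n\ge 1$ be integers with $2g+n\ge 3$, and let $\Sigma_{g,n}$ be a closed connected orientable surface of genus $g$ with $n$ distinct labelled marked points. A triangulation of $\Sigma_{g,n}$ is a maximal collection of pairwise non-isotopic essential simple arcs with endpoints in the set of marked points and pairwise disjoint interiors that contain no marked point; equivalently, it is a finite collection of such arcs that cuts the surface into triangles whose vertices are the marked points. Loops, multiple arcs, and triangles glued to themselves along two of their sides are allowed. A quadrilateral of a triangulation consists of two distinct triangles adjacent along an arc, its diagonal, and flipping this arc means replacing it by the other diagonal of the quadrilateral. A simultaneous flip move flips finitely many arcs whose quadrilaterals have pairwise disjoint interiors. The modular simultaneous flip graph $\mathcal{MF}^s(\Sigma_{g,n})$ has as vertices the triangulations of $\Sigma_{g,n}$ up to homeomorphisms of the surface that fix every labelled marked point (orientation-preserving or not). Two distinct vertices are joined by an edge if they have representatives that differ by one simultaneous flip move. Then the graph $\mathcal{MF}^s(\Sigma_{g,n})$ is connected, and its diameter is finite and satisfies $$\operatorname{diam}\bigl(\mathcal{MF}^s(\Sigma_{g,n})\bigr) < 4500\,\bigl(\log(g+n)\bigr)^2,$$ where $\log$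 is the natural logarithm. In particular any two triangulations of $\Sigma_{g,n}$, taken up to homeomorphism, are related by fewer than $4500\,(\log(g+n))^2$ simultaneous flip moves, and the diameter is $O\bigl((\log(g+n))^2\bigr)$. -/

import Mathlib

open scoped unitInterval

namespace SimFlip

/-- The closed triangle, in barycentric coordinates. -/
abbrev Triangle : Type := stdSimplex ℝ (Fin 3)

/-- The point at time `t` on the `i`-th oriented side of the triangle, which runs from the vertex
`i` to the vertex `i + 1` (indices modulo 3). The three sides taken in order run once around the
boundary. -/
def sidePoint (i : Fin 3) (t : I) : Triangle :=
  ⟨Pi.single i (1 - (t : ℝ)) + Pi.single (i + 1) (t : ℝ), by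
    constructor
    · intro j
      have h0 := t.2.1
      have h1 := t.2.2
      simp only [Pi.add_apply, Pi.single_apply]
      split_ifs <;> linarith
    · simp [Finset.sum_add_distrib]⟩

/-- The `i`-th vertex of the triangle. -/
def vertex (i : Fin 3) : Triangle := sidePoint i 0

/-- A compact connected Hausdorff space with `n` labelled (distinct) marked points. All the marked
spaces considered below carry a triangulation, and this makes them closed orientable surfaces. -/
structure MarkedSpace (n : ℕ) where
  carrier : Type
  [top : TopologicalSpace carrier]
  [compact : CompactSpace carrier]
  [hausdorff : T2Space carrier]
  [connected : ConnectedSpace carrier]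
  mark : Fin n → carrier
  mark_injective : Function.Injective mark

attribute [instance] MarkedSpace.top MarkedSpace.compact MarkedSpace.hausdorff
  MarkedSpace.connected

/-- The elementary identifications between the points of `F` disjoint triangles whose sides are
glued according to `glue`: the point at time `t` of a side is identified with the point at time
`1 - t` of its partner. Sides are thus glued against their boundary orientations, so that the
orientations of the triangles match. -/
def Glued {F : ℕ} (glue : Fin F × Fin 3 → Fin F × Fin 3) (x y : Fin F × Triangle) : Prop :=
  ∃ (d : Fin F × Fin 3) (t : I),
    x = (d.1, sidePoint d.2 t) ∧ y = ((glue d).1, sidePoint (glue d).2 (σ t))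

/-- A triangulation of a space with marked points: a presentation of the space as the result of
gluing finitely many triangles along their sides in pairs, compatibly with orientations, such that
the vertices are exactly the marked points. Two sides of the same triangle may be glued to each
other, and triangles may share several vertices or sides, so the arcs may be loops or multiple
edges. Since the space is compact and Hausdorff, `chart_eq_iff` says that it is homeomorphic to
the quotient of the disjoint union of the triangles by the gluing. -/
structure Triangulation {n : ℕ} (S : MarkedSpace n) where
  /-- the number of triangles -/
  faces : ℕ
  /-- the characteristic maps of the triangles -/
  chart : Fin faces → C(Triangle, S.carrier)
  /-- the pairing of the sides of the triangles -/
  glue : Fin faces × Fin 3 → Fin faces × Fin 3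
  glue_glue : ∀ d, glue (glue d) = d
  glue_ne : ∀ d, glue d ≠ d
  chart_surjective : ∀ x : S.carrier, ∃ f y, chart f y = x
  chart_eq_iff : ∀ x y : Fin faces × Triangle,
    chart x.1 x.2 = chart y.1 y.2 ↔ Relation.EqvGen (Glued glue) x y
  range_vertices : Set.range (fun d : Fin faces × Fin 3 => chart d.1 (vertex d.2)) =
    Set.range S.mark

namespace Triangulation

variable {n : ℕ} {S : MarkedSpace n}

/-- The arcs of a triangulation: the images of the sides of its triangles. -/
def arcs (T : Triangulation S) : Set (Set S.carrier) :=
  Set.range fun d : Fin T.faces × Fin 3 => Set.range fun t : I => T.chart d.1 (sidePoint d.2 t)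

/-- The Euler characteristic: vertices minus edges plus faces. -/
noncomputable def eulerChar (T : Triangulation S) : ℤ :=
  (n : ℤ) - (T.arcs.ncard : ℤ) + (T.faces : ℤ)

end Triangulation

/-- The open unit square. -/
def openSquare : Set (I × I) := {x | x.1 ∈ Set.Ioo 0 1 ∧ x.2 ∈ Set.Ioo 0 1}

/-- The diagonal of the unit square. -/
def diagonal : Set (I × I) := {x | x.1 = x.2}

/-- The other diagonal of the unit square. -/
def antidiagonal : Set (I × I) := {x | (x.1 : ℝ) + (x.2 : ℝ) = 1}

/-- `q` is a quadrilateral of the triangulation `T`, formed by two distinct triangles that are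
adjacent along the arc `q '' diagonal`: it is a map of the closed square that is injective on the
open square (sides or corners may be identified), its corners and no other points are sent to
marked points, its four sides and its diagonal are sent to arcs of `T`, and the open square meets
the arcs of `T` along the diagonal only. -/
structure IsQuadrilateral {n : ℕ} {S : MarkedSpace n} (T : Triangulation S)
    (q : C(I × I, S.carrier)) : Prop where
  injOn : Set.InjOn q openSquare
  corners : ∀ x, q x ∈ Set.range S.mark ↔ (x.1 = 0 ∨ x.1 = 1) ∧ (x.2 = 0 ∨ x.2 = 1)
  left : q '' {x | x.1 = 0} ∈ T.arcs
  right : q '' {x | x.1 = 1} ∈ T.arcs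
  bottom : q '' {x | x.2 = 0} ∈ T.arcs
  top : q '' {x | x.2 = 1} ∈ T.arcs
  diag : q '' diagonal ∈ T.arcs
  avoids : ∀ x ∈ openSquare, ∀ a ∈ T.arcs, q x ∈ a → x ∈ diagonal

/-- `T'` is obtained from `T` by one simultaneous flip move: there are finitely many
quadrilaterals of `T` with pairwise disjoint interiors such that `T'` results from `T` by replacing
in each of them one diagonal by the other one. -/
def SimultaneousFlip {n : ℕ} {S : MarkedSpace n} (T T' : Triangulation S) : Prop :=
  ∃ (k : ℕ) (q : Fin k → C(I × I, S.carrier)),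
    (∀ i, IsQuadrilateral T (q i)) ∧
    (∀ i j, i ≠ j → Disjoint (q i '' openSquare) (q j '' openSquare)) ∧
    T'.arcs = (T.arcs \ Set.range fun i => q i '' diagonal) ∪
      Set.range fun i => q i '' antidiagonal

/-- A surface of genus `g` with `n` labelled marked points together with a triangulation of it. -/
structure TriangulatedSurface (g n : ℕ) where
  surface : MarkedSpace n
  triang : Triangulation surface
  genus_eq : triang.eulerChar = 2 - 2 * (g : ℤ)

/-- Two triangulated surfaces agree up to homeomorphism: some homeomorphism of the surfaces (which
may preserve or reverse orientations) respects every labelled marked point and carries the arcs of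
the one triangulation to those of the other. On one surface, this is the relation of differing by
a homeomorphism that fixes the labelled marked points. -/
def HomeoEquiv {g n : ℕ} (A B : TriangulatedSurface g n) : Prop :=
  ∃ h : A.surface.carrier ≃ₜ B.surface.carrier,
    (∀ i, h (A.surface.mark i) = B.surface.mark i) ∧
    (fun a : Set A.surface.carrier => h '' a) '' A.triang.arcs = B.triang.arcs

theorem homeoEquiv_equivalence (g n : ℕ) :
    Equivalence (HomeoEquiv : TriangulatedSurface g n → TriangulatedSurface g n → Prop) where
  refl A := ⟨Homeomorph.refl _, fun _ => rfl, by simp⟩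
  symm := by
    rintro A B ⟨h, hm, ha⟩
    refine ⟨h.symm, fun i => by rw [← hm i, h.symm_apply_apply], ?_⟩
    rw [← ha, Set.image_image]
    simp [Set.image_image]
  trans := by
    rintro A B C ⟨h, hm, ha⟩ ⟨k, km, ka⟩
    refine ⟨h.trans k, fun i => by simp [hm i, km i], ?_⟩
    rw [← ka, ← ha, Set.image_image]
    refine Set.image_congr fun a _ => ?_
    rw [Set.image_image]
    rfl

instance triangulatedSurfaceSetoid (g n : ℕ) : Setoid (TriangulatedSurface g n) :=
  ⟨HomeoEquiv, homeoEquiv_equivalence g n⟩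

/-- The vertices of the modular flip graph of the surface of genus `g` with `n` labelled marked
points: its triangulations up to homeomorphism. -/
abbrev ModularVertex (g n : ℕ) : Type 1 := Quotient (triangulatedSurfaceSetoid g n)

/-- The modular simultaneous flip graph of the surface of genus `g` with `n` labelled marked
points: two distinct vertices are joined by an edge if they have representatives, on one surface,
that differ by a simultaneous flip move. -/
def modularSimultaneousFlipGraph (g n : ℕ) : SimpleGraph (ModularVertex g n) :=
  SimpleGraph.fromRel fun u v =>
    ∃ (S : MarkedSpace n) (T T' : Triangulation S)
      (hT : T.eulerChar = 2 - 2 * (g : ℤ)) (hT' : T'.eulerChar = 2 - 2 * (g : ℤ)),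
      u = Quotient.mk _ ⟨S, T, hT⟩ ∧ v = Quotient.mk _ ⟨S, T', hT'⟩ ∧ SimultaneousFlip T T'

end SimFlip

/-! A triangulation is encoded by its darts (the sides of its triangles), the pairing `α` of the
darts, the rotation `φ` around each triangle and the label of the initial vertex of each dart.
Isomorphic encodings give homeomorphic triangulated surfaces (`Triangulation.exists_homeomorph`),
and every combinatorial flip of disjoint edges is realized on the same space by a simultaneous flip
(`Triangulation.exists_simultaneousFlip`). It therefore suffices that two closed combinatorial
surfaces of the same genus with the same labels become isomorphic after few moves on either side
(`Closed.meet`); the moves on the second side are then run backwards.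

The basic tool is the polygon. Gluing all triangles along a spanning tree of the dual graph gives a
polygon whose sides are matched in some way, and its triangulation is a binary tree. Rotations at
disjoint places of the tree are simultaneous flips. Two trees with `m` leaves differ by `O(log m)`
such steps (`BT.rotN_of_leaves_eq`): rounds of contraction lower the height to `O(log m)`, and a
tree of height `H` unrolls to the left comb in `H` steps. Hence a polygon can be retriangulated at
will, for instance as a fan, in `O(log m)` moves (`Span.polygon`, `Span.exists_comb`).

The second tool is to flip nearly all sides of a fan in a single move. Since the opposite corners of
all the quadrilaterals are at the centre, the centre `z` then occupies at least two corners of every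
triangle (`Comb.dom_flip`). The surface can now be cut open to a polygon in which each other label
occurs at one corner only (`exists_starred_span`). If instead a set `F` of matched sides is spared,
and the contour obtained by opening just these sides passes all of them, the same move makes the
sides in `F` consecutive in a new polygon (`Comb.exists_contour`), where one diagonal cuts them off.
Which sets `F` are possible is a question about permutations: opening a matched pair multiplies the
rotation along the contour by a transposition, so an orbit splits or two orbits merge, and `F` is
built from handles (four letters) and isolated vertices (two letters), see `Chain.exists_chain`.

So a piece with `h` handles, the extra labels `L` and one free side is cut by `O(log)` moves into
two pieces of prescribed types and a triangle (`Piece.exists_split`). Both pieces are then treated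
at the same time, and halving `h + L.card` leads after logarithmically many levels to pieces with
one handle or one extra label, which are unique up to `O(log)` moves (`Piece.meet_one`).
Logarithmically many levels with logarithmically many moves each give the square of the logarithm
(`Piece.meet`). A closed surface is first cut into two pieces, by a loop around a second vertex or
around a handle; the torus with one vertex is settled directly. -/

namespace SimFlip

/-! ### Combinatorial surfaces and simultaneous flips. -/

/-- A combinatorial triangulated surface with labelled vertices. The darts are the sides of the
triangles, `φ` runs around the triangles and `α` matches the sides; its fixed points are the free
sides. The label of a dart is that of its initial vertex. -/
@[ext]
structure TriSurf (V D : Type) where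
  α : D → D
  φ : D → D
  lab : D → V
  αα : ∀ d, α (α d) = d
  φφφ : ∀ d, φ (φ (φ d)) = d
  φ_ne : ∀ d, φ d ≠ d
  lab_ν : ∀ d, lab (φ (α d)) = lab d

namespace TriSurf

variable {V D : Type}

theorem φ_inj (M : TriSurf V D) : Function.Injective M.φ := fun a b h => by
  rw [← M.φφφ a, h, M.φφφ]

theorem α_inj (M : TriSurf V D) : Function.Injective M.α := fun a b h => by
  rw [← M.αα a, h, M.αα]

theorem φφ_ne (M : TriSurf V D) (d : D) : M.φ (M.φ d) ≠ d := fun h =>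
  M.φ_ne d (by have := M.φφφ d; rwa [h] at this)

/-- The next dart with the same initial vertex. -/
def ν (M : TriSurf V D) (d : D) : D := M.φ (M.α d)

theorem ν_inj (M : TriSurf V D) : Function.Injective M.ν := fun _ _ h => M.α_inj (M.φ_inj h)

@[simp] theorem lab_ν' (M : TriSurf V D) (d : D) : M.lab (M.ν d) = M.lab d := M.lab_ν d

/-- `X` is a union of edges that can be flipped simultaneously. -/
structure Flippable (M : TriSurf V D) (X : Set D) : Prop where
  α_mem : ∀ d ∈ X, M.α d ∈ X
  α_ne : ∀ d ∈ X, M.α d ≠ d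
  -- Since `φ` has order three, this excludes `φ (φ d)` too: a triangle has at most one side in `X`.
  φ_notMem : ∀ d ∈ X, M.φ d ∉ X

open Classical in
/-- The rotation around the triangles after flipping the edges in `X`. -/
noncomputable def flipφ (M : TriSurf V D) (X : Set D) (x : D) : D :=
  if x ∈ X then M.φ (M.φ x) else if M.φ x ∈ X then M.φ (M.α (M.φ x))
  else if M.φ (M.φ x) ∈ X then M.α (M.φ (M.φ x)) else M.φ x

section flip
variable {M : TriSurf V D} {X : Set D}

theorem flipφ_of_mem {x : D} (h : x ∈ X) : M.flipφ X x = M.φ (M.φ x) := by simp [flipφ, h]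

theorem Flippable.φφ_notMem (hX : M.Flippable X) {d : D} (h : d ∈ X) : M.φ (M.φ d) ∉ X := by
  intro h'
  have := hX.φ_notMem _ h'
  rw [M.φφφ] at this
  exact this h

theorem Flippable.flipφ_of_φ_mem (hX : M.Flippable X) {x : D} (h : M.φ x ∈ X) :
    M.flipφ X x = M.φ (M.α (M.φ x)) := by
  have : x ∉ X := fun h' => hX.φ_notMem _ h' h
  simp [flipφ, h, this]

theorem Flippable.flipφ_of_φφ_mem (hX : M.Flippable X) {x : D} (h : M.φ (M.φ x) ∈ X) :
    M.flipφ X x = M.α (M.φ (M.φ x)) := by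
  have h1 : x ∉ X := fun h' => hX.φφ_notMem h' h
  have h2 : M.φ x ∉ X := fun h' => hX.φ_notMem _ h' h
  simp [flipφ, h, h1, h2]

theorem flipφ_of_notMem {x : D} (h : x ∉ X) (h1 : M.φ x ∉ X) (h2 : M.φ (M.φ x) ∉ X) :
    M.flipφ X x = M.φ x := by
  simp [flipφ, h, h1, h2]

/-- Every dart of a quadrilateral lies in a new triangle `e`, `φ (φ e)`, `φ (α e)` with `e ∈ X`; the
three cases for `x` are its possible places there. -/
theorem Flippable.flipφ_flipφ_flipφ (hX : M.Flippable X) (x : D) :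
    M.flipφ X (M.flipφ X (M.flipφ X x)) = x := by
  -- the three darts of a new triangle, starting with the flipped one
  have key : ∀ e ∈ X, M.flipφ X e = M.φ (M.φ e) ∧
      M.flipφ X (M.φ (M.φ e)) = M.φ (M.α e) ∧ M.flipφ X (M.φ (M.α e)) = e := by
    intro e he
    refine ⟨flipφ_of_mem he, ?_, ?_⟩
    · rw [hX.flipφ_of_φ_mem (by rwa [M.φφφ]), M.φφφ]
    · rw [hX.flipφ_of_φφ_mem (by rw [M.φφφ]; exact hX.α_mem _ he), M.φφφ, M.αα]
  by_cases h : x ∈ X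
  · obtain ⟨h1, h2, h3⟩ := key x h
    rw [h1, h2, h3]
  by_cases h1 : M.φ x ∈ X
  · obtain ⟨k1, k2, k3⟩ := key _ h1
    rw [M.φφφ] at k1 k2
    rw [k2, k3, k1]
  by_cases h2 : M.φ (M.φ x) ∈ X
  · obtain ⟨k1, k2, k3⟩ := key _ (hX.α_mem _ h2)
    rw [M.αα, M.φφφ] at k2 k3
    rw [k3, k1, k2]
  rw [flipφ_of_notMem h h1 h2, flipφ_of_notMem h1 h2 (by rwa [M.φφφ]),
    flipφ_of_notMem h2 (by rwa [M.φφφ]) (by rwa [M.φφφ]), M.φφφ]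

theorem Flippable.flipφ_ne (hX : M.Flippable X) (x : D) : M.flipφ X x ≠ x := by
  by_cases h : x ∈ X
  · rw [flipφ_of_mem h]; exact M.φφ_ne x
  by_cases h1 : M.φ x ∈ X
  · rw [hX.flipφ_of_φ_mem h1]
    intro h3
    have h4 : M.α (M.φ x) = M.φ (M.φ x) := by rw [← M.φφφ (M.α (M.φ x)), h3]
    exact hX.φ_notMem _ h1 (h4 ▸ hX.α_mem _ h1)
  by_cases h2 : M.φ (M.φ x) ∈ X
  · rw [hX.flipφ_of_φφ_mem h2]
    intro h3
    exact h (h3 ▸ hX.α_mem _ h2)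
  rw [flipφ_of_notMem h h1 h2]; exact M.φ_ne x

theorem Flippable.flipφ_α_notMem (hX : M.Flippable X) {d : D} (h : d ∈ X) :
    M.flipφ X (M.α d) ∉ X := by
  rw [flipφ_of_mem (hX.α_mem _ h)]
  exact hX.φφ_notMem (hX.α_mem _ h)

open Classical in
/-- The surface after flipping the edges in `X`. -/
noncomputable def flip (M : TriSurf V D) (X : Set D) (hX : M.Flippable X) : TriSurf V D where
  α := M.α
  φ := M.flipφ X
  -- A flipped dart gets a new initial vertex. It is read off from the next dart around that vertex,
  -- which is not flipped.
  lab d := if d ∈ X then M.lab (M.flipφ X (M.α d)) else M.lab d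
  αα := M.αα
  φφφ := hX.flipφ_flipφ_flipφ
  φ_ne := hX.flipφ_ne
  lab_ν d := by
    by_cases hd : d ∈ X
    · simp only [hd, if_true, hX.flipφ_α_notMem hd, if_false]
    by_cases h1 : M.φ (M.α d) ∈ X
    · have h3 := hX.flipφ_of_φ_mem h1
      have h4 : M.flipφ X (M.α d) ∉ X := by
        rw [h3]; exact hX.φ_notMem _ (hX.α_mem _ h1)
      simp only [hd, h4, if_false]
      rw [h3, M.lab_ν, M.lab_ν]
    by_cases h2 : M.φ (M.φ (M.α d)) ∈ X
    · have h3 := hX.flipφ_of_φφ_mem h2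
      have h4 : M.flipφ X (M.α d) ∈ X := by rw [h3]; exact hX.α_mem _ h2
      simp only [hd, h4, if_false, if_true]
      rw [h3, M.αα, flipφ_of_mem h2, M.φφφ, M.lab_ν]
    · have hαd : M.α d ∉ X := fun h => hd (by simpa [M.αα] using hX.α_mem _ h)
      have h3 := flipφ_of_notMem hαd h1 h2
      simp only [hd, if_false]
      rw [h3, if_neg h1, M.lab_ν]

@[simp] theorem flip_α (hX : M.Flippable X) : (M.flip X hX).α = M.α := rfl
@[simp] theorem flip_φ (hX : M.Flippable X) : (M.flip X hX).φ = M.flipφ X := rfl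
theorem flip_lab (hX : M.Flippable X) {d : D} (h : d ∉ X) : (M.flip X hX).lab d = M.lab d := by
  simp [flip, h]

theorem flippable_empty (M : TriSurf V D) : M.Flippable ∅ := ⟨by simp, by simp, by simp⟩

theorem flip_empty (M : TriSurf V D) : M.flip ∅ M.flippable_empty = M := by
  ext d
  · rfl
  · simp [flipφ_of_notMem]
  · rw [flip_lab _ (by simp)]

end flip

/-- One simultaneous flip. -/
def Step (M M' : TriSurf V D) : Prop := ∃ (X : Set D) (hX : M.Flippable X), M' = M.flip X hX

/-- Idle moves make `Reach` monotone in the number of moves, so that parts that need different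
numbers of moves can be run side by side. -/
theorem Step.refl (M : TriSurf V D) : Step M M := ⟨∅, M.flippable_empty, M.flip_empty.symm⟩

/-- `k` simultaneous flips. -/
inductive Reach : ℕ → TriSurf V D → TriSurf V D → Prop
  | zero (M) : Reach 0 M M
  | succ {k M M' M''} : Reach k M M' → Step M' M'' → Reach (k + 1) M M''

namespace Reach
variable {M M' M'' : TriSurf V D} {k l : ℕ}

theorem trans (h : Reach k M M') (h' : Reach l M' M'') : Reach (k + l) M M'' := by
  induction h' with
  | zero => exact h
  | succ _ s ih => exact (ih h).succ s

theorem one (h : Step M M') : Reach 1 M M' := (Reach.zero M).succ h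

theorem refl (M : TriSurf V D) : ∀ k, Reach k M M
  | 0 => .zero M
  | k + 1 => (refl M k).succ (.refl M)

theorem mono (h : Reach k M M') (hkl : k ≤ l) : Reach l M M' := by
  obtain ⟨m, rfl⟩ := Nat.exists_eq_add_of_le hkl
  exact h.trans (refl _ m)

theorem α_eq (h : Reach k M M') : M'.α = M.α := by
  induction h with
  | zero => rfl
  | succ _ s ih => obtain ⟨X, hX, rfl⟩ := s; exact ih

end Reach

/-- The surface is connected, and different vertices have different labels. -/
structure Good (M : TriSurf V D) : Prop where
  conn : ∀ S : Set D, S.Nonempty → (∀ d ∈ S, M.α d ∈ S) → (∀ d ∈ S, M.φ d ∈ S) → S = Set.univ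
  vconn : ∀ S : Set D, (∀ d ∈ S, M.ν d ∈ S) → ∀ d ∈ S, ∀ d', M.lab d' = M.lab d → d' ∈ S

/-- On a finite set an injective map that sends `S` into itself permutes `S`. This is why closure in
one direction is enough in `Good`. -/
theorem mem_iff_of_closed [Finite D] {f : D → D} (hf : Function.Injective f) {S : Set D}
    (h : ∀ d ∈ S, f d ∈ S) (d : D) : f d ∈ S ↔ d ∈ S := by
  refine ⟨fun hd => ?_, h d⟩
  have h1 : f '' S ⊆ S := by rintro _ ⟨x, hx, rfl⟩; exact h x hx
  have h2 : f '' S = S := Set.eq_of_subset_of_ncard_le h1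
    (by rw [Set.ncard_image_of_injective _ hf]) (Set.toFinite _)
  rw [← h2] at hd
  obtain ⟨x, hx, hxd⟩ := hd
  rwa [← hf hxd]

theorem ν_notMem_of_mem {M : TriSurf V D} {X : Set D} (hX : M.Flippable X) {d : D} (h : d ∈ X) :
    M.ν d ∉ X := hX.φ_notMem _ (hX.α_mem _ h)

/-- Off the flipped edges, going around a vertex is not affected by the flip. -/
theorem flip_ν {M : TriSurf V D} {X : Set D} (hX : M.Flippable X) {x : D} (hx : x ∉ X) :
    (M.ν x ∈ X → (M.flip X hX).ν x = M.ν (M.ν x)) ∧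
    (M.ν x ∉ X → (M.flip X hX).ν x ∈ X ∧ (M.flip X hX).ν ((M.flip X hX).ν x) = M.ν x ∨
      (M.flip X hX).ν x = M.ν x) := by
  simp only [ν, flip_α, flip_φ]
  refine ⟨fun h => hX.flipφ_of_φ_mem h, fun h => ?_⟩
  have hαx : M.α x ∉ X := fun h => hx (by simpa [M.αα] using hX.α_mem _ h)
  by_cases h2 : M.φ (M.φ (M.α x)) ∈ X
  · left
    rw [hX.flipφ_of_φφ_mem h2]
    refine ⟨hX.α_mem _ h2, ?_⟩
    rw [M.αα, flipφ_of_mem h2, M.φφφ]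
  · right
    exact flipφ_of_notMem hαx h h2

/-- A set closed for the new surface contains all or none of the darts of each flipped
quadrilateral, so it is closed for the old one. For the vertices, only unflipped darts are compared,
as they keep their labels; every vertex has one, because the dart after a flipped one is not
flipped. -/
theorem Good.flip [Finite D] {M : TriSurf V D} (hM : M.Good) {X : Set D} (hX : M.Flippable X) :
    (M.flip X hX).Good where
  conn S hS hα hφ := by
    have hφ' : ∀ d, M.flipφ X d ∈ S ↔ d ∈ S :=
      mem_iff_of_closed (M.flip X hX).φ_inj hφ
    have key : ∀ e ∈ X, (M.φ (M.φ e) ∈ S ↔ e ∈ S) ∧ (M.φ (M.α e) ∈ S ↔ e ∈ S) := by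
      intro e he
      have h1 : M.φ (M.φ e) ∈ S ↔ e ∈ S := by rw [← flipφ_of_mem he]; exact hφ' e
      refine ⟨h1, ?_⟩
      rw [← h1, ← hφ' (M.φ (M.φ e)), hX.flipφ_of_φ_mem (by rwa [M.φφφ]), M.φφφ]
    have hα' : ∀ e, M.α e ∈ S ↔ e ∈ S := mem_iff_of_closed M.α_inj hα
    refine hM.conn S hS hα fun d hd => ?_
    by_cases h : d ∈ X
    · have := (key _ (hX.α_mem _ h)).2
      rw [M.αα] at this
      rw [this, hα']; exact hd
    by_cases h1 : M.φ d ∈ X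
    · rw [← (key _ h1).1, M.φφφ]; exact hd
    by_cases h2 : M.φ (M.φ d) ∈ X
    · have h3 := (key _ (hX.α_mem _ h2)).2
      rw [M.αα, M.φφφ] at h3
      have h4 := (key _ h2).1
      rw [M.φφφ] at h4
      rw [h4, ← hα', ← h3]; exact hd
    · rw [← flipφ_of_notMem h h1 h2]; exact hφ d hd
  vconn S hS := by
    set M' := M.flip X hX with hM'
    have hS' : ∀ d, M'.ν d ∈ S ↔ d ∈ S := mem_iff_of_closed M'.ν_inj hS
    -- the saturation of `S` for the old rotation
    have hT : ∀ d ∈ {d | (d ∉ X ∧ d ∈ S) ∨ (d ∈ X ∧ M.ν d ∈ S)},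
        M.ν d ∈ {d | (d ∉ X ∧ d ∈ S) ∨ (d ∈ X ∧ M.ν d ∈ S)} := by
      rintro d (⟨h1, h2⟩ | ⟨h1, h2⟩)
      · obtain ⟨k1, k2⟩ := flip_ν hX h1
        by_cases h3 : M.ν d ∈ X
        · exact Or.inr ⟨h3, by rw [← k1 h3]; exact hS _ h2⟩
        · refine Or.inl ⟨h3, ?_⟩
          rcases k2 h3 with ⟨k3, k4⟩ | k3
          · rw [← k4]; exact hS _ (hS _ h2)
          · rw [← k3]; exact hS _ h2
      · exact Or.inl ⟨ν_notMem_of_mem hX h1, h2⟩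
    have main : ∀ d ∈ S, d ∉ X → ∀ d', d' ∉ X → M.lab d' = M.lab d → d' ∈ S := by
      intro d hd hdX d' hdX' hl
      rcases hM.vconn _ hT d (Or.inl ⟨hdX, hd⟩) d' hl with h | h
      · exact h.2
      · exact absurd h.1 hdX'
    have hν : ∀ d ∈ X, M'.ν d ∉ X := fun d hd => hX.flipφ_α_notMem hd
    -- Any dart may be replaced by an unflipped one at the same new vertex.
    have red : ∀ d, ∃ e, e ∉ X ∧ M'.lab d = M.lab e ∧ (e ∈ S ↔ d ∈ S) := by
      intro d
      by_cases hd : d ∈ X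
      · refine ⟨M'.ν d, hν d hd, ?_, hS' d⟩
        rw [← flip_lab hX (hν d hd), ← hM', lab_ν']
      · exact ⟨d, hd, flip_lab hX hd, Iff.rfl⟩
    intro d hd d' hl
    obtain ⟨e, he, hel, hes⟩ := red d
    obtain ⟨e', he', hel', hes'⟩ := red d'
    rw [← hes']
    exact main e (hes.2 hd) he e' he' (by rw [← hel', ← hel, hl])

theorem Reach.good [Finite D] {M M' : TriSurf V D} {k : ℕ} (h : Reach k M M') (hM : M.Good) :
    M'.Good := by
  induction h with
  | zero => exact hM
  | succ _ s ih => obtain ⟨X, hX, rfl⟩ := s; exact (ih hM).flip hX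

/-- No vertex gets lost: before and after a flip, the dart following a flipped one around its vertex
is unflipped and has the same label. -/
theorem Reach.lab_range {M M' : TriSurf V D} {k : ℕ} (h : Reach k M M') :
    Set.range M'.lab = Set.range M.lab := by
  induction h with
  | zero => rfl
  | @succ _ _ M' _ _ s ih =>
    obtain ⟨X, hX, rfl⟩ := s
    rw [← ih]
    ext v
    constructor
    · rintro ⟨d, rfl⟩
      by_cases hd : d ∈ X
      · refine ⟨(M'.flip X hX).ν d, ?_⟩
        exact (flip_lab hX (hX.flipφ_α_notMem hd : (M'.flip X hX).ν d ∉ X)).symm.trans (lab_ν' _ d)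
      · exact ⟨d, (flip_lab hX hd).symm⟩
    · rintro ⟨d, rfl⟩
      by_cases hd : d ∈ X
      · exact ⟨M'.ν d, by rw [flip_lab hX (ν_notMem_of_mem hX hd), lab_ν']⟩
      · exact ⟨d, flip_lab hX hd⟩

/-- Compatibility with `α` is required on `X` only, so that `f` may also be the inclusion of a part
whose attaching side is free there but glued in the whole. -/
theorem flipφ_map {D' : Type} {M : TriSurf V D} {N : TriSurf V D'} {f : D → D'} {X : Set D}
    {Y : Set D'} (hφ : ∀ d, f (M.φ d) = N.φ (f d)) (hXY : ∀ d, f d ∈ Y ↔ d ∈ X)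
    (hα : ∀ d ∈ X, f (M.α d) = N.α (f d)) (d : D) : f (M.flipφ X d) = N.flipφ Y (f d) := by
  have h2 : N.φ (f d) ∈ Y ↔ M.φ d ∈ X := by rw [← hφ, hXY]
  have h3 : N.φ (N.φ (f d)) ∈ Y ↔ M.φ (M.φ d) ∈ X := by rw [← hφ, ← hφ, hXY]
  unfold flipφ
  by_cases c1 : d ∈ X
  · rw [if_pos c1, if_pos ((hXY _).2 c1), hφ, hφ]
  rw [if_neg c1, if_neg (mt (hXY _).1 c1)]
  by_cases c2 : M.φ d ∈ X
  · rw [if_pos c2, if_pos (h2.2 c2), hφ, hα _ c2, hφ]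
  rw [if_neg c2, if_neg (mt h2.1 c2)]
  by_cases c3 : M.φ (M.φ d) ∈ X
  · rw [if_pos c3, if_pos (h3.2 c3), hα _ c3, hφ, hφ]
  rw [if_neg c3, if_neg (mt h3.1 c3), hφ]

theorem flip_lab_map {D' : Type} {M : TriSurf V D} {N : TriSurf V D'} {f : D → D'} {X : Set D}
    {Y : Set D'} (hX : M.Flippable X) (hY : N.Flippable Y)
    (hφ : ∀ d, f (M.φ d) = N.φ (f d)) (hXY : ∀ d, f d ∈ Y ↔ d ∈ X)
    (hα : ∀ d ∈ X, f (M.α d) = N.α (f d)) (hl : ∀ d, N.lab (f d) = M.lab d) (d : D) :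
    (N.flip Y hY).lab (f d) = (M.flip X hX).lab d := by
  by_cases c : d ∈ X
  · simp only [flip]
    rw [if_pos c, if_pos ((hXY d).2 c), ← hα d c, ← flipφ_map hφ hXY hα, hl]
  · rw [flip_lab hX c, flip_lab hY (mt (hXY d).1 c), hl]

/-- An isomorphism of labelled triangulated surfaces. -/
structure Iso {D' : Type} (M : TriSurf V D) (N : TriSurf V D') (e : D ≃ D') : Prop where
  α : ∀ d, e (M.α d) = N.α (e d)
  φ : ∀ d, e (M.φ d) = N.φ (e d)
  lab : ∀ d, N.lab (e d) = M.lab d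

namespace Iso
variable {D' D'' : Type} {M : TriSurf V D} {N : TriSurf V D'} {e : D ≃ D'}

theorem refl (M : TriSurf V D) : Iso M M (Equiv.refl D) := ⟨fun _ => rfl, fun _ => rfl, fun _ => rfl⟩

theorem symm (h : Iso M N e) : Iso N M e.symm where
  α d := by rw [Equiv.symm_apply_eq, h.α, e.apply_symm_apply]
  φ d := by rw [Equiv.symm_apply_eq, h.φ, e.apply_symm_apply]
  lab d := by rw [← h.lab, e.apply_symm_apply]

theorem trans {P : TriSurf V D''} {e' : D' ≃ D''} (h : Iso M N e) (h' : Iso N P e') :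
    Iso M P (e.trans e') where
  α d := by simp [h.α, h'.α]
  φ d := by simp [h.φ, h'.φ]
  lab d := by simp [h.lab, h'.lab]

theorem flippable (h : Iso M N e) {X : Set D} (hX : M.Flippable X) :
    N.Flippable (e.symm ⁻¹' X) := by
  have h' := h.symm
  refine ⟨fun d hd => ?_, fun d hd => ?_, fun d hd => ?_⟩
  · simp only [Set.mem_preimage] at *; rw [h'.α]; exact hX.α_mem _ hd
  · intro hh; exact hX.α_ne _ hd (by rw [← h'.α, hh])
  · simp only [Set.mem_preimage] at *; rw [h'.φ]; exact hX.φ_notMem _ hd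

theorem flip (h : Iso M N e) {X : Set D} (hX : M.Flippable X) :
    Iso (M.flip X hX) (N.flip _ (h.flippable hX)) e := by
  have hm : ∀ d, e d ∈ e.symm ⁻¹' X ↔ d ∈ X := by simp
  exact ⟨h.α, flipφ_map h.φ hm fun d _ => h.α d,
    flip_lab_map hX _ h.φ hm (fun d _ => h.α d) h.lab⟩

theorem step (h : Iso M N e) {M' : TriSurf V D} (hs : Step M M') : ∃ N', Step N N' ∧ Iso M' N' e := by
  obtain ⟨X, hX, rfl⟩ := hs
  exact ⟨_, ⟨_, h.flippable hX, rfl⟩, h.flip hX⟩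

theorem reach {k : ℕ} {M' : TriSurf V D} (hs : Reach k M M') (h : Iso M N e) :
    ∃ N', Reach k N N' ∧ Iso M' N' e := by
  induction hs with
  | zero => exact ⟨N, .zero N, h⟩
  | succ _ s ih =>
    obtain ⟨N', r, i⟩ := ih h
    obtain ⟨N'', s', i'⟩ := i.step s
    exact ⟨N'', r.succ s', i'⟩

end Iso

end TriSurf

end SimFlip

/-! ### Gluing surfaces along a free side and cutting them along a loop. -/

namespace SimFlip

namespace TriSurf

variable {V D D₁ D₂ E₁ E₂ : Type}

section glue

open Classical in
/-- Two surfaces glued along a free side. -/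
noncomputable def glue (M₁ : TriSurf V D₁) (M₂ : TriSurf V D₂) (r₁ : D₁) (r₂ : D₂)
    (h₁ : M₁.α r₁ = r₁) (h₂ : M₂.α r₂ = r₂) (hl : M₁.lab r₁ = M₂.lab r₂) :
    TriSurf V (D₁ ⊕ D₂) where
  α := Sum.elim (fun d => if d = r₁ then .inr r₂ else .inl (M₁.α d))
    (fun d => if d = r₂ then .inl r₁ else .inr (M₂.α d))
  φ := Sum.map M₁.φ M₂.φ
  lab := Sum.elim M₁.lab M₂.lab
  αα := by
    rintro (d | d)
    · by_cases h : d = r₁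
      · simp [h]
      · have : M₁.α d ≠ r₁ := fun h' => h (by rw [← M₁.αα d, h', h₁])
        simp [h, this, M₁.αα]
    · by_cases h : d = r₂
      · simp [h]
      · have : M₂.α d ≠ r₂ := fun h' => h (by rw [← M₂.αα d, h', h₂])
        simp [h, this, M₂.αα]
  φφφ := by rintro (d | d) <;> simp [M₁.φφφ, M₂.φφφ]
  φ_ne := by rintro (d | d) <;> simp [M₁.φ_ne, M₂.φ_ne]
  lab_ν := by
    rintro (d | d)
    · by_cases h : d = r₁
      · have := M₂.lab_ν r₂
        rw [h₂] at this
        simp [h, this, hl]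
      · simp [h, M₁.lab_ν]
    · by_cases h : d = r₂
      · have := M₁.lab_ν r₁
        rw [h₁] at this
        simp [h, this, hl]
      · simp [h, M₂.lab_ν]

variable {M₁ M₁' : TriSurf V D₁} {M₂ M₂' : TriSurf V D₂} {r₁ : D₁} {r₂ : D₂}

theorem Flippable.glue {X₁ : Set D₁} {X₂ : Set D₂} (hX₁ : M₁.Flippable X₁) (hX₂ : M₂.Flippable X₂)
    (h₁ : M₁.α r₁ = r₁) (h₂ : M₂.α r₂ = r₂) (hl : M₁.lab r₁ = M₂.lab r₂) :
    (M₁.glue M₂ r₁ r₂ h₁ h₂ hl).Flippable (Sum.inl '' X₁ ∪ Sum.inr '' X₂) := by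
  have n₁ : ∀ d ∈ X₁, d ≠ r₁ := fun d hd h => hX₁.α_ne d hd (by rw [h, h₁])
  have n₂ : ∀ d ∈ X₂, d ≠ r₂ := fun d hd h => hX₂.α_ne d hd (by rw [h, h₂])
  refine ⟨?_, ?_, ?_⟩
  · rintro _ (⟨d, hd, rfl⟩ | ⟨d, hd, rfl⟩)
    · simp [TriSurf.glue, n₁ d hd, hX₁.α_mem d hd]
    · simp [TriSurf.glue, n₂ d hd, hX₂.α_mem d hd]
  · rintro _ (⟨d, hd, rfl⟩ | ⟨d, hd, rfl⟩)
    · simp [TriSurf.glue, n₁ d hd, hX₁.α_ne d hd]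
    · simp [TriSurf.glue, n₂ d hd, hX₂.α_ne d hd]
  · rintro _ (⟨d, hd, rfl⟩ | ⟨d, hd, rfl⟩)
    · simp [TriSurf.glue, hX₁.φ_notMem d hd]
    · simp [TriSurf.glue, hX₂.φ_notMem d hd]

theorem Flippable.flip_glue {X₁ : Set D₁} {X₂ : Set D₂} (hX₁ : M₁.Flippable X₁)
    (hX₂ : M₂.Flippable X₂)
    (h₁ : M₁.α r₁ = r₁) (h₂ : M₂.α r₂ = r₂) (hl : M₁.lab r₁ = M₂.lab r₂)
    (hl' : (M₁.flip X₁ hX₁).lab r₁ = (M₂.flip X₂ hX₂).lab r₂) :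
    (M₁.glue M₂ r₁ r₂ h₁ h₂ hl).flip _ (hX₁.glue hX₂ h₁ h₂ hl) =
      (M₁.flip X₁ hX₁).glue (M₂.flip X₂ hX₂) r₁ r₂ h₁ h₂ hl' := by
  have n₁ : ∀ d ∈ X₁, d ≠ r₁ := fun d hd h => hX₁.α_ne d hd (by rw [h, h₁])
  have n₂ : ∀ d ∈ X₂, d ≠ r₂ := fun d hd h => hX₂.α_ne d hd (by rw [h, h₂])
  have m₁ : ∀ d, (Sum.inl d : D₁ ⊕ D₂) ∈ (Sum.inl '' X₁ ∪ Sum.inr '' X₂ : Set (D₁ ⊕ D₂)) ↔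
      d ∈ X₁ := by simp
  have m₂ : ∀ d, (Sum.inr d : D₁ ⊕ D₂) ∈ (Sum.inl '' X₁ ∪ Sum.inr '' X₂ : Set (D₁ ⊕ D₂)) ↔
      d ∈ X₂ := by simp
  have a₁ : ∀ d ∈ X₁, (M₁.glue M₂ r₁ r₂ h₁ h₂ hl).α (.inl d) = .inl (M₁.α d) := fun d hd => by
    simp [TriSurf.glue, n₁ d hd]
  have a₂ : ∀ d ∈ X₂, (M₁.glue M₂ r₁ r₂ h₁ h₂ hl).α (.inr d) = .inr (M₂.α d) := fun d hd => by
    simp [TriSurf.glue, n₂ d hd]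
  ext d
  · rfl
  · rcases d with d | d
    · exact (flipφ_map (f := Sum.inl) (fun _ => rfl) m₁ (fun d hd => (a₁ d hd).symm) d).symm
    · exact (flipφ_map (f := Sum.inr) (fun _ => rfl) m₂ (fun d hd => (a₂ d hd).symm) d).symm
  · rcases d with d | d
    · exact flip_lab_map (f := Sum.inl) hX₁ _ (fun _ => rfl) m₁ (fun d hd => (a₁ d hd).symm)
        (fun _ => rfl) d
    · exact flip_lab_map (f := Sum.inr) hX₂ _ (fun _ => rfl) m₂ (fun d hd => (a₂ d hd).symm)
        (fun _ => rfl) d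

theorem flip_lab_free {X : Set D₁} (hX : M₁.Flippable X) (h : M₁.α r₁ = r₁) :
    (M₁.flip X hX).lab r₁ = M₁.lab r₁ :=
  flip_lab hX fun h' => hX.α_ne _ h' h

theorem Reach.lab_free {k : ℕ} (h : Reach k M₁ M₁') (hr : M₁.α r₁ = r₁) :
    M₁'.lab r₁ = M₁.lab r₁ := by
  induction h with
  | zero => rfl
  | succ h' s ih =>
    obtain ⟨X, hX, rfl⟩ := s
    rw [flip_lab_free hX (by rw [h'.α_eq, hr]), ih hr]

theorem Reach.α_free {k : ℕ} (h : Reach k M₁ M₁') (hr : M₁.α r₁ = r₁) :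
    M₁'.α r₁ = r₁ := by rw [h.α_eq, hr]

/-- A free side is never flipped, so moves in the two parts do not interfere and happen at the same
time: the cost is `k` and not `2 * k`. The divide and conquer below rests on this. -/
theorem Reach.glue {k : ℕ} (H₁ : Reach k M₁ M₁') (H₂ : Reach k M₂ M₂')
    (h₁ : M₁.α r₁ = r₁) (h₂ : M₂.α r₂ = r₂) (hl : M₁.lab r₁ = M₂.lab r₂) :
    Reach k (M₁.glue M₂ r₁ r₂ h₁ h₂ hl) (M₁'.glue M₂' r₁ r₂ (H₁.α_free h₁) (H₂.α_free h₂)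
      (by rw [H₁.lab_free h₁, H₂.lab_free h₂, hl])) := by
  induction k generalizing M₁' M₂' with
  | zero => cases H₁; cases H₂; exact .zero _
  | succ k ih =>
    cases H₁ with
    | succ p₁ s₁ => cases H₂ with
      | succ p₂ s₂ =>
        obtain ⟨X₁, hX₁, rfl⟩ := s₁
        obtain ⟨X₂, hX₂, rfl⟩ := s₂
        refine (ih p₁ p₂).succ ⟨_, hX₁.glue hX₂ _ _ _, ?_⟩
        exact (hX₁.flip_glue hX₂ _ _ _ _).symm

theorem Iso.glue {N₁ : TriSurf V E₁} {N₂ : TriSurf V E₂} {e₁ : D₁ ≃ E₁} {e₂ : D₂ ≃ E₂}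
    (H₁ : Iso M₁ N₁ e₁) (H₂ : Iso M₂ N₂ e₂) {s₁ : E₁} {s₂ : E₂}
    (h₁ : M₁.α r₁ = r₁) (h₂ : M₂.α r₂ = r₂) (hl : M₁.lab r₁ = M₂.lab r₂)
    (k₁ : N₁.α s₁ = s₁) (k₂ : N₂.α s₂ = s₂) (kl : N₁.lab s₁ = N₂.lab s₂)
    (hr₁ : e₁ r₁ = s₁) (hr₂ : e₂ r₂ = s₂) :
    Iso (M₁.glue M₂ r₁ r₂ h₁ h₂ hl) (N₁.glue N₂ s₁ s₂ k₁ k₂ kl) (Equiv.sumCongr e₁ e₂) where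
  α := by
    subst hr₁ hr₂
    rintro (d | d) <;> simp only [TriSurf.glue, Sum.elim_inl, Sum.elim_inr, Equiv.sumCongr_apply,
      Sum.map_inl, Sum.map_inr, e₁.apply_eq_iff_eq, e₂.apply_eq_iff_eq] <;> split_ifs <;>
      simp_all [H₁.α, H₂.α]
  φ := by rintro (d | d) <;> simp [TriSurf.glue, H₁.φ, H₂.φ]
  lab := by rintro (d | d) <;> simp [TriSurf.glue, H₁.lab, H₂.lab]

end glue

/-- `k` flips on either side make the two surfaces isomorphic, by an isomorphism that respects the
pairs of darts in `C`. -/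
def Meet (k : ℕ) (M₁ : TriSurf V D₁) (M₂ : TriSurf V D₂) (C : Set (D₁ × D₂)) : Prop :=
  ∃ M₁' M₂' e, Reach k M₁ M₁' ∧ Reach k M₂ M₂' ∧ Iso M₁' M₂' e ∧ ∀ p ∈ C, e p.1 = p.2

namespace Meet

variable {M₁ M₁' : TriSurf V D₁} {M₂ M₂' : TriSurf V D₂} {N₁ : TriSurf V E₁} {N₂ : TriSurf V E₂}
  {C : Set (D₁ × D₂)} {k l : ℕ}

theorem mono (h : Meet k M₁ M₂ C) (hkl : k ≤ l) : Meet l M₁ M₂ C := by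
  obtain ⟨A, B, e, h1, h2, h3⟩ := h
  exact ⟨A, B, e, h1.mono hkl, h2.mono hkl, h3⟩

theorem of_reach (h₁ : Reach k M₁ M₁') (h₂ : Reach k M₂ M₂') (h : Meet l M₁' M₂' C) :
    Meet (k + l) M₁ M₂ C := by
  obtain ⟨A, B, e, h1, h2, h3⟩ := h
  exact ⟨A, B, e, h₁.trans h1, h₂.trans h2, h3⟩

theorem of_iso {e₁ : D₁ ≃ E₁} {e₂ : D₂ ≃ E₂} (h₁ : Iso M₁ N₁ e₁) (h₂ : Iso M₂ N₂ e₂)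
    {C' : Set (E₁ × E₂)} (h : Meet k N₁ N₂ C') (hC : ∀ p ∈ C, (e₁ p.1, e₂ p.2) ∈ C') :
    Meet k M₁ M₂ C := by
  obtain ⟨A, B, e, h1, h2, h3, h4⟩ := h
  obtain ⟨A', r₁, i₁⟩ := h₁.symm.reach h1
  obtain ⟨B', r₂, i₂⟩ := h₂.symm.reach h2
  refine ⟨A', B', _, r₁, r₂, (i₁.symm.trans h3).trans i₂, fun p hp => ?_⟩
  have := h4 _ (hC p hp)
  simp only at this
  simp [this]

/-- Two isomorphisms fit together only if both respect the attaching sides; the set `C` in `Meet`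
serves to record this. -/
theorem glue {N₁ : TriSurf V E₁} {N₂ : TriSurf V E₂} {C₁ : Set (D₁ × E₁)} {C₂ : Set (D₂ × E₂)}
    {r₁ : D₁} {r₂ : D₂} {s₁ : E₁} {s₂ : E₂}
    (H₁ : Meet k M₁ N₁ C₁) (H₂ : Meet k M₂ N₂ C₂)
    (h₁ : M₁.α r₁ = r₁) (h₂ : M₂.α r₂ = r₂) (hl : M₁.lab r₁ = M₂.lab r₂)
    (k₁ : N₁.α s₁ = s₁) (k₂ : N₂.α s₂ = s₂) (kl : N₁.lab s₁ = N₂.lab s₂)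
    (hr₁ : (r₁, s₁) ∈ C₁) (hr₂ : (r₂, s₂) ∈ C₂) :
    Meet k (M₁.glue M₂ r₁ r₂ h₁ h₂ hl) (N₁.glue N₂ s₁ s₂ k₁ k₂ kl)
      ((fun p => (Sum.inl p.1, Sum.inl p.2)) '' C₁ ∪
        (fun p => (Sum.inr p.1, Sum.inr p.2)) '' C₂) := by
  obtain ⟨A₁, B₁, e₁, a1, a2, a3, a4⟩ := H₁
  obtain ⟨A₂, B₂, e₂, b1, b2, b3, b4⟩ := H₂
  refine ⟨_, _, Equiv.sumCongr e₁ e₂, a1.glue b1 h₁ h₂ hl, a2.glue b2 k₁ k₂ kl,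
    a3.glue b3 _ _ _ _ _ _ (a4 _ hr₁) (b4 _ hr₂), ?_⟩
  rintro _ (⟨p, hp, rfl⟩ | ⟨p, hp, rfl⟩)
  · simp [a4 p hp]
  · simp [b4 p hp]

end Meet

/-- `S` is a part of the surface that is attached to the rest along the side `s` only. -/
structure Side (M : TriSurf V D) (S : Set D) (s : D) : Prop where
  mem : s ∈ S
  α_notMem : M.α s ∉ S
  α_mem : ∀ d ∈ S, d ≠ s → M.α d ∈ S
  φ_mem : ∀ d ∈ S, M.φ d ∈ S

namespace Side

variable {M : TriSurf V D} {S : Set D} {s : D}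

theorem compl (h : M.Side S s) : M.Side Sᶜ (M.α s) where
  mem := h.α_notMem
  α_notMem := by simpa [M.αα] using h.mem
  α_mem d hd hds hd' := by
    refine hds (M.α_inj ?_)
    rw [M.αα]
    by_contra hne
    exact hd (by simpa [M.αα] using h.α_mem _ hd' hne)
  φ_mem d hd hd' := hd (by simpa [M.φφφ] using h.φ_mem _ (h.φ_mem _ hd'))

open Classical in
/-- The pairing of the sides in `S`, where `s` becomes free. -/
noncomputable def α (_ : M.Side S s) (d : D) : D := if d = s then s else M.α d

theorem α_mem' (h : M.Side S s) {d : D} (hd : d ∈ S) : h.α d ∈ S := by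
  unfold α
  split_ifs with hs
  · exact h.mem
  · exact h.α_mem d hd hs

theorem α_self (h : M.Side S s) : h.α s = s := by simp [α]

theorem α_of_ne (h : M.Side S s) {d : D} (hd : d ≠ s) : h.α d = M.α d := by simp [α, hd]

theorem α_ne (h : M.Side S s) {d : D} (hd : d ∈ S) : M.α d ≠ s := fun h' =>
  h.α_notMem (by rw [← h', M.αα]; exact hd)

theorem αα (h : M.Side S s) {d : D} (hd : d ∈ S) : h.α (h.α d) = d := by
  by_cases hs : d = s
  · rw [hs, h.α_self, h.α_self]
  · rw [h.α_of_ne hs, h.α_of_ne (h.α_ne hd), M.αα]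

/-- Both ends of the attaching side have the same label. -/
theorem lab_φ [Finite D] (h : M.Side S s) : M.lab (M.φ s) = M.lab s := by
  classical
  have := Fintype.ofFinite D
  by_contra hne
  -- Turning around the vertices within `S` is a permutation of `S`. It preserves labels except at
  -- `s`, where it trades the label of `s` for that of `φ s`. If they differed, the number of darts
  -- with the label of `s` would drop.
  let f : S → S := fun d => ⟨M.φ (h.α d), h.φ_mem _ (h.α_mem' d.2)⟩
  have hf : Function.Injective f := by
    intro a b hab
    have h1 := M.φ_inj (congrArg Subtype.val hab)
    apply Subtype.ext
    rw [← h.αα a.2, h1, h.αα b.2]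
  have hbij := Finite.injective_iff_bijective.1 hf
  have hs : ∑ d : S, (if M.lab (f d : D) = M.lab s then 1 else 0) =
      ∑ d : S, (if M.lab (d : D) = M.lab s then 1 else 0) :=
    (Equiv.ofBijective f hbij).sum_comp (fun d : S => if M.lab (d : D) = M.lab s then 1 else 0)
  have hlt : ∑ d : S, (if M.lab (f d : D) = M.lab s then 1 else 0) <
      ∑ d : S, (if M.lab (d : D) = M.lab s then 1 else 0) := by
    refine Finset.sum_lt_sum (fun d _ => ?_) ⟨⟨s, h.mem⟩, Finset.mem_univ _, ?_⟩
    · by_cases hd : (d : D) = s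
      · simp only [f, hd, h.α_self, hne, if_false]; simp
      · simp only [f, h.α_of_ne hd, M.lab_ν]; exact le_rfl
    · simp [f, h.α_self, hne]
  exact absurd hs hlt.ne

/-- The part of the surface as a surface of its own, with the attaching side free. -/
noncomputable def surf [Finite D] (h : M.Side S s) : TriSurf V S where
  α d := ⟨h.α d, h.α_mem' d.2⟩
  φ d := ⟨M.φ d, h.φ_mem _ d.2⟩
  lab d := M.lab d
  αα d := Subtype.ext (h.αα d.2)
  φφφ d := Subtype.ext (M.φφφ _)
  φ_ne d hd := M.φ_ne d (congrArg Subtype.val hd)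
  lab_ν d := by
    by_cases hd : (d : D) = s
    · simp only [hd, h.α_self, h.lab_φ]
    · simp only [h.α_of_ne hd, M.lab_ν]

variable [Finite D]

theorem surf_α_self (h : M.Side S s) : h.surf.α ⟨s, h.mem⟩ = ⟨s, h.mem⟩ := Subtype.ext h.α_self

theorem surf_α (h : M.Side S s) {d : S} (hd : (d : D) ≠ s) : (h.surf.α d : D) = M.α d := h.α_of_ne hd

theorem surf_φ (h : M.Side S s) (d : S) : (h.surf.φ d : D) = M.φ d := rfl

theorem surf_lab (h : M.Side S s) (d : S) : h.surf.lab d = M.lab d := rfl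

theorem surf_ν (h : M.Side S s) {d : S} (hd : (d : D) ≠ s) : (h.surf.ν d : D) = M.ν d := by
  simp [ν, surf_φ, surf_α h hd]

/-- A closed subset of the part is closed in the whole surface as it stands if it avoids the
attaching side, and after adding all of `Sᶜ` if it contains that side. -/
theorem surf_good (h : M.Side S s) (hM : M.Good) : h.surf.Good where
  conn A hA hα hφ := by
    by_cases hs : (⟨s, h.mem⟩ : S) ∈ A
    · have := hM.conn (Subtype.val '' A ∪ Sᶜ) (hA.image _ |>.inl) ?_ ?_
      · ext d
        have hd : (d : D) ∈ Subtype.val '' A ∪ Sᶜ := by rw [this]; trivial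
        simpa using hd
      · rintro x (⟨d, hd, rfl⟩ | hd)
        · by_cases hds : (d : D) = s
          · right; rw [hds]; exact h.α_notMem
          · left; exact ⟨_, hα d hd, surf_α h hds⟩
        · by_cases hds : x = M.α s
          · left; exact ⟨_, hs, by rw [hds, M.αα]⟩
          · right; exact h.compl.α_mem x hd hds
      · rintro x (⟨d, hd, rfl⟩ | hd)
        · left; exact ⟨_, hφ d hd, rfl⟩
        · right; exact h.compl.φ_mem x hd
    · have := hM.conn (Subtype.val '' A) (hA.image _) ?_ ?_
      · exfalso
        apply hs
        have hd : s ∈ Subtype.val '' A := by rw [this]; trivial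
        simpa [h.mem] using hd
      · rintro _ ⟨d, hd, rfl⟩
        exact ⟨_, hα d hd, surf_α h fun hds => hs (by convert hd; exact hds.symm)⟩
      · rintro _ ⟨d, hd, rfl⟩
        exact ⟨_, hφ d hd, rfl⟩
  vconn B hB d hd d' hl := by
    by_cases hs : (⟨s, h.mem⟩ : S) ∈ B
    · have hφs : (⟨M.φ s, h.φ_mem s h.mem⟩ : S) ∈ B := by
        have := hB _ hs
        rwa [ν, surf_α_self] at this
      have := hM.vconn (Subtype.val '' B ∪ Sᶜ) ?_ d (Or.inl ⟨d, hd, rfl⟩) d' hl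
      · simpa using this
      · rintro x (⟨d, hd, rfl⟩ | hd)
        · by_cases hds : (d : D) = s
          · right; rw [hds]; exact h.compl.φ_mem _ h.α_notMem
          · left; exact ⟨_, hB d hd, surf_ν h hds⟩
        · by_cases hds : x = M.α s
          · left; exact ⟨_, hφs, by rw [hds, ν, M.αα]⟩
          · right; exact h.compl.φ_mem _ (h.compl.α_mem x hd hds)
    · have := hM.vconn (Subtype.val '' B) ?_ d ⟨d, hd, rfl⟩ d' hl
      · simpa using this
      · rintro _ ⟨d, hd, rfl⟩
        exact ⟨_, hB d hd, surf_ν h fun hds => hs (by convert hd; exact hds.symm)⟩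

open Classical in
theorem iso (h : M.Side S s) : Iso (h.surf.glue h.compl.surf ⟨s, h.mem⟩ ⟨M.α s, h.α_notMem⟩
    h.surf_α_self h.compl.surf_α_self (by
      rw [surf_lab, surf_lab]
      have := M.lab_ν (M.α s)
      rw [M.αα] at this
      rw [← this, h.lab_φ])) M (Equiv.Set.sumCompl S) where
  α := by
    rintro (d | d)
    · simp only [glue, Sum.elim_inl, Equiv.Set.sumCompl_apply_inl]
      split_ifs with hd
      · simp [hd]
      · have : (d : D) ≠ s := fun h' => hd (Subtype.ext h')
        simp [surf_α h this]
    · simp only [glue, Sum.elim_inr, Equiv.Set.sumCompl_apply_inr]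
      split_ifs with hd
      · simp [hd, M.αα]
      · have : (d : D) ≠ M.α s := fun h' => hd (Subtype.ext h')
        simp [surf_α h.compl this]
  φ := by rintro (d | d) <;> simp [glue, surf_φ]
  lab := by rintro (d | d) <;> simp [glue, surf_lab]

end Side

end TriSurf

end SimFlip

/-! ### Binary trees and parallel rotations. -/

namespace SimFlip

/-- Binary trees with labelled leaves. -/
inductive BT (L : Type) : Type
  | leaf : L → BT L
  | node : BT L → BT L → BT L

namespace BT

variable {L : Type}

def leaves : BT L → List L
  | leaf a => [a]
  | node a b => leaves a ++ leaves b

theorem leaves_ne_nil : ∀ t : BT L, t.leaves ≠ []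
  | leaf a => by simp [leaves]
  | node a b => by simp [leaves, leaves_ne_nil a]

/-- Rotations at a set of disjoint places of a tree. -/
inductive Rot : BT L → BT L → Prop
  | leaf (a) : Rot (leaf a) (leaf a)
  | node {a a' b b'} : Rot a a' → Rot b b' → Rot (node a b) (node a' b')
  | right {a a' b b' c c'} : Rot a a' → Rot b b' → Rot c c' →
      Rot (.node (.node a b) c) (.node a' (.node b' c'))
  | left {a a' b b' c c'} : Rot a a' → Rot b b' → Rot c c' →
      Rot (.node a (.node b c)) (.node (.node a' b') c')

namespace Rot

theorem refl : ∀ t : BT L, Rot t t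
  | .leaf a => .leaf a
  | .node a b => .node (refl a) (refl b)

theorem symm {s t : BT L} (h : Rot s t) : Rot t s := by
  induction h with
  | leaf a => exact .leaf a
  | node _ _ h1 h2 => exact .node h1 h2
  | right _ _ _ h1 h2 h3 => exact .left h1 h2 h3
  | left _ _ _ h1 h2 h3 => exact .right h1 h2 h3

theorem leaves_eq {s t : BT L} (h : Rot s t) : t.leaves = s.leaves := by
  induction h with
  | leaf a => rfl
  | node _ _ h1 h2 => simp [leaves, h1, h2]
  | right _ _ _ h1 h2 h3 => simp [leaves, h1, h2, h3]
  | left _ _ _ h1 h2 h3 => simp [leaves, h1, h2, h3]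

end Rot

/-- `k` steps of rotations at disjoint places. -/
def RotN : ℕ → BT L → BT L → Prop
  | 0, s, t => s = t
  | k + 1, s, t => ∃ u, Rot s u ∧ RotN k u t

namespace RotN

theorem refl (t : BT L) : ∀ k, RotN k t t
  | 0 => rfl
  | k + 1 => ⟨t, .refl t, refl t k⟩

theorem trans {k l : ℕ} {s t u : BT L} (h : RotN k s t) (h' : RotN l t u) : RotN (k + l) s u := by
  induction k generalizing s with
  | zero => cases h; simpa using h'
  | succ k ih =>
    obtain ⟨v, h1, h2⟩ := h
    rw [Nat.add_right_comm]
    exact ⟨v, h1, ih h2⟩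

theorem mono {k l : ℕ} {s t : BT L} (h : RotN k s t) (hkl : k ≤ l) : RotN l s t := by
  obtain ⟨m, rfl⟩ := Nat.exists_eq_add_of_le hkl
  exact h.trans (refl _ _)

theorem one {s t : BT L} (h : Rot s t) : RotN 1 s t := ⟨t, h, rfl⟩

theorem symm {k : ℕ} {s t : BT L} (h : RotN k s t) : RotN k t s := by
  induction k generalizing s with
  | zero => exact Eq.symm h
  | succ k ih =>
    obtain ⟨v, h1, h2⟩ := h
    exact (ih h2).trans (one h1.symm)

end RotN

/-- The tree obtained by replacing the leaves by their labels. -/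
def join : BT (BT L) → BT L
  | leaf t => t
  | node a b => node (join a) (join b)

def ht : BT L → ℕ
  | leaf _ => 0
  | node a b => max (ht a) (ht b) + 1

/-- The largest height of a label of a leaf. -/
def maxht : BT (BT L) → ℕ
  | leaf t => ht t
  | node a b => max (maxht a) (maxht b)

def size : BT L → ℕ
  | leaf _ => 1
  | node a b => size a + size b

theorem size_pos : ∀ t : BT L, 0 < size t
  | leaf _ => Nat.one_pos
  | node a b => by have := size_pos a; simp only [size]; omega

theorem size_eq : ∀ t : BT L, size t = t.leaves.length
  | leaf _ => rfl
  | node a b => by simp [size, leaves, size_eq a, size_eq b]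

/-- `s'` is obtained from `s` by merging some leaves. -/
def Con (s s' : BT (BT L)) : Prop := RotN 2 (join s) (join s') ∧ maxht s' ≤ maxht s + 1

/-- The factor 5/6 has a slack of 2: two shrinking subtrees have slack 4 together, which pays for up
to two leaves left as they are, each costing `6 - 5 = 1`. -/
def Small (s s' : BT (BT L)) : Prop := 6 * size s' + 2 ≤ 5 * size s

theorem Con.node {a a' b b' : BT (BT L)} (ha : Con a a') (hb : Con b b') :
    Con (node a b) (node a' b') := by
  obtain ⟨⟨u, h1, v, h2, h3⟩, h4⟩ := ha
  obtain ⟨⟨u', k1, v', k2, k3⟩, k4⟩ := hb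
  refine ⟨⟨_, .node h1 k1, _, .node h2 k2, ?_⟩, ?_⟩
  · cases h3; cases k3; rfl
  · simp only [maxht]; omega

theorem Con.refl (s : BT (BT L)) : Con s s := ⟨.refl _ _, by omega⟩

/-- Tree contraction: one round of two parallel rotation steps merges a fixed fraction of the
leaves. Two subtrees that are nodes shrink independently. Where leaves hang off a path, two
neighbouring ones are rotated next to each other and merged; if they hang on opposite sides of the
path, this takes both steps. -/
theorem exists_con : ∀ (n : ℕ) (s : BT (BT L)), size s ≤ n →
    ∃ s', Con s s' ∧ (Small s s' ∨ (∃ t, s = leaf t) ∧ size s' = 1) := by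
  intro n
  induction n using Nat.strong_induction_on with
  | _ n ih =>
  intro s hs
  have hr0 : ∀ u : BT (BT L), size u < size s →
      ∃ s', Con u s' ∧ (Small u s' ∨ (∃ t, u = leaf t) ∧ size s' = 1) := fun u hu =>
    ih (size u) (by omega) u le_rfl
  have hr : ∀ u : BT (BT L), size u < size s →
      ∃ s', Con u s' ∧ (6 * size s' + 2 ≤ 5 * size u ∨ size u = 1 ∧ size s' = 1) := by
    intro u hu
    obtain ⟨s', h1, h2 | ⟨⟨t, rfl⟩, h2⟩⟩ := hr0 u hu
    · exact ⟨s', h1, Or.inl h2⟩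
    · exact ⟨s', h1, Or.inr ⟨rfl, h2⟩⟩
  have hr2 : ∀ u v : BT (BT L), size (node u v) < size s →
      ∃ s', Con (node u v) s' ∧ 6 * size s' + 2 ≤ 5 * size (node u v) := by
    intro u v hu
    obtain ⟨s', h1, h2 | ⟨⟨t, ht⟩, h2⟩⟩ := hr0 _ hu
    · exact ⟨s', h1, h2⟩
    · cases ht
  match s, hs, hr, hr2 with
  | leaf t, _, _, _ => exact ⟨leaf t, .refl _, Or.inr ⟨⟨t, rfl⟩, rfl⟩⟩
  | node (leaf a) (leaf b), _, _, _ =>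
    exact ⟨leaf (node a b), ⟨.refl _ _, by simp [maxht, ht]⟩, Or.inl (by simp [Small, size])⟩
  | node (node a b) (node c d), _, _, hr2 =>
    have p1 := size_pos (node a b)
    have p2 := size_pos (node c d)
    obtain ⟨x, hx, hx'⟩ := hr2 a b (by simp only [size] at *; omega)
    obtain ⟨y, hy, hy'⟩ := hr2 c d (by simp only [size] at *; omega)
    exact ⟨_, hx.node hy, Or.inl (by simp only [Small, size] at *; omega)⟩
  | node (leaf a) (node (leaf b) s), _, hr, _ =>
    obtain ⟨x, ⟨⟨u, h1, v, h2, h3⟩, h4⟩, hx⟩ := hr s (by simp only [size]; omega)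
    cases h3
    refine ⟨node (leaf (node a b)) x, ⟨⟨_, .left (.refl _) (.refl _) h1, _,
      .node (.refl _) h2, rfl⟩, ?_⟩, Or.inl ?_⟩
    · simp only [maxht, ht]; omega
    · simp only [Small, size] at *; omega
  | node (leaf a) (node (node (leaf c) s) (leaf b)), _, hr, _ =>
    obtain ⟨x, ⟨⟨u, h1, v, h2, h3⟩, h4⟩, hx⟩ := hr s (by simp only [size]; omega)
    cases h3
    refine ⟨node (leaf (node a c)) (node x (leaf b)), ⟨⟨_, .node (.refl _)
      (.right (.refl _) h1 (.refl _)), _, .left (.refl _) (.refl _) (.node h2 (.refl _)), rfl⟩, ?_⟩,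
      Or.inl ?_⟩
    · simp only [maxht, ht]; omega
    · simp only [Small, size] at *; omega
  | node (leaf a) (node (node (node s1 s2) (leaf c)) (leaf b)), _, hr, _ =>
    obtain ⟨x, ⟨⟨u, h1, v, h2, h3⟩, h4⟩, hx⟩ := hr (node s1 s2) (by simp only [size]; omega)
    cases h3
    refine ⟨node (leaf a) (node x (leaf (node c b))), ⟨⟨_, .node (.refl _)
      (.right h1 (.refl _) (.refl _)), _, .node (.refl _) (.node h2 (.refl _)), rfl⟩, ?_⟩,
      Or.inl ?_⟩
    · simp only [maxht, ht] at *; omega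
    · have := size_pos s1
      have := size_pos s2
      simp only [Small, size] at *; omega
  | node (leaf a) (node (node (node s1 s2) (node s3 s4)) (leaf b)), _, _, hr2 =>
    have p1 := size_pos (node s1 s2)
    have p2 := size_pos (node s3 s4)
    obtain ⟨x, hx, hx'⟩ := hr2 s1 s2 (by simp only [size] at *; omega)
    obtain ⟨y, hy, hy'⟩ := hr2 s3 s4 (by simp only [size] at *; omega)
    exact ⟨_, (Con.refl (leaf a)).node ((hx.node hy).node (.refl (leaf b))), Or.inl (by
      simp only [Small, size] at *; omega)⟩
  | node (leaf a) (node (node s1 s2) (node s3 s4)), _, _, hr2 =>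
    have p1 := size_pos (node s1 s2)
    have p2 := size_pos (node s3 s4)
    obtain ⟨x, hx, hx'⟩ := hr2 s1 s2 (by simp only [size] at *; omega)
    obtain ⟨y, hy, hy'⟩ := hr2 s3 s4 (by simp only [size] at *; omega)
    exact ⟨_, (Con.refl (leaf a)).node (hx.node hy), Or.inl (by
      simp only [Small, size] at *; omega)⟩
  | node (node s (leaf b)) (leaf a), _, hr, _ =>
    obtain ⟨x, ⟨⟨u, h1, v, h2, h3⟩, h4⟩, hx⟩ := hr s (by simp only [size]; omega)
    cases h3
    refine ⟨node x (leaf (node b a)), ⟨⟨_, .right h1 (.refl _) (.refl _), _,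
      .node h2 (.refl _), rfl⟩, ?_⟩, Or.inl ?_⟩
    · simp only [maxht, ht]; omega
    · simp only [Small, size] at *; omega
  | node (node (leaf b) (node s (leaf c))) (leaf a), _, hr, _ =>
    obtain ⟨x, ⟨⟨u, h1, v, h2, h3⟩, h4⟩, hx⟩ := hr s (by simp only [size]; omega)
    cases h3
    refine ⟨node (node (leaf b) x) (leaf (node c a)), ⟨⟨_, .node
      (.left (.refl _) h1 (.refl _)) (.refl _), _, .right (.node (.refl _) h2) (.refl _) (.refl _),
      rfl⟩, ?_⟩, Or.inl ?_⟩
    · simp only [maxht, ht]; omega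
    · simp only [Small, size] at *; omega
  | node (node (leaf b) (node (leaf c) (node s1 s2))) (leaf a), _, hr, _ =>
    obtain ⟨x, ⟨⟨u, h1, v, h2, h3⟩, h4⟩, hx⟩ := hr (node s1 s2) (by simp only [size]; omega)
    cases h3
    refine ⟨node (node (leaf (node b c)) x) (leaf a), ⟨⟨_, .node
      (.left (.refl _) (.refl _) h1) (.refl _), _, .node (.node (.refl _) h2) (.refl _), rfl⟩, ?_⟩,
      Or.inl ?_⟩
    · simp only [maxht, ht] at *; omega
    · have := size_pos s1
      have := size_pos s2
      simp only [Small, size] at *; omega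
  | node (node (leaf b) (node (node s1 s2) (node s3 s4))) (leaf a), _, _, hr2 =>
    have p1 := size_pos (node s1 s2)
    have p2 := size_pos (node s3 s4)
    obtain ⟨x, hx, hx'⟩ := hr2 s1 s2 (by simp only [size] at *; omega)
    obtain ⟨y, hy, hy'⟩ := hr2 s3 s4 (by simp only [size] at *; omega)
    exact ⟨_, ((Con.refl (leaf b)).node (hx.node hy)).node (.refl (leaf a)), Or.inl (by
      simp only [Small, size] at *; omega)⟩
  | node (node (node s1 s2) (node s3 s4)) (leaf a), _, _, hr2 =>
    have p1 := size_pos (node s1 s2)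
    have p2 := size_pos (node s3 s4)
    obtain ⟨x, hx, hx'⟩ := hr2 s1 s2 (by simp only [size] at *; omega)
    obtain ⟨y, hy, hy'⟩ := hr2 s3 s4 (by simp only [size] at *; omega)
    exact ⟨_, (hx.node hy).node (.refl (leaf a)), Or.inl (by
      simp only [Small, size] at *; omega)⟩

theorem exists_con' (s : BT (BT L)) : ∃ s', RotN 2 (join s) (join s') ∧ maxht s' ≤ maxht s + 1 ∧
    (6 * size s' + 2 ≤ 5 * size s ∨ size s = 1 ∧ size s' = 1) := by
  obtain ⟨s', ⟨h0, h1⟩, h2 | ⟨⟨t, rfl⟩, h2⟩⟩ := exists_con _ s le_rfl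
  · exact ⟨s', h0, h1, Or.inl h2⟩
  · exact ⟨s', h0, h1, Or.inr ⟨rfl, h2⟩⟩

/-- Four rounds halve the number of leaves, since `2 * 5 ^ 4 < 6 ^ 4`. They cost eight steps and
raise the heights by at most four. -/
theorem exists_low (k : ℕ) (s : BT (BT L)) (hs : size s ≤ 2 ^ k) :
    ∃ t, RotN (8 * k) (join s) t ∧ ht t ≤ maxht s + 4 * k := by
  induction k generalizing s with
  | zero =>
    match s, hs with
    | leaf t, _ => exact ⟨t, .refl _ _, by simp [maxht]⟩
    | node a b, hs =>
      have := size_pos a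
      have := size_pos b
      simp only [size] at hs
      omega
  | succ k ih =>
    obtain ⟨s1, a1, b1, c1⟩ := exists_con' s
    obtain ⟨s2, a2, b2, c2⟩ := exists_con' s1
    obtain ⟨s3, a3, b3, c3⟩ := exists_con' s2
    obtain ⟨s4, a4, b4, c4⟩ := exists_con' s3
    have h2 : 0 < 2 ^ k := by positivity
    rw [pow_succ] at hs
    obtain ⟨t, h, h'⟩ := ih s4 (by omega)
    refine ⟨t, ?_, by omega⟩
    have := ((a1.trans a2).trans (a3.trans a4)).trans h
    exact this.mono (by omega)

/-- The tree all of whose leaves are separate. -/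
def sep : BT L → BT (BT L)
  | leaf a => leaf (leaf a)
  | node a b => node (sep a) (sep b)

theorem join_sep : ∀ t : BT L, join (sep t) = t
  | leaf _ => rfl
  | node a b => by simp [sep, join, join_sep a, join_sep b]

theorem size_sep : ∀ t : BT L, size (sep t) = size t
  | leaf _ => rfl
  | node a b => by simp [sep, size, size_sep a, size_sep b]

theorem maxht_sep : ∀ t : BT L, maxht (sep t) = 0
  | leaf _ => rfl
  | node a b => by simp [sep, maxht, maxht_sep a, maxht_sep b]

/-- The largest height of a right subtree at the left spine. -/
def rht : BT L → ℕ
  | leaf _ => 0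
  | node a b => max (rht a) (ht b)

theorem rht_le_ht : ∀ t : BT L, rht t ≤ ht t
  | leaf _ => le_rfl
  | node a b => by have := rht_le_ht a; simp only [rht, ht]; omega

/-- All right subtrees along the left spine are rotated at once. Each one gives its root to the
spine, so the largest of their heights drops by one. -/
theorem exists_rot_rht : ∀ t : BT L, ∃ t', Rot t t' ∧ rht t' ≤ rht t - 1
  | leaf a => ⟨leaf a, .refl _, by simp [rht]⟩
  | node a (leaf e) => by
    obtain ⟨a', h, h'⟩ := exists_rot_rht a
    exact ⟨node a' (leaf e), .node h (.refl _), by simp only [rht, ht]; omega⟩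
  | node a (node b c) => by
    obtain ⟨a', h, h'⟩ := exists_rot_rht a
    exact ⟨node (node a' b) c, .left h (.refl _) (.refl _), by simp only [rht, ht]; omega⟩

theorem exists_rht_zero (k : ℕ) (t : BT L) (ht : rht t ≤ k) : ∃ t', RotN k t t' ∧ rht t' = 0 := by
  induction k generalizing t with
  | zero => exact ⟨t, rfl, by omega⟩
  | succ k ih =>
    obtain ⟨u, h, h'⟩ := exists_rot_rht t
    obtain ⟨v, h1, h2⟩ := ih u (by omega)
    exact ⟨v, ⟨u, h, h1⟩, h2⟩

theorem RotN.leaves_eq {k : ℕ} {s t : BT L} (h : RotN k s t) : t.leaves = s.leaves := by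
  induction k generalizing s with
  | zero => cases h; rfl
  | succ k ih => obtain ⟨u, h1, h2⟩ := h; rw [ih h2, h1.leaves_eq]

/-- The value zero means that only leaves hang off the left spine, so the tree is the left comb on
its list of leaves. -/
theorem eq_of_rht_zero : ∀ {s t : BT L}, rht s = 0 → rht t = 0 → s.leaves = t.leaves → s = t
  | leaf a, leaf b, _, _, h => by simpa [leaves] using h
  | leaf a, node b c, _, _, h => by
    have := congrArg List.length h
    have h1 := size_pos b
    have h2 := size_pos c
    simp only [leaves, List.length_append, ← size_eq, List.length_singleton] at this
    omega
  | node b c, leaf a, _, _, h => by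
    have := congrArg List.length h
    have h1 := size_pos b
    have h2 := size_pos c
    simp only [leaves, List.length_append, ← size_eq, List.length_singleton] at this
    omega
  | node a (node _ _), _, hs, _, _ => by simp [rht, ht] at hs
  | node _ (leaf _), node _ (node _ _), _, ht, _ => by simp [rht, BT.ht] at ht
  | node a (leaf b), node a' (leaf b'), hs, ht, h => by
    simp only [leaves] at h
    have h1 := List.append_inj' h rfl
    rw [eq_of_rht_zero (s := a) (t := a') (by simp only [rht] at hs; omega)
      (by simp only [rht] at ht; omega) h1.1]
    simpa using h1.2

/-- Contraction takes `8 * k` steps to reach height at most `4 * k`; unrolling to the comb takes `4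
* k` more. -/
theorem exists_rotN_rht_zero {k : ℕ} (t : BT L) (h : t.leaves.length ≤ 2 ^ k) :
    ∃ t', RotN (12 * k) t t' ∧ rht t' = 0 := by
  obtain ⟨u, h1, h2⟩ := exists_low k (sep t) (by rwa [size_sep, size_eq])
  rw [join_sep] at h1
  rw [maxht_sep] at h2
  obtain ⟨v, h3, h4⟩ := exists_rht_zero (4 * k) u (by have := rht_le_ht u; omega)
  exact ⟨v, (h1.trans h3).mono (by omega), h4⟩

/-- Two trees with the same leaves differ by logarithmically many steps of rotations. -/
theorem rotN_of_leaves_eq {k : ℕ} {s t : BT L} (h : s.leaves = t.leaves)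
    (hk : s.leaves.length ≤ 2 ^ k) : RotN (24 * k) s t := by
  obtain ⟨s', h1, h2⟩ := exists_rotN_rht_zero s hk
  obtain ⟨t', h3, h4⟩ := exists_rotN_rht_zero t (h ▸ hk)
  have := eq_of_rht_zero h2 h4 (by rw [h1.leaves_eq, h3.leaves_eq, h])
  subst this
  exact (h1.trans h3.symm).mono (by omega)

end BT

end SimFlip

/-! ### Dual trees of triangulated polygons; rotations as flips. -/

namespace SimFlip

namespace TriSurf

open BT

variable {V D : Type}

/-- The triangulated polygon that is seen through the side `e` has the dual tree `t`; its further
sides are the leaves of `t`. -/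
def Hang (M : TriSurf V D) : D → BT D → Prop
  | e, .leaf d => e = d
  | e, .node l r => Hang M (M.φ (M.α e)) l ∧ Hang M (M.φ (M.φ (M.α e))) r

/-- The darts of the triangles behind `e` that are met by the tree. -/
def dl (M : TriSurf V D) : D → BT D → List D
  | _, .leaf _ => []
  | e, .node l r => M.α e :: M.φ (M.α e) :: M.φ (M.φ (M.α e)) ::
      (dl M (M.φ (M.α e)) l ++ dl M (M.φ (M.φ (M.α e))) r)

theorem φ_mem_dl {M : TriSurf V D} {d : D} : ∀ {t : BT D} {e : D}, d ∈ M.dl e t → M.φ d ∈ M.dl e t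
  | .leaf _, e, h => by simp [dl] at h
  | .node l r, e, h => by
    simp only [dl, List.mem_cons, List.mem_append] at h ⊢
    rcases h with rfl | rfl | rfl | h | h
    · simp
    · simp
    · simp [M.φφφ]
    · simp [φ_mem_dl h]
    · simp [φ_mem_dl h]

theorem Hang.leaves_sub {M : TriSurf V D} {d : D} : ∀ {t : BT D} {e : D}, M.Hang e t →
    d ∈ t.leaves → d = e ∨ d ∈ M.dl e t
  | .leaf _, e, h, h' => by
    simp only [leaves, List.mem_singleton] at h'
    exact Or.inl (h'.trans (Eq.symm h))
  | .node l r, e, h, h' => by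
    simp only [leaves, List.mem_append] at h'
    simp only [dl, List.mem_cons, List.mem_append]
    rcases h' with h' | h'
    · rcases h.1.leaves_sub h' with h2 | h2 <;> simp [h2]
    · rcases h.2.leaves_sub h' with h2 | h2 <;> simp [h2]

theorem flipφ_congr {M : TriSurf V D} {X Y : Set D} {d : D} (h0 : d ∈ X ↔ d ∈ Y)
    (h1 : M.φ d ∈ X ↔ M.φ d ∈ Y) (h2 : M.φ (M.φ d) ∈ X ↔ M.φ (M.φ d) ∈ Y) :
    M.flipφ X d = M.flipφ Y d :=
  by
  classical
  exact if_congr h0 rfl (if_congr h1 rfl (if_congr h2 rfl rfl))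

/-- Flipping `X` realises the passage from the dual tree `t` to `t'`. -/
structure Realizes (M : TriSurf V D) (e : D) (t t' : BT D) (X : Set D) : Prop where
  α_mem : ∀ d ∈ X, M.α d ∈ X
  α_ne : ∀ d ∈ X, M.α d ≠ d
  φ_notMem : ∀ d ∈ X, M.φ d ∉ X
  sub : ∀ d ∈ X, d ∈ M.dl e t
  root : M.α e ∉ X
  leaf : ∀ d ∈ X, d ∉ t.leaves
  -- Only the values on the darts met by the tree matter. So flips behind different sides can be
  -- combined into one.
  hang : ∀ M' : TriSurf V D, M'.α = M.α → (∀ d ∈ M.dl e t, M'.φ d = M.flipφ X d) →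
    M'.Hang e t' ∧ (M'.dl e t').Perm (M.dl e t)

theorem Realizes.flippable {M : TriSurf V D} {e : D} {t t' : BT D} {X : Set D}
    (h : M.Realizes e t t' X) : M.Flippable X := ⟨h.α_mem, h.α_ne, h.φ_notMem⟩

/-- A local change behind another side does not matter. -/
theorem Realizes.congr {M M' : TriSurf V D} {e : D} {t t' : BT D} {X Y : Set D}
    (h : M.Realizes e t t' X) (hα : M'.α = M.α) (hXY : ∀ d ∈ M.dl e t, d ∈ Y ↔ d ∈ X)
    (hφ : ∀ d ∈ M.dl e t, M'.φ d = M.flipφ Y d) :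
    M'.Hang e t' ∧ (M'.dl e t').Perm (M.dl e t) :=
  h.hang M' hα fun d hd => (hφ d hd).trans
    (flipφ_congr (hXY _ hd) (hXY _ (φ_mem_dl hd)) (hXY _ (φ_mem_dl (φ_mem_dl hd))))

/-- The rotation is the flip of the edge `p` between the root triangle and the triangle at the root
of the left subtree. The flips behind the three remaining sides of this quadrilateral are disjoint
from it and from each other. -/
theorem exists_realizes_right {M : TriSurf V D} {a a' b b' c c' : BT D}
    (iha : ∀ e, M.Hang e a → (M.dl e a).Nodup → ∃ X, M.Realizes e a a' X)
    (ihb : ∀ e, M.Hang e b → (M.dl e b).Nodup → ∃ X, M.Realizes e b b' X)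
    (ihc : ∀ e, M.Hang e c → (M.dl e c).Nodup → ∃ X, M.Realizes e c c' X) :
    ∀ e, M.Hang e (.node (.node a b) c) → (M.dl e (.node (.node a b) c)).Nodup →
      ∃ X, M.Realizes e (.node (.node a b) c) (.node a' (.node b' c')) X := by
  intro e he hn
  obtain ⟨⟨ha, hb⟩, hc⟩ := he
  set p := M.φ (M.α e) with hp
  set q := M.φ p with hq
  set p1 := M.φ (M.α p) with hp1
  set p2 := M.φ p1 with hp2
  simp only [dl, ← hp, ← hq, ← hp1, ← hp2, List.nodup_cons, List.nodup_append, List.mem_cons,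
    List.mem_append, not_or] at hn
  obtain ⟨A, hA⟩ := iha p1 ha (by tauto)
  obtain ⟨B, hB⟩ := ihb p2 hb (by tauto)
  obtain ⟨C, hC⟩ := ihc q hc (by tauto)
  have la : ∀ d ∈ a.leaves, d = p1 ∨ d ∈ M.dl p1 a := fun d => ha.leaves_sub
  have lb : ∀ d ∈ b.leaves, d = p2 ∨ d ∈ M.dl p2 b := fun d => hb.leaves_sub
  have lc : ∀ d ∈ c.leaves, d = q ∨ d ∈ M.dl q c := fun d => hc.leaves_sub
  have sA := hA.sub
  have sB := hB.sub
  have sC := hC.sub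
  have hqq : M.φ q = M.α e := M.φφφ _
  have hpp : M.φ p2 = M.α p := M.φφφ _
  have hXsub : ∀ d ∈ ({p, M.α p} ∪ A ∪ B ∪ C : Set D), d = p ∨ d = M.α p ∨ d ∈ M.dl p1 a ∨
      d ∈ M.dl p2 b ∨ d ∈ M.dl q c := by
    rintro d ((((rfl | rfl) | h) | h) | h) <;> grind
  have hXA : ∀ d ∈ M.dl p1 a, d ∈ ({p, M.α p} ∪ A ∪ B ∪ C : Set D) ↔ d ∈ A := by
    intro d hd
    simp only [Set.mem_union, Set.mem_insert_iff, Set.mem_singleton_iff]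
    grind
  have hXB : ∀ d ∈ M.dl p2 b, d ∈ ({p, M.α p} ∪ A ∪ B ∪ C : Set D) ↔ d ∈ B := by
    intro d hd
    simp only [Set.mem_union, Set.mem_insert_iff, Set.mem_singleton_iff]
    grind
  have hXC : ∀ d ∈ M.dl q c, d ∈ ({p, M.α p} ∪ A ∪ B ∪ C : Set D) ↔ d ∈ C := by
    intro d hd
    simp only [Set.mem_union, Set.mem_insert_iff, Set.mem_singleton_iff]
    grind
  have x1 : p ∈ ({p, M.α p} ∪ A ∪ B ∪ C : Set D) := by simp
  have x2 : M.α p ∈ ({p, M.α p} ∪ A ∪ B ∪ C : Set D) := by simp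
  have x3 : q ∉ ({p, M.α p} ∪ A ∪ B ∪ C : Set D) := fun h => by
    have := hXsub _ h; grind
  have x4 : M.α e ∉ ({p, M.α p} ∪ A ∪ B ∪ C : Set D) := fun h => by
    have := hXsub _ h; grind
  have x5 : p1 ∉ ({p, M.α p} ∪ A ∪ B ∪ C : Set D) := fun h => by
    have := hXsub _ h; grind
  have x6 : p2 ∉ ({p, M.α p} ∪ A ∪ B ∪ C : Set D) := fun h => by
    have := hXsub _ h; grind
  have hX : M.Flippable ({p, M.α p} ∪ A ∪ B ∪ C) := by
    refine ⟨?_, ?_, ?_⟩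
    · rintro d ((((rfl | rfl) | h) | h) | h)
      · exact x2
      · rw [M.αα]; exact x1
      · rw [hXA _ (sA _ (hA.α_mem d h))]; exact hA.α_mem d h
      · rw [hXB _ (sB _ (hB.α_mem d h))]; exact hB.α_mem d h
      · rw [hXC _ (sC _ (hC.α_mem d h))]; exact hC.α_mem d h
    · rintro d ((((rfl | rfl) | h) | h) | h)
      · grind
      · rw [M.αα]; grind
      · exact hA.α_ne d h
      · exact hB.α_ne d h
      · exact hC.α_ne d h
    · rintro d ((((rfl | rfl) | h) | h) | h)
      · exact x3
      · exact x5
      · rw [hXA _ (φ_mem_dl (sA _ h))]; exact hA.φ_notMem d h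
      · rw [hXB _ (φ_mem_dl (sB _ h))]; exact hB.φ_notMem d h
      · rw [hXC _ (φ_mem_dl (sC _ h))]; exact hC.φ_notMem d h
  refine ⟨{p, M.α p} ∪ A ∪ B ∪ C, hX.α_mem, hX.α_ne, hX.φ_notMem, ?_, x4, ?_, ?_⟩
  · intro d hd
    have := hXsub _ hd
    simp only [dl, ← hp, ← hq, ← hp1, ← hp2, List.mem_cons, List.mem_append, List.cons_append]
    tauto
  · intro d hd hd'
    have := hA.leaf d
    have := hB.leaf d
    have := hC.leaf d
    simp only [leaves, List.mem_append] at hd'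
    rcases hd' with (h | h) | h
    · rcases la d h with rfl | h'
      · exact x5 hd
      · rw [hXA _ h'] at hd; grind
    · rcases lb d h with rfl | h'
      · exact x6 hd
      · rw [hXB _ h'] at hd; grind
    · rcases lc d h with rfl | h'
      · exact x3 hd
      · rw [hXC _ h'] at hd; grind
  · intro M' hα hφ
    simp only [dl, ← hp, ← hq, ← hp1, ← hp2, List.mem_cons, List.mem_append,
      List.cons_append] at hφ
    have e1 : M'.φ (M.α e) = p1 := by
      rw [hφ _ (by simp), hX.flipφ_of_φ_mem x1]
    have e2 : M'.φ p1 = p := by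
      rw [hφ _ (by simp), hX.flipφ_of_φφ_mem (by rw [← hp2, hpp]; exact x2), ← hp2, hpp, M.αα]
    have e3 : M'.φ (M.α p) = p2 := by
      rw [hφ _ (by simp), flipφ_of_mem x2]
    have e4 : M'.φ p2 = q := by
      rw [hφ _ (by simp), hX.flipφ_of_φ_mem (by rw [hpp]; exact x2), hpp, M.αα]
    obtain ⟨ga, pa⟩ := hA.congr hα hXA (fun d hd => hφ d (by simp [hd]))
    obtain ⟨gb, pb⟩ := hB.congr hα hXB (fun d hd => hφ d (by simp [hd]))
    obtain ⟨gc, pc⟩ := hC.congr hα hXC (fun d hd => hφ d (by simp [hd]))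
    refine ⟨?_, ?_⟩
    · simp only [Hang, hα, e1, e2, e3, e4]; exact ⟨ga, gb, gc⟩
    · simp only [dl, hα, e1, e2, e3, e4, ← hp, ← hq, ← hp1, ← hp2]
      classical
      rw [List.perm_iff_count]
      intro x
      have := pa.count_eq x
      have := pb.count_eq x
      have := pc.count_eq x
      simp only [List.count_cons, List.count_append]
      omega

/-- The mirror image: the flipped edge is `q`, towards the right subtree. -/
theorem exists_realizes_left {M : TriSurf V D} {a a' b b' c c' : BT D}
    (iha : ∀ e, M.Hang e a → (M.dl e a).Nodup → ∃ X, M.Realizes e a a' X)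
    (ihb : ∀ e, M.Hang e b → (M.dl e b).Nodup → ∃ X, M.Realizes e b b' X)
    (ihc : ∀ e, M.Hang e c → (M.dl e c).Nodup → ∃ X, M.Realizes e c c' X) :
    ∀ e, M.Hang e (.node a (.node b c)) → (M.dl e (.node a (.node b c))).Nodup →
      ∃ X, M.Realizes e (.node a (.node b c)) (.node (.node a' b') c') X := by
  intro e he hn
  obtain ⟨ha, hb, hc⟩ := he
  set p := M.φ (M.α e) with hp
  set q := M.φ p with hq
  set q1 := M.φ (M.α q) with hq1
  set q2 := M.φ q1 with hq2
  simp only [dl, ← hp, ← hq, ← hq1, ← hq2, List.nodup_cons, List.nodup_append, List.mem_cons,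
    List.mem_append, not_or] at hn
  obtain ⟨A, hA⟩ := iha p ha (by tauto)
  obtain ⟨B, hB⟩ := ihb q1 hb (by tauto)
  obtain ⟨C, hC⟩ := ihc q2 hc (by tauto)
  have la : ∀ d ∈ a.leaves, d = p ∨ d ∈ M.dl p a := fun d => ha.leaves_sub
  have lb : ∀ d ∈ b.leaves, d = q1 ∨ d ∈ M.dl q1 b := fun d => hb.leaves_sub
  have lc : ∀ d ∈ c.leaves, d = q2 ∨ d ∈ M.dl q2 c := fun d => hc.leaves_sub
  have sA := hA.sub
  have sB := hB.sub
  have sC := hC.sub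
  have hpp : M.φ q = M.α e := M.φφφ _
  have hqq : M.φ q2 = M.α q := M.φφφ _
  have hXsub : ∀ d ∈ ({q, M.α q} ∪ A ∪ B ∪ C : Set D), d = q ∨ d = M.α q ∨ d ∈ M.dl p a ∨
      d ∈ M.dl q1 b ∨ d ∈ M.dl q2 c := by
    rintro d ((((rfl | rfl) | h) | h) | h) <;> grind
  have hXA : ∀ d ∈ M.dl p a, d ∈ ({q, M.α q} ∪ A ∪ B ∪ C : Set D) ↔ d ∈ A := by
    intro d hd
    simp only [Set.mem_union, Set.mem_insert_iff, Set.mem_singleton_iff]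
    grind
  have hXB : ∀ d ∈ M.dl q1 b, d ∈ ({q, M.α q} ∪ A ∪ B ∪ C : Set D) ↔ d ∈ B := by
    intro d hd
    simp only [Set.mem_union, Set.mem_insert_iff, Set.mem_singleton_iff]
    grind
  have hXC : ∀ d ∈ M.dl q2 c, d ∈ ({q, M.α q} ∪ A ∪ B ∪ C : Set D) ↔ d ∈ C := by
    intro d hd
    simp only [Set.mem_union, Set.mem_insert_iff, Set.mem_singleton_iff]
    grind
  have x1 : q ∈ ({q, M.α q} ∪ A ∪ B ∪ C : Set D) := by simp
  have x2 : M.α q ∈ ({q, M.α q} ∪ A ∪ B ∪ C : Set D) := by simp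
  have x3 : p ∉ ({q, M.α q} ∪ A ∪ B ∪ C : Set D) := fun h => by
    have := hXsub _ h; grind
  have x4 : M.α e ∉ ({q, M.α q} ∪ A ∪ B ∪ C : Set D) := fun h => by
    have := hXsub _ h; grind
  have x5 : q1 ∉ ({q, M.α q} ∪ A ∪ B ∪ C : Set D) := fun h => by
    have := hXsub _ h; grind
  have x6 : q2 ∉ ({q, M.α q} ∪ A ∪ B ∪ C : Set D) := fun h => by
    have := hXsub _ h; grind
  have hX : M.Flippable ({q, M.α q} ∪ A ∪ B ∪ C) := by
    refine ⟨?_, ?_, ?_⟩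
    · rintro d ((((rfl | rfl) | h) | h) | h)
      · exact x2
      · rw [M.αα]; exact x1
      · rw [hXA _ (sA _ (hA.α_mem d h))]; exact hA.α_mem d h
      · rw [hXB _ (sB _ (hB.α_mem d h))]; exact hB.α_mem d h
      · rw [hXC _ (sC _ (hC.α_mem d h))]; exact hC.α_mem d h
    · rintro d ((((rfl | rfl) | h) | h) | h)
      · grind
      · rw [M.αα]; grind
      · exact hA.α_ne d h
      · exact hB.α_ne d h
      · exact hC.α_ne d h
    · rintro d ((((rfl | rfl) | h) | h) | h)
      · rw [hpp]; exact x4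
      · exact x5
      · rw [hXA _ (φ_mem_dl (sA _ h))]; exact hA.φ_notMem d h
      · rw [hXB _ (φ_mem_dl (sB _ h))]; exact hB.φ_notMem d h
      · rw [hXC _ (φ_mem_dl (sC _ h))]; exact hC.φ_notMem d h
  refine ⟨{q, M.α q} ∪ A ∪ B ∪ C, hX.α_mem, hX.α_ne, hX.φ_notMem, ?_, x4, ?_, ?_⟩
  · intro d hd
    have := hXsub _ hd
    simp only [dl, ← hp, ← hq, ← hq1, ← hq2, List.mem_cons, List.mem_append]
    tauto
  · intro d hd hd'
    have := hA.leaf d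
    have := hB.leaf d
    have := hC.leaf d
    simp only [leaves, List.mem_append] at hd'
    rcases hd' with h | h | h
    · rcases la d h with rfl | h'
      · exact x3 hd
      · rw [hXA _ h'] at hd; grind
    · rcases lb d h with rfl | h'
      · exact x5 hd
      · rw [hXB _ h'] at hd; grind
    · rcases lc d h with rfl | h'
      · exact x6 hd
      · rw [hXC _ h'] at hd; grind
  · intro M' hα hφ
    simp only [dl, ← hp, ← hq, ← hq1, ← hq2, List.mem_cons, List.mem_append] at hφ
    have e1 : M'.φ (M.α e) = M.α q := by
      rw [hφ _ (by simp), hX.flipφ_of_φφ_mem (by rw [← hp, ← hq]; exact x1)]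
    have e2 : M'.φ (M.α q) = q2 := by
      rw [hφ _ (by simp), flipφ_of_mem x2]
    have e3 : M'.φ q = p := by
      rw [hφ _ (by simp), flipφ_of_mem x1, hpp]
    have e4 : M'.φ p = q1 := by
      rw [hφ _ (by simp), hX.flipφ_of_φ_mem x1]
    obtain ⟨ga, pa⟩ := hA.congr hα hXA (fun d hd => hφ d (by simp [hd]))
    obtain ⟨gb, pb⟩ := hB.congr hα hXB (fun d hd => hφ d (by simp [hd]))
    obtain ⟨gc, pc⟩ := hC.congr hα hXC (fun d hd => hφ d (by simp [hd]))
    refine ⟨?_, ?_⟩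
    · simp only [Hang, hα, e1, e2, M.αα, e3, e4]; exact ⟨⟨ga, gb⟩, gc⟩
    · simp only [dl, hα, e1, e2, M.αα, e3, e4, ← hp, ← hq, ← hq1, ← hq2]
      classical
      rw [List.perm_iff_count]
      intro x
      have := pa.count_eq x
      have := pb.count_eq x
      have := pc.count_eq x
      simp only [List.count_cons, List.count_append]
      omega

theorem exists_realizes {M : TriSurf V D} {t t' : BT D} (h : Rot t t') :
    ∀ e, M.Hang e t → (M.dl e t).Nodup → ∃ X, M.Realizes e t t' X := by
  classical
  induction h with
  | leaf a =>
    intro e he _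
    exact ⟨∅, by simp, by simp, by simp, by simp, by simp, by simp,
      fun M' _ _ => ⟨he, by simp [dl]⟩⟩
  | @node a a' b b' _ _ iha ihb =>
    intro e he hn
    obtain ⟨ha, hb⟩ := he
    set p := M.φ (M.α e) with hp
    set q := M.φ p with hq
    simp only [dl, ← hp, ← hq, List.nodup_cons, List.nodup_append, List.mem_cons,
      List.mem_append, not_or] at hn
    obtain ⟨⟨n1, n2, n3, n4⟩, ⟨n5, n6, n7⟩, ⟨n8, n9⟩, na, nb, nab⟩ := hn
    obtain ⟨A, hA⟩ := iha p ha na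
    obtain ⟨B, hB⟩ := ihb q hb nb
    have hAB : ∀ d ∈ A, d ∉ M.dl q b := fun d h1 h2 => nab d (hA.sub d h1) d h2 rfl
    have hBA : ∀ d ∈ B, d ∉ M.dl p a := fun d h1 h2 => nab d h2 d (hB.sub d h1) rfl
    have la : ∀ d ∈ a.leaves, d = p ∨ d ∈ M.dl p a := fun d => ha.leaves_sub
    have lb : ∀ d ∈ b.leaves, d = q ∨ d ∈ M.dl q b := fun d => hb.leaves_sub
    have sA := hA.sub
    have sB := hB.sub
    have hqq : M.φ q = M.α e := M.φφφ _
    refine ⟨A ∪ B, ⟨?_, ?_, ?_, ?_, ?_, ?_, ?_⟩⟩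
    · rintro d (hd | hd)
      · exact Or.inl (hA.α_mem d hd)
      · exact Or.inr (hB.α_mem d hd)
    · rintro d (hd | hd)
      · exact hA.α_ne d hd
      · exact hB.α_ne d hd
    · rintro d (hd | hd) (hd' | hd')
      · exact hA.φ_notMem d hd hd'
      · exact hBA _ hd' (φ_mem_dl (sA d hd))
      · exact hAB _ hd' (φ_mem_dl (sB d hd))
      · exact hB.φ_notMem d hd hd'
    · rintro d (hd | hd)
      · simp [dl, ← hp, ← hq, sA d hd]
      · simp [dl, ← hp, ← hq, sB d hd]
    · rintro (hd | hd)
      · exact n3 (sA _ hd)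
      · exact n4 (sB _ hd)
    · intro d hd hd'
      simp only [leaves, List.mem_append] at hd'
      rcases hd with hd | hd <;> rcases hd' with hd' | hd'
      · exact hA.leaf d hd hd'
      · rcases lb d hd' with rfl | h
        · exact n8 (sA _ hd)
        · exact hAB d hd h
      · rcases la d hd' with rfl | h
        · exact n7 (sB _ hd)
        · exact hBA d hd h
      · exact hB.leaf d hd hd'
    · intro M' hα hφ
      simp only [dl, ← hp, ← hq, List.mem_cons, List.mem_append] at hφ
      have m1 : M.α e ∉ A ∪ B := by rintro (h | h); exacts [n3 (sA _ h), n4 (sB _ h)]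
      have m2 : p ∉ A ∪ B := by rintro (h | h); exacts [n6 (sA _ h), n7 (sB _ h)]
      have m3 : q ∉ A ∪ B := by rintro (h | h); exacts [n8 (sA _ h), n9 (sB _ h)]
      have e1 : M'.φ (M'.α e) = p := by
        rw [hα, hφ _ (by simp), flipφ_of_notMem m1 m2 m3]
      have e2 : M'.φ p = q := by
        rw [hφ _ (by simp), flipφ_of_notMem m2 m3 (by rwa [← hq, hqq])]
      obtain ⟨ga, pa⟩ := hA.congr (Y := A ∪ B) hα
        (fun d hd => ⟨fun h => h.resolve_right fun h' => hBA d h' hd, Or.inl⟩)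
        (fun d hd => hφ d (by simp [hd]))
      obtain ⟨gb, pb⟩ := hB.congr (Y := A ∪ B) hα
        (fun d hd => ⟨fun h => h.resolve_left fun h' => hAB d h' hd, Or.inr⟩)
        (fun d hd => hφ d (by simp [hd]))
      refine ⟨?_, ?_⟩
      · simp only [Hang, e1, e2]; exact ⟨ga, gb⟩
      · rw [hα] at e1
        simp only [dl, hα, e1, e2, ← hp, ← hq]
        exact (((pa.append pb).cons _).cons _).cons _
  | right _ _ _ iha ihb ihc => exact exists_realizes_right iha ihb ihc
  | left _ _ _ iha ihb ihc => exact exists_realizes_left iha ihb ihc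

/-- The tree `t` behind `e` meets each dart of the surface exactly once. -/
structure Span (M : TriSurf V D) (e : D) (t : BT D) : Prop where
  hang : M.Hang e t
  nodup : (M.dl e t).Nodup
  mem : ∀ d, d ∈ M.dl e t

/-- Neither the root nor the leaves are flipped, so the sides of the polygon keep their labels,
however they are matched among themselves. -/
theorem Span.reach {e : D} {k : ℕ} {t t' : BT D} (hr : RotN k t t') :
    ∀ {M : TriSurf V D}, M.Span e t → ∃ M', Reach k M M' ∧ M'.Span e t' ∧
      (∀ d ∈ t.leaves, M'.lab d = M.lab d) ∧ M'.lab (M.α e) = M.lab (M.α e) ∧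
      M'.lab e = M.lab e := by
  induction k generalizing t with
  | zero => cases hr; exact fun {M} h => ⟨M, .zero M, h, fun _ _ => rfl, rfl, rfl⟩
  | succ k ih =>
    intro M h
    obtain ⟨u, h1, h2⟩ := hr
    obtain ⟨X, hX⟩ := exists_realizes h1 e h.hang h.nodup
    obtain ⟨h3, h4⟩ := hX.hang (M.flip X hX.flippable) rfl fun _ _ => rfl
    obtain ⟨M', r, s, l1, l2, l3⟩ := ih h2 (M := M.flip X hX.flippable)
      ⟨h3, h4.nodup_iff.2 h.nodup, fun d => h4.mem_iff.2 (h.mem d)⟩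
    have he : e ∉ X := fun he => hX.root (hX.α_mem e he)
    refine ⟨M', ?_, s, fun d hd => ?_, ?_, ?_⟩
    · rw [Nat.add_comm]
      exact (Reach.one ⟨X, hX.flippable, rfl⟩).trans r
    · rw [l1 d (by rwa [h1.leaves_eq]), flip_lab _ fun h' => hX.leaf d h' hd]
    · rw [flip_α] at l2
      rw [l2, flip_lab _ hX.root]
    · rw [l3, flip_lab _ he]

/-- A triangulated polygon can be changed to any other one. -/
theorem Span.polygon {M : TriSurf V D} {e : D} {k : ℕ} {t t' : BT D} (h : M.Span e t)
    (hl : t.leaves = t'.leaves) (hk : t.leaves.length ≤ 2 ^ k) :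
    ∃ M', Reach (24 * k) M M' ∧ M'.Span e t' ∧
      (∀ d ∈ t.leaves, M'.lab d = M.lab d) ∧ M'.lab (M.α e) = M.lab (M.α e) ∧
      M'.lab e = M.lab e :=
  h.reach (rotN_of_leaves_eq hl hk)

end TriSurf

end SimFlip

/-! ### Extending a polygon to the whole surface; fans. -/

namespace SimFlip

namespace TriSurf

open BT

variable {V D : Type} {M : TriSurf V D}

/-- A binary tree with `m` leaves has `m - 1` nodes, and each node is a triangle with three darts.
-/
theorem length_dl (M : TriSurf V D) : ∀ (t : BT D) (e : D),
    (M.dl e t).length + 3 = 3 * t.leaves.length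
  | .leaf _, e => by simp [dl, leaves]
  | .node l r, e => by
    have h1 := length_dl M l (M.φ (M.α e))
    have h2 := length_dl M r (M.φ (M.φ (M.α e)))
    simp only [dl, leaves, List.length_cons, List.length_append]
    omega

/-- Another tree is put on a leaf. -/
theorem Hang.graft {d : D} {s : BT D} (hs : M.Hang d s) : ∀ {t : BT D} {e : D} {l₁ l₂ : List D},
    M.Hang e t → t.leaves = l₁ ++ d :: l₂ → ∃ t', M.Hang e t' ∧ t'.leaves = l₁ ++ s.leaves ++ l₂ ∧
      (M.dl e t').Perm (M.dl e t ++ M.dl d s)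
  | .leaf x, e, l₁, l₂, h, hl => by
    have : l₁ = [] ∧ x = d ∧ l₂ = [] := by
      rcases l₁ with _ | ⟨y, l₁⟩
      · simpa [leaves, eq_comm] using hl
      · simp [leaves] at hl
    obtain ⟨rfl, rfl, rfl⟩ := this
    cases h
    exact ⟨s, hs, by simp, by simp [dl]⟩
  | .node a b, e, l₁, l₂, h, hl => by
    simp only [leaves] at hl
    rcases List.append_eq_append_iff.1 hl with ⟨m, h1, h2⟩ | ⟨m, h1, h2⟩
    · obtain ⟨b', g1, g2, g3⟩ := hs.graft h.2 h2
      refine ⟨.node a b', ⟨h.1, g1⟩, by simp [leaves, g2, h1], ?_⟩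
      simp only [dl, List.cons_append, List.append_assoc]
      exact (((g3.append_left _).cons _).cons _).cons _
    · rcases m with _ | ⟨y, m⟩
      · simp only [List.append_nil, List.nil_append] at h1 h2
        obtain ⟨b', g1, g2, g3⟩ := hs.graft (l₁ := []) h.2 h2.symm
        refine ⟨.node a b', ⟨h.1, g1⟩, by simp [leaves, g2, h1], ?_⟩
        simp only [dl, List.cons_append, List.append_assoc]
        exact (((g3.append_left _).cons _).cons _).cons _
      · simp only [List.cons_append, List.cons.injEq] at h2
        obtain ⟨rfl, h2⟩ := h2
        obtain ⟨a', g1, g2, g3⟩ := hs.graft h.1 h1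
        refine ⟨.node a' b, ⟨g1, h.2⟩, by simp [leaves, g2, h2], ?_⟩
        simp only [dl, List.cons_append]
        refine (((?_ : List.Perm _ _).cons _).cons _).cons _
        refine (g3.append_right _).trans ?_
        rw [List.append_assoc, List.append_assoc]
        exact List.Perm.append_left _ List.perm_append_comm

/-- Both darts of an inner edge of the polygon are met, so the way out leads through a side of the
polygon. -/
theorem Hang.mem_leaves_of_α_notMem {d : D} : ∀ {t : BT D} {e : D}, M.Hang e t →
    d ∈ M.dl e t → M.α d ∉ M.dl e t → d ∈ t.leaves ∨ d = M.α e
  | .leaf _, e, _, hd, _ => by simp [dl] at hd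
  | .node l r, e, h, hd, hd' => by
    simp only [dl, List.mem_cons, List.mem_append, not_or] at hd hd'
    obtain ⟨h1, h2, h3, h4, h5⟩ := hd'
    have aux : ∀ {u : BT D} {p : D}, M.Hang p u → d = p → M.α d ∉ M.dl p u → d ∈ u.leaves := by
      rintro (x | ⟨x, y⟩) p hu rfl hn
      · cases hu; simp [leaves]
      · simp [dl] at hn
    simp only [leaves, List.mem_append]
    rcases hd with hd | hd | hd | hd | hd
    · exact Or.inr hd
    · exact Or.inl (Or.inl (aux h.1 hd h4))
    · exact Or.inl (Or.inr (aux h.2 hd h5))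
    · rcases h.1.mem_leaves_of_α_notMem hd h4 with h' | h'
      · exact Or.inl (Or.inl h')
      · exact absurd (by rw [h', M.αα]) h2
    · rcases h.2.mem_leaves_of_α_notMem hd h5 with h' | h'
      · exact Or.inl (Or.inr h')
      · exact absurd (by rw [h', M.αα]) h3

/-- A tree can be extended by the triangle behind one of its leaves. -/
theorem Hang.grow {t : BT D} {e d : D} {l₁ l₂ : List D} (h : M.Hang e t)
    (hn : (M.dl e t).Nodup) (hl : t.leaves = l₁ ++ d :: l₂) (hd : M.α d ∉ M.dl e t) :
    ∃ t', M.Hang e t' ∧ (M.dl e t').Nodup ∧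
      t'.leaves = l₁ ++ M.φ (M.α d) :: M.φ (M.φ (M.α d)) :: l₂ ∧
      (∀ x, x ∈ M.dl e t' ↔ x ∈ M.dl e t ∨ x = M.α d ∨ x = M.φ (M.α d) ∨
        x = M.φ (M.φ (M.α d))) := by
  obtain ⟨t', h1, h2, h3⟩ := Hang.graft (M := M) (d := d)
    (s := .node (.leaf (M.φ (M.α d))) (.leaf (M.φ (M.φ (M.α d))))) ⟨rfl, rfl⟩ h hl
  refine ⟨t', h1, ?_, by simpa [leaves] using h2, fun x => by simpa [dl] using h3.mem_iff⟩
  rw [h3.nodup_iff]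
  have e1 : M.φ (M.α d) ∉ M.dl e t := fun h' => hd (by
    simpa [M.φφφ] using φ_mem_dl (φ_mem_dl h'))
  have e2 : M.φ (M.φ (M.α d)) ∉ M.dl e t := fun h' => hd (by simpa [M.φφφ] using φ_mem_dl h')
  have e3 := M.φ_ne (M.α d)
  have e4 := M.φ_ne (M.φ (M.α d))
  have e5 := M.φφ_ne (M.α d)
  simp only [dl, List.append_nil, List.nodup_append, hn, List.nodup_cons, List.mem_cons,
    List.not_mem_nil, or_false, not_or, true_and]
  refine ⟨by simp [e3.symm, e4.symm, e5.symm], ?_⟩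
  rintro x hx y (rfl | rfl | rfl) rfl
  · exact hd hx
  · exact e1 hx
  · exact e2 hx

/-- Every tree extends to a spanning one. The leaves that do not lead to new triangles stay. -/
theorem Hang.exists_span [Finite D] (hM : M.Good) {e : D} {F : List D} {n : ℕ} :
    ∀ {t : BT D} {l : List D}, Nat.card D - (M.dl e t).length ≤ n → M.Hang e t →
    (M.dl e t).Nodup → e ∈ M.dl e t → t.leaves = l ++ F → (∀ f ∈ F, M.α f ∈ M.dl e t) →
    ∃ t' l', M.Span e t' ∧ t'.leaves = l' ++ F := by
  induction n with
  | zero =>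
    intro t l hc h hn _ hl _
    refine ⟨t, l, ⟨h, hn, fun d => ?_⟩, hl⟩
    by_contra hd
    have : (d :: M.dl e t).Nodup := List.nodup_cons.2 ⟨hd, hn⟩
    classical
    have := Fintype.ofFinite D
    have := ‹(d :: M.dl e t).Nodup›.length_le_card
    rw [Nat.card_eq_fintype_card] at hc
    simp only [List.length_cons] at this
    omega
  | succ n ih =>
    intro t l hc h hn he hl hF
    by_cases hall : ∀ d, d ∈ M.dl e t
    · exact ⟨t, l, ⟨h, hn, hall⟩, hl⟩
    have : ∃ d, d ∈ M.dl e t ∧ M.α d ∉ M.dl e t := by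
      -- Otherwise the darts met are closed under `α` and `φ`, hence all darts by connectedness.
      by_contra hcon
      push Not at hcon
      have := hM.conn {d | d ∈ M.dl e t} ⟨e, he⟩ hcon fun d hd => φ_mem_dl hd
      exact hall fun d => by
        have hd : d ∈ {d | d ∈ M.dl e t} := by rw [this]; trivial
        exact hd
    obtain ⟨d, hd, hd'⟩ := this
    -- The way out is not the root, because `e` itself has been met.
    have hdl : d ∈ t.leaves := (h.mem_leaves_of_α_notMem hd hd').resolve_right fun h' =>
      hd' (by rw [h', M.αα]; exact he)
    rw [hl, List.mem_append] at hdl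
    obtain ⟨l₁, l₂, hl'⟩ := List.append_of_mem (hdl.resolve_right fun h' => hd' (hF d h'))
    obtain ⟨t', g1, g2, g3, g4⟩ := h.grow hn (l₁ := l₁) (l₂ := l₂ ++ F) (by rw [hl, hl']; simp) hd'
    refine ih (l := l₁ ++ M.φ (M.α d) :: M.φ (M.φ (M.α d)) :: l₂) ?_ g1 g2 ((g4 _).2 (Or.inl he))
      (by rw [g3]; simp) fun f hf => (g4 _).2 (Or.inl (hF f hf))
    have k1 := length_dl M t e
    have k2 := length_dl M t' e
    rw [hl, hl'] at k1
    rw [g3] at k2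
    simp only [List.length_append, List.length_cons] at k1 k2
    omega

theorem Span.card {e : D} {t : BT D} (h : M.Span e t) : Nat.card D + 3 = 3 * t.leaves.length := by
  classical
  rw [← length_dl M t e]
  congr 1
  have : (Set.univ : Set D) = ((M.dl e t).toFinset : Set D) := by
    ext d; simp [h.mem d]
  rw [← Set.ncard_univ, this, Set.ncard_coe_finset, List.toFinset_card_of_nodup h.nodup]

/-- The surface is a fan of triangles around a corner. The sides of the fan are `a 1`, …, `a N`
and `r N`, its spokes are `r 1`, …, `r N`. -/
structure Comb (M : TriSurf V D) (N : ℕ) (a r : ℕ → D) : Prop where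
  r_one : r 1 = M.α (a 1)
  φ_a : ∀ i, 1 ≤ i → i < N → M.φ (a (i + 1)) = r (i + 1)
  φ_r : ∀ i, 1 ≤ i → i < N → M.φ (r (i + 1)) = M.α (r i)
  exists_tri : ∀ d, ∃ i, 1 ≤ i ∧ i < N ∧ (d = a (i + 1) ∨ d = r (i + 1) ∨ d = M.α (r i))
  a_inj : ∀ i j, 1 ≤ i → i < N → 1 ≤ j → j < N → a (i + 1) = a (j + 1) → i = j
  a_ne_r : ∀ i j, 1 ≤ i → i < N → 1 ≤ j → j < N → a (i + 1) ≠ r (j + 1)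
  a_ne_αr : ∀ i j, 1 ≤ i → i < N → 1 ≤ j → j < N → a (i + 1) ≠ M.α (r j)

/-- A left comb is the dual tree of a fan: each node adds the triangle `a (i + 1)`, `r (i + 1)`, `α
(r i)`, attached along the last spoke. The numbering of the `a i` starts at 1, that of the list of
leaves at 0. -/
theorem Hang.comb_aux {a r : ℕ → D} (hr : r 1 = M.α (a 1)) : ∀ {t : BT D} {e : D},
    M.Hang e t → rht t = 0 → (∀ i, (hi : i < t.leaves.length) → a (i + 1) = t.leaves[i]) →
    (∀ i, 1 ≤ i → i < t.leaves.length → r (i + 1) = M.φ (a (i + 1))) →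
    r t.leaves.length = M.α e ∧
    (∀ i, 1 ≤ i → i < t.leaves.length → M.φ (r (i + 1)) = M.α (r i)) ∧
    (M.dl e t).Perm ((List.range (t.leaves.length - 1)).flatMap
      fun j => [a (j + 2), r (j + 2), M.α (r (j + 1))])
  | .leaf x, e, h, _, ha, _ => by
    cases h
    have := ha 0 (by simp [leaves])
    simp only [leaves, List.getElem_cons_zero] at this
    refine ⟨by simp [leaves, hr, this], fun i h1 h2 => ?_, by simp [leaves, dl]⟩
    simp only [leaves, List.length_singleton] at h2
    omega
  | .node s (.node _ _), e, h, h0, ha, ha' => by simp [rht, ht] at h0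
  | .node s (.leaf x), e, h, h0, ha, ha' => by
    obtain ⟨hs, hx⟩ := h
    simp only [rht] at h0
    simp only [leaves, List.length_append, List.length_singleton] at ha ha' ⊢
    have hpos := List.length_pos_iff.2 (leaves_ne_nil s)
    obtain ⟨g1, g2, g3⟩ := hs.comb_aux hr (by omega)
      (fun i hi => by rw [ha i (by omega), List.getElem_append_left hi])
      (fun i h1 h2 => ha' i h1 (by omega))
    have hlast := ha s.leaves.length (by omega)
    simp only [List.getElem_append_right le_rfl, Nat.sub_self, List.getElem_cons_zero] at hlast
    have hx' : M.φ (M.φ (M.α e)) = x := hx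
    have hlast2 := ha' s.leaves.length (by omega) (by omega)
    have e1 : r (s.leaves.length + 1) = M.α e := by rw [hlast2, hlast, ← hx', M.φφφ]
    refine ⟨e1, ?_, ?_⟩
    · intro i h1 h2
      rcases Nat.lt_succ_iff_lt_or_eq.1 h2 with h3 | rfl
      · exact g2 i h1 h3
      · rw [e1, g1, M.αα]
    · obtain ⟨m, hm⟩ : ∃ m, s.leaves.length = m + 1 := ⟨s.leaves.length - 1, by omega⟩
      rw [hm] at g1 g3 e1 hlast ⊢
      simp only [Nat.add_sub_cancel] at g3 ⊢
      rw [List.range_succ, List.flatMap_append]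
      simp only [dl, List.append_nil, List.flatMap_cons, List.flatMap_nil]
      rw [e1, g1, hlast, M.αα, hx']
      classical
      rw [List.perm_iff_count]
      intro y
      have := g3.count_eq y
      simp only [List.count_cons, List.count_append, List.count_nil]
      omega

theorem Span.comb {e : D} {t : BT D} (h : M.Span e t) (h0 : rht t = 0) :
    ∃ a r, M.Comb t.leaves.length a r ∧ r t.leaves.length = M.α e ∧
      (∀ i, (hi : i < t.leaves.length) → a (i + 1) = t.leaves[i]) := by
  classical
  -- The default value `e` and the values at index 0 play no role.
  let a : ℕ → D := fun i => t.leaves.getD (i - 1) e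
  let r : ℕ → D := fun i => if i = 1 then M.α (a 1) else M.φ (a i)
  have ha : ∀ i, (hi : i < t.leaves.length) → a (i + 1) = t.leaves[i] := fun i hi => by
    simp [a, hi]
  have hr : r 1 = M.α (a 1) := by simp [r]
  have hr' : ∀ i, 1 ≤ i → i < t.leaves.length → r (i + 1) = M.φ (a (i + 1)) := fun i h1 _ => by
    have : i ≠ 0 := by omega
    simp [r, this]
  obtain ⟨g1, g2, g3⟩ := h.hang.comb_aux hr h0 ha hr'
  have hn := g3.nodup_iff.1 h.nodup
  rw [List.nodup_flatMap] at hn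
  obtain ⟨n1, n2⟩ := hn
  have key : ∀ i j, 1 ≤ i → i < t.leaves.length → 1 ≤ j → j < t.leaves.length →
      ∀ d ∈ [a (i + 1), r (i + 1), M.α (r i)], d ∈ [a (j + 1), r (j + 1), M.α (r j)] → i = j := by
    intro i j h1 h2 h3 h4 d h5 h6
    rw [List.pairwise_iff_getElem] at n2
    obtain ⟨i, rfl⟩ := Nat.exists_eq_add_of_le' h1
    obtain ⟨j, rfl⟩ := Nat.exists_eq_add_of_le' h3
    rcases lt_trichotomy i j with h | h | h
    · have := n2 i j (by simp; omega) (by simp; omega) h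
      simp only [List.getElem_range, Function.onFun] at this
      exact absurd h6 (this h5)
    · rw [h]
    · have := n2 j i (by simp; omega) (by simp; omega) h
      simp only [List.getElem_range, Function.onFun] at this
      exact absurd h5 (this h6)
  have key2 : ∀ i, 1 ≤ i → i < t.leaves.length → [a (i + 1), r (i + 1), M.α (r i)].Nodup := by
    intro i h1 h2
    obtain ⟨i, rfl⟩ := Nat.exists_eq_add_of_le' h1
    exact n1 i (by simp; omega)
  refine ⟨a, r, ⟨hr, fun i h1 h2 => (hr' i h1 h2).symm, g2, ?_, ?_, ?_, ?_⟩, g1, ha⟩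
  · intro d
    have := g3.mem_iff.1 (h.mem d)
    rw [List.mem_flatMap] at this
    obtain ⟨j, hj, hd⟩ := this
    rw [List.mem_range] at hj
    exact ⟨j + 1, by omega, by omega, by simpa using hd⟩
  · intro i j h1 h2 h3 h4 h5
    exact key i j h1 h2 h3 h4 (a (i + 1)) (by simp) (by simp [h5])
  · intro i j h1 h2 h3 h4 h5
    have := key i j h1 h2 h3 h4 (a (i + 1)) (by simp) (by simp [h5])
    subst this
    have := key2 i h1 h2
    simp [h5] at this
  · intro i j h1 h2 h3 h4 h5
    have := key i j h1 h2 h3 h4 (a (i + 1)) (by simp) (by simp [h5])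
    subst this
    have := key2 i h1 h2
    simp [h5] at this

end TriSurf

end SimFlip

/-! ### Fans: the matching of the sides and the corners. -/

namespace SimFlip

namespace TriSurf

open BT

variable {V D : Type} {M : TriSurf V D}

/-- The sides of a fan, in cyclic order. -/
def sd (N : ℕ) (a r : ℕ → D) (i : Fin (N + 1)) : D := if i = 0 then r N else a i

namespace Comb

variable {N : ℕ} {a r : ℕ → D}

theorem φ_αr (h : M.Comb N a r) {i : ℕ} (h1 : 1 ≤ i) (h2 : i < N) : M.φ (M.α (r i)) = a (i + 1) := by
  rw [← h.φ_r i h1 h2, ← h.φ_a i h1 h2, M.φφφ]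

theorem αr_one (h : M.Comb N a r) : M.α (r 1) = a 1 := by rw [h.r_one, M.αα]

theorem r_inj (h : M.Comb N a r) {i j : ℕ} (h1 : 1 ≤ i) (h2 : i < N) (h3 : 1 ≤ j) (h4 : j < N)
    (h5 : r i = r j) : i = j := by
  refine h.a_inj i j h1 h2 h3 h4 ?_
  rw [← h.φ_αr h1 h2, ← h.φ_αr h3 h4, h5]

theorem r_inj' (h : M.Comb N a r) {i j : ℕ} (h1 : 2 ≤ i) (h2 : i ≤ N) (h3 : 2 ≤ j) (h4 : j ≤ N)
    (h5 : r i = r j) : i = j := by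
  obtain ⟨i, rfl⟩ := Nat.exists_eq_add_of_le' h1
  obtain ⟨j, rfl⟩ := Nat.exists_eq_add_of_le' h3
  have := congrArg M.φ h5
  rw [h.φ_r (i + 1) (by omega) (by omega), h.φ_r (j + 1) (by omega) (by omega)] at this
  have := h.r_inj (by omega) (by omega) (by omega) (by omega) (M.α_inj this)
  omega

theorem r_ne_αr (h : M.Comb N a r) {i j : ℕ} (h1 : 2 ≤ i) (h2 : i ≤ N) (h3 : 1 ≤ j) (h4 : j < N) :
    r i ≠ M.α (r j) := by
  intro h5
  obtain ⟨i, rfl⟩ := Nat.exists_eq_add_of_le' h1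
  have := congrArg M.φ h5
  rw [h.φ_r (i + 1) (by omega) (by omega), h.φ_αr h3 h4] at this
  exact h.a_ne_αr _ _ h3 h4 (by omega) (by omega) this.symm

theorem a_ne_r' (h : M.Comb N a r) {i j : ℕ} (h1 : 1 ≤ i) (h2 : i ≤ N) (h3 : 2 ≤ j) (h4 : j ≤ N) :
    a i ≠ r j := by
  rcases Nat.lt_or_ge 1 i with h5 | h5
  · obtain ⟨i, rfl⟩ := Nat.exists_eq_add_of_le' h5
    obtain ⟨j, rfl⟩ := Nat.exists_eq_add_of_le' h3
    exact h.a_ne_r _ _ (by omega) (by omega) (by omega) (by omega)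
  · obtain rfl : i = 1 := by omega
    rw [← h.αr_one]
    exact (h.r_ne_αr h3 h4 le_rfl (by omega)).symm

theorem a_ne_αr' (h : M.Comb N a r) {i j : ℕ} (h1 : 1 ≤ i) (h2 : i ≤ N) (h3 : 2 ≤ j) (h4 : j < N) :
    a i ≠ M.α (r j) := by
  rcases Nat.lt_or_ge 1 i with h5 | h5
  · obtain ⟨i, rfl⟩ := Nat.exists_eq_add_of_le' h5
    exact h.a_ne_αr _ _ (by omega) (by omega) (by omega) (by omega)
  · obtain rfl : i = 1 := by omega
    rw [← h.αr_one]
    intro h6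
    have := h.r_inj (by omega) (by omega) (by omega) h4 (M.α_inj h6)
    omega

theorem a_inj' (h : M.Comb N a r) (hN : 2 ≤ N) {i j : ℕ} (h1 : 1 ≤ i) (h2 : i ≤ N) (h3 : 1 ≤ j)
    (h4 : j ≤ N) (h5 : a i = a j) : i = j := by
  have key : ∀ i, 2 ≤ i → i ≤ N → a i ≠ a 1 := by
    intro i h1 h2
    obtain ⟨i, rfl⟩ := Nat.exists_eq_add_of_le' h1
    rw [← h.αr_one]
    exact h.a_ne_αr _ _ (by omega) (by omega) (by omega) (by omega)
  rcases Nat.lt_or_ge 1 i with h6 | h6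
  · rcases Nat.lt_or_ge 1 j with h7 | h7
    · obtain ⟨i, rfl⟩ := Nat.exists_eq_add_of_le' h6
      obtain ⟨j, rfl⟩ := Nat.exists_eq_add_of_le' h7
      have := h.a_inj (i + 1) (j + 1) (by omega) (by omega) (by omega) (by omega) h5
      omega
    · obtain rfl : j = 1 := by omega
      exact absurd h5 (key i h6 h2)
  · obtain rfl : i = 1 := by omega
    rcases Nat.lt_or_ge 1 j with h7 | h7
    · exact absurd h5.symm (key j h7 h4)
    · omega

theorem sd_of_pos {i : Fin (N + 1)} (hi : i ≠ 0) : sd N a r i = a i := by simp [sd, hi]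

theorem sd_zero : sd N a r 0 = r N := by simp [sd]

theorem sd_succ {i : Fin (N + 1)} (hi : (i : ℕ) < N) : sd N a r (i + 1) = a (i + 1) := by
  have h1 : ((i + 1 : Fin (N + 1)) : ℕ) = i + 1 := by
    rw [Fin.val_add_one, if_neg]
    rintro rfl
    simp at hi
  rw [sd_of_pos, h1]
  intro h2
  rw [h2] at h1
  simp at h1

theorem sd_last {i : Fin (N + 1)} (hi : (i : ℕ) = N) : sd N a r (i + 1) = r N := by
  have : i = Fin.last N := Fin.ext hi
  rw [this, Fin.last_add_one, sd_zero]

theorem val_pos {i : Fin (N + 1)} (hi : i ≠ 0) : 1 ≤ (i : ℕ) :=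
  Nat.one_le_iff_ne_zero.2 fun h => hi (Fin.ext h)

theorem sd_inj (h : M.Comb N a r) (hN : 2 ≤ N) : Function.Injective (sd N a r) := by
  intro i j hij
  by_cases hi : i = 0 <;> by_cases hj : j = 0
  · rw [hi, hj]
  · rw [hi, sd_zero, sd_of_pos hj] at hij
    exact absurd hij.symm (h.a_ne_r' (val_pos hj) (by omega) hN le_rfl)
  · rw [hj, sd_zero, sd_of_pos hi] at hij
    exact absurd hij (h.a_ne_r' (val_pos hi) (by omega) hN le_rfl)
  · rw [sd_of_pos hi, sd_of_pos hj] at hij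
    exact Fin.ext (h.a_inj' hN (val_pos hi) (by omega) (val_pos hj) (by omega) hij)

theorem sd_ne_r (h : M.Comb N a r) (i : Fin (N + 1)) {j : ℕ} (h1 : 2 ≤ j) (h2 : j < N) :
    sd N a r i ≠ r j := by
  by_cases hi : i = 0
  · rw [hi, sd_zero]
    intro h3
    have := h.r_inj' (by omega) le_rfl h1 h2.le h3
    omega
  · rw [sd_of_pos hi]
    exact h.a_ne_r' (val_pos hi) (by omega) h1 h2.le

theorem sd_ne_αr (h : M.Comb N a r) (i : Fin (N + 1)) {j : ℕ} (h1 : 2 ≤ j) (h2 : j < N) :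
    sd N a r i ≠ M.α (r j) := by
  by_cases hi : i = 0
  · rw [hi, sd_zero]
    exact h.r_ne_αr (by omega) le_rfl (by omega) h2
  · rw [sd_of_pos hi]
    exact h.a_ne_αr' (val_pos hi) (by omega) h1 h2

/-- Every dart is a side or belongs to a spoke. -/
theorem dart_cases (h : M.Comb N a r) (d : D) : (∃ i, d = sd N a r i) ∨
    ∃ j, 2 ≤ j ∧ j < N ∧ (d = r j ∨ d = M.α (r j)) := by
  have ha : ∀ i, 1 ≤ i → i ≤ N → ∃ k, a i = sd N a r k := fun i h1 h2 =>
    ⟨⟨i, by omega⟩, by rw [sd_of_pos fun h => by simp [Fin.ext_iff] at h; omega]⟩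
  obtain ⟨i, h1, h2, h3 | h3 | h3⟩ := h.exists_tri d
  · left; rw [h3]; exact ha _ (by omega) (by omega)
  · rcases Nat.lt_or_ge (i + 1) N with h4 | h4
    · exact Or.inr ⟨i + 1, by omega, h4, Or.inl h3⟩
    · left
      obtain rfl : N = i + 1 := by omega
      exact ⟨0, by rw [sd_zero, h3]⟩
  · rcases Nat.lt_or_ge 1 i with h4 | h4
    · exact Or.inr ⟨i, h4, h2, Or.inr h3⟩
    · left
      obtain rfl : i = 1 := by omega
      rw [h3, h.αr_one]; exact ha 1 le_rfl h2.le

/-- The two darts of an inner spoke are matched with each other, so only sides are left as partners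
of sides. -/
theorem exists_pair (h : M.Comb N a r) (i : Fin (N + 1)) :
    ∃ j, M.α (sd N a r i) = sd N a r j := by
  rcases h.dart_cases (M.α (sd N a r i)) with h1 | ⟨j, h1, h2, h3 | h3⟩
  · exact h1
  · exact absurd (by rw [← h3, M.αα]) (h.sd_ne_αr i h1 h2)
  · exact absurd (M.α_inj h3) (h.sd_ne_r i h1 h2)

/-- The matching of the sides of a fan. -/
noncomputable def pair (h : M.Comb N a r) (i : Fin (N + 1)) : Fin (N + 1) :=
  (h.exists_pair i).choose

theorem α_sd (h : M.Comb N a r) (i : Fin (N + 1)) : M.α (sd N a r i) = sd N a r (h.pair i) :=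
  (h.exists_pair i).choose_spec

theorem pair_eq (h : M.Comb N a r) (hN : 2 ≤ N) {i j : Fin (N + 1)}
    (hij : M.α (sd N a r i) = sd N a r j) : h.pair i = j :=
  h.sd_inj hN (by rw [← h.α_sd, hij])

theorem pair_pair (h : M.Comb N a r) (hN : 2 ≤ N) (i : Fin (N + 1)) : h.pair (h.pair i) = i :=
  h.pair_eq hN (by rw [← h.α_sd, M.αα])

/-- All the darts `α (r i)` start at the centre of the fan, and so does the side `a 1`. -/
theorem lab_αr (h : M.Comb N a r) {i : ℕ} (h1 : 1 ≤ i) (h2 : i ≤ N) :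
    M.lab (M.α (r i)) = M.lab (a 1) := by
  induction i, h1 using Nat.le_induction with
  | base => rw [h.αr_one]
  | succ i h1 ih =>
    rw [← ih (by omega), ← h.φ_r i h1 (by omega)]
    have := M.lab_ν (M.α (r (i + 1)))
    rw [M.αα] at this
    exact this.symm

theorem lab_r (h : M.Comb N a r) {i : ℕ} (h1 : 1 ≤ i) (h2 : i < N) :
    M.lab (r i) = M.lab (a (i + 1)) := by
  rw [← h.φ_αr h1 h2, M.lab_ν]

/-- The dart after a side starts at the corner where the next side starts. -/
theorem lab_φ_sd (h : M.Comb N a r) (hN : 2 ≤ N) (i : Fin (N + 1)) :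
    M.lab (M.φ (sd N a r i)) = M.lab (sd N a r (i + 1)) := by
  by_cases hi : i = 0
  · obtain ⟨m, rfl⟩ := Nat.exists_eq_add_of_le' hN
    rw [hi, sd_zero, h.φ_r _ (by omega) (by omega), h.lab_αr (by omega) (by omega),
      sd_succ (by simp)]
    simp
  · have h1 := val_pos hi
    rw [sd_of_pos hi]
    rcases Nat.lt_or_ge 1 (i : ℕ) with h2 | h2
    · obtain ⟨k, hk⟩ := Nat.exists_eq_add_of_le' h2
      rw [hk, h.φ_a _ (by omega) (by omega), ← hk]
      rcases Nat.lt_or_ge (i : ℕ) N with h3 | h3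
      · rw [sd_succ h3, h.lab_r h1 h3]
      · have h4 : (i : ℕ) = N := by omega
        rw [sd_last h4, h4]
    · have h4 : (i : ℕ) = 1 := by omega
      rw [sd_succ (by omega), h4, ← h.αr_one, h.φ_αr le_rfl (by omega)]

/-- The corner between the sides `i` and `i + 1` gets the index `i`. With this convention `i ↦ pair
(i + 1)` is the rotation of the corners around the vertices of the glued surface. -/
theorem lab_pair_succ (h : M.Comb N a r) (hN : 2 ≤ N) (i : Fin (N + 1)) :
    M.lab (sd N a r (h.pair (i + 1) + 1)) = M.lab (sd N a r (i + 1)) := by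
  rw [← h.lab_φ_sd hN, ← h.α_sd, M.lab_ν]

/-- Corners with the same label are related by going around the vertex. -/
theorem mem_of_lab_eq (h : M.Comb N a r) (hN : 2 ≤ N) (hM : M.Good) {Q : Set (Fin (N + 1))}
    (hQ : ∀ i ∈ Q, h.pair (i + 1) ∈ Q) {i j : Fin (N + 1)} (hi : i ∈ Q)
    (hl : M.lab (sd N a r (j + 1)) = M.lab (sd N a r (i + 1))) : j ∈ Q := by
  -- These are the darts starting at the corners in `Q`: the sides, the spokes that run to the
  -- centre and, if the centre (corner 0) belongs to `Q`, the spokes that leave it.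
  let S : Set D := {d | (∃ i ∈ Q, d = sd N a r (i + 1)) ∨
    (∃ i : Fin (N + 1), 2 ≤ (i : ℕ) ∧ (i : ℕ) < N ∧ i ∈ Q ∧ d = r i) ∨
    (∃ i, 2 ≤ i ∧ i < N ∧ 0 ∈ Q ∧ d = M.α (r i))}
  have hαr : ∀ i, 1 ≤ i → i < N → 0 ∈ Q → M.α (r i) ∈ S := by
    intro i h1 h2 h3
    rcases Nat.lt_or_ge 1 i with h4 | h4
    · exact Or.inr (Or.inr ⟨i, h4, h2, h3, rfl⟩)
    · obtain rfl : i = 1 := by omega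
      refine Or.inl ⟨0, h3, ?_⟩
      rw [sd_succ (by simp; omega), h.αr_one]
      simp
  have hsd : ∀ j ∈ Q, M.φ (sd N a r j) ∈ S := by
    intro i hi
    by_cases hi0 : i = 0
    · obtain ⟨m, rfl⟩ := Nat.exists_eq_add_of_le' hN
      rw [hi0, sd_zero, h.φ_r _ (by omega) (by omega)]
      exact hαr _ (by omega) (by omega) (hi0 ▸ hi)
    · have h1 := val_pos hi0
      rw [sd_of_pos hi0]
      rcases Nat.lt_or_ge 1 (i : ℕ) with h2 | h2
      · obtain ⟨k, hk⟩ := Nat.exists_eq_add_of_le' h2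
        rw [hk, h.φ_a _ (by omega) (by omega), ← hk]
        rcases Nat.lt_or_ge (i : ℕ) N with h3 | h3
        · exact Or.inr (Or.inl ⟨i, h2, h3, hi, rfl⟩)
        · have h4 : (i : ℕ) = N := by omega
          exact Or.inl ⟨i, hi, by rw [sd_last h4, h4]⟩
      · have h4 : (i : ℕ) = 1 := by omega
        refine Or.inl ⟨i, hi, ?_⟩
        rw [sd_succ (by omega), h4, ← h.αr_one, h.φ_αr le_rfl (by omega)]
  have hS : ∀ d ∈ S, M.ν d ∈ S := by
    rintro d (⟨i, hi, rfl⟩ | ⟨i, h1, h2, hi, rfl⟩ | ⟨i, h1, h2, h0, rfl⟩)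
    · rw [ν, h.α_sd]
      exact hsd _ (hQ i hi)
    · rw [ν, h.φ_αr (by omega) h2]
      exact Or.inl ⟨i, hi, by rw [sd_succ h2]⟩
    · rw [ν, M.αα]
      obtain ⟨k, rfl⟩ := Nat.exists_eq_add_of_le' h1
      rw [h.φ_r (k + 1) (by omega) (by omega)]
      exact hαr _ (by omega) (by omega) h0
  rcases hM.vconn S hS _ (Or.inl ⟨i, hi, rfl⟩) _ hl with
    ⟨k, hk, h1⟩ | ⟨k, h1, h2, _, h3⟩ | ⟨k, h1, h2, _, h3⟩
  · have := h.sd_inj hN h1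
    rw [add_left_inj] at this
    rwa [this]
  · exact absurd h3 (h.sd_ne_r _ h1 h2)
  · exact absurd h3 (h.sd_ne_αr _ h1 h2)

/-- The darts of a fan, triangle by triangle. -/
def dart (M : TriSurf V D) (N : ℕ) (a r : ℕ → D) (p : Fin (N - 1) × Fin 3) : D :=
  ![a (p.1 + 1 + 1), r (p.1 + 1 + 1), M.α (r (p.1 + 1))] p.2

theorem dart_bijective (h : M.Comb N a r) : Function.Bijective (dart M N a r) := by
  constructor
  · rintro ⟨i, k⟩ ⟨j, l⟩ hij
    have hi := i.2
    have hj := j.2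
    have e1 := h.a_inj (i + 1) (j + 1) (by omega) (by omega) (by omega) (by omega)
    have e2 : r (i + 1 + 1) = r (j + 1 + 1) → (i : ℕ) + 1 + 1 = j + 1 + 1 :=
      h.r_inj' (by omega) (by omega) (by omega) (by omega)
    have e3 : r (i + 1) = r (j + 1) → (i : ℕ) + 1 = j + 1 :=
      h.r_inj (by omega) (by omega) (by omega) (by omega)
    have f1 := h.a_ne_r (i + 1) (j + 1) (by omega) (by omega) (by omega) (by omega)
    have f2 := h.a_ne_αr (i + 1) (j + 1) (by omega) (by omega) (by omega) (by omega)
    have f3 := h.a_ne_r (j + 1) (i + 1) (by omega) (by omega) (by omega) (by omega)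
    have f4 := h.a_ne_αr (j + 1) (i + 1) (by omega) (by omega) (by omega) (by omega)
    have f5 : r (i + 1 + 1) ≠ M.α (r (j + 1)) :=
      h.r_ne_αr (by omega) (by omega) (by omega) (by omega)
    have f6 : r (j + 1 + 1) ≠ M.α (r (i + 1)) :=
      h.r_ne_αr (by omega) (by omega) (by omega) (by omega)
    have e4 : M.α (r (i + 1)) = M.α (r (j + 1)) → (i : ℕ) + 1 = j + 1 := fun h' => e3 (M.α_inj h')
    fin_cases k <;> fin_cases l <;> simp [dart] at hij
    · rw [Fin.ext (by have := e1 hij; omega : (i : ℕ) = j)]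
    · exact absurd hij f1
    · exact absurd hij f2
    · exact absurd hij.symm f3
    · rw [Fin.ext (by have := e2 hij; omega : (i : ℕ) = j)]
    · exact absurd hij f5
    · exact absurd hij.symm f4
    · exact absurd hij.symm f6
    · rw [Fin.ext (by have := e4 hij; omega : (i : ℕ) = j)]
  · intro d
    obtain ⟨i, h1, h2, h3⟩ := h.exists_tri d
    obtain ⟨i, rfl⟩ := Nat.exists_eq_add_of_le' h1
    have hi : i < N - 1 := by omega
    rcases h3 with rfl | rfl | rfl
    · exact ⟨(⟨i, hi⟩, 0), rfl⟩
    · exact ⟨(⟨i, hi⟩, 1), rfl⟩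
    · exact ⟨(⟨i, hi⟩, 2), rfl⟩

/-- A fan is determined by the matching of the sides and the labels of the corners. -/
theorem exists_iso {D' : Type} {M' : TriSurf V D'} {a' r' : ℕ → D'} (h : M.Comb N a r)
    (h' : M'.Comb N a' r') (hN : 2 ≤ N) (hp : ∀ i, h.pair i = h'.pair i)
    (hl : ∀ i, M'.lab (sd N a' r' i) = M.lab (sd N a r i)) :
    ∃ e, Iso M M' e ∧ e (r N) = r' N := by
  let e : D ≃ D' := (Equiv.ofBijective _ h.dart_bijective).symm.trans
    (Equiv.ofBijective _ h'.dart_bijective)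
  have he : ∀ p, e (dart M N a r p) = dart M' N a' r' p := fun p => by
    simp only [e, Equiv.trans_apply]
    rw [← Equiv.ofBijective_apply _ h.dart_bijective, Equiv.symm_apply_apply]
    rfl
  have ea : ∀ i, 1 ≤ i → i < N → e (a (i + 1)) = a' (i + 1) := fun i h1 h2 => by
    obtain ⟨i, rfl⟩ := Nat.exists_eq_add_of_le' h1
    exact he (⟨i, by omega⟩, 0)
  have er : ∀ i, 1 ≤ i → i < N → e (r (i + 1)) = r' (i + 1) := fun i h1 h2 => by
    obtain ⟨i, rfl⟩ := Nat.exists_eq_add_of_le' h1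
    exact he (⟨i, by omega⟩, 1)
  have eα : ∀ i, 1 ≤ i → i < N → e (M.α (r i)) = M'.α (r' i) := fun i h1 h2 => by
    obtain ⟨i, rfl⟩ := Nat.exists_eq_add_of_le' h1
    exact he (⟨i, by omega⟩, 2)
  have esd : ∀ i, e (sd N a r i) = sd N a' r' i := by
    intro i
    by_cases hi : i = 0
    · obtain ⟨m, rfl⟩ := Nat.exists_eq_add_of_le' hN
      rw [hi, sd_zero, sd_zero, er _ (by omega) (by omega)]
    · have h1 := val_pos hi
      rw [sd_of_pos hi, sd_of_pos hi]
      rcases Nat.lt_or_ge 1 (i : ℕ) with h2 | h2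
      · obtain ⟨k, hk⟩ := Nat.exists_eq_add_of_le' h2
        rw [hk, ea _ (by omega) (by omega)]
      · have h4 : (i : ℕ) = 1 := by omega
        rw [h4, ← h.αr_one, ← h'.αr_one, eα _ le_rfl (by omega)]
  refine ⟨e, ⟨fun d => ?_, fun d => ?_, fun d => ?_⟩, by have := esd 0; rwa [sd_zero, sd_zero] at this⟩
  · rcases h.dart_cases d with ⟨i, rfl⟩ | ⟨j, h1, h2, rfl | rfl⟩
    · rw [h.α_sd, esd, esd, h'.α_sd, hp]
    · obtain ⟨j, rfl⟩ := Nat.exists_eq_add_of_le' h1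
      rw [eα _ (by omega) h2, er _ (by omega) (by omega)]
    · obtain ⟨j, rfl⟩ := Nat.exists_eq_add_of_le' h1
      rw [M.αα, eα _ (by omega) h2, er _ (by omega) (by omega), M'.αα]
  · obtain ⟨i, h1, h2, rfl | rfl | rfl⟩ := h.exists_tri d
    · rw [h.φ_a i h1 h2, ea i h1 h2, er i h1 h2, h'.φ_a i h1 h2]
    · rw [h.φ_r i h1 h2, eα i h1 h2, er i h1 h2, h'.φ_r i h1 h2]
    · rw [h.φ_αr h1 h2, eα i h1 h2, ea i h1 h2, h'.φ_αr h1 h2]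
  · rcases h.dart_cases d with ⟨i, rfl⟩ | ⟨j, h1, h2, rfl | rfl⟩
    · rw [esd, hl]
    · obtain ⟨j, rfl⟩ := Nat.exists_eq_add_of_le' h1
      rw [er _ (by omega) (by omega), h.lab_r (by omega) h2, h'.lab_r (by omega) h2]
      have := hl ⟨j + 2 + 1, by omega⟩
      rwa [sd_of_pos (by simp [Fin.ext_iff]), sd_of_pos (by simp [Fin.ext_iff])] at this
    · rw [eα _ (by omega) h2, h.lab_αr (by omega) h2.le, h'.lab_αr (by omega) h2.le]
      have := hl ⟨1, by omega⟩
      rwa [sd_of_pos (by simp [Fin.ext_iff]), sd_of_pos (by simp [Fin.ext_iff])] at this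

end Comb

end TriSurf

end SimFlip

/-! ### Flipping almost all sides of a fan at once. -/

namespace SimFlip

/-- The involution `g`, made trivial on `F`. -/
def cut {P : Type} [DecidableEq P] (g : P → P) (F : Finset P) (i : P) : P := if i ∈ F then i else g i

namespace TriSurf

open BT

variable {V D : Type} {M : TriSurf V D}

/-- Every triangle has at most one corner whose label is not `z`. -/
def Dom (M : TriSurf V D) (z : V) : Prop :=
  ∀ d, M.lab d ≠ z → M.lab (M.φ d) = z ∧ M.lab (M.φ (M.φ d)) = z

namespace Comb

variable {N : ℕ} {a r : ℕ → D}

/-- All sides that are neither in `F` nor matched with the first side. -/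
def others (h : M.Comb N a r) (F : Finset (Fin (N + 1))) : Set D :=
  {d | ∃ i, i ∉ F ∧ i ≠ 1 ∧ h.pair i ≠ 1 ∧ d = sd N a r i}

variable {F : Finset (Fin (N + 1))}

theorem sd_mem_others (h : M.Comb N a r) (hN : 2 ≤ N) {i : Fin (N + 1)} :
    sd N a r i ∈ h.others F ↔ i ∉ F ∧ i ≠ 1 ∧ h.pair i ≠ 1 := by
  constructor
  · rintro ⟨j, h1, h2, h3, h4⟩
    rw [h.sd_inj hN h4]
    exact ⟨h1, h2, h3⟩
  · rintro ⟨h1, h2, h3⟩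
    exact ⟨i, h1, h2, h3, rfl⟩

theorem one_ne_zero' (hN : 2 ≤ N) : (1 : Fin (N + 1)) ≠ 0 := by
  obtain ⟨m, rfl⟩ := Nat.exists_eq_add_of_le' hN
  simp

theorem val_one' (hN : 2 ≤ N) : ((1 : Fin (N + 1)) : ℕ) = 1 := by
  obtain ⟨m, rfl⟩ := Nat.exists_eq_add_of_le' hN
  simp

theorem r_notMem_others (h : M.Comb N a r) (h0 : 0 ∈ F) {j : ℕ} (h1 : 2 ≤ j)
    (h2 : j ≤ N) : r j ∉ h.others F := by
  rintro ⟨i, k1, k2, k3, k4⟩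
  have hi : i ≠ 0 := fun h => k1 (h ▸ h0)
  rw [sd_of_pos hi] at k4
  exact h.a_ne_r' (val_pos hi) (by omega) h1 h2 k4.symm

theorem αr_notMem_others (h : M.Comb N a r) (hN : 2 ≤ N) (h0 : 0 ∈ F) {j : ℕ} (h1 : 1 ≤ j)
    (h2 : j < N) : M.α (r j) ∉ h.others F := by
  rintro ⟨i, k1, k2, k3, k4⟩
  have hi : i ≠ 0 := fun h => k1 (h ▸ h0)
  rcases Nat.lt_or_ge 1 j with h3 | h3
  · exact h.sd_ne_αr i h3 h2 k4.symm
  · obtain rfl : j = 1 := by omega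
    rw [h.αr_one, sd_of_pos hi] at k4
    have := h.a_inj' hN le_rfl (by omega) (val_pos hi) (by omega) k4
    exact k2 (Fin.ext (by rw [val_one' hN]; exact this.symm))

theorem val_ge_two (hN : 2 ≤ N) {i : Fin (N + 1)} (h0 : i ≠ 0) (h1 : i ≠ 1) : 2 ≤ (i : ℕ) := by
  have := val_pos h0
  rcases Nat.lt_or_ge 1 (i : ℕ) with h | h
  · exact h
  · exact absurd (Fin.ext (by rw [val_one' hN]; omega)) h1

/-- The sides in `F` are spared by the flip. Outside `F` there are no free sides, so everything
there has a partner to be flipped with. -/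
structure IsCut (h : M.Comb N a r) (F : Finset (Fin (N + 1))) : Prop where
  zero_mem : 0 ∈ F
  pair_mem : ∀ i ∈ F, h.pair i ∈ F
  pair_ne : ∀ i, i ∉ F → h.pair i ≠ i

/-- A triangle of the fan contains a single side of the polygon, except that the first one contains
`a 1` as well and the last one `r N`. The former is spared together with its partner, the latter
because `0 ∈ F`. -/
theorem flippable_others (h : M.Comb N a r) (hN : 2 ≤ N) (hF : h.IsCut F) :
    M.Flippable (h.others F) := by
  refine ⟨?_, ?_, ?_⟩
  · rintro d ⟨i, k1, k2, k3, rfl⟩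
    rw [h.α_sd, h.sd_mem_others hN, h.pair_pair hN]
    exact ⟨fun h' => k1 (by simpa [h.pair_pair hN] using hF.pair_mem _ h'), k3, k2⟩
  · rintro d ⟨i, k1, k2, k3, rfl⟩
    rw [h.α_sd]
    exact fun h' => hF.pair_ne i k1 (h.sd_inj hN h')
  · rintro d ⟨i, k1, k2, k3, rfl⟩
    have hi : i ≠ 0 := fun h => k1 (h ▸ hF.zero_mem)
    rw [sd_of_pos hi]
    obtain ⟨k, hk⟩ := Nat.exists_eq_add_of_le' (val_ge_two hN hi k2)
    rw [hk, h.φ_a _ (by omega) (by omega)]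
    exact h.r_notMem_others hF.zero_mem (by omega) (by omega)

theorem val_succ {i : Fin (N + 1)} (hi : (i : ℕ) < N) : ((i + 1 : Fin (N + 1)) : ℕ) = i + 1 := by
  rw [Fin.val_add_one, if_neg]
  rintro rfl
  simp at hi

/-- The triangles with a flipped side. -/
theorem flip_of_notMem (h : M.Comb N a r) (hN : 2 ≤ N) (hF : h.IsCut F) {i : Fin (N + 1)}
    (h0 : i ≠ 0) (hi : (i : ℕ) < N) (h1 : i + 1 ∉ F) (h2 : h.pair (i + 1) ≠ 1) :
    M.flipφ (h.others F) (sd N a r (i + 1)) = M.α (r i) ∧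
    M.flipφ (h.others F) (M.α (r i)) = r (h.pair (i + 1)) ∧
    M.flipφ (h.others F) (r (h.pair (i + 1))) = sd N a r (i + 1) ∧ 2 ≤ (h.pair (i + 1) : ℕ) := by
  have hX := h.flippable_others hN hF
  have hi1 : i + 1 ≠ 1 := by
    intro h'
    have := congrArg Fin.val h'
    rw [val_succ hi, val_one' hN] at this
    have := val_pos h0
    omega
  have hm : sd N a r (i + 1) ∈ h.others F := (h.sd_mem_others hN).2 ⟨h1, hi1, h2⟩
  have hp0 : h.pair (i + 1) ≠ 0 := fun h' => h1 (by
    have := hF.pair_mem _ hF.zero_mem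
    rw [← h', h.pair_pair hN] at this
    exact this)
  have hp := val_ge_two hN hp0 h2
  have e1 : M.φ (M.φ (sd N a r (i + 1))) = M.α (r i) := by
    rw [sd_succ hi, h.φ_a _ (val_pos h0) hi, h.φ_r _ (val_pos h0) hi]
  have e2 : M.φ (sd N a r (h.pair (i + 1))) = r (h.pair (i + 1)) := by
    rw [sd_of_pos hp0]
    obtain ⟨k, hk⟩ := Nat.exists_eq_add_of_le' hp
    rw [hk, h.φ_a _ (by omega) (by omega)]
  have e3 : M.flipφ (h.others F) (M.α (r i)) = r (h.pair (i + 1)) := by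
    rw [← e1, hX.flipφ_of_φ_mem (by rw [M.φφφ]; exact hm), M.φφφ, h.α_sd, e2]
  have e4 : M.flipφ (h.others F) (sd N a r (i + 1)) = M.α (r i) := by
    rw [flipφ_of_mem hm, e1]
  refine ⟨e4, e3, ?_, hp⟩
  rw [← e3, ← e4, hX.flipφ_flipφ_flipφ]

/-- The triangles without a flipped side. -/
theorem flip_of_mem (h : M.Comb N a r) (hN : 2 ≤ N) (hF : h.IsCut F) {i : Fin (N + 1)}
    (h0 : i ≠ 0) (hi : (i : ℕ) < N) (h1 : i + 1 ∈ F ∨ h.pair (i + 1) = 1) :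
    M.flipφ (h.others F) (sd N a r (i + 1)) = r (i + 1) ∧
    M.flipφ (h.others F) (r (i + 1)) = M.α (r i) ∧
    M.flipφ (h.others F) (M.α (r i)) = sd N a r (i + 1) := by
  have m1 : a (i + 1) ∉ h.others F := by
    rw [← sd_succ (a := a) (r := r) hi, h.sd_mem_others hN]
    rintro ⟨k1, k2, k3⟩
    rcases h1 with h1 | h1
    · exact k1 h1
    · exact k3 h1
  have m2 := h.r_notMem_others hF.zero_mem (j := i + 1) (by have := val_pos h0; omega) hi
  have m3 := h.αr_notMem_others hN hF.zero_mem (j := i) (val_pos h0) hi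
  have e1 := h.φ_a i (val_pos h0) hi
  have e2 := h.φ_r i (val_pos h0) hi
  have e3 := h.φ_αr (val_pos h0) hi
  rw [sd_succ hi]
  refine ⟨?_, ?_, ?_⟩
  · rw [flipφ_of_notMem m1 (by rwa [e1]) (by rwa [e1, e2]), e1]
  · rw [flipφ_of_notMem m2 (by rwa [e2]) (by rwa [e2, e3]), e2]
  · rw [flipφ_of_notMem m3 (by rwa [e3]) (by rwa [e3, e1]), e3]

/-- The new triangles are named by the darts `α (r i)`, one in each. If side `i + 1` is flipped, `r
(i + 1)` moves to the triangle of its partner. -/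
theorem exists_flip_tri (h : M.Comb N a r) (hN : 2 ≤ N) (hF : h.IsCut F) (d : D) :
    ∃ i : Fin (N + 1), i ≠ 0 ∧ (i : ℕ) < N ∧ (d = M.α (r i) ∨
      d = M.flipφ (h.others F) (M.α (r i)) ∨
      d = M.flipφ (h.others F) (M.flipφ (h.others F) (M.α (r i)))) := by
  have key : ∀ i : Fin (N + 1), i ≠ 0 → (i : ℕ) < N →
      sd N a r (i + 1) = M.flipφ (h.others F) (M.α (r i)) ∨
      sd N a r (i + 1) = M.flipφ (h.others F) (M.flipφ (h.others F) (M.α (r i))) := by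
    intro i h0 hi
    by_cases hc : i + 1 ∈ F ∨ h.pair (i + 1) = 1
    · exact Or.inl (h.flip_of_mem hN hF h0 hi hc).2.2.symm
    · rw [not_or] at hc
      obtain ⟨_, e2, e3, _⟩ := h.flip_of_notMem hN hF h0 hi hc.1 hc.2
      right; rw [e2, e3]
  obtain ⟨k, h1, h2, h3⟩ := h.exists_tri d
  have h0 : (⟨k, by omega⟩ : Fin (N + 1)) ≠ 0 := by simp [Fin.ext_iff]; omega
  rcases h3 with rfl | rfl | rfl
  · refine ⟨⟨k, by omega⟩, h0, h2, Or.inr ?_⟩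
    have := key ⟨k, by omega⟩ h0 h2
    rw [sd_succ (a := a) (r := r) (i := ⟨k, by omega⟩) h2] at this
    exact this
  · set i : Fin (N + 1) := ⟨k, by omega⟩ with hi
    have hk : (i : ℕ) = k := rfl
    by_cases hc : i + 1 ∈ F ∨ h.pair (i + 1) = 1
    · refine ⟨i, h0, h2, Or.inr (Or.inr ?_)⟩
      obtain ⟨e1, e2, e3⟩ := h.flip_of_mem hN hF h0 h2 hc
      rw [e3, e1]
    · rw [not_or] at hc
      set j := h.pair (i + 1) with hj
      have hj0 : j ≠ 0 := fun h' => hc.1 (by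
        have := hF.pair_mem _ hF.zero_mem
        rw [← h', hj, h.pair_pair hN] at this
        exact this)
      have hj2 := val_ge_two hN hj0 hc.2
      let i' : Fin (N + 1) := ⟨(j : ℕ) - 1, by omega⟩
      have hi' : (i' : ℕ) = j - 1 := rfl
      have hi'N : (i' : ℕ) < N := by omega
      have hi'0 : i' ≠ 0 := fun h' => by
        have := congrArg Fin.val h'
        simp only [hi', Fin.val_zero] at this
        omega
      have hi'1 : i' + 1 = j := Fin.ext (by rw [val_succ hi'N]; omega)
      have hpj : h.pair (i' + 1) = i + 1 := by rw [hi'1, hj, h.pair_pair hN]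
      have hv : ((i + 1 : Fin (N + 1)) : ℕ) = k + 1 := val_succ h2
      refine ⟨i', hi'0, hi'N, Or.inr (Or.inl ?_)⟩
      rw [(h.flip_of_notMem hN hF hi'0 hi'N ?_ ?_).2.1, hpj, hv]
      · rw [hi'1]
        exact fun h' => hc.1 (by simpa [hj, h.pair_pair hN] using hF.pair_mem _ h')
      · rw [hpj]
        intro h'
        have := congrArg Fin.val h'
        rw [hv, val_one' hN] at this
        omega
  · exact ⟨⟨k, by omega⟩, h0, h2, Or.inl rfl⟩

/-- After the flip, different triangles contain different spokes. -/
theorem flip_spoke_inj (h : M.Comb N a r) (hN : 2 ≤ N) (hF : h.IsCut F) {i j : Fin (N + 1)}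
    (hi0 : i ≠ 0) (hi : (i : ℕ) < N) (hj0 : j ≠ 0) (hj : (j : ℕ) < N)
    (hij : M.α (r i) = M.α (r j) ∨ M.α (r i) = M.flipφ (h.others F) (M.α (r j)) ∨
      M.α (r i) = M.flipφ (h.others F) (M.flipφ (h.others F) (M.α (r j)))) : i = j := by
  have f1 : M.α (r i) ≠ sd N a r (j + 1) := by
    rw [sd_succ hj]
    exact (h.a_ne_αr _ _ (val_pos hj0) hj (val_pos hi0) hi).symm
  have f2 : ∀ k, 2 ≤ k → k ≤ N → M.α (r i) ≠ r k := fun k h1 h2 =>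
    (h.r_ne_αr h1 h2 (val_pos hi0) hi).symm
  rcases hij with hij | hij
  · exact Fin.ext (h.r_inj (val_pos hi0) hi (val_pos hj0) hj (M.α_inj hij))
  · exfalso
    by_cases hc : j + 1 ∈ F ∨ h.pair (j + 1) = 1
    · obtain ⟨e1, e2, e3⟩ := h.flip_of_mem hN hF hj0 hj hc
      rw [e3, e1] at hij
      rcases hij with hij | hij
      · exact f1 hij
      · exact f2 _ (by have := val_pos hj0; omega) hj hij
    · rw [not_or] at hc
      obtain ⟨e1, e2, e3, e4⟩ := h.flip_of_notMem hN hF hj0 hj hc.1 hc.2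
      rw [e2, e3] at hij
      rcases hij with hij | hij
      · exact f2 _ e4 (by omega) hij
      · exact f1 hij

/-- After flipping all sides of a fan, almost all corners are at its centre. -/
theorem dom_flip (h : M.Comb N a r) (hN : 2 ≤ N) (hF : h.IsCut {0, h.pair 0}) :
    (M.flip _ (h.flippable_others hN hF)).Dom (M.lab (a 1)) := by
  set X := h.others {0, h.pair 0} with hX
  set M' := M.flip X (h.flippable_others hN hF) with hM'
  have hαr : ∀ j, 1 ≤ j → j ≤ N → M'.lab (M.α (r j)) = M.lab (a 1) := by
    intro j h1 h2
    rcases Nat.lt_or_ge j N with h3 | h3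
    · rw [hM', flip_lab _ (h.αr_notMem_others hN hF.zero_mem h1 h3), h.lab_αr h1 h2]
    · obtain rfl : j = N := by omega
      have hr := h.lab_αr h1 h2
      have h0 : M.α (r j) = sd j a r (h.pair 0) := by rw [← h.α_sd, sd_zero]
      rw [hM', flip_lab, hr]
      rw [h0, h.sd_mem_others hN]
      simp
  -- The dart `α (r i)` provides one corner at the centre. A second one comes from the flipped side,
  -- now a loop at the centre, or from a spared side that already ends there.
  have key : ∀ i : Fin (N + 1), i ≠ 0 → (i : ℕ) < N → M'.lab (M.α (r i)) = M.lab (a 1) ∧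
      (M'.lab (M'.φ (M.α (r i))) = M.lab (a 1) ∨ M'.lab (M'.φ (M'.φ (M.α (r i)))) = M.lab (a 1)) := by
    intro i h0 hi
    refine ⟨hαr i (val_pos h0) hi.le, ?_⟩
    have hφ : M'.φ = M.flipφ X := rfl
    by_cases hc : i + 1 ∈ ({0, h.pair 0} : Finset (Fin (N + 1))) ∨ h.pair (i + 1) = 1
    · obtain ⟨e1, e2, e3⟩ := h.flip_of_mem hN hF h0 hi hc
      rw [hφ, e3, e1]
      rcases hc with hc | hc
      · left
        rw [Finset.mem_insert, Finset.mem_singleton] at hc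
        rcases hc with hc | hc
        · have := congrArg Fin.val hc
          rw [val_succ hi] at this
          simp at this
        · rw [hc, ← h.α_sd, sd_zero]
          exact hαr N (by omega) le_rfl
      · right
        have h1 : M.α (a 1) = sd N a r (i + 1) := by
          rw [← h.pair_pair hN (i + 1), hc, ← h.α_sd, sd_of_pos (one_ne_zero' hN), val_one' hN]
        have h2 := M'.lab_ν (a 1)
        have h3 : M'.α = M.α := rfl
        rw [h3, h1, hφ, e1] at h2
        rw [h2, ← h.αr_one]
        exact (hαr 1 le_rfl (by omega)).trans (by rw [h.αr_one])
    · rw [not_or] at hc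
      obtain ⟨e1, e2, e3, e4⟩ := h.flip_of_notMem hN hF h0 hi hc.1 hc.2
      right
      rw [hφ, e2, ← hφ]
      have h2 := M'.lab_ν (M.α (r (h.pair (i + 1))))
      have h3 : M'.α = M.α := rfl
      rw [h3, M.αα] at h2
      rw [h2]
      exact hαr _ (by omega) (by omega)
  intro d hd
  obtain ⟨i, h0, hi, hc⟩ := h.exists_flip_tri hN hF d
  obtain ⟨k1, k2⟩ := key i h0 hi
  have hφ : M'.φ = M.flipφ X := rfl
  rw [← hX, ← hφ] at hc
  have := M'.φφφ (M.α (r i))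
  rcases hc with rfl | rfl | rfl
  · exact absurd k1 hd
  · rw [M'.φφφ]; tauto
  · rw [M'.φφφ]; tauto

end Comb

end TriSurf

end SimFlip

/-! ### The contour of an opened fan. -/

namespace SimFlip

namespace TriSurf

open BT

variable {V D : Type} {M : TriSurf V D}

theorem Hang.mem_dl_of_mem_leaves {e d : D} {l r : BT D} (h : M.Hang e (.node l r))
    (hd : d ∈ (BT.node l r).leaves) : d ∈ M.dl e (.node l r) := by
  simp only [leaves, List.mem_append] at hd
  simp only [dl, List.mem_cons, List.mem_append]
  rcases hd with hd | hd
  · rcases h.1.leaves_sub hd with h2 | h2 <;> simp [h2]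
  · rcases h.2.leaves_sub hd with h2 | h2 <;> simp [h2]

theorem dl_node_leaf_nodup {e x : D} {t : BT D} (h1 : (M.dl (M.φ (M.α e)) t).Nodup)
    (h2 : M.φ (M.α e) ∉ M.dl (M.φ (M.α e)) t) : (M.dl e (.node t (.leaf x))).Nodup := by
  have h3 : M.α e ∉ M.dl (M.φ (M.α e)) t := fun h => h2 (φ_mem_dl h)
  have h4 : M.φ (M.φ (M.α e)) ∉ M.dl (M.φ (M.α e)) t := fun h => h3 (by
    simpa [M.φφφ] using φ_mem_dl h)
  have e3 := M.φ_ne (M.α e)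
  have e4 := M.φ_ne (M.φ (M.α e))
  have e5 := M.φφ_ne (M.α e)
  simp [dl, h1, h2, h3, h4, e3.symm, e4.symm, e5.symm]

theorem dl_leaf_node_nodup {e x : D} {t : BT D} (h1 : (M.dl (M.φ (M.φ (M.α e))) t).Nodup)
    (h2 : M.φ (M.φ (M.α e)) ∉ M.dl (M.φ (M.φ (M.α e))) t) :
    (M.dl e (.node (.leaf x) t)).Nodup := by
  have h3 : M.φ (M.α e) ∉ M.dl (M.φ (M.φ (M.α e))) t := fun h => h2 (φ_mem_dl h)
  have h4 : M.α e ∉ M.dl (M.φ (M.φ (M.α e))) t := fun h => h3 (φ_mem_dl h)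
  have e3 := M.φ_ne (M.α e)
  have e4 := M.φ_ne (M.φ (M.α e))
  have e5 := M.φφ_ne (M.α e)
  simp [dl, h1, h2, h3, h4, e3.symm, e4.symm, e5.symm]

namespace Comb

variable {N : ℕ} {a r : ℕ → D} {F : Finset (Fin (N + 1))}

/-- Going around the contour of the fan after opening the sides in `F`. -/
noncomputable def turn (h : M.Comb N a r) (F : Finset (Fin (N + 1))) (i : Fin (N + 1)) :
    Fin (N + 1) := cut h.pair F (i + 1)

/-- After the flip, the triangle of `α (r i)` is adjacent to that of `α (r (turn i))` along a spoke.
The orbit of 0 under `turn` thus gives a strip of triangles, which are distinct by `flip_spoke_inj`,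
and its dual tree is a caterpillar. A side in `F` becomes a right leaf and any other outer side a
left leaf, so the opened sides form the final segment `f` of the leaves. -/
theorem exists_contour_aux (h : M.Comb N a r) (hN : 2 ≤ N) (hF : h.IsCut F) (n : ℕ)
    (hn : ∀ m ≤ n, ((h.turn F)^[m] 0 : ℕ) < N)
    (hinj : ∀ k ≤ n + 1, ∀ m ≤ n + 1, (h.turn F)^[k] 0 = (h.turn F)^[m] 0 → k = m) :
    ∃ (t : BT D) (l f : List D),
      (M.flip _ (h.flippable_others hN hF)).Hang (M.α (r ((h.turn F)^[n + 1] 0))) t ∧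
      ((M.flip _ (h.flippable_others hN hF)).dl (M.α (r ((h.turn F)^[n + 1] 0))) t).Nodup ∧
      (∀ m, 1 ≤ m → m ≤ n → M.α (r ((h.turn F)^[m] 0)) ∈
        (M.flip _ (h.flippable_others hN hF)).dl (M.α (r ((h.turn F)^[n + 1] 0))) t) ∧
      (∀ d ∈ (M.flip _ (h.flippable_others hN hF)).dl (M.α (r ((h.turn F)^[n + 1] 0))) t,
        ∃ m, 1 ≤ m ∧ m ≤ n ∧ (d = M.α (r ((h.turn F)^[m] 0)) ∨
          d = M.flipφ (h.others F) (M.α (r ((h.turn F)^[m] 0))) ∨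
          d = M.flipφ (h.others F) (M.flipφ (h.others F) (M.α (r ((h.turn F)^[m] 0)))))) ∧
      t.leaves = l ++ f ∧ f.Nodup ∧
      ∀ d, d ∈ f ↔ ∃ m ≤ n, (h.turn F)^[m] 0 + 1 ∈ F ∧ d = sd N a r ((h.turn F)^[m] 0 + 1) := by
  set M' := M.flip _ (h.flippable_others hN hF) with hM'
  have hφ' : M'.φ = M.flipφ (h.others F) := rfl
  have hα' : M'.α = M.α := rfl
  have hsd1 : sd N a r 1 = a 1 := by rw [sd_of_pos (one_ne_zero' hN), val_one' hN]
  induction n with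
  | zero =>
    have e0 : (h.turn F)^[0 + 1] 0 = cut h.pair F 1 := by simp [turn]
    have e0' : (h.turn F)^[0] 0 = 0 := rfl
    -- The strip is still empty; its only leaf belongs to `f` exactly if side 1 is opened.
    by_cases h1 : (1 : Fin (N + 1)) ∈ F
    · refine ⟨.leaf (a 1), [], [a 1], ?_, by simp [dl], fun m _ _ => by omega, by simp [dl],
        by simp [leaves], by simp, fun d => ?_⟩
      · rw [e0, cut, if_pos h1, val_one' hN, h.αr_one]; rfl
      · simp only [List.mem_singleton, Nat.le_zero, exists_eq_left, e0', zero_add, h1, true_and, hsd1]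
    · refine ⟨.leaf _, [_], [], rfl, by simp [dl], fun m _ _ => by omega, by simp [dl],
        by simp [leaves]; rfl, by simp, fun d => ?_⟩
      simp only [List.not_mem_nil, Nat.le_zero, exists_eq_left, e0', zero_add, h1, false_and]
  | succ n ih =>
    obtain ⟨t, l, f, g1, g2, g3, g4, g5, g6, g7⟩ := ih (fun m hm => hn m (by omega))
      (fun k hk m hm => hinj k (by omega) m (by omega))
    set i := (h.turn F)^[n + 1] 0 with hi
    have hiN : (i : ℕ) < N := hn (n + 1) le_rfl
    have hi0 : i ≠ 0 := fun h' => by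
      have := hinj (n + 1) (by omega) 0 (by omega) h'
      omega
    have hnext : (h.turn F)^[n + 1 + 1] 0 = cut h.pair F (i + 1) := by
      rw [Function.iterate_succ_apply', ← hi]; rfl
    have hnot : M.α (r i) ∉ M'.dl (M.α (r i)) t := by
      intro h'
      obtain ⟨m, h1, h2, h3⟩ := g4 _ h'
      have hm : ((h.turn F)^[m] 0) ≠ 0 := fun h' => by
        have := hinj m (by omega) 0 (by omega) h'
        omega
      have := hinj _ (by omega) m (by omega)
        (h.flip_spoke_inj hN hF hi0 hiN hm (hn m (by omega)) h3)
      omega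
    by_cases h1 : i + 1 ∈ F
    · obtain ⟨e1, e2, e3⟩ := h.flip_of_mem hN hF hi0 hiN (Or.inl h1)
      have hv := val_succ hiN
      have hc : cut h.pair F (i + 1) = i + 1 := by simp [cut, h1]
      have p1 : M'.φ (M'.α (M.α (r (i + 1)))) = M.α (r i) := by rw [hα', M.αα, hφ', e2]
      have p2 : M'.φ (M'.φ (M'.α (M.α (r (i + 1))))) = sd N a r (i + 1) := by rw [p1, hφ', e3]
      have hm : sd N a r (i + 1) ∉ f := by
        rw [g7]
        rintro ⟨m, h2, h3, h4⟩
        have := h.sd_inj hN h4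
        rw [add_left_inj] at this
        have := hinj _ (by omega) m (by omega) this
        omega
      rw [hnext, hc, hv]
      refine ⟨.node t (.leaf (sd N a r (i + 1))), l, f ++ [sd N a r (i + 1)], ?_, ?_, ?_, ?_,
        by simp [leaves, g5], ?_, ?_⟩
      · exact ⟨by rw [p1]; exact g1, p2⟩
      · exact dl_node_leaf_nodup (by rw [p1]; exact g2) (by rw [p1]; exact hnot)
      · intro m h2 h3
        simp only [dl, List.mem_cons, p1, List.append_nil]
        rcases Nat.lt_succ_iff_lt_or_eq.1 (Nat.lt_succ_of_le h3) with h4 | rfl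
        · exact Or.inr (Or.inr (Or.inr (g3 m h2 (by omega))))
        · exact Or.inr (Or.inl rfl)
      · intro d hd
        simp only [dl, List.mem_cons, p1, List.append_nil] at hd
        have hd' : M'.α (M.α (r (i + 1))) = M.flipφ (h.others F) (M.flipφ (h.others F)
          (M.α (r i))) := by rw [hα', M.αα, e3, e1]
        rcases hd with rfl | rfl | rfl | hd
        · exact ⟨n + 1, by omega, le_rfl, Or.inr (Or.inr (by rw [hd']))⟩
        · exact ⟨n + 1, by omega, le_rfl, Or.inl rfl⟩
        · exact ⟨n + 1, by omega, le_rfl, Or.inr (Or.inl rfl)⟩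
        · obtain ⟨m, h2, h3, h4⟩ := g4 d hd
          exact ⟨m, h2, by omega, h4⟩
      · rw [List.nodup_append]
        refine ⟨g6, by simp, ?_⟩
        rintro x hx y hy rfl
        rw [List.mem_singleton] at hy
        exact hm (hy ▸ hx)
      · intro d
        rw [List.mem_append, List.mem_singleton, g7]
        constructor
        · rintro (⟨m, h2, h3⟩ | rfl)
          · exact ⟨m, by omega, h3⟩
          · exact ⟨n + 1, le_rfl, h1, rfl⟩
        · rintro ⟨m, h2, h3, rfl⟩
          rcases Nat.lt_succ_iff_lt_or_eq.1 (Nat.lt_succ_of_le h2) with h4 | rfl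
          · exact Or.inl ⟨m, by omega, h3, rfl⟩
          · exact Or.inr rfl
    · have hf : ∀ d, d ∈ f ↔ ∃ m ≤ n + 1, (h.turn F)^[m] 0 + 1 ∈ F ∧
          d = sd N a r ((h.turn F)^[m] 0 + 1) := by
        intro d
        rw [g7]
        constructor
        · rintro ⟨m, h2, h3⟩
          exact ⟨m, by omega, h3⟩
        · rintro ⟨m, h2, h3, rfl⟩
          rcases Nat.lt_succ_iff_lt_or_eq.1 (Nat.lt_succ_of_le h2) with h4 | rfl
          · exact ⟨m, by omega, h3, rfl⟩
          · exact absurd h3 h1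
      have hc : cut h.pair F (i + 1) = h.pair (i + 1) := by simp [cut, h1]
      -- the new triangle, seen from its side `x`
      have main : ∀ x y, M'.φ (M'.α x) = y → M'.φ y = M.α (r i) →
          x = M.α (r (h.pair (i + 1))) → ∃ (t : BT D) (l f : List D),
          M'.Hang x t ∧ (M'.dl x t).Nodup ∧
          (∀ m, 1 ≤ m → m ≤ n + 1 → M.α (r ((h.turn F)^[m] 0)) ∈ M'.dl x t) ∧
          (∀ d ∈ M'.dl x t, ∃ m, 1 ≤ m ∧ m ≤ n + 1 ∧ (d = M.α (r ((h.turn F)^[m] 0)) ∨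
            d = M.flipφ (h.others F) (M.α (r ((h.turn F)^[m] 0))) ∨
            d = M.flipφ (h.others F) (M.flipφ (h.others F) (M.α (r ((h.turn F)^[m] 0)))))) ∧
          t.leaves = l ++ f ∧ f.Nodup ∧
          ∀ d, d ∈ f ↔ ∃ m ≤ n + 1, (h.turn F)^[m] 0 + 1 ∈ F ∧
            d = sd N a r ((h.turn F)^[m] 0 + 1) := by
        intro x y hy1 hy2 _
        have hx : M'.φ (M.α (r i)) = M'.α x := by rw [← hy2, ← hy1, M'.φφφ]
        refine ⟨.node (.leaf y) t, y :: l, f, ⟨hy1, by rw [hy1, hy2]; exact g1⟩, ?_, ?_, ?_,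
          by simp [leaves, g5], g6, hf⟩
        · exact dl_leaf_node_nodup (by rw [hy1, hy2]; exact g2) (by rw [hy1, hy2]; exact hnot)
        · intro m h2 h3
          simp only [dl, List.mem_cons, hy1, hy2, List.nil_append]
          rcases Nat.lt_succ_iff_lt_or_eq.1 (Nat.lt_succ_of_le h3) with h4 | rfl
          · exact Or.inr (Or.inr (Or.inr (g3 m h2 (by omega))))
          · exact Or.inr (Or.inr (Or.inl rfl))
        · intro d hd
          simp only [dl, List.mem_cons, hy1, hy2, List.nil_append] at hd
          rcases hd with rfl | rfl | rfl | hd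
          · exact ⟨n + 1, by omega, le_rfl, Or.inr (Or.inl hx.symm)⟩
          · exact ⟨n + 1, by omega, le_rfl, Or.inr (Or.inr (by
              rw [← hφ', ← hi, hx, hy1]))⟩
          · exact ⟨n + 1, by omega, le_rfl, Or.inl rfl⟩
          · obtain ⟨m, h2, h3, h4⟩ := g4 d hd
            exact ⟨m, h2, by omega, h4⟩
      rw [hnext, hc]
      by_cases h2 : h.pair (i + 1) = 1
      · obtain ⟨e1, e2, e3⟩ := h.flip_of_mem hN hF hi0 hiN (Or.inr h2)
        refine main _ (r (i + 1)) ?_ (by rw [hφ', e2]) rfl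
        rw [h2, val_one' hN, h.αr_one, ← hsd1, hα', h.α_sd, ← h2, h.pair_pair hN, hφ', e1]
      · obtain ⟨e1, e2, e3, e4⟩ := h.flip_of_notMem hN hF hi0 hiN h1 h2
        exact main _ (sd N a r (i + 1)) (by rw [hα', M.αα, hφ', e3]) (by rw [hφ', e1]) rfl

/-- If the contour of the opened fan is connected, the flipped fan has a dual tree behind
`M.α (r N)` with all opened sides at the end. -/
theorem exists_contour (h : M.Comb N a r) (hN : 2 ≤ N) (hF : h.IsCut F)
    (horb : ∀ i ∈ F, ∃ n, (h.turn F)^[n] 0 = i) (hN' : ∃ n, (h.turn F)^[n] 0 = Fin.last N)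
    (hF2 : ∃ i ∈ F, i ≠ 0) :
    ∃ (t : BT D) (l f : List D), (M.flip _ (h.flippable_others hN hF)).Hang (M.α (r N)) t ∧
      ((M.flip _ (h.flippable_others hN hF)).dl (M.α (r N)) t).Nodup ∧
      r N ∈ (M.flip _ (h.flippable_others hN hF)).dl (M.α (r N)) t ∧
      t.leaves = l ++ f ∧ f.Nodup ∧ (∀ d, d ∈ f ↔ ∃ i ∈ F, i ≠ 0 ∧ d = sd N a r i) ∧
      ∀ d ∈ f, d ∈ (M.flip _ (h.flippable_others hN hF)).dl (M.α (r N)) t := by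
  classical
  -- The orbit runs from 0 to `Fin.last N` in `T` steps and then returns to 0, as `0 ∈ F`. So the
  -- points up to time `T` are the whole orbit and include all of `F`.
  set T := Nat.find hN' with hT
  have hT1 : (h.turn F)^[T] 0 = Fin.last N := Nat.find_spec hN'
  have hT2 : ∀ m < T, (h.turn F)^[m] 0 ≠ Fin.last N := fun m hm => Nat.find_min hN' hm
  have hlt : ∀ m < T, ((h.turn F)^[m] 0 : ℕ) < N := fun m hm => by
    have h1 := hT2 m hm
    have h2 := ((h.turn F)^[m] 0).2
    rcases Nat.lt_or_ge ((h.turn F)^[m] 0 : ℕ) N with h3 | h3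
    · exact h3
    · exact absurd (Fin.ext (by simp; omega)) h1
  have hinj' : ∀ k m, k < m → m ≤ T → (h.turn F)^[k] 0 ≠ (h.turn F)^[m] 0 := by
    intro k m hkm hm heq
    refine hT2 (T - m + k) (by omega) ?_
    rw [Function.iterate_add_apply, heq, ← Function.iterate_add_apply, Nat.sub_add_cancel hm, hT1]
  have hinj : ∀ k ≤ T, ∀ m ≤ T, (h.turn F)^[k] 0 = (h.turn F)^[m] 0 → k = m := by
    intro k hk m hm heq
    rcases lt_trichotomy k m with h1 | h1 | h1
    · exact absurd heq (hinj' k m h1 hm)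
    · exact h1
    · exact absurd heq.symm (hinj' m k h1 hk)
  have hT0 : T ≠ 0 := by
    intro h0
    rw [h0] at hT1
    have := congrArg Fin.val hT1
    simp at this
    omega
  have hnext : (h.turn F)^[T + 1] 0 = 0 := by
    rw [Function.iterate_succ_apply', hT1, turn, Fin.last_add_one, cut, if_pos hF.zero_mem]
  have hall : ∀ n, ∃ m ≤ T, (h.turn F)^[n] 0 = (h.turn F)^[m] 0 := by
    intro n
    induction n with
    | zero => exact ⟨0, by omega, rfl⟩
    | succ n ih =>
      obtain ⟨m, h1, h2⟩ := ih
      rw [Function.iterate_succ_apply', h2, ← Function.iterate_succ_apply' (h.turn F)]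
      rcases Nat.lt_or_ge m T with h3 | h3
      · exact ⟨m + 1, h3, rfl⟩
      · obtain rfl : m = T := by omega
        exact ⟨0, by omega, hnext⟩
  obtain ⟨n, hn⟩ := Nat.exists_eq_succ_of_ne_zero hT0
  obtain ⟨t, l, f, g1, g2, g3, g4, g5, g6, g7⟩ := h.exists_contour_aux hN hF n
    (fun m hm => hlt m (by omega)) (fun k hk m hm => hinj k (by omega) m (by omega))
  have hlast : (((h.turn F)^[n + 1] 0 : Fin (N + 1)) : ℕ) = N := by
    have h1 := congrArg Fin.val hT1
    rw [hn] at h1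
    exact h1
  rw [hlast] at g1 g2 g3 g4
  have hmem : ∀ d, d ∈ f ↔ ∃ i ∈ F, i ≠ 0 ∧ d = sd N a r i := by
    intro d
    rw [g7]
    constructor
    · rintro ⟨m, h1, h2, rfl⟩
      refine ⟨_, h2, ?_, rfl⟩
      intro h3
      have := congrArg Fin.val h3
      rw [val_succ (hlt m (by omega))] at this
      simp at this
    · rintro ⟨i, h1, h2, rfl⟩
      obtain ⟨k, hk⟩ := horb i h1
      obtain ⟨m, h3, h4⟩ := hall k
      rw [hk] at h4
      rcases m with _ | m
      · exact absurd h4 h2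
      · rw [Function.iterate_succ_apply', turn, cut] at h4
        split_ifs at h4 with h5
        · exact ⟨m, by omega, h5, by rw [← h4]⟩
        · exfalso
          have := hF.pair_mem i h1
          rw [h4, h.pair_pair hN] at this
          exact h5 this
  have hnode : ∃ u v, t = .node u v := by
    rcases t with x | ⟨u, v⟩
    · exfalso
      rcases Nat.eq_zero_or_pos n with rfl | hpos
      · obtain ⟨i, hi, hi0⟩ := hF2
        have := (hmem _).2 ⟨i, hi, hi0, rfl⟩
        rw [g7] at this
        obtain ⟨m, h1, h2, h3⟩ := this
        obtain rfl : m = 0 := by omega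
        have e1 : (h.turn F)^[0] 0 = 0 := rfl
        rw [e1, zero_add] at h2
        have : (h.turn F)^[0 + 1] 0 = 1 := by
          simp [turn, cut, h2]
        rw [this, val_one' hN] at hlast
        omega
      · have := g3 1 le_rfl hpos
        simp [dl] at this
    · exact ⟨u, v, rfl⟩
  obtain ⟨u, v, rfl⟩ := hnode
  refine ⟨_, l, f, g1, g2, ?_, g5, g6, hmem, fun d hd => g1.mem_dl_of_mem_leaves (by
    rw [g5]; simp [hd])⟩
  simp [dl, M.αα]

end Comb

end TriSurf

end SimFlip

/-! ### Stars of the vertices when one label dominates. -/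

namespace SimFlip

namespace TriSurf

open BT

variable {V D : Type} {M : TriSurf V D}

/-- The previous dart with the same initial vertex. -/
def prev (M : TriSurf V D) (y : D) : D := M.α (M.φ (M.φ y))

theorem ν_prev (M : TriSurf V D) (y : D) : M.ν (M.prev y) = y := by
  rw [ν, prev, M.αα, M.φφφ]

theorem prev_inj (M : TriSurf V D) : Function.Injective M.prev :=
  Function.LeftInverse.injective M.ν_prev

theorem lab_prev (M : TriSurf V D) (y : D) : M.lab (M.prev y) = M.lab y := by
  rw [← lab_ν', ν_prev]

/-- The tree of the triangles met by going around a vertex. -/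
def chain (M : TriSurf V D) : ℕ → D → BT D
  | 0, y => .leaf (M.φ (M.φ y))
  | m + 1, y => .node (.leaf (M.φ (M.prev y))) (chain M m (M.prev y))

theorem hang_chain (M : TriSurf V D) : ∀ m y, M.Hang (M.φ (M.φ y)) (M.chain m y)
  | 0, _ => rfl
  | m + 1, y => ⟨rfl, hang_chain M m (M.prev y)⟩

theorem leaves_chain (M : TriSurf V D) {z : V} (hD : M.Dom z) : ∀ m y, M.lab y ≠ z →
    ∃ l, (M.chain m y).leaves = l ++ [M.φ (M.φ (M.prev^[m] y))] ∧
      ∀ x ∈ (M.chain m y).leaves, M.lab x = z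
  | 0, y, hy => ⟨[], rfl, by simpa [chain, leaves] using (hD y hy).2⟩
  | m + 1, y, hy => by
    obtain ⟨l, h1, h2⟩ := leaves_chain M hD m (M.prev y) (by rwa [lab_prev])
    refine ⟨M.φ (M.prev y) :: l, by simp [chain, leaves, h1], ?_⟩
    simp only [chain, leaves, List.mem_append, List.mem_singleton]
    rintro x (rfl | hx)
    · exact (hD _ (by rwa [lab_prev])).1
    · exact h2 x hx

/-- The darts of the triangle of `y` and of the triangles met by going around its vertex. -/
def chainDarts (M : TriSurf V D) (m : ℕ) (y : D) : List D :=
  y :: M.φ y :: M.φ (M.φ y) :: M.dl (M.φ (M.φ y)) (M.chain m y)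

theorem chainDarts_succ (M : TriSurf V D) (m : ℕ) (y : D) :
    M.chainDarts (m + 1) y = y :: M.φ y :: M.φ (M.φ y) :: M.chainDarts m (M.prev y) := rfl

theorem mem_chainDarts {x : D} : ∀ {m : ℕ} {y : D}, x ∈ M.chainDarts m y ↔
    ∃ j ≤ m, x = M.prev^[j] y ∨ x = M.φ (M.prev^[j] y) ∨ x = M.φ (M.φ (M.prev^[j] y))
  | 0, y => by simp [chainDarts, dl, chain]
  | m + 1, y => by
    rw [chainDarts_succ]
    simp only [List.mem_cons, mem_chainDarts (m := m)]
    constructor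
    · rintro (h | h | h | ⟨j, hj, h⟩)
      · exact ⟨0, by omega, Or.inl h⟩
      · exact ⟨0, by omega, Or.inr (Or.inl h)⟩
      · exact ⟨0, by omega, Or.inr (Or.inr h)⟩
      · exact ⟨j + 1, by omega, h⟩
    · rintro ⟨j, hj, h⟩
      rcases j with _ | j
      · simp only [Function.iterate_zero, id] at h
        tauto
      · exact Or.inr (Or.inr (Or.inr ⟨j, by omega, h⟩))

theorem φ_mem_chainDarts {m : ℕ} {x y : D} (h : x ∈ M.chainDarts m y) :
    M.φ x ∈ M.chainDarts m y := by
  rw [mem_chainDarts] at h ⊢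
  obtain ⟨j, hj, rfl | rfl | rfl⟩ := h
  · exact ⟨j, hj, by simp⟩
  · exact ⟨j, hj, by simp⟩
  · exact ⟨j, hj, by simp [M.φφφ]⟩

theorem lab_iterate_prev (M : TriSurf V D) (y : D) (j : ℕ) : M.lab (M.prev^[j] y) = M.lab y := by
  induction j with
  | zero => rfl
  | succ j ih => rw [Function.iterate_succ_apply', lab_prev, ih]

/-- By `Dom`, a triangle has only one corner that is not labelled `z`, so different darts at such a
vertex lie in different triangles. -/
theorem chainDarts_nodup {z : V} (hD : M.Dom z) : ∀ {m : ℕ} {y : D}, M.lab y ≠ z →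
    (∀ j, 1 ≤ j → j ≤ m → M.prev^[j] y ≠ y) → (M.chainDarts m y).Nodup
  | 0, y, _, _ => by
    have e3 := M.φ_ne y
    have e4 := M.φ_ne (M.φ y)
    have e5 := M.φφ_ne y
    simp [chainDarts, chain, dl, e3.symm, e4.symm, e5.symm]
  | m + 1, y, hy, h => by
    have e3 := M.φ_ne y
    have e4 := M.φ_ne (M.φ y)
    have e5 := M.φφ_ne y
    have ih := chainDarts_nodup hD (m := m) (y := M.prev y) (by rwa [lab_prev])
      (fun j h1 h2 h3 => h j h1 (by omega) (M.prev_inj (by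
        rw [← Function.iterate_succ_apply' M.prev, Function.iterate_succ_apply, h3])))
    have h0 : y ∉ M.chainDarts m (M.prev y) := by
      rw [mem_chainDarts]
      rintro ⟨j, hj, h1 | h1 | h1⟩
      · exact h (j + 1) (by omega) (by omega) h1.symm
      · have := (hD (M.prev^[j] (M.prev y)) (by rwa [lab_iterate_prev, lab_prev])).1
        rw [← h1] at this
        exact hy this
      · have := (hD (M.prev^[j] (M.prev y)) (by rwa [lab_iterate_prev, lab_prev])).2
        rw [← h1] at this
        exact hy this
    have h2 : M.φ (M.φ y) ∉ M.chainDarts m (M.prev y) := fun h' => h0 (by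
      simpa [M.φφφ] using φ_mem_chainDarts h')
    have h1 : M.φ y ∉ M.chainDarts m (M.prev y) := fun h' => h2 (φ_mem_chainDarts h')
    rw [chainDarts_succ]
    simp [ih, h0, h1, h2, e3.symm, e4.symm, e5.symm]

/-- The star of a vertex with all corners of its triangles, except the one at the vertex, labelled
`z`. -/
theorem exists_star [Finite D] (hM : M.Good) {z : V} (hD : M.Dom z) {y : D} (hy : M.lab y ≠ z) :
    ∃ m, (M.chainDarts m y).Nodup ∧
      (∀ x, M.lab x = M.lab y → x ∈ M.chainDarts m y) ∧
      (∀ x ∈ M.chainDarts m y, M.lab x = z ∨ M.lab x = M.lab y) ∧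
      (∀ x ∈ (M.chain m y).leaves, M.lab x = z) ∧
      (∃ l, (M.chain m y).leaves = l ++ [M.α y]) := by
  have hper : y ∈ Function.periodicPts M.prev := M.prev_inj.mem_periodicPts y
  set k := Function.minimalPeriod M.prev y with hk
  have hkpos : 0 < k := Function.minimalPeriod_pos_of_mem_periodicPts hper
  obtain ⟨m, hm⟩ := Nat.exists_eq_succ_of_ne_zero hkpos.ne'
  have hkk : M.prev^[k] y = y := Function.iterate_minimalPeriod
  obtain ⟨l, l1, l2⟩ := M.leaves_chain hD m y hy
  refine ⟨m, chainDarts_nodup hD hy fun j h1 h2 h3 => ?_, fun x hx => ?_, fun x hx => ?_, l2, l, ?_⟩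
  · exact absurd h3 (Function.not_isPeriodicPt_of_pos_of_lt_minimalPeriod (by omega) (by omega))
  · have := hM.vconn {d | ∃ j, d = M.prev^[j] y} ?_ y ⟨0, rfl⟩ x hx
    · obtain ⟨j, rfl⟩ := this
      rw [mem_chainDarts]
      refine ⟨j % k, by have := Nat.mod_lt j hkpos; omega, Or.inl ?_⟩
      rw [Function.iterate_mod_minimalPeriod_eq]
    · rintro _ ⟨j, rfl⟩
      rcases j with _ | j
      · refine ⟨m, ?_⟩
        apply M.prev_inj
        rw [← Function.iterate_succ_apply' M.prev, ← hm, hkk]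
        apply M.ν_inj
        rw [ν_prev]; rfl
      · exact ⟨j, by rw [Function.iterate_succ_apply', ν_prev]⟩
  · rw [mem_chainDarts] at hx
    obtain ⟨j, _, h⟩ := hx
    have hj := hD (M.prev^[j] y) (by rwa [lab_iterate_prev])
    rcases h with rfl | rfl | rfl
    · right; exact lab_iterate_prev _ _ _
    · exact Or.inl hj.1
    · exact Or.inl hj.2
  · rw [l1, ← M.αα (M.φ (M.φ (M.prev^[m] y)))]
    have : M.α (M.φ (M.φ (M.prev^[m] y))) = y := by
      change M.prev (M.prev^[m] y) = y
      rw [← Function.iterate_succ_apply' M.prev, ← hm, hkk]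
    rw [this]

open Classical in
/-- How often the label `b` occurs. -/
noncomputable def occ (M : TriSurf V D) (b : V) (l : List D) : ℕ := (l.map M.lab).count b

theorem occ_append (b : V) (l l' : List D) : M.occ b (l ++ l') = M.occ b l + M.occ b l' := by
  simp [occ]

theorem occ_cons_of_ne {b : V} {d : D} (h : M.lab d ≠ b) (l : List D) :
    M.occ b (d :: l) = M.occ b l := by
  simp [occ, h]

theorem occ_cons_of_eq {b : V} {d : D} (h : M.lab d = b) (l : List D) :
    M.occ b (d :: l) = M.occ b l + 1 := by
  simp [occ, h]

theorem occ_nil (b : V) : M.occ b [] = 0 := rfl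

theorem occ_eq_zero {b : V} {l : List D} : M.occ b l = 0 ↔ ∀ d ∈ l, M.lab d ≠ b := by
  simp [occ, List.count_eq_zero]

/-- Each star is either met completely, once on the boundary, or not at all. -/
structure Starred (M : TriSurf V D) (z : V) (e : D) (t : BT D) : Prop where
  hang : M.Hang e t
  nodup : (M.dl e t).Nodup
  star : ∀ b, b ≠ z → ((∀ x, M.lab x = b → x ∈ M.dl e t) ∧ M.occ b (M.α e :: t.leaves) = 1) ∨
    ((∀ x ∈ M.dl e t, M.lab x ≠ b) ∧ M.occ b (M.α e :: t.leaves) = 0)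

/-- The side `e` can be reached from behind. -/
def Returns (M : TriSurf V D) (e : D) : Prop :=
  ∀ S : Set D, M.α e ∈ S → (∀ d ∈ S, M.φ d ∈ S) → (∀ d ∈ S, d ≠ M.α e → M.α d ∈ S) → e ∈ S

/-- A side leading out has both ends labelled `z`, because the other stars are met completely or not
at all. If the new triangle has its third corner at `z`, too, it is added alone. Otherwise the whole
star of that corner is added, cut open along the edge `y`; its boundary shows the new label only
once, at the start of `y`. -/
theorem Starred.extend [Finite D] (hM : M.Good) {z : V} (hD : M.Dom z) {e d : D} {t : BT D}
    (h : M.Starred z e t) (hd : d ∈ t.leaves) (hαd : M.α d ∉ M.dl e t) :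
    ∃ t', M.Starred z e t' ∧ (M.dl e t).length < (M.dl e t').length := by
  obtain ⟨l₁, l₂, hl⟩ := List.append_of_mem hd
  have hlab : M.lab d = z := by
    by_contra hb
    rcases h.star _ hb with ⟨h1, _⟩ | ⟨_, h2⟩
    · have h3 := φ_mem_dl (φ_mem_dl (h1 (M.φ (M.α d)) (M.lab_ν d)))
      rw [M.φφφ] at h3
      exact hαd h3
    · rw [occ_eq_zero] at h2
      exact h2 d (by simp [hd]) rfl
  have hlab2 : M.lab (M.α d) = z := by
    by_contra hb
    rcases h.star _ hb with ⟨h1, _⟩ | ⟨h1, h2⟩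
    · exact hαd (h1 _ rfl)
    · rcases h.hang.leaves_sub hd with rfl | h3
      · rw [occ_eq_zero] at h2
        exact h2 _ (by simp) rfl
      · refine h1 _ (φ_mem_dl h3) ?_
        have := M.lab_ν (M.α d)
        rwa [M.αα] at this
  have hlab3 : M.lab (M.φ (M.α d)) = z := by rw [M.lab_ν, hlab]
  -- putting the tree `s` behind `d`
  have main : ∀ s : BT D, M.Hang d s → (M.dl d s).Nodup → (∀ x ∈ M.dl d s, x ∉ M.dl e t) →
      M.dl d s ≠ [] →
      (∀ b, b ≠ z → ((∀ x, M.lab x = b → x ∈ M.dl d s) ∧ M.occ b s.leaves = 1) ∨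
        ((∀ x ∈ M.dl d s, M.lab x ≠ b) ∧ M.occ b s.leaves = 0)) →
      ∃ t', M.Starred z e t' ∧ (M.dl e t).length < (M.dl e t').length := by
    intro s hs hn hdis hne hstar
    obtain ⟨t', g1, g2, g3⟩ := hs.graft h.hang hl
    have hmem : ∀ x, x ∈ M.dl e t' ↔ x ∈ M.dl e t ∨ x ∈ M.dl d s := fun x => by
      rw [g3.mem_iff, List.mem_append]
    refine ⟨t', ⟨g1, ?_, fun b hb => ?_⟩, ?_⟩
    · rw [g3.nodup_iff, List.nodup_append]
      exact ⟨h.nodup, hn, fun x hx y hy hxy => hdis y hy (hxy ▸ hx)⟩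
    · have hocc : M.occ b (M.α e :: t'.leaves) =
          M.occ b (M.α e :: t.leaves) + M.occ b s.leaves := by
        rw [g2, hl, ← List.cons_append, ← List.cons_append, ← List.cons_append, occ_append,
          occ_append, occ_append, occ_cons_of_ne (d := d) (by rw [hlab]; exact hb.symm)]
        omega
      rw [hocc]
      rcases h.star b hb with ⟨h1, h2⟩ | ⟨h1, h2⟩
      · left
        refine ⟨fun x hx => (hmem x).2 (Or.inl (h1 x hx)), ?_⟩
        rcases hstar b hb with ⟨h3, h4⟩ | ⟨_, h4⟩
        · exfalso
          have : M.occ b s.leaves ≠ 0 := by omega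
          rw [Ne, occ_eq_zero] at this
          push Not at this
          obtain ⟨x, _, hx⟩ := this
          exact hdis x (h3 x hx) (h1 x hx)
        · omega
      · rcases hstar b hb with ⟨h3, h4⟩ | ⟨h3, h4⟩
        · left
          exact ⟨fun x hx => (hmem x).2 (Or.inr (h3 x hx)), by omega⟩
        · right
          refine ⟨fun x hx => ?_, by omega⟩
          rcases (hmem x).1 hx with hx | hx
          · exact h1 x hx
          · exact h3 x hx
    · rw [g3.length_eq, List.length_append]
      have := List.length_pos_iff.2 hne
      omega
  have d1 : M.φ (M.α d) ∉ M.dl e t := fun h' => hαd (by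
    simpa [M.φφφ] using φ_mem_dl (φ_mem_dl h'))
  have d2 : M.φ (M.φ (M.α d)) ∉ M.dl e t := fun h' => hαd (by simpa [M.φφφ] using φ_mem_dl h')
  have e3 := M.φ_ne (M.α d)
  have e4 := M.φ_ne (M.φ (M.α d))
  have e5 := M.φφ_ne (M.α d)
  by_cases hlab4 : M.lab (M.φ (M.φ (M.α d))) = z
  · refine main (.node (.leaf (M.φ (M.α d))) (.leaf (M.φ (M.φ (M.α d))))) ⟨rfl, rfl⟩ ?_ ?_ ?_ ?_
    · simp [dl, e3.symm, e4.symm, e5.symm]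
    · simp [dl, hαd, d1, d2]
    · simp [dl]
    · intro b hb
      right
      constructor
      · simp [dl, hlab2, hlab3, hlab4, hb.symm]
      · rw [occ_eq_zero]
        simp [leaves, hlab3, hlab4, hb.symm]
  · set y := M.φ (M.φ (M.α d)) with hy
    have hy1 : M.φ y = M.α d := M.φφφ _
    obtain ⟨m, g1, g2, g3, g4, l, g5⟩ := exists_star hM hD hlab4
    have hperm : (M.dl d (.node (M.chain m y) (.leaf y))).Perm (M.chainDarts m y) := by
      simp only [dl, List.append_nil, chainDarts, hy1, ← hy]
      exact ((List.Perm.swap _ _ _).trans ((List.Perm.swap _ _ _).cons _)).symm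
    have hbabs : ∀ x ∈ M.dl e t, M.lab x ≠ M.lab y := by
      rcases h.star _ hlab4 with ⟨h1, _⟩ | ⟨h1, _⟩
      · exact absurd (h1 y rfl) d2
      · exact h1
    refine main (.node (M.chain m y) (.leaf y)) ⟨?_, rfl⟩ ?_ ?_ ?_ ?_
    · rw [← hy1]; exact M.hang_chain m y
    · exact hperm.nodup_iff.2 g1
    · intro x hx hx'
      rw [hperm.mem_iff, mem_chainDarts] at hx
      obtain ⟨j, _, hj⟩ := hx
      have hc : M.prev^[j] y ∈ M.dl e t := by
        rcases hj with rfl | rfl | rfl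
        · exact hx'
        · simpa [M.φφφ] using φ_mem_dl (φ_mem_dl hx')
        · simpa [M.φφφ] using φ_mem_dl hx'
      exact hbabs _ hc (lab_iterate_prev _ _ _)
    · simp [dl]
    · intro b hb
      have hocc : M.occ b (BT.node (M.chain m y) (.leaf y)).leaves = M.occ b [y] := by
        have : M.occ b (M.chain m y).leaves = 0 :=
          occ_eq_zero.2 fun x hx => by rw [g4 x hx]; exact hb.symm
        rw [leaves, occ_append, this, Nat.zero_add]; rfl
      rw [hocc]
      by_cases hyb : M.lab y = b
      · left
        exact ⟨fun x hx => hperm.mem_iff.2 (g2 x (by rw [hx, hyb])), by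
          rw [occ_cons_of_eq hyb, occ_nil]⟩
      · right
        refine ⟨fun x hx hxb => ?_, by rw [occ_cons_of_ne hyb, occ_nil]⟩
        rcases g3 x (hperm.mem_iff.1 hx) with h' | h'
        · exact hb (by rw [← hxb, h'])
        · exact hyb (by rw [← hxb, h'])

theorem Starred.exists_span [Finite D] (hM : M.Good) {z : V} (hD : M.Dom z) {e : D}
    (hr : M.Returns e) {n : ℕ} : ∀ {t : BT D}, Nat.card D - (M.dl e t).length ≤ n →
    M.Starred z e t → ∃ t', M.Span e t' ∧ M.Starred z e t' := by
  induction n with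
  | zero =>
    intro t hc h
    refine ⟨t, ⟨h.hang, h.nodup, fun d => ?_⟩, h⟩
    by_contra hd
    have : (d :: M.dl e t).Nodup := List.nodup_cons.2 ⟨hd, h.nodup⟩
    classical
    have := Fintype.ofFinite D
    have := ‹(d :: M.dl e t).Nodup›.length_le_card
    rw [Nat.card_eq_fintype_card] at hc
    simp only [List.length_cons] at this
    omega
  | succ n ih =>
    intro t hc h
    by_cases hall : ∀ d, d ∈ M.dl e t
    · exact ⟨t, ⟨h.hang, h.nodup, hall⟩, h⟩
    have : ∃ d, d ∈ t.leaves ∧ M.α d ∉ M.dl e t := by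
      by_contra hcon
      push Not at hcon
      apply hall
      rcases t with x | ⟨u, v⟩
      · have := hcon x (by simp [leaves])
        simp [dl] at this
      · set t := BT.node u v
        have he : M.α e ∈ M.dl e t := by simp [t, dl]
        have hcl : ∀ d ∈ {d | d ∈ M.dl e t}, d ≠ M.α e → M.α d ∈ {d | d ∈ M.dl e t} := by
          intro d hd hde
          by_contra hd'
          exact (h.hang.mem_leaves_of_α_notMem hd hd').elim (fun h' => hd' (hcon d h')) hde
        -- As no leaf leads out, the root is the only exit, and `Returns` says that `e`, beyond it,
        -- has been met already.
        have he' := hr {d | d ∈ M.dl e t} he (fun d hd => φ_mem_dl hd) hcl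
        have := hM.conn {d | d ∈ M.dl e t} ⟨_, he⟩ (fun d hd => by
          by_cases hde : d = M.α e
          · rw [hde, M.αα]; exact he'
          · exact hcl d hd hde) fun d hd => φ_mem_dl hd
        exact fun d => by
          have hd : d ∈ {d | d ∈ M.dl e t} := by rw [this]; trivial
          exact hd
    obtain ⟨d, hd, hd'⟩ := this
    obtain ⟨t', g1, g2⟩ := h.extend hM hD hd hd'
    exact ih (by omega) g1

/-- A spanning tree that cuts the surface open along one edge at each vertex not labelled `z`. -/
theorem exists_starred_span [Finite D] (hM : M.Good) {z : V} (hD : M.Dom z) {e : D}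
    (hr : M.Returns e) (he : M.lab e = z) (hαe : M.lab (M.α e) = z) :
    ∃ t, M.Span e t ∧ ∀ b, b ≠ z → (∃ d, M.lab d = b) → M.occ b (M.α e :: t.leaves) = 1 := by
  have h0 : M.Starred z e (.leaf e) := ⟨rfl, by simp [dl], fun b hb => Or.inr
    ⟨by simp [dl], occ_eq_zero.2 (by simp [leaves, he, hαe, hb.symm])⟩⟩
  obtain ⟨t, h1, h2⟩ := h0.exists_span hM hD hr le_rfl
  refine ⟨t, h1, fun b hb ⟨d, hd⟩ => ?_⟩
  rcases h2.star b hb with ⟨_, h3⟩ | ⟨h3, _⟩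
  · exact h3
  · exact absurd hd (h3 d (h1.mem d))

end TriSurf

end SimFlip

/-! ### Orbits of permutations and the choice of the letters to be opened. -/

namespace SimFlip

/-- The points `x` and `y` lie on the same orbit. -/
def Conn {P : Type} (τ : P → P) (x y : P) : Prop :=
  ∀ A : Set P, (∀ w ∈ A, τ w ∈ A) → x ∈ A → y ∈ A

namespace Conn

variable {P : Type} {τ : P → P} {x y w : P}

theorem refl (τ : P → P) (x : P) : Conn τ x x := fun _ _ h => h

theorem trans (h : Conn τ x y) (h' : Conn τ y w) : Conn τ x w := fun A hA hx => h' A hA (h A hA hx)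

theorem step (τ : P → P) (x : P) : Conn τ x (τ x) := fun _ hA hx => hA _ hx

theorem exists_iterate (h : Conn τ x y) : ∃ n, τ^[n] x = y := by
  refine h {w | ∃ n, τ^[n] x = w} ?_ ⟨0, rfl⟩
  rintro _ ⟨n, rfl⟩
  exact ⟨n + 1, Function.iterate_succ_apply' _ _ _⟩

theorem closed (τ : P → P) (x : P) : ∀ w ∈ {w | Conn τ x w}, τ w ∈ {w | Conn τ x w} :=
  fun w hw => hw.trans (step τ w)

theorem symm [Finite P] (hτ : Function.Injective τ) (h : Conn τ x y) : Conn τ y x := by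
  by_contra h'
  have h1 := h {w | Conn τ y w}ᶜ (fun w hw => by
    rw [Set.mem_compl_iff, TriSurf.mem_iff_of_closed hτ (closed τ y)]; exact hw) h'
  exact h1 (refl τ y)

section swap

variable [DecidableEq P] {i j : P} {τ' : P → P}

theorem closed_swap (h : ∀ w, τ' w = Equiv.swap i j (τ w)) {A : Set P} (hA : ∀ w ∈ A, τ w ∈ A)
    (hij : i ∈ A ↔ j ∈ A) : ∀ w ∈ A, τ' w ∈ A := by
  intro w hw
  have := hA w hw
  rw [h]
  by_cases h2 : τ w = i
  · rw [h2, Equiv.swap_apply_left]; exact hij.1 (h2 ▸ this)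
  by_cases h3 : τ w = j
  · rw [h3, Equiv.swap_apply_right]; exact hij.2 (h3 ▸ this)
  rwa [Equiv.swap_apply_of_ne_of_ne h2 h3]

theorem swap_symm (h : ∀ w, τ' w = Equiv.swap i j (τ w)) (w : P) :
    τ w = Equiv.swap i j (τ' w) := by rw [h, Equiv.swap_apply_self]

theorem swap_inj (hτ : Function.Injective τ) (h : ∀ w, τ' w = Equiv.swap i j (τ w)) :
    Function.Injective τ' := fun a b hab => by
  rw [h, h] at hab
  exact hτ ((Equiv.swap i j).injective hab)

/-- Two orbits are merged. -/
theorem merge [Finite P] (hτ : Function.Injective τ) (h : ∀ w, τ' w = Equiv.swap i j (τ w))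
    (hij : ¬ Conn τ i j) : Conn τ' i j := by
  intro A hA hi
  have h1 : ∀ w ∈ A ∩ {w | Conn τ i w}, τ w ∈ A ∩ {w | Conn τ i w} := by
    rintro w ⟨hw, hw'⟩
    have h2 : Conn τ i (τ w) := closed τ i w hw'
    refine ⟨?_, h2⟩
    by_cases h3 : τ w = i
    · rwa [h3]
    have h4 : τ w ≠ j := fun h4 => hij (h4 ▸ h2)
    have := hA w hw
    rwa [h, Equiv.swap_apply_of_ne_of_ne h3 h4] at this
  obtain ⟨u, hu⟩ := (Finite.injective_iff_surjective.1 hτ) i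
  have h2 : Conn τ i u := symm hτ (hu ▸ step τ u)
  have h3 := hA u (h2 _ h1 ⟨hi, refl τ i⟩).1
  rwa [h, hu, Equiv.swap_apply_left] at h3

/-- An orbit is split. -/
theorem split (h : ∀ w, τ' w = Equiv.swap i j (τ w)) (hne : i ≠ j) (hij : Conn τ i j) :
    ¬ Conn τ' i j := by
  classical
  have hex := hij.exists_iterate
  set m := Nat.find hex with hm
  have hmj : τ^[m] i = j := Nat.find_spec hex
  have hmin : ∀ k < m, τ^[k] i ≠ j := fun k hk => Nat.find_min hex hk
  have hm0 : 0 < m := Nat.pos_of_ne_zero fun h0 => hne (by rw [h0] at hmj; exact hmj)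
  intro hc
  -- The points of the orbit from `i` up to the one before `j` close up to a cycle of `τ'`.
  obtain ⟨k, hk, hkj⟩ := hc {w | ∃ k < m, τ^[k] i = w} (by
    rintro _ ⟨k, hk, rfl⟩
    rw [h, ← Function.iterate_succ_apply' τ k i]
    by_cases h1 : k + 1 = m
    · rw [Nat.succ_eq_add_one, h1, hmj, Equiv.swap_apply_right]
      exact ⟨0, hm0, rfl⟩
    · have h2 : k + 1 < m := by omega
      have h3 : τ^[k + 1] i ≠ i := by
        intro h3
        refine hmin (m - (k + 1)) (by omega) ?_
        have : τ^[m - (k + 1)] (τ^[k + 1] i) = j := by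
          rw [← Function.iterate_add_apply, ← hmj]
          congr 2
          omega
        rwa [h3] at this
      rw [Equiv.swap_apply_of_ne_of_ne h3 (hmin _ h2)]
      exact ⟨k + 1, h2, rfl⟩) ⟨0, hm0, rfl⟩
  exact hmin k hk hkj

/-- Connected points stay connected if the swapped points are connected. -/
theorem of_swap [Finite P] (hτ : Function.Injective τ) (h : ∀ w, τ' w = Equiv.swap i j (τ w))
    (hij : Conn τ' i j) (hxy : Conn τ x y) : Conn τ' x y := fun A hA hx =>
  hxy A (closed_swap (swap_symm h) hA
    ⟨fun hi => hij A hA hi, fun hj => symm (swap_inj hτ h) hij A hA hj⟩) hx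

theorem or_of_swap (h : ∀ w, τ' w = Equiv.swap i j (τ w)) (hx : Conn τ i x) :
    Conn τ' i x ∨ Conn τ' j x :=
  hx {w | Conn τ' i w ∨ Conn τ' j w} (closed_swap (swap_symm h)
    (fun w hw => hw.imp (closed τ' i w) (closed τ' j w))
    ⟨fun _ => Or.inr (refl _ _), fun _ => Or.inl (refl _ _)⟩) (Or.inl (refl _ _))

end swap

end Conn

section chain

variable {P : Type} [DecidableEq P] {g ρ : P → P} {z : P}

/-- Going around with the letters in `F` freed: all of them lie on one orbit, the other orbits
are trivial. -/
structure Chain (g ρ : P → P) (z : P) (F : Finset P) : Prop where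
  g_mem : ∀ i ∈ F, g i ∈ F
  conn : ∀ x ∈ F, Conn (fun x => cut g F (ρ x)) z x
  fix : ∀ x, ¬ Conn (fun x => cut g F (ρ x)) z x → cut g F (ρ x) = x

/-- Opening one more matched pair is multiplication by a transposition, which merges two orbits or
splits one. -/
theorem cut_insert {F : Finset P} (hgg : ∀ i, g (g i) = i) (hF : ∀ i ∈ F, g i ∈ F) {i : P}
    (hi : i ∉ F) (x : P) : cut g (insert i (insert (g i) F)) x = Equiv.swap i (g i) (cut g F x) := by
  have hgi : g i ∉ F := fun h => hi (by simpa [hgg] using hF _ h)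
  unfold cut
  by_cases h1 : x = i
  · subst h1; simp [hi]
  by_cases h2 : x = g i
  · subst h2; simp [hgi, hgg]
  by_cases h3 : x ∈ F
  · have e1 : x ≠ i := h1
    simp [h3, Equiv.swap_apply_of_ne_of_ne e1 h2]
  · have e1 : g x ≠ i := fun h => h2 (by rw [← h, hgg])
    have e2 : g x ≠ g i := fun h => h1 (by rw [← hgg x, h, hgg])
    simp [h1, h2, h3, Equiv.swap_apply_of_ne_of_ne e1 e2]

theorem cut_inj {F : Finset P} (hgg : ∀ i, g (g i) = i) (hF : ∀ i ∈ F, g i ∈ F) :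
    Function.Injective (cut g F) := by
  have : ∀ x, cut g F (cut g F x) = x := by
    intro x
    unfold cut
    by_cases h : x ∈ F
    · simp [h]
    · have : g x ∉ F := fun h' => h (by simpa [hgg] using hF _ h')
      simp [h, this, hgg]
  exact Function.LeftInverse.injective this

namespace Chain

variable {F : Finset P}

/-- A trivial orbit is a vertex of degree one: the consecutive letters `x` and `ρ x` are folded
together. -/
theorem fix' (h : Chain g ρ z F) {x : P} (hx : ¬ Conn (fun x => cut g F (ρ x)) z x) :
    ρ x ∉ F ∧ g (ρ x) = x := by
  have h1 := h.fix x hx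
  have h2 : ρ x ∉ F := by
    intro h2
    rw [cut, if_pos h2] at h1
    exact hx (h.conn x (h1 ▸ h2))
  rw [cut, if_neg h2] at h1
  exact ⟨h2, h1⟩

theorem notMem (h : Chain g ρ z F) {x : P} (hx : ¬ Conn (fun x => cut g F (ρ x)) z x) : x ∉ F :=
  fun h' => hx (h.conn x h')

/-- Opening the folded pair `x`, `ρ x` merges the trivial orbit of `x` with that of `ρ x`. The
latter is the main orbit, because two folded pairs in a row would form an invariant set under `ρ`.
-/
theorem exists_star [Finite P] (hgg : ∀ i, g (g i) = i) (hρ : Function.Injective ρ)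
    (htr : ∀ A : Set P, A.Nonempty → (∀ x ∈ A, ρ x ∈ A) → A = Set.univ) (h : Chain g ρ z F) {x : P}
    (hx : ¬ Conn (fun x => cut g F (ρ x)) z x) : ∃ F', F ⊆ F' ∧ ρ x ∈ F' ∧ Chain g ρ z F' ∧
    F'.card = F.card + 2 ∧
      ∀ w, Conn (fun x => cut g F' (ρ x)) z w ↔ Conn (fun x => cut g F (ρ x)) z w ∨ w = x := by
  obtain ⟨hyF, hgy⟩ := h.fix' hx
  set τ := fun x => cut g F (ρ x) with hτ
  have hxF := h.notMem hx
  have hyx : ρ x ≠ x := by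
    intro h1
    have := htr {x} ⟨x, rfl⟩ (by rintro _ rfl; exact h1)
    have h2 : z ∈ ({x} : Set P) := this ▸ Set.mem_univ z
    exact hx (h2 ▸ Conn.refl τ z)
  have hgx : g x = ρ x := by rw [← hgg (ρ x), hgy]
  have hy : Conn τ z (ρ x) := by
    by_contra hy
    obtain ⟨_, h2⟩ := h.fix' hy
    have h3 : ρ (ρ x) = x := by rw [← hgg (ρ (ρ x)), h2, hgy]
    have := htr {x, ρ x} ⟨x, by simp⟩ (by rintro _ (rfl | rfl) <;> simp [h3])
    have h2 : z ∈ ({x, ρ x} : Set P) := this ▸ Set.mem_univ z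
    rcases h2 with rfl | h2
    · exact hx (Conn.refl τ _)
    · exact hy (h2 ▸ Conn.refl τ z)
  have hτi : Function.Injective τ := (cut_inj hgg h.g_mem).comp hρ
  set F' := insert x (insert (g x) F) with hF'
  set τ' := fun x => cut g F' (ρ x) with hτ'
  have hs : ∀ w, τ' w = Equiv.swap x (g x) (τ w) := fun w => cut_insert hgg h.g_mem hxF (ρ w)
  have hn : ¬ Conn τ x (g x) := fun h1 => hx (hy.trans (hgx ▸ h1.symm hτi))
  have hm := Conn.merge hτi hs hn
  have hτi' := Conn.swap_inj hτi hs
  have hmono : ∀ {a b}, Conn τ a b → Conn τ' a b := fun hab => Conn.of_swap hτi hs hm hab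
  have hy' : Conn τ' z (g x) := hgx ▸ hmono hy
  refine ⟨F', fun i hi => by simp [hF', hi], by simp [hF', hgx], ⟨?_, ?_, ?_⟩, ?_, ?_⟩
  · intro i hi
    simp only [hF', Finset.mem_insert] at hi ⊢
    rcases hi with rfl | rfl | hi
    · simp
    · simp [hgg]
    · simp [h.g_mem i hi]
  · intro i hi
    simp only [hF', Finset.mem_insert] at hi
    rcases hi with rfl | rfl | hi
    · exact hy'.trans (hm.symm hτi')
    · exact hy'
    · exact hmono (h.conn i hi)
  · intro w hw
    have h1 : ¬ Conn τ z w := fun h1 => hw (hmono h1)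
    have h2 := h.fix w h1
    change τ' w = w
    have h3 : τ w = w := h2
    rw [hs, h3, Equiv.swap_apply_of_ne_of_ne]
    · rintro rfl; exact hw (hy'.trans (hm.symm hτi'))
    · rintro rfl; exact hw hy'
  · rw [hF', Finset.card_insert_of_notMem, Finset.card_insert_of_notMem]
    · rw [hgx]; exact hyF
    · simp [hgx, hyx.symm, hxF]
  · refine fun w => ⟨fun hw' => ?_, ?_⟩
    · exact hw' {w | Conn τ z w ∨ w = x} (Conn.closed_swap hs (by
      rintro w (hw | rfl)
      · exact Or.inl (Conn.closed τ z w hw)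
      · exact Or.inr (h.fix w hx)) ⟨fun _ => Or.inl (hgx ▸ hy), fun _ => Or.inr rfl⟩)
        (Or.inl (Conn.refl τ z))
    · rintro (h1 | rfl)
      · exact hmono h1
      · exact hy'.trans (hm.symm hτi')

/-- Opening the pair of `i` splits the main orbit in two. Some other pair has one letter in each
half, since otherwise a proper set would be invariant under `ρ`; opening it merges the halves again.
Two pairs linked in this way are a handle. -/
theorem exists_handle [Finite P] (hgg : ∀ i, g (g i) = i) (hρ : Function.Injective ρ)
    (htr : ∀ A : Set P, A.Nonempty → (∀ x ∈ A, ρ x ∈ A) → A = Set.univ) (h : Chain g ρ z F) {i : P}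
    (hi : i ∉ F) (hgi : g i ≠ i) (hiz : Conn (fun x => cut g F (ρ x)) z i)
    (hjz : Conn (fun x => cut g F (ρ x)) z (g i)) : ∃ F', F ⊆ F' ∧ i ∈ F' ∧ Chain g ρ z F' ∧
    F'.card = F.card + 4 ∧
      ∀ w, Conn (fun x => cut g F' (ρ x)) z w ↔ Conn (fun x => cut g F (ρ x)) z w := by
  set τ := fun x => cut g F (ρ x) with hτ
  have hτi : Function.Injective τ := (cut_inj hgg h.g_mem).comp hρ
  set F₁ := insert i (insert (g i) F) with hF₁
  set τ₁ := fun x => cut g F₁ (ρ x) with hτ₁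
  have hs₁ : ∀ w, τ₁ w = Equiv.swap i (g i) (τ w) := fun w => cut_insert hgg h.g_mem hi (ρ w)
  have hij : Conn τ i (g i) := (hiz.symm hτi).trans hjz
  have hn : ¬ Conn τ₁ i (g i) := Conn.split hs₁ hgi.symm hij
  have hτi₁ := Conn.swap_inj hτi hs₁
  have hF₁g : ∀ j ∈ F₁, g j ∈ F₁ := by
    intro j hj
    simp only [hF₁, Finset.mem_insert] at hj ⊢
    rcases hj with rfl | rfl | hj
    · simp
    · simp [hgg]
    · simp [h.g_mem j hj]
  have hZ₁ : ∀ w ∈ {w | Conn τ z w}, τ₁ w ∈ {w | Conn τ z w} :=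
    Conn.closed_swap hs₁ (Conn.closed τ z) ⟨fun _ => hjz, fun _ => hiz⟩
  have hor : ∀ {w}, Conn τ z w → Conn τ₁ i w ∨ Conn τ₁ (g i) w := fun hw =>
    Conn.or_of_swap hs₁ ((hiz.symm hτi).trans hw)
  have key : ∃ k, k ∉ F₁ ∧ Conn τ₁ i k ∧ Conn τ₁ (g i) (g k) := by
    by_contra! hk
    -- The half of `i` becomes invariant under `ρ` after the trivial orbits that are followed by one
    -- of its letters are added.
    have h1 := htr {w | Conn τ₁ i w ∨ (¬ Conn τ z w ∧ Conn τ₁ i (ρ w))} ⟨i, Or.inl (Conn.refl _ _)⟩ (by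
      rintro w (hw | hw)
      · have h2 : Conn τ₁ i (τ₁ w) := Conn.closed τ₁ i w hw
        by_cases h3 : ρ w ∈ F₁
        · have h4 : τ₁ w = ρ w := by simp only [hτ₁, cut, if_pos h3]
          exact Or.inl (h4 ▸ h2)
        have h4 : τ₁ w = g (ρ w) := by simp only [hτ₁, cut, if_neg h3]
        rw [h4] at h2
        by_cases h5 : Conn τ z (ρ w)
        · rcases hor h5 with h6 | h6
          · exact Or.inl h6
          · exact absurd (by rwa [hgg]) (hk (g (ρ w)) (fun h7 => h3 (by simpa [hgg] using hF₁g _ h7)) h2)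
        · refine Or.inr ⟨h5, ?_⟩
          have h6 := (h.fix' h5).2
          have h7 : ρ (ρ w) = g (ρ w) := by rw [← hgg (ρ (ρ w)), h6]
          rwa [h7]
      · exact Or.inl hw.2)
    have h2 : g i ∈ {w | Conn τ₁ i w ∨ (¬ Conn τ z w ∧ Conn τ₁ i (ρ w))} := h1 ▸ Set.mem_univ _
    rcases h2 with h2 | h2
    · exact hn h2
    · exact h2.1 hjz
  obtain ⟨k, hkF, hik, hjk⟩ := key
  have hkz : Conn τ z k := hik _ hZ₁ hiz
  have hgkz : Conn τ z (g k) := hjk _ hZ₁ hjz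
  have hgk : g k ≠ k := fun h1 => hn (hik.trans ((h1 ▸ hjk).symm hτi₁))
  have hgkF : g k ∉ F₁ := fun h1 => hkF (by simpa [hgg] using hF₁g _ h1)
  set F' := insert k (insert (g k) F₁) with hF'
  set τ' := fun x => cut g F' (ρ x) with hτ'
  have hs : ∀ w, τ' w = Equiv.swap k (g k) (τ₁ w) := fun w => cut_insert hgg hF₁g hkF (ρ w)
  have hm : Conn τ' k (g k) := Conn.merge hτi₁ hs fun h1 =>
    hn ((hik.trans h1).trans (hjk.symm hτi₁))
  have hτi' := Conn.swap_inj hτi₁ hs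
  have hmono : ∀ {a b}, Conn τ₁ a b → Conn τ' a b := fun hab => Conn.of_swap hτi₁ hs hm hab
  have hij' : Conn τ' i (g i) := ((hmono hik).trans hm).trans ((hmono hjk).symm hτi')
  have hiw : ∀ {w}, Conn τ z w → Conn τ' i w := fun hw => by
    rcases hor hw with h1 | h1
    · exact hmono h1
    · exact hij'.trans (hmono h1)
  have hzw : ∀ {w}, Conn τ z w → Conn τ' z w := fun hw =>
    ((hiw (Conn.refl τ z)).symm hτi').trans (hiw hw)
  refine ⟨F', fun i hi => by simp [hF', hF₁, hi], by simp [hF', hF₁], ⟨?_, ?_, ?_⟩, ?_, ?_⟩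
  · intro j hj
    simp only [hF', Finset.mem_insert] at hj ⊢
    rcases hj with rfl | rfl | hj
    · simp
    · simp [hgg]
    · simp [hF₁g j hj]
  · intro j hj
    simp only [hF', hF₁, Finset.mem_insert] at hj
    rcases hj with rfl | rfl | rfl | rfl | hj
    · exact hzw hkz
    · exact hzw hgkz
    · exact hzw hiz
    · exact hzw hjz
    · exact hzw (h.conn j hj)
  · intro w hw
    have h1 : ¬ Conn τ z w := fun h1 => hw (hzw h1)
    have h2 : τ w = w := h.fix w h1
    change τ' w = w
    rw [hs, hs₁, h2, Equiv.swap_apply_of_ne_of_ne, Equiv.swap_apply_of_ne_of_ne]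
    · rintro rfl; exact h1 hiz
    · rintro rfl; exact h1 hjz
    · rw [Equiv.swap_apply_of_ne_of_ne]
      · rintro rfl; exact h1 hkz
      · rintro rfl; exact h1 hiz
      · rintro rfl; exact h1 hjz
    · rw [Equiv.swap_apply_of_ne_of_ne]
      · rintro rfl; exact h1 hgkz
      · rintro rfl; exact h1 hiz
      · rintro rfl; exact h1 hjz
  · rw [hF', Finset.card_insert_of_notMem, Finset.card_insert_of_notMem hgkF, hF₁,
      Finset.card_insert_of_notMem, Finset.card_insert_of_notMem]
    · exact fun h1 => hi (by simpa [hgg] using h.g_mem _ h1)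
    · simp [hgi.symm, hi]
    · simp only [Finset.mem_insert, not_or]
      exact ⟨hgk.symm, by simpa [hF₁] using hkF⟩
  · exact fun w => ⟨fun hw' =>
      hw' _ (Conn.closed_swap hs hZ₁ ⟨fun _ => hgkz, fun _ => hkz⟩) (Conn.refl τ z), hzw⟩

variable [Fintype P]

open Classical in
/-- The trivial orbits that are not joined to the base point. -/
noncomputable def rest (g ρ : P → P) (z : P) (F : Finset P) : Finset P :=
  {x | ¬ Conn (fun x => cut g F (ρ x)) z x}

theorem mem_rest {x : P} : x ∈ rest g ρ z F ↔ ¬ Conn (fun x => cut g F (ρ x)) z x := by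
  simp [rest]

/-- Free the letters of a given number of handles. -/
theorem exists_handles (hgg : ∀ i, g (g i) = i) (hρ : Function.Injective ρ)
    (htr : ∀ A : Set P, A.Nonempty → (∀ x ∈ A, ρ x ∈ A) → A = Set.univ) (h : Chain g ρ z F)
    (hgF : ∀ i ∉ F, g i ≠ i) (m : ℕ)
    (hm : F.card + 4 * m + 2 * (rest g ρ z F).card ≤ Fintype.card P + 3) :
    ∃ F', F ⊆ F' ∧ Chain g ρ z F' ∧ F'.card = F.card + 4 * m ∧ rest g ρ z F' = rest g ρ z F := by
  induction m with
  | zero => exact ⟨F, subset_rfl, h, rfl, rfl⟩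
  | succ m ih =>
    obtain ⟨F₁, h1, h2, h3, h4⟩ := ih (by omega)
    -- Each trivial orbit blocks the two letters `x` and `ρ x`. One handle needs four letters, so
    -- the bound with `+ 3` leaves at least one letter over.
    have hex : ∃ i, i ∉ F₁ ∪ (rest g ρ z F₁ ∪ (rest g ρ z F₁).image ρ) := by
      by_contra! hall
      have h7 : Fintype.card P ≤ _ := Finset.card_le_card (fun x _ => hall x : Finset.univ ⊆ _)
      have h8 := Finset.card_union_le F₁ (rest g ρ z F₁ ∪ (rest g ρ z F₁).image ρ)
      have h9 := Finset.card_union_le (rest g ρ z F₁) ((rest g ρ z F₁).image ρ)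
      have h10 : ((rest g ρ z F₁).image ρ).card ≤ _ := Finset.card_image_le
      rw [h4] at h7 h8 h9 h10
      omega
    obtain ⟨i, hi⟩ := hex
    simp only [Finset.mem_union, not_or, Finset.mem_image, not_exists, not_and] at hi
    obtain ⟨i1, i2, i3⟩ := hi
    have i4 : g i ∉ rest g ρ z F₁ := fun h5 => i3 _ h5 (by
      rw [← hgg (ρ (g i)), (h2.fix' (mem_rest.1 h5)).2, hgg])
    rw [mem_rest, not_not] at i2 i4
    obtain ⟨F', k1, -, k2, k3, k4⟩ := h2.exists_handle hgg hρ htr i1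
      (hgF i fun h5 => i1 (h1 h5)) i2 i4
    refine ⟨F', h1.trans k1, k2, by omega, ?_⟩
    rw [← h4]
    ext w
    rw [mem_rest, mem_rest, k4]

/-- Free the letters of a given number of handles and of given trivial orbits. -/
theorem exists_chain (hgg : ∀ i, g (g i) = i) (hρ : Function.Injective ρ)
    (htr : ∀ A : Set P, A.Nonempty → (∀ x ∈ A, ρ x ∈ A) → A = Set.univ) (h : Chain g ρ z F)
    (hgF : ∀ i ∉ F, g i ≠ i) (m : ℕ)
    (hm : F.card + 4 * m + 2 * (rest g ρ z F).card ≤ Fintype.card P + 3) (W : Finset P)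
    (hW : W ⊆ rest g ρ z F) :
    ∃ F', F ⊆ F' ∧ Chain g ρ z F' ∧ F'.card = F.card + 4 * m + 2 * W.card ∧
      ∀ x ∈ rest g ρ z F, ρ x ∈ F' ↔ x ∈ W := by
  obtain ⟨F₁, h1, h2, h3, h4⟩ := h.exists_handles hgg hρ htr hgF m hm
  suffices hs : ∃ F', F₁ ⊆ F' ∧ Chain g ρ z F' ∧ F'.card = F₁.card + 2 * W.card ∧
      (∀ x ∈ W, ρ x ∈ F') ∧ rest g ρ z F' = rest g ρ z F \ W by
    obtain ⟨F', k1, k2, k3, k4, k5⟩ := hs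
    refine ⟨F', h1.trans k1, k2, by omega, fun x hx => ⟨fun hx' => ?_, k4 x⟩⟩
    by_contra hxW
    have : x ∈ rest g ρ z F' := by rw [k5]; exact Finset.mem_sdiff.2 ⟨hx, hxW⟩
    exact (k2.fix' (mem_rest.1 this)).1 hx'
  clear hm
  induction W using Finset.induction_on with
  | empty => exact ⟨F₁, subset_rfl, h2, by simp, by simp, by simpa using h4⟩
  | insert x W hx ih =>
    obtain ⟨F', k1, k2, k3, k4, k5⟩ := ih ((Finset.subset_insert _ _).trans hW)
    have hxr : x ∈ rest g ρ z F' := by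
      rw [k5]; exact Finset.mem_sdiff.2 ⟨hW (Finset.mem_insert_self _ _), hx⟩
    obtain ⟨F'', l1, l2, l3, l4, l5⟩ := k2.exists_star hgg hρ htr (mem_rest.1 hxr)
    refine ⟨F'', k1.trans l1, l3, ?_, ?_, ?_⟩
    · rw [Finset.card_insert_of_notMem hx]; omega
    · intro y hy
      rcases Finset.mem_insert.1 hy with rfl | hy
      · exact l2
      · exact l1 (k4 y hy)
    · ext w
      have k6 : w ∈ rest g ρ z F' ↔ w ∈ rest g ρ z F ∧ w ∉ W := by rw [k5, Finset.mem_sdiff]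
      rw [mem_rest] at k6
      rw [mem_rest, l5, not_or, k6, Finset.mem_sdiff, Finset.mem_insert]
      tauto

end Chain

end chain

end SimFlip

/-! ### Pieces with one free side. -/

namespace SimFlip

theorem BT.exists_leaves_eq {L : Type} : ∀ {l : List L}, l ≠ [] → ∃ t : BT L, t.leaves = l
  | [], h => absurd rfl h
  | [x], _ => ⟨.leaf x, rfl⟩
  | x :: y :: l, _ => by
    obtain ⟨t, ht⟩ := BT.exists_leaves_eq (List.cons_ne_nil y l)
    exact ⟨.node (.leaf x) t, by simp [BT.leaves, ht]⟩

namespace TriSurf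

open BT

variable {V D : Type} {M : TriSurf V D}

/-- As long as `e` has not been met, `Returns` provides a leaf that leads to a new triangle, and the
surface is finite. -/
theorem Hang.exists_mem_root [Finite D] {e : D} (hr : M.Returns e) {n : ℕ} :
    ∀ {t : BT D}, Nat.card D - (M.dl e t).length ≤ n → M.Hang e t → (M.dl e t).Nodup →
    ∃ t', M.Hang e t' ∧ (M.dl e t').Nodup ∧ e ∈ M.dl e t' := by
  induction n with
  | zero =>
    intro t hc h hn
    refine ⟨t, h, hn, ?_⟩
    by_contra hd
    have : (e :: M.dl e t).Nodup := List.nodup_cons.2 ⟨hd, hn⟩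
    have := Fintype.ofFinite D
    have h1 := List.Nodup.length_le_card ‹(e :: M.dl e t).Nodup›
    rw [← Nat.card_eq_fintype_card, List.length_cons] at h1
    omega
  | succ n ih =>
    intro t hc h hn
    by_cases he : e ∈ M.dl e t
    · exact ⟨t, h, hn, he⟩
    obtain ⟨d, hd, hαd⟩ : ∃ d ∈ t.leaves, M.α d ∉ M.dl e t := by
      by_contra! hall
      cases t with
      | leaf d =>
        have := hall d (by simp [leaves])
        simp [dl] at this
      | node l r =>
        refine he (hr {x | x ∈ M.dl e (.node l r)} (by simp [dl]) (fun d hd => φ_mem_dl hd) ?_)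
        intro d hd hde
        by_contra h'
        rcases h.mem_leaves_of_α_notMem hd h' with h2 | h2
        · exact h' (hall d h2)
        · exact hde h2
    obtain ⟨l₁, l₂, hl⟩ := List.append_of_mem hd
    obtain ⟨t', h1, h2, h3, h4⟩ := h.grow hn hl hαd
    refine ih ?_ h1 h2
    have h5 := length_dl M t e
    have h6 := length_dl M t' e
    rw [hl] at h5
    rw [h3] at h6
    simp at h5 h6
    omega

theorem exists_span_of_returns [Finite D] (hM : M.Good) {e : D} (hr : M.Returns e) :
    ∃ t, M.Span e t := by
  obtain ⟨t, h1, h2, h3⟩ := Hang.exists_mem_root hr (t := .leaf e) le_rfl rfl (by simp [dl])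
  obtain ⟨t', l', h4, -⟩ := h1.exists_span hM le_rfl h2 h3 (List.append_nil _).symm (by simp)
  exact ⟨t', h4⟩

/-- A triangulated polygon can be changed to a fan. -/
theorem Span.exists_comb {e : D} {t : BT D} {N k : ℕ} (h : M.Span e t) (hN : t.leaves.length = N)
    (hk : N ≤ 2 ^ k) : ∃ M' a r, Reach (24 * k) M M' ∧ M'.Comb N a r ∧ r N = M.α e ∧
      List.ofFn (sd N a r) = M.α e :: t.leaves ∧
      (∀ d ∈ M.α e :: t.leaves, M'.lab d = M.lab d) ∧ M'.lab e = M.lab e := by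
  subst hN
  obtain ⟨t', h0, h1⟩ := exists_rht_zero (rht t) t le_rfl
  have h2 := h0.leaves_eq
  obtain ⟨M', r1, r2, r3, r4, r5⟩ := h.polygon h2.symm hk
  obtain ⟨a, r, c1, c2, c3⟩ := r2.comb h1
  rw [h2] at c1 c2 c3
  rw [r1.α_eq] at c2
  refine ⟨M', a, r, r1, c1, c2, ?_, ?_, r5⟩
  · rw [List.ofFn_succ]
    refine List.cons_eq_cons.2 ⟨by rw [Comb.sd_zero, c2], ?_⟩
    · refine List.ext_getElem (by simp) fun i h3 h4 => ?_
      rw [List.getElem_ofFn, Comb.sd_of_pos (Fin.succ_ne_zero _)]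
      exact c3 i h4
  · intro d hd
    rcases List.mem_cons.1 hd with rfl | hd
    · exact r4
    · exact r3 d hd

theorem eq_of_occ_eq_one {N : ℕ} {s : Fin N → D} {b : V} (h : M.occ b (List.ofFn s) = 1) :
    ∃ i, M.lab (s i) = b ∧ ∀ j, M.lab (s j) = b → j = i := by
  classical
  have h1 : M.occ b (List.ofFn s) = (Finset.univ.filter fun i => M.lab (s i) = b).card := by
    rw [occ, List.map_ofFn, List.count_eq_countP, List.countP_eq_length_filter]
    rw [Finset.card_filter, ← List.sum_ofFn]
    clear h
    induction N with
    | zero => simp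
    | succ N ih =>
      rw [List.ofFn_succ, List.ofFn_succ, List.filter_cons, List.sum_cons]
      have := ih (s := fun i => s i.succ)
      split_ifs with h1 h2 h2
      · rw [List.length_cons]
        exact (congrArg (· + 1) this).trans (add_comm _ _)
      · simp at h1; exact absurd h1 h2
      · simp at h1; exact absurd h2 h1
      · exact this.trans (zero_add _).symm
  rw [h1, Finset.card_eq_one] at h
  obtain ⟨i, hi⟩ := h
  have h2 : ∀ j, M.lab (s j) = b ↔ j = i := fun j => by
    have := congrArg (j ∈ ·) hi
    simpa using this
  exact ⟨i, (h2 i).2 rfl, fun j hj => (h2 j).1 hj⟩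

/-- The triangulated polygon has no inner vertices, so every corner of a triangle is a corner of the
polygon. -/
theorem lab_of_mem_dl : ∀ {t : BT D} {e : D}, M.Hang e t → ∀ d ∈ M.dl e t,
    ∃ x ∈ M.α e :: t.leaves, M.lab d = M.lab x
  | .leaf _, _, _, d, hd => by simp [dl] at hd
  | .node l r, e, h, d, hd => by
    -- the label of the target of `x` is that of the first leaf
    have hp : ∀ {u : BT D} {x : D}, M.Hang x u → ∃ y ∈ u.leaves, M.lab x = M.lab y := by
      intro u
      induction u with
      | leaf y => rintro x rfl; exact ⟨_, by simp [leaves], rfl⟩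
      | node a b iha _ =>
        intro x hx
        obtain ⟨y, hy, hxy⟩ := iha hx.1
        exact ⟨y, by simp [leaves, hy], by rw [← hxy, M.lab_ν]⟩
    obtain ⟨y, hy, hxy⟩ := hp h.1
    obtain ⟨w, hw, hxw⟩ := hp h.2
    have hsub : ∀ {x}, (∃ v ∈ l.leaves, M.lab x = M.lab v) ∨ (∃ v ∈ r.leaves, M.lab x = M.lab v) →
        ∃ v ∈ M.α e :: (BT.node l r).leaves, M.lab x = M.lab v := by
      rintro x (⟨v, hv, hx⟩ | ⟨v, hv, hx⟩) <;> exact ⟨v, by simp [leaves, hv], hx⟩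
    have hα : ∀ x, M.lab (M.α x) = M.lab (M.φ x) := fun x => by
      have := M.lab_ν (M.α x)
      rw [M.αα] at this
      exact this.symm
    simp only [dl, List.mem_cons, List.mem_append] at hd
    rcases hd with rfl | rfl | rfl | hd | hd
    · exact ⟨_, by simp, rfl⟩
    · exact hsub (Or.inl ⟨y, hy, hxy⟩)
    · exact hsub (Or.inr ⟨w, hw, hxw⟩)
    · obtain ⟨x, hx, hdx⟩ := lab_of_mem_dl h.1 d hd
      rcases List.mem_cons.1 hx with rfl | hx
      · exact hsub (Or.inr ⟨w, hw, by rw [hdx, hα, hxw]⟩)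
      · exact hsub (Or.inl ⟨x, hx, hdx⟩)
    · obtain ⟨x, hx, hdx⟩ := lab_of_mem_dl h.2 d hd
      rcases List.mem_cons.1 hx with rfl | hx
      · refine ⟨M.α e, by simp, by rw [hdx, hα, M.φφφ]⟩
      · exact hsub (Or.inr ⟨x, hx, hdx⟩)

/-- The part behind the left branch of the root. -/
theorem Span.side_left {e : D} {t u : BT D} (h : M.Span e (.node t u))
    (ht : 2 ≤ t.leaves.length) (hα : ∀ d ∈ M.α e :: u.leaves, M.α d ∈ M.α e :: u.leaves) :
    M.Side {d | d ∈ M.dl (M.φ (M.α e)) t} (M.α (M.φ (M.α e))) := by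
  set p := M.φ (M.α e) with hp
  set q := M.φ p with hq
  have hn := h.nodup
  simp only [dl, List.nodup_cons, List.mem_cons, List.mem_append, not_or, List.nodup_append] at hn
  obtain ⟨⟨n1, n2, n3, n4⟩, ⟨n5, n6, n7⟩, ⟨n8, n9⟩, n10, n11, n12⟩ := hn
  have hdis : ∀ d, d ∈ M.dl p t → d ∉ M.dl q u := fun d h1 h2 => n12 d h1 d h2 rfl
  have hmem : M.α p ∈ M.dl p t := by
    cases t with
    | leaf x => simp [leaves] at ht
    | node l r => simp [dl]
  have hR : ∀ d, M.α d ∈ M.α e :: u.leaves → d ∈ M.α e :: u.leaves := fun d hd => by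
    simpa [M.αα] using hα _ hd
  have hRS : ∀ d ∈ M.α e :: u.leaves, d ∉ M.dl p t := by
    intro d hd h1
    rcases List.mem_cons.1 hd with rfl | hd
    · exact n3 h1
    · rcases h.hang.2.leaves_sub hd with rfl | h2
      · exact n8 h1
      · exact hdis _ h1 h2
  refine ⟨hmem, by rw [M.αα]; exact n6, ?_, fun d hd => φ_mem_dl hd⟩
  intro d hd hdp
  by_contra hd'
  have hd1 : d ∉ M.α e :: u.leaves := fun h1 => hRS d h1 hd
  have hαq : d ≠ M.α q := by
    rintro rfl
    cases u with
    | leaf x =>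
      have : q = x := h.hang.2
      exact hd1 (hR _ (by rw [M.αα]; simp [leaves, this]))
    | node l r => exact hdis _ hd (by simp [dl])
  have h1 := h.mem (M.α d)
  simp only [dl, List.mem_cons, List.mem_append] at h1
  rcases h1 with h1 | h1 | h1 | h1 | h1
  · exact hd1 (hR _ (by rw [h1]; simp))
  · exact hdp (by rw [← M.αα d, h1])
  · exact hαq (by rw [← M.αα d, h1])
  · exact hd' h1
  · rcases h.hang.2.mem_leaves_of_α_notMem h1 (by rw [M.αα]; exact hdis d hd) with h2 | h2
    · exact hd1 (hR _ (by simp [h2]))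
    · exact n8 (M.α_inj h2 ▸ hd)

theorem Span.side_right {e : D} {t u : BT D} (h : M.Span e (.node t u))
    (hu : 2 ≤ u.leaves.length) (hα : ∀ d ∈ u.leaves, M.α d ∈ u.leaves) :
    M.Side {d | d ∈ M.dl (M.φ (M.φ (M.α e))) u} (M.α (M.φ (M.φ (M.α e)))) := by
  have hn := h.nodup
  simp only [dl, List.nodup_cons, List.mem_cons, List.mem_append, not_or, List.nodup_append] at hn
  obtain ⟨-, -, ⟨n8, n9⟩, -⟩ := hn
  cases u with
  | leaf x => simp [leaves] at hu
  | node l r =>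
    refine ⟨by simp [dl], by rw [M.αα]; exact n9, ?_, fun d hd => φ_mem_dl hd⟩
    intro d hd hdq
    by_contra hd'
    rcases h.hang.2.mem_leaves_of_α_notMem hd hd' with h1 | h1
    · exact hd' (h.hang.2.mem_dl_of_mem_leaves (hα d h1))
    · exact hdq h1

theorem ncard_dl {e : D} {t : BT D} (h : (M.dl e t).Nodup) :
    {d | d ∈ M.dl e t}.ncard + 3 = 3 * t.leaves.length := by
  classical
  rw [← length_dl M t e, ← List.toFinset_card_of_nodup h, ← Set.ncard_coe_finset]
  congr 2
  ext d
  simp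

/-- A part of the surface with a given number of handles, given labels and one side on the
boundary, whose ends have the label `z`. -/
structure SidePiece (M : TriSurf V D) (S : Set D) (s : D) (z : V) (h : ℕ) (L : Finset V) : Prop where
  side : M.Side S s
  ne : ∀ d ∈ S, M.α d ≠ d
  lab : M.lab s = z
  range : ∀ v, (∃ d ∈ S, M.lab d = v) ↔ v = z ∨ v ∈ L
  -- Cut open, the piece is a polygon that has, besides `s`, four sides for each handle and two for
  -- each further vertex.
  card : S.ncard + 3 = 3 * (4 * h + 2 * L.card)

/-- A surface with one free side. -/
structure Piece (M : TriSurf V D) (c : D) (z : V) (h : ℕ) (L : Finset V) : Prop where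
  good : M.Good
  fix : M.α c = c
  ne : ∀ d, d ≠ c → M.α d ≠ d
  lab : M.lab c = z
  range : ∀ v, (∃ d, M.lab d = v) ↔ v = z ∨ v ∈ L
  notMem : z ∉ L
  card : Nat.card D + 3 = 3 * (4 * h + 2 * L.card)

variable {z : V} {h : ℕ} {L : Finset V}

theorem SidePiece.piece [Finite D] (hM : M.Good) {S : Set D} {s : D} (hz : z ∉ L)
    (H : M.SidePiece S s z h L) : H.side.surf.Piece ⟨s, H.side.mem⟩ z h L where
  good := H.side.surf_good hM
  fix := H.side.surf_α_self
  ne d hd h' := by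
    have h1 : (d : D) ≠ s := fun h2 => hd (Subtype.ext h2)
    exact H.ne d d.2 ((H.side.surf_α h1).symm.trans (congrArg Subtype.val h'))
  lab := H.lab
  range v := by
    rw [← H.range v]
    exact ⟨fun ⟨d, hd⟩ => ⟨d, d.2, hd⟩, fun ⟨d, hd, hd'⟩ => ⟨⟨d, hd⟩, hd'⟩⟩
  notMem := hz
  card := by
    rw [← H.card]
    rfl

theorem Side.restrict [Finite D] {A S : Set D} {a s : D} (hA : M.Side A a) (hS : M.Side S s)
    (hSA : S ⊆ A) (ha : a ∉ S) :
    hA.surf.Side (Subtype.val ⁻¹' S) ⟨s, hSA hS.mem⟩ where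
  mem := hS.mem
  α_notMem := by
    rw [Set.mem_preimage, hA.surf_α (fun h' : s = a => ha (h' ▸ hS.mem))]
    exact hS.α_notMem
  α_mem d hd hds := by
    rw [Set.mem_preimage, hA.surf_α (fun h' : (d : D) = a => ha (h' ▸ hd))]
    exact hS.α_mem d hd fun h' => hds (Subtype.ext h')
  φ_mem d hd := hS.φ_mem d hd

theorem SidePiece.restrict [Finite D] {A S : Set D} {a s : D} (hA : M.Side A a)
    (hS : M.SidePiece S s z h L) (hSA : S ⊆ A) (ha : a ∉ S) :
    hA.surf.SidePiece (Subtype.val ⁻¹' S) ⟨s, hSA hS.side.mem⟩ z h L where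
  side := hA.restrict hS.side hSA ha
  ne d hd h' := hS.ne d hd (by
    rw [← hA.surf_α (fun h' : (d : D) = a => ha (h' ▸ hd)), h'])
  lab := hS.lab
  range v := by
    rw [← hS.range v]
    exact ⟨fun ⟨d, hd, hd'⟩ => ⟨d, hd, hd'⟩, fun ⟨d, hd, hd'⟩ => ⟨⟨d, hSA hd⟩, hd, hd'⟩⟩
  card := by
    rw [← hS.card, Set.ncard_preimage_of_injective_subset_range Subtype.val_injective]
    simpa using hSA

/-- Surfaces meet if the two parts on either side of a cut do. -/
theorem Meet.of_sides [Finite D] {D' : Type} [Finite D'] {M' : TriSurf V D'} {S : Set D} {s : D}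
    {S' : Set D'} {s' : D'} (hS : M.Side S s) (hS' : M'.Side S' s') {k : ℕ} {C : Set (D × D')}
    {C₁ : Set (S × S')} {C₂ : Set (↑Sᶜ × ↑S'ᶜ)}
    (h₁ : Meet k hS.surf hS'.surf C₁) (hC₁ : (⟨s, hS.mem⟩, ⟨s', hS'.mem⟩) ∈ C₁)
    (h₂ : Meet k hS.compl.surf hS'.compl.surf C₂)
    (hC₂ : (⟨M.α s, hS.α_notMem⟩, ⟨M'.α s', hS'.α_notMem⟩) ∈ C₂)
    (hC : ∀ p ∈ C, ∃ h h', (⟨p.1, h⟩, ⟨p.2, h'⟩) ∈ C₂) : Meet k M M' C := by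
  classical
  have hl := fun (D : Type) [Finite D] (M : TriSurf V D) (S : Set D) (s : D) (hS : M.Side S s) =>
    (show hS.surf.lab ⟨s, hS.mem⟩ = hS.compl.surf.lab ⟨M.α s, hS.α_notMem⟩ by
      rw [hS.surf_lab, hS.compl.surf_lab]
      have := M.lab_ν (M.α s)
      rw [M.αα] at this
      rw [← this, hS.lab_φ])
  refine Meet.of_iso hS.iso.symm hS'.iso.symm (h₁.glue h₂ hS.surf_α_self hS.compl.surf_α_self
    (hl D M S s hS) hS'.surf_α_self hS'.compl.surf_α_self (hl D' M' S' s' hS') hC₁ hC₂) ?_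
  rintro ⟨p, p'⟩ hp
  obtain ⟨h, h', hh⟩ := hC _ hp
  refine Or.inr ⟨_, hh, ?_⟩
  simp only [Prod.mk.injEq]
  exact ⟨(Equiv.Set.sumCompl_symm_apply_of_notMem h).symm,
    (Equiv.Set.sumCompl_symm_apply_of_notMem h').symm⟩

theorem Piece.reach [Finite D] {c : D} {M' : TriSurf V D} {k : ℕ} (H : M.Piece c z h L)
    (hr : Reach k M M') : M'.Piece c z h L where
  good := hr.good H.good
  fix := hr.α_free H.fix
  ne d hd := by rw [hr.α_eq]; exact H.ne d hd
  lab := by rw [hr.lab_free H.fix, H.lab]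
  range v := by
    rw [← H.range v]
    exact Set.ext_iff.1 hr.lab_range v
  notMem := H.notMem
  card := H.card

/-- A single triangle with three free sides. -/
theorem exists_iso_triangle {D' : Type} {M' : TriSurf V D'} {c : D} {c' : D'}
    (hα : ∀ d, M.α d = d) (hα' : ∀ d, M'.α d = d) (hl : ∀ d, M.lab d = z) (hl' : ∀ d, M'.lab d = z)
    (hd : ∀ d, d = c ∨ d = M.φ c ∨ d = M.φ (M.φ c))
    (hd' : ∀ d, d = c' ∨ d = M'.φ c' ∨ d = M'.φ (M'.φ c')) :
    ∃ e, Iso M M' e ∧ e c = c' ∧ e (M.φ c) = M'.φ c' ∧ e (M.φ (M.φ c)) = M'.φ (M'.φ c') := by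
  have bij : ∀ {D : Type} (M : TriSurf V D) (c : D), (∀ d, d = c ∨ d = M.φ c ∨ d = M.φ (M.φ c)) →
      Function.Bijective ![c, M.φ c, M.φ (M.φ c)] := by
    intro D M c h
    have e1 := M.φ_ne c
    have e2 := M.φφ_ne c
    have e3 := M.φ_ne (M.φ c)
    constructor
    · intro i j hij
      fin_cases i <;> fin_cases j
      · rfl
      · exact absurd hij.symm e1
      · exact absurd hij.symm e2
      · exact absurd hij e1
      · rfl
      · exact absurd hij.symm e3
      · exact absurd hij e2
      · exact absurd hij e3
      · rfl
    · intro d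
      rcases h d with h | h | h
      · exact ⟨0, by simp [h]⟩
      · exact ⟨1, by simp [h]⟩
      · exact ⟨2, by simp [h]⟩
  let e := (Equiv.ofBijective _ (bij M c hd)).symm.trans (Equiv.ofBijective _ (bij M' c' hd'))
  have hE : ∀ i, e (![c, M.φ c, M.φ (M.φ c)] i) = ![c', M'.φ c', M'.φ (M'.φ c')] i := fun i =>
    congrArg ![c', M'.φ c', M'.φ (M'.φ c')] (Equiv.ofBijective_symm_apply_apply _ (bij M c hd) i)
  have e0 : e c = c' := hE 0
  have e1 : e (M.φ c) = M'.φ c' := hE 1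
  have e2 : e (M.φ (M.φ c)) = M'.φ (M'.φ c') := hE 2
  refine ⟨e, ⟨fun d => by rw [hα, hα'], fun d => ?_, fun d => by rw [hl, hl']⟩, e0, e1, e2⟩
  rcases hd d with rfl | rfl | rfl
  · rw [e1, e0]
  · rw [e2, e1]
  · rw [e2, M.φφφ, e0, M'.φφφ]

end TriSurf

end SimFlip

/-! ### Splitting a piece into two pieces of prescribed types. -/

namespace SimFlip

namespace TriSurf

open BT

variable {V D : Type} {M : TriSurf V D} {z : V} {h : ℕ} {L : Finset V} {c : D}

theorem Piece.returns (H : M.Piece c z h L) : M.Returns c := fun S hS _ _ => by rwa [H.fix] at hS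

theorem Piece.leaves_length [Finite D] (H : M.Piece c z h L) {e : D} {t : BT D} (ht : M.Span e t) :
    t.leaves.length = 4 * h + 2 * L.card := by
  have h1 := ht.card
  have h2 := H.card
  omega

theorem Piece.exists_comb [Finite D] (H : M.Piece c z h L) {K : ℕ} (hK : 4 * h + 2 * L.card ≤ 2 ^ K) :
    ∃ M' a r, Reach (24 * K) M M' ∧ M'.Comb (4 * h + 2 * L.card) a r ∧
      r (4 * h + 2 * L.card) = c := by
  obtain ⟨t, ht⟩ := exists_span_of_returns H.good H.returns
  obtain ⟨M', a, r, h1, h2, h3, -⟩ := ht.exists_comb (H.leaves_length ht) hK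
  exact ⟨M', a, r, h1, h2, by rw [h3, H.fix]⟩

theorem Piece.two_le [Finite D] (H : M.Piece c z h L) : 2 ≤ 4 * h + 2 * L.card := by
  have := H.card
  omega

theorem Piece.pair_zero {N : ℕ} {a r : ℕ → D} (H : M.Piece c z h L) (hc : M.Comb N a r) (hN : 2 ≤ N)
    (hr : r N = c) : hc.pair 0 = 0 :=
  hc.pair_eq hN (by rw [Comb.sd_zero, hr, H.fix])

theorem Piece.pair_ne {N : ℕ} {a r : ℕ → D} (H : M.Piece c z h L) (hc : M.Comb N a r) (hN : 2 ≤ N)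
    (hr : r N = c) {i : Fin (N + 1)} (hi : i ≠ 0) : hc.pair i ≠ i := fun h1 => by
  have h2 := hc.α_sd i
  rw [h1] at h2
  refine H.ne _ (fun h3 => hi (hc.sd_inj hN ?_)) h2
  rw [h3, Comb.sd_zero, hr]

theorem Piece.isCut {N : ℕ} {a r : ℕ → D} (H : M.Piece c z h L) (hc : M.Comb N a r) (hN : 2 ≤ N)
    (hr : r N = c) {F : Finset (Fin (N + 1))} (h0 : 0 ∈ F) (hF : ∀ i ∈ F, hc.pair i ∈ F) :
    hc.IsCut F :=
  ⟨h0, hF, fun _ hi => H.pair_ne hc hN hr fun h => hi (h ▸ h0)⟩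

theorem Piece.lab_one {N : ℕ} {a r : ℕ → D} (H : M.Piece c z h L) (hc : M.Comb N a r) (hN : 2 ≤ N)
    (hr : r N = c) : M.lab (a 1) = z := by
  rw [← hc.lab_αr (by omega) le_rfl, hr, H.fix, H.lab]

/-- A piece can be turned to a fan where every label but `z` occurs exactly once on the boundary. -/
theorem Piece.exists_starred_comb [Finite D] (H : M.Piece c z h L) {K N : ℕ}
    (hN : N = 4 * h + 2 * L.card) (hK : N ≤ 2 ^ K) :
    ∃ M' a r, Reach (48 * K + 1) M M' ∧ M'.Comb N a r ∧ r N = c ∧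
      ∀ b ∈ L, ∃ i, M'.lab (sd N a r i) = b ∧ ∀ j, M'.lab (sd N a r j) = b → j = i := by
  subst hN
  have hN := H.two_le
  obtain ⟨M₁, a, r, h1, h2, h3⟩ := H.exists_comb hK
  have H₁ := H.reach h1
  have hcut : h2.IsCut {0, h2.pair 0} := H₁.isCut h2 hN h3 (by simp) (by
    simp [H₁.pair_zero h2 hN h3])
  have hD := h2.dom_flip hN hcut
  rw [H₁.lab_one h2 hN h3] at hD
  have s1 : Reach 1 M₁ (M₁.flip _ (h2.flippable_others hN hcut)) := Reach.one ⟨_, _, rfl⟩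
  have H₂ := H₁.reach s1
  obtain ⟨t, t1, t2⟩ := exists_starred_span H₂.good hD H₂.returns H₂.lab (by rw [H₂.fix, H₂.lab])
  obtain ⟨M', a', r', k1, k2, k3, k4, k5, -⟩ := t1.exists_comb (H₂.leaves_length t1) hK
  -- `24 * K` moves to a fan, one to make `z` dominate, and `24 * K` to a fan for the new boundary.
  refine ⟨M', a', r', ((h1.trans s1).trans k1).mono (by omega), k2, by rw [k3, H₂.fix], ?_⟩
  intro b hb
  have hbz : b ≠ z := fun h => H.notMem (h ▸ hb)
  refine eq_of_occ_eq_one ?_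
  rw [k4]
  refine Eq.trans ?_ (t2 b hbz ((H₂.range b).2 (Or.inr hb)))
  unfold occ
  rw [List.map_congr_left k5]

/-- Turning around a vertex preserves labels, so a corner whose label occurs once is an orbit by
itself, and the corners labelled `z` form the orbit of 0. This is the starting `Chain`, with just
the free side opened. -/
theorem exists_unique_letters [Finite D] (hM : M.Good) {N : ℕ} {a r : ℕ → D} (hc : M.Comb N a r)
    (hN : 2 ≤ N) (hp : hc.pair 0 = 0) (hz : M.lab (a 1) = z)
    (hu : ∀ i j, M.lab (sd N a r i) ≠ z → M.lab (sd N a r j) = M.lab (sd N a r i) → j = i) :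
    Chain hc.pair (· + 1) 0 {0} ∧ ∀ x, x ∈ Chain.rest hc.pair (· + 1) 0 {0} ↔
      M.lab (sd N a r (x + 1)) ≠ z := by
  have hτ : ∀ x, cut hc.pair {0} (x + 1) = hc.pair (x + 1) := by
    intro x
    unfold cut
    split_ifs with h1
    · rw [Finset.mem_singleton.1 h1, hp]
    · rfl
  have h0 : M.lab (sd N a r (0 + 1)) = z := by
    rw [zero_add, Comb.sd_of_pos (Comb.one_ne_zero' hN), Comb.val_one' hN, hz]
  have key : ∀ x, M.lab (sd N a r (x + 1)) = z → Conn (fun x => cut hc.pair {0} (x + 1)) 0 x := by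
    intro x hx A hA h0A
    exact hc.mem_of_lab_eq hN hM (fun i hi => by rw [← hτ]; exact hA i hi) h0A (by rw [hx, h0])
  refine ⟨⟨by simp [hp], by simpa using Conn.refl _ _, fun x hx => ?_⟩, fun x => ?_⟩
  · have h1 : M.lab (sd N a r (x + 1)) ≠ z := fun h => hx (key x h)
    rw [hτ]
    have h2 := hu (x + 1) _ h1 (hc.lab_pair_succ hN x)
    exact add_right_cancel h2
  · rw [Chain.mem_rest]
    refine not_congr ⟨fun h => ?_, key x⟩
    refine h {x | M.lab (sd N a r (x + 1)) = z} (fun w hw => ?_) h0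
    change M.lab (sd N a r (cut hc.pair {0} (w + 1) + 1)) = z
    rw [hτ, hc.lab_pair_succ hN]
    exact hw

open Fin.NatCast in
theorem add_one_transitive {N : ℕ} (A : Set (Fin (N + 1))) (hA : A.Nonempty)
    (h : ∀ x ∈ A, x + 1 ∈ A) : A = Set.univ := by
  obtain ⟨x, hx⟩ := hA
  have h1 : ∀ k : ℕ, x + (k : Fin (N + 1)) ∈ A := by
    intro k
    induction k with
    | zero => simpa using hx
    | succ k ih =>
      have := h _ ih
      rwa [add_assoc, ← Nat.cast_succ] at this
  ext y
  refine ⟨fun _ => trivial, fun _ => ?_⟩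
  have := h1 (y - x : Fin (N + 1)).val
  rw [Fin.cast_val_eq_self] at this
  simpa using this

/-- The labels that are to be split off, and letters of handles. -/
theorem Piece.exists_cut [Finite D] (H : M.Piece c z h L) {N : ℕ} {a r : ℕ → D} (hc : M.Comb N a r)
    (hN : N = 4 * h + 2 * L.card) (hr : r N = c)
    (hu : ∀ b ∈ L, ∃ i, M.lab (sd N a r i) = b ∧ ∀ j, M.lab (sd N a r j) = b → j = i)
    {h₂ : ℕ} {L₂ : Finset V} (hh : h₂ ≤ h) (hL : L₂ ⊆ L) :
    ∃ F : Finset (Fin (N + 1)), Chain hc.pair (· + 1) 0 F ∧ 0 ∈ F ∧ F.card = 1 + 4 * h₂ + 2 * L₂.card ∧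
      ∀ i, M.lab (sd N a r i) ≠ z → (i ∈ F ↔ M.lab (sd N a r i) ∈ L₂) := by
  classical
  have hN2 : 2 ≤ N := hN ▸ H.two_le
  have hp := H.pair_zero hc hN2 hr
  have hLz : ∀ d, M.lab d ≠ z → M.lab d ∈ L := fun d hd =>
    ((H.range _).1 ⟨d, rfl⟩).resolve_left hd
  obtain ⟨h1, h2⟩ := exists_unique_letters H.good hc hN2 hp (H.lab_one hc hN2 hr) (by
    intro i j hi hj
    obtain ⟨k, -, hk⟩ := hu _ (hLz _ hi)
    rw [hk i rfl, hk j hj])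
  have hcard : ∀ L' : Finset V, L' ⊆ L →
      ((Chain.rest hc.pair (· + 1) 0 {0}).filter fun x => M.lab (sd N a r (x + 1)) ∈ L').card =
        L'.card := by
    intro L' hL'
    refine Finset.card_bij (fun x _ => M.lab (sd N a r (x + 1))) ?_ ?_ ?_
    · intro x hx
      exact (Finset.mem_filter.1 hx).2
    · intro x hx y hy hxy
      obtain ⟨k, -, hk⟩ := hu _ (hL' (Finset.mem_filter.1 hy).2)
      exact add_right_cancel ((hk _ hxy).trans (hk _ rfl).symm)
    · intro b hb
      obtain ⟨k, hk, -⟩ := hu b (hL' hb)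
      refine ⟨k - 1, Finset.mem_filter.2 ⟨(h2 _).2 ?_, ?_⟩, by rw [sub_add_cancel, hk]⟩
      · rw [sub_add_cancel, hk]
        exact fun h => H.notMem (h ▸ hL' hb)
      · rwa [sub_add_cancel, hk]
  have hrest : (Chain.rest hc.pair (· + 1) 0 {0}).card = L.card := by
    rw [← hcard L subset_rfl, Finset.filter_true_of_mem]
    intro x hx
    exact hLz _ ((h2 x).1 hx)
  obtain ⟨F, k1, k2, k3, k4⟩ := h1.exists_chain (hc.pair_pair hN2) (add_left_injective 1)
    add_one_transitive (fun i hi => H.pair_ne hc hN2 hr (by simpa using hi)) h₂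
    (by rw [hrest, Fintype.card_fin]; simp; omega)
    ((Chain.rest hc.pair (· + 1) 0 {0}).filter fun x => M.lab (sd N a r (x + 1)) ∈ L₂)
    (Finset.filter_subset _ _)
  refine ⟨F, k2, k1 (by simp), by rw [k3, hcard L₂ hL]; simp, fun i hi => ?_⟩
  have h3 : i - 1 ∈ Chain.rest hc.pair (· + 1) 0 {0} := by
    rw [h2, sub_add_cancel]; exact hi
  have h4 := k4 _ h3
  rw [sub_add_cancel, Finset.mem_filter, sub_add_cancel] at h4
  rw [h4]
  exact ⟨fun h => h.2, fun h => ⟨h3, h⟩⟩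

theorem chain_contour {N : ℕ} {a r : ℕ → D} (hc : M.Comb N a r) {F : Finset (Fin (N + 1))}
    (hN : 2 ≤ N) (hF : Chain hc.pair (· + 1) 0 F) (h0 : 0 ∈ F) :
    (∀ i ∈ F, ∃ n, (hc.turn F)^[n] 0 = i) ∧ ∃ n, (hc.turn F)^[n] 0 = Fin.last N := by
  refine ⟨fun i hi => (hF.conn i hi).exists_iterate, ?_⟩
  refine Conn.exists_iterate (τ := hc.turn F) (Conn.symm ?_ ?_)
  · exact (cut_inj (hc.pair_pair hN) hF.g_mem).comp (add_left_injective 1)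
  · have h1 : hc.turn F (Fin.last N) = 0 := by
      rw [Comb.turn, Fin.last_add_one, cut, if_pos h0]
    exact h1 ▸ Conn.step _ _

end TriSurf

end SimFlip

namespace SimFlip

namespace TriSurf

open BT

variable {V D : Type} {M : TriSurf V D} {z : V} {h : ℕ} {L : Finset V} {c : D}

theorem lab_α (M : TriSurf V D) (d : D) : M.lab (M.α d) = M.lab (M.φ d) := by
  have := M.lab_ν (M.α d)
  rw [M.αα] at this
  exact this.symm

/-- Away from the root label, a label is either on one side or on the other. -/
theorem Side.mem_of_lab_eq (hM : M.Good) {S : Set D} {s : D} (hS : M.Side S s) {d d' : D}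
    (hd : d ∈ S) (hz : M.lab d ≠ M.lab s) (hl : M.lab d' = M.lab d) : d' ∈ S := by
  have h1 := hM.vconn {x | x ∈ S ∧ M.lab x = M.lab d} (fun x hx => ⟨?_, by rw [lab_ν', hx.2]⟩) d
    ⟨hd, rfl⟩ d' hl
  · exact h1.1
  · exact hS.φ_mem _ (hS.α_mem _ hx.1 fun h => hz (by rw [← hx.2, h]))

/-- A piece can be cut into two pieces of prescribed types and a triangle. -/
theorem Piece.exists_split [Finite D] [DecidableEq V] (H : M.Piece c z h L) {K : ℕ}
    (hK : 4 * h + 2 * L.card ≤ 2 ^ K) {h₂ : ℕ} {L₂ : Finset V} (hh : h₂ ≤ h) (hL : L₂ ⊆ L)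
    (hw : 0 < h₂ + L₂.card) (hw' : h₂ + L₂.card < h + L.card) :
    ∃ M' S₁ S₂, Reach (72 * K + 2) M M' ∧ M'.SidePiece S₁ (M'.α (M'.φ c)) z (h - h₂) (L \ L₂) ∧
      M'.SidePiece S₂ (M'.α (M'.φ (M'.φ c))) z h₂ L₂ ∧ Disjoint S₁ S₂ ∧
      c ∉ S₁ ∧ c ∉ S₂ ∧ M'.φ c ∉ S₂ ∧ M'.φ (M'.φ c) ∉ S₁ ∧
      (∀ d, d ∈ S₁ ∨ d ∈ S₂ ∨ d = c ∨ d = M'.φ c ∨ d = M'.φ (M'.φ c)) ∧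
      M'.lab (M'.φ c) = z ∧ M'.lab (M'.φ (M'.φ c)) = z := by
  obtain ⟨N, hN⟩ : ∃ N, N = 4 * h + 2 * L.card := ⟨_, rfl⟩
  have hN2 : 2 ≤ N := hN ▸ H.two_le
  have hLc := Finset.card_le_card hL
  obtain ⟨M₁, a, r, r1, hc, hr, hu⟩ := H.exists_starred_comb hN (hN ▸ hK)
  have H₁ := H.reach r1
  obtain ⟨F, f1, f2, f3, f4⟩ := H₁.exists_cut hc hN hr hu hh hL
  have hF := H₁.isCut hc hN2 hr f2 f1.g_mem
  obtain ⟨g1, g2⟩ := chain_contour hc hN2 f1 f2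
  -- One move makes the chosen letters consecutive. Their partners are among them, so the tree
  -- extends to the whole surface with `f` still at its end.
  obtain ⟨t, l, f, k1, k2, k3, k4, k5, k6, k7⟩ := hc.exists_contour hN2 hF g1 g2 (by
    by_contra! hall
    have : F.card ≤ 1 := Finset.card_le_one.2 fun a ha b hb => by rw [hall a ha, hall b hb]
    omega)
  have hfc : f.length + 1 = F.card := by
    classical
    rw [← List.toFinset_card_of_nodup k5, ← Finset.card_erase_add_one f2]
    congr 1
    symm
    refine Finset.card_bij (fun i _ => sd N a r i) ?_ ?_ ?_
    · intro i hi
      rw [List.mem_toFinset, k6]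
      exact ⟨i, Finset.mem_of_mem_erase hi, Finset.ne_of_mem_erase hi, rfl⟩
    · intro i _ j _ hij
      exact hc.sd_inj hN2 hij
    · intro d hd
      rw [List.mem_toFinset, k6] at hd
      obtain ⟨i, h1, h2, rfl⟩ := hd
      exact ⟨i, Finset.mem_erase.2 ⟨h2, h1⟩, rfl⟩
  set X := hc.others F with hX
  set M₂ := M₁.flip X (hc.flippable_others hN2 hF) with hM₂
  have s2 : Reach 1 M₁ M₂ := Reach.one ⟨_, _, rfl⟩
  have H₂ := H₁.reach s2
  have hα₂ : M₂.α = M₁.α := rfl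
  have hαr : M₁.α (r N) = c := by rw [hr, H₁.fix]
  rw [hαr] at k1 k2 k3 k7
  rw [hr] at k3
  have fα : ∀ d ∈ f, M₂.α d ∈ f := by
    intro d hd
    rw [k6] at hd
    obtain ⟨i, h1, h2, rfl⟩ := hd
    rw [k6, hα₂, hc.α_sd]
    refine ⟨_, f1.g_mem i h1, fun h3 => h2 ?_, rfl⟩
    rw [← hc.pair_pair hN2 i, h3, H₁.pair_zero hc hN2 hr]
  obtain ⟨t₂, l', m1, m2⟩ := k1.exists_span H₂.good le_rfl k2 k3 k4 fun d hd => k7 _ (fα d hd)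
  have hlen := H₂.leaves_length m1
  rw [m2, List.length_append] at hlen
  obtain ⟨tΛ, n1⟩ := exists_leaves_eq (l := l') (by rintro rfl; simp at hlen; omega)
  obtain ⟨tF, n2⟩ := exists_leaves_eq (l := f) (by rintro rfl; simp at hfc; omega)
  -- In the new triangulation the root triangle separates the sides in `f` from the other ones.
  obtain ⟨M', r3, m3, m4, m5, m6⟩ := m1.polygon (t' := .node tΛ tF) (k := K)
    (by rw [m2]; simp [leaves, n1, n2]) (by rw [m2, List.length_append]; omega)
  have H₃ := H₂.reach r3
  have hα₃ : M'.α = M₂.α := r3.α_eq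
  have hf2 : 2 ≤ tF.leaves.length := by rw [n2]; omega
  have hl2 : 2 ≤ tΛ.leaves.length := by rw [n1]; omega
  have fα' : ∀ d ∈ tF.leaves, M'.α d ∈ tF.leaves := by rw [n2, hα₃]; exact fα
  have hs1 := m3.side_left hl2 (by
    intro d hd
    rcases List.mem_cons.1 hd with rfl | hd
    · rw [H₃.fix, H₃.fix]; simp
    · exact List.mem_cons_of_mem _ (fα' d hd))
  have hs2 := m3.side_right hf2 fα'
  have hnd := m3.nodup
  have hmem := m3.mem
  have hh1 := m3.hang.1
  have hh2 := m3.hang.2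
  rw [H₃.fix] at hs1 hs2 hh1 hh2
  simp only [dl, H₃.fix, List.nodup_cons, List.mem_cons, List.mem_append, not_or,
    List.nodup_append] at hnd hmem
  obtain ⟨⟨p1, p2, p3, p4⟩, ⟨p5, p6, p7⟩, ⟨p8, p9⟩, p10, p11, p12⟩ := hnd
  set S₁ : Set D := {d | d ∈ M'.dl (M'.φ c) tΛ} with hS₁
  set S₂ : Set D := {d | d ∈ M'.dl (M'.φ (M'.φ c)) tF} with hS₂
  have hdis : Disjoint S₁ S₂ := Set.disjoint_left.2 fun d h1 h2 => p12 d h1 d h2 rfl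
  have lp : M'.lab (M'.φ c) = z := by rw [← lab_α, H₃.fix, H₃.lab]
  have lαp : M'.lab (M'.α (M'.φ c)) = z := by
    rw [← hs1.lab_φ, M'.lab_ν, lp]
  have lq : M'.lab (M'.φ (M'.φ c)) = z := by rw [← lab_α, lαp]
  have lαq : M'.lab (M'.α (M'.φ (M'.φ c))) = z := by rw [← hs2.lab_φ, M'.lab_ν, lq]
  have hα : ∀ d, d ≠ c → M'.α d ≠ d := H₃.ne
  -- labels of the split sides
  have lf : ∀ d ∈ f, M'.lab d = M₁.lab d := by
    intro d hd
    rw [m4 d (by rw [m2]; simp [hd]), hM₂, flip_lab]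
    rw [k6] at hd
    obtain ⟨i, h1, h2, rfl⟩ := hd
    rw [hX, hc.sd_mem_others hN2]
    exact fun h => h.1 h1
  have hin : ∀ v ∈ L₂, ∃ d ∈ S₂, M'.lab d = v := by
    intro v hv
    have hvz : v ≠ z := fun h => H.notMem (h ▸ hL hv)
    obtain ⟨i, hi, -⟩ := hu v (hL hv)
    have hiF := (f4 i (by rwa [hi])).2 (by rwa [hi])
    have hi0 : i ≠ 0 := by
      rintro rfl
      rw [Comb.sd_zero, hr, H₁.lab] at hi
      exact hvz hi.symm
    have hif : sd N a r i ∈ f := (k6 _).2 ⟨i, hiF, hi0, rfl⟩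
    refine ⟨sd N a r i, ?_, by rw [lf _ hif, hi]⟩
    cases tF with
    | leaf x => simp [leaves] at hf2
    | node u w => exact hh2.mem_dl_of_mem_leaves (n2 ▸ hif)
  have hout : ∀ d ∈ S₂, M'.lab d ≠ z → M'.lab d ∈ L₂ := by
    intro d hd hdz
    obtain ⟨x, hx, hdx⟩ := lab_of_mem_dl hh2 d hd
    rcases List.mem_cons.1 hx with rfl | hx
    · exact absurd (hdx.trans lαq) hdz
    rw [n2] at hx
    rw [hdx, lf _ hx] at hdz ⊢
    obtain ⟨i, h1, h2, rfl⟩ := (k6 _).1 hx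
    exact (f4 i hdz).1 h1
  have c1 := ncard_dl p10
  have c2 := ncard_dl p11
  -- The moves are `48 * K + 1` for the starred fan, one flip and `24 * K` for the polygon.
  refine ⟨M', S₁, S₂, ((r1.trans s2).trans r3).mono (by omega), ⟨hs1, ?_, lαp, ?_, ?_⟩,
    ⟨hs2, ?_, lαq, ?_, ?_⟩, hdis, p3, p4, p7, p8, ?_, lp, lq⟩
  · exact fun d hd => hα d (ne_of_mem_of_not_mem hd (show c ∉ S₁ from p3))
  · intro v
    constructor
    · rintro ⟨d, hd, rfl⟩
      by_cases hz : M'.lab d = z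
      · exact Or.inl hz
      refine Or.inr (Finset.mem_sdiff.2 ⟨((H₃.range _).1 ⟨d, rfl⟩).resolve_left hz, fun h1 => ?_⟩)
      obtain ⟨x, hx, hxd⟩ := hin _ h1
      exact Set.disjoint_left.1 hdis hd
        (hs2.mem_of_lab_eq H₃.good hx (by rw [hxd, lαq]; exact hz) hxd.symm)
    · rintro (rfl | hv)
      · exact ⟨_, hs1.mem, lαp⟩
      · obtain ⟨hv1, hv2⟩ := Finset.mem_sdiff.1 hv
        obtain ⟨d, rfl⟩ := (H₃.range v).2 (Or.inr hv1)
        have hz : M'.lab d ≠ z := fun h => H.notMem (h ▸ hv1)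
        refine ⟨d, ?_, rfl⟩
        rcases hmem d with rfl | rfl | rfl | h1 | h1
        · exact absurd H₃.lab hz
        · exact absurd lp hz
        · exact absurd lq hz
        · exact h1
        · exact absurd (hout d h1 hz) hv2
  · rw [c1, n1, Finset.card_sdiff_of_subset hL]
    omega
  · exact fun d hd => hα d (ne_of_mem_of_not_mem hd (show c ∉ S₂ from p4))
  · intro v
    constructor
    · rintro ⟨d, hd, rfl⟩
      by_cases hz : M'.lab d = z
      · exact Or.inl hz
      · exact Or.inr (hout d hd hz)
    · rintro (rfl | hv)
      · exact ⟨_, hs2.mem, lαq⟩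
      · exact hin v hv
  · rw [c2, n2]
    omega
  · intro d
    rcases hmem d with h1 | h1 | h1 | h1 | h1 <;> simp [hS₁, hS₂, h1]

end TriSurf

end SimFlip

/-! ### Reassembling split surfaces. -/

namespace SimFlip

namespace TriSurf

open BT

variable {V D D' : Type} {M : TriSurf V D} {M' : TriSurf V D'} {z : V} {h : ℕ} {L : Finset V}
  {c : D} {c' : D'}

theorem Side.surf_α_of_eq [Finite D] {S : Set D} {s : D} (hS : M.Side S s) {d : S} (hd : (d : D) = s) :
    hS.surf.α d = d := by
  have h1 : d = ⟨s, hS.mem⟩ := Subtype.ext hd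
  rw [h1, hS.surf_α_self]

/-- Surfaces that are cut in the same way meet if the parts do. -/
theorem Meet.of_split [Finite D] [Finite D'] [DecidableEq V] (H : M.Piece c z h L)
    (H' : M'.Piece c' z h L) {h₁ h₂ : ℕ} {L₁ L₂ : Finset V} {S₁ S₂ : Set D} {S₁' S₂' : Set D'} {k : ℕ}
    (a1 : M.SidePiece S₁ (M.α (M.φ c)) z h₁ L₁) (a2 : M.SidePiece S₂ (M.α (M.φ (M.φ c))) z h₂ L₂)
    (a3 : Disjoint S₁ S₂) (a4 : c ∉ S₁) (a5 : c ∉ S₂) (a6 : M.φ c ∉ S₂) (a7 : M.φ (M.φ c) ∉ S₁)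
    (a8 : ∀ d, d ∈ S₁ ∨ d ∈ S₂ ∨ d = c ∨ d = M.φ c ∨ d = M.φ (M.φ c))
    (a9 : M.lab (M.φ c) = z) (a10 : M.lab (M.φ (M.φ c)) = z)
    (b1 : M'.SidePiece S₁' (M'.α (M'.φ c')) z h₁ L₁)
    (b2 : M'.SidePiece S₂' (M'.α (M'.φ (M'.φ c'))) z h₂ L₂)
    (b3 : Disjoint S₁' S₂') (b4 : c' ∉ S₁') (b5 : c' ∉ S₂') (b6 : M'.φ c' ∉ S₂')
    (b7 : M'.φ (M'.φ c') ∉ S₁')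
    (b8 : ∀ d, d ∈ S₁' ∨ d ∈ S₂' ∨ d = c' ∨ d = M'.φ c' ∨ d = M'.φ (M'.φ c'))
    (b9 : M'.lab (M'.φ c') = z) (b10 : M'.lab (M'.φ (M'.φ c')) = z)
    (hL₁ : z ∉ L₁) (hL₂ : z ∉ L₂)
    (m : ∀ {D D' : Type} [Finite D] [Finite D'] (M : TriSurf V D) (M' : TriSurf V D') (c : D) (c' : D')
      (h₀ : ℕ) (L₀ : Finset V), (h₀ = h₁ ∧ L₀ = L₁ ∨ h₀ = h₂ ∧ L₀ = L₂) →
      M.Piece c z h₀ L₀ → M'.Piece c' z h₀ L₀ → Meet k M M' {(c, c')}) :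
    Meet k M M' {(c, c')} := by
  -- Cutting off `S₁` and then `S₂` leaves a triangle with three free sides, all of whose corners
  -- are labelled `z`.
  have aux : ∀ {D : Type} [Finite D] (M : TriSurf V D) (c : D) (S₁ S₂ : Set D) (H : M.Piece c z h L)
      (a1 : M.SidePiece S₁ (M.α (M.φ c)) z h₁ L₁) (a2 : M.SidePiece S₂ (M.α (M.φ (M.φ c))) z h₂ L₂)
      (a3 : Disjoint S₁ S₂) (a4 : c ∉ S₁) (a5 : c ∉ S₂) (a6 : M.φ c ∉ S₂) (a7 : M.φ (M.φ c) ∉ S₁)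
      (a8 : ∀ d, d ∈ S₁ ∨ d ∈ S₂ ∨ d = c ∨ d = M.φ c ∨ d = M.φ (M.φ c))
      (a9 : M.lab (M.φ c) = z) (a10 : M.lab (M.φ (M.φ c)) = z),
      ∃ (R : a1.side.compl.surf.SidePiece (Subtype.val ⁻¹' S₂) ⟨M.α (M.φ (M.φ c)),
          Set.disjoint_right.1 a3 a2.side.mem⟩ z h₂ L₂)
        (hc : (⟨c, a4⟩ : ↑S₁ᶜ) ∈ (Subtype.val ⁻¹' S₂ : Set ↑S₁ᶜ)ᶜ),
        (∀ d, R.side.compl.surf.α d = d) ∧ (∀ d, R.side.compl.surf.lab d = z) ∧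
        (∀ d, d = ⟨⟨c, a4⟩, hc⟩ ∨ d = R.side.compl.surf.φ ⟨⟨c, a4⟩, hc⟩ ∨
          d = R.side.compl.surf.φ (R.side.compl.surf.φ ⟨⟨c, a4⟩, hc⟩)) := by
    intro D _ M c S₁ S₂ H a1 a2 a3 a4 a5 a6 a7 a8 a9 a10
    have e1 := M.φ_ne c
    have e2 := M.φφ_ne c
    have e3 := M.φ_ne (M.φ c)
    refine ⟨a2.restrict a1.side.compl (Set.disjoint_right.1 a3) (by rw [M.αα]; exact a6), a5, ?_, ?_, ?_⟩
    · rintro ⟨⟨d, hd1⟩, hd2⟩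
      have hcase := ((a8 d).resolve_left hd1).resolve_left hd2
      have hqq : a1.side.compl.surf.α ⟨M.α (M.φ (M.φ c)), Set.disjoint_right.1 a3 a2.side.mem⟩ =
          ⟨M.φ (M.φ c), a7⟩ := by
        apply Subtype.ext
        rw [a1.side.compl.surf_α]
        · exact M.αα _
        · rw [M.αα]
          intro h'
          exact a6 (h' ▸ a2.side.mem)
      by_cases hq : d = M.φ (M.φ c)
      · subst hq
        exact (a2.restrict a1.side.compl (Set.disjoint_right.1 a3)
          (by rw [M.αα]; exact a6)).side.compl.surf_α_of_eq hqq.symm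
      · apply Subtype.ext
        rw [Side.surf_α]
        · apply Subtype.ext
          by_cases hp : d = M.φ c
          · subst hp
            exact congrArg Subtype.val (a1.side.compl.surf_α_of_eq
              (d := ⟨M.φ c, hd1⟩) (M.αα _).symm)
          · have hdc : d = c := by tauto
            subst hdc
            rw [Side.surf_α _ (by rw [M.αα]; exact fun h => hp h)]
            exact H.fix
        · rw [hqq]
          exact fun h' => hq (congrArg Subtype.val h')
    · rintro ⟨⟨d, hd1⟩, hd2⟩
      change M.lab d = z
      rcases ((a8 d).resolve_left hd1).resolve_left hd2 with rfl | rfl | rfl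
      · exact H.lab
      · exact a9
      · exact a10
    · rintro ⟨⟨d, hd1⟩, hd2⟩
      rcases ((a8 d).resolve_left hd1).resolve_left hd2 with rfl | rfl | rfl
      · exact Or.inl rfl
      · exact Or.inr (Or.inl rfl)
      · exact Or.inr (Or.inr rfl)
  obtain ⟨R, hc, u1, u2, u3⟩ := aux M c S₁ S₂ H a1 a2 a3 a4 a5 a6 a7 a8 a9 a10
  obtain ⟨R', hc', v1, v2, v3⟩ := aux M' c' S₁' S₂' H' b1 b2 b3 b4 b5 b6 b7 b8 b9 b10
  have g1 := a1.side.compl.surf_good H.good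
  have g1' := b1.side.compl.surf_good H'.good
  obtain ⟨e, i1, i2, i3, i4⟩ := exists_iso_triangle u1 v1 u2 v2 u3 v3
  -- Besides the free side `c`, the side of the triangle facing `S₁` has to be tracked, since `S₁`
  -- is glued back there.
  refine Meet.of_sides a1.side b1.side
    (m _ _ _ _ h₁ L₁ (Or.inl ⟨rfl, rfl⟩) (a1.piece H.good hL₁) (b1.piece H'.good hL₁)) rfl
    (C₂ := {(⟨M.α (M.α (M.φ c)), a1.side.α_notMem⟩, ⟨M'.α (M'.α (M'.φ c')), b1.side.α_notMem⟩),
      (⟨c, a4⟩, ⟨c', b4⟩)}) ?_ (Or.inl rfl) ?_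
  · refine Meet.of_sides R.side R'.side
      (m _ _ _ _ h₂ L₂ (Or.inr ⟨rfl, rfl⟩) (R.piece g1 hL₂) (R'.piece g1' hL₂)) rfl
      (C₂ := {p | e p.1 = p.2}) ⟨_, _, e, Reach.refl _ _, Reach.refl _ _, i1, fun p hp => hp⟩ ?_ ?_
    · have w : (⟨_, R.side.α_notMem⟩ : ↑(Subtype.val ⁻¹' S₂ : Set ↑S₁ᶜ)ᶜ) =
          R.side.compl.surf.φ (R.side.compl.surf.φ ⟨⟨c, a4⟩, hc⟩) := by
        apply Subtype.ext
        apply Subtype.ext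
        rw [a1.side.compl.surf_α]
        · exact M.αα _
        · rw [M.αα]
          intro h'
          exact a6 (h' ▸ a2.side.mem)
      have w' : (⟨_, R'.side.α_notMem⟩ : ↑(Subtype.val ⁻¹' S₂' : Set ↑S₁'ᶜ)ᶜ) =
          R'.side.compl.surf.φ (R'.side.compl.surf.φ ⟨⟨c', b4⟩, hc'⟩) := by
        apply Subtype.ext
        apply Subtype.ext
        rw [b1.side.compl.surf_α]
        · exact M'.αα _
        · rw [M'.αα]
          intro h'
          exact b6 (h' ▸ b2.side.mem)
      rw [w, w']
      exact i4
    · rintro p (rfl | rfl)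
      · have x1 : M.α (M.α (M.φ c)) ∉ S₂ := by rwa [M.αα]
        have x2 : M'.α (M'.α (M'.φ c')) ∉ S₂' := by rwa [M'.αα]
        refine ⟨x1, x2, ?_⟩
        rw [Set.mem_ofPred_eq]
        convert i3 using 1
        · congr 1
          apply Subtype.ext
          apply Subtype.ext
          exact M.αα _
        · apply Subtype.ext
          apply Subtype.ext
          exact M'.αα _
      · exact ⟨hc, hc', i2⟩
  · rintro p rfl
    exact ⟨a4, b4, Or.inr rfl⟩

/-- Four letters around a one-vertex polygon with one free side. -/
theorem pair_eq_of_handle {g g' : Fin 5 → Fin 5} (hg : ∀ i, g (g i) = i) (h0 : g 0 = 0)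
    (hne : ∀ i, i ≠ 0 → g i ≠ i) (hs : ∀ i, g (i + 1) ≠ i)
    (hg' : ∀ i, g' (g' i) = i) (h0' : g' 0 = 0)
    (hne' : ∀ i, i ≠ 0 → g' i ≠ i) (hs' : ∀ i, g' (i + 1) ≠ i) (i : Fin 5) : g i = g' i := by
  -- Neighbouring letters must not be folded together, which leaves only the pattern of a
  -- commutator.
  have key : ∀ g : Fin 5 → Fin 5, (∀ i, g (g i) = i) → g 0 = 0 → (∀ i, i ≠ 0 → g i ≠ i) →
      (∀ i, g (i + 1) ≠ i) → g 1 = 3 ∧ g 2 = 4 ∧ g 3 = 1 ∧ g 4 = 2 := by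
    intro g hg h0 hne hs
    have n1 := hne 1 (by decide)
    have n2 := hne 2 (by decide)
    have s1 := hs 1
    have s2 := hs 2
    have g0 := hg 0
    have g1 := hg 1
    have g2 := hg 2
    have g3 := hg 3
    have g4 := hg 4
    simp only [show (1 : Fin 5) + 1 = 2 by decide, show (2 : Fin 5) + 1 = 3 by decide] at s1 s2
    generalize hx : g 1 = x at *
    generalize hy : g 2 = y at *
    fin_cases x <;> fin_cases y <;> simp_all
  obtain ⟨k1, k2, k3, k4⟩ := key g hg h0 hne hs
  obtain ⟨l1, l2, l3, l4⟩ := key g' hg' h0' hne' hs'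
  fin_cases i
  · exact h0.trans h0'.symm
  · exact k1.trans l1.symm
  · exact k2.trans l2.symm
  · exact k3.trans l3.symm
  · exact k4.trans l4.symm

end TriSurf

end SimFlip

/-! ### The recursion for pieces. -/

namespace SimFlip

namespace TriSurf

open BT

variable {V D D' : Type} {M : TriSurf V D} {M' : TriSurf V D'} {z : V} {h : ℕ} {L : Finset V}
  {c : D} {c' : D'}

/-- Pieces with one handle or one label besides `z`. -/
theorem Piece.meet_one [Finite D] [Finite D'] (H : M.Piece c z h L) (H' : M'.Piece c' z h L) {K : ℕ}
    (hK : 4 * h + 2 * L.card ≤ 2 ^ K) (hw : h + L.card = 1) : Meet (24 * K) M M' {(c, c')} := by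
  obtain ⟨M₁, a, r, r1, hc, hr⟩ := H.exists_comb hK
  obtain ⟨M₁', a', r', r1', hc', hr'⟩ := H'.exists_comb hK
  have H₁ := H.reach r1
  have H₁' := H'.reach r1'
  suffices hs : ∃ e, Iso M₁ M₁' e ∧ e c = c' by
    obtain ⟨e, h1, h2⟩ := hs
    exact ⟨M₁, M₁', e, r1, r1', h1, by rintro p rfl; exact h2⟩
  -- For one label, the fan is a single triangle with two sides folded together. For one handle, all
  -- labels are `z`, so a folded pair, which would enclose a vertex of its own, cannot occur.
  rcases Nat.eq_zero_or_pos h with rfl | hh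
  · obtain ⟨b, rfl⟩ := Finset.card_eq_one.1 (by omega : L.card = 1)
    have hbz : b ≠ z := fun h => H.notMem (by simp [h])
    have hN : 4 * 0 + 2 * ({b} : Finset V).card = 2 := by simp
    rw [hN] at hc hr hc' hr'
    have key : ∀ {D : Type} [Finite D] (M : TriSurf V D) (c : D) (a r : ℕ → D) (hc : M.Comb 2 a r)
        (hr : r 2 = c) (H : M.Piece c z 0 {b}), hc.pair 0 = 0 ∧ hc.pair 1 = 2 ∧ hc.pair 2 = 1 ∧
        M.lab (sd 2 a r 0) = z ∧ M.lab (sd 2 a r 1) = z ∧ M.lab (sd 2 a r 2) = b := by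
      intro D _ M c a r hc hr H
      have p0 := H.pair_zero hc le_rfl hr
      have p1 := H.pair_ne hc le_rfl hr (i := 1) (by decide)
      have p2 := H.pair_ne hc le_rfl hr (i := 2) (by decide)
      have pp0 := hc.pair_pair le_rfl 0
      have pp1 := hc.pair_pair le_rfl 1
      have pp2 := hc.pair_pair le_rfl 2
      have l0 : M.lab (sd 2 a r 0) = z := by rw [Comb.sd_zero, hr, H.lab]
      have l1 : M.lab (sd 2 a r 1) = z := by
        rw [Comb.sd_of_pos (by decide)]; exact H.lab_one hc le_rfl hr
      have q1 : hc.pair 1 = 2 := by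
        generalize hx : hc.pair 1 = x at *
        fin_cases x
        · exact absurd (p0.symm.trans pp1) (by decide)
        · exact absurd rfl p1
        · rfl
      refine ⟨p0, q1, by rw [← q1, pp1], l0, l1, ?_⟩
      obtain ⟨d, hd⟩ := (H.range b).2 (by simp)
      rcases hc.dart_cases d with ⟨i, rfl⟩ | ⟨j, h1, h2, -⟩
      · fin_cases i
        · exact absurd (hd.symm.trans l0) hbz
        · exact absurd (hd.symm.trans l1) hbz
        · exact hd
      · omega
    obtain ⟨k0, k1, k2, k3, k4, k5⟩ := key M₁ c a r hc hr H₁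
    obtain ⟨l0, l1, l2, l3, l4, l5⟩ := key M₁' c' a' r' hc' hr' H₁'
    obtain ⟨e, h1, h2⟩ := hc.exists_iso hc' le_rfl (by
      intro i
      fin_cases i
      · exact k0.trans l0.symm
      · exact k1.trans l1.symm
      · exact k2.trans l2.symm) (by
      intro i
      fin_cases i
      · exact l3.trans k3.symm
      · exact l4.trans k4.symm
      · exact l5.trans k5.symm)
    exact ⟨e, h1, by rw [← hr, h2, hr']⟩
  · obtain rfl : h = 1 := by omega
    obtain rfl : L = ∅ := Finset.card_eq_zero.1 (by omega)
    have hN : 4 * 1 + 2 * (∅ : Finset V).card = 4 := by simp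
    rw [hN] at hc hr hc' hr'
    have key : ∀ {D : Type} [Finite D] (M : TriSurf V D) (c : D) (a r : ℕ → D) (hc : M.Comb 4 a r)
        (hr : r 4 = c) (H : M.Piece c z 1 ∅), (∀ i, hc.pair (i + 1) ≠ i) ∧ ∀ d, M.lab d = z := by
      intro D _ M c a r hc hr H
      have hl : ∀ d, M.lab d = z := fun d => by
        have := (H.range _).1 ⟨d, rfl⟩
        simpa using this
      refine ⟨fun i hi => ?_, hl⟩
      have := hc.mem_of_lab_eq (by norm_num) H.good (Q := {i}) (by rintro _ rfl; exact hi)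
        (i := i) (j := i + 1) rfl (by rw [hl, hl])
      have h2 : i + 1 = i := this
      simp at h2
    obtain ⟨k1, k2⟩ := key M₁ c a r hc hr H₁
    obtain ⟨l1, l2⟩ := key M₁' c' a' r' hc' hr' H₁'
    obtain ⟨e, h1, h2⟩ := hc.exists_iso hc' (by norm_num)
      (pair_eq_of_handle (hc.pair_pair (by norm_num)) (H₁.pair_zero hc (by norm_num) hr)
        (fun _ => H₁.pair_ne hc (by norm_num) hr) k1 (hc'.pair_pair (by norm_num))
        (H₁'.pair_zero hc' (by norm_num) hr') (fun _ => H₁'.pair_ne hc' (by norm_num) hr') l1)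
      (fun i => by rw [k2, l2])
    exact ⟨e, h1, by rw [← hr, h2, hr']⟩

/-- Pieces of the same type are related by few flips. -/
theorem Piece.meet (K k : ℕ) : ∀ {D D' : Type} [Finite D] [Finite D'] (M : TriSurf V D)
    (M' : TriSurf V D') (c : D) (c' : D') (h : ℕ) (L : Finset V), M.Piece c z h L → M'.Piece c' z h L →
    4 * h + 2 * L.card ≤ 2 ^ K → h + L.card ≤ 2 ^ k →
    Meet (k * (72 * K + 2) + 24 * K) M M' {(c, c')} := by
  classical
  induction k with
  | zero =>
    intro D D' _ _ M M' c c' h L H H' hK hw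
    have := H.two_le
    exact (H.meet_one H' hK (by simp at hw; omega)).mono (by omega)
  | succ k ih =>
    intro D D' _ _ M M' c c' h L H H' hK hw
    have h1 : (k + 1) * (72 * K + 2) + 24 * K = (72 * K + 2) + (k * (72 * K + 2) + 24 * K) := by ring
    rcases Nat.lt_or_ge (2 ^ k) (h + L.card) with hlt | hge
    swap
    · exact (ih M M' c c' h L H H' hK hge).mono (by omega)
    have hpos : 0 < 2 ^ k := by positivity
    rw [pow_succ] at hw
    -- A part of weight exactly `2 ^ k` is split off, taking handles first and then labels; the
    -- remaining weight is at most `2 ^ k` as well.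
    obtain ⟨h₂, hh₂⟩ : ∃ h₂, h₂ = min h (2 ^ k) := ⟨_, rfl⟩
    obtain ⟨L₂, hL, hLc⟩ := Finset.exists_subset_card_eq (s := L) (n := 2 ^ k - h₂) (by omega)
    have hsd := Finset.card_sdiff_of_subset hL
    have hle := Finset.card_le_card hL
    obtain ⟨N, S₁, S₂, r, a1, a2, a3, a4, a5, a6, a7, a8, a9, a10⟩ :=
      H.exists_split hK (h₂ := h₂) (L₂ := L₂) (by omega) hL (by omega) (by omega)
    obtain ⟨N', S₁', S₂', r', b1, b2, b3, b4, b5, b6, b7, b8, b9, b10⟩ :=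
      H'.exists_split hK (h₂ := h₂) (L₂ := L₂) (by omega) hL (by omega) (by omega)
    rw [h1]
    refine Meet.of_reach r r' (Meet.of_split (H.reach r) (H'.reach r') a1 a2 a3 a4 a5 a6 a7 a8 a9 a10
      b1 b2 b3 b4 b5 b6 b7 b8 b9 b10 (fun h => H.notMem (Finset.mem_sdiff.1 h).1)
      (fun h => H.notMem (hL h)) ?_)
    intro D D' _ _ M M' c c' h₀ L₀ hcase P P'
    rcases hcase with ⟨rfl, rfl⟩ | ⟨rfl, rfl⟩
    · exact ih M M' c c' _ _ P P' (by omega) (by omega)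
    · exact ih M M' c c' _ _ P P' (by omega) (by omega)

end TriSurf

end SimFlip

/-! ### Closed surfaces. -/

namespace SimFlip

namespace TriSurf

open BT

variable {V D D' : Type} {M : TriSurf V D} {M' : TriSurf V D'} {z : V} {g : ℕ} {L : Finset V}

/-- A surface without boundary. -/
structure Closed (M : TriSurf V D) (g : ℕ) (L : Finset V) : Prop where
  good : M.Good
  ne : ∀ d, M.α d ≠ d
  range : ∀ v, (∃ d, M.lab d = v) ↔ v ∈ L
  card : Nat.card D + 12 = 12 * g + 6 * L.card

theorem Closed.reach [Finite D] {M' : TriSurf V D} {k : ℕ} (H : M.Closed g L)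
    (hr : Reach k M M') : M'.Closed g L where
  good := hr.good H.good
  ne d := by rw [hr.α_eq]; exact H.ne d
  range v := by
    rw [← H.range v]
    exact Set.ext_iff.1 hr.lab_range v
  card := H.card

/-- A set that refutes `Returns` is a part of the surface attached along the edge of `e` only. -/
theorem side_of_not_returns {e : D} (h : ¬ M.Returns e) : ∃ S, M.Side S (M.α e) := by
  unfold Returns at h
  push Not at h
  obtain ⟨S, h1, h2, h3, h4⟩ := h
  exact ⟨S, h1, by rwa [M.αα], h3, h2⟩

/-- Some side does not separate the surface. -/
theorem exists_returns [Finite D] [Nonempty D] : ∃ e, M.Returns e := by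
  by_contra! hall
  obtain ⟨d⟩ := ‹Nonempty D›
  obtain ⟨S₀, hS₀⟩ := side_of_not_returns (hall d)
  -- If all sides separate, take a smallest part `S` that is cut off. The next side `φ s` of the
  -- triangle at `s` also separates; its part `T` that avoids `s` makes `T ∩ S` a smaller part.
  obtain ⟨⟨S, s⟩, hS, hmin⟩ := Set.exists_min_image {p : Set D × D | M.Side p.1 p.2}
    (fun p => p.1.ncard) (Set.toFinite _) ⟨(S₀, _), hS₀⟩
  simp only [Set.mem_ofPred_eq] at hS hmin
  have hp : M.φ s ∈ S := hS.φ_mem _ hS.mem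
  obtain ⟨T, x, hT, hsT, hx⟩ : ∃ T x, M.Side T x ∧ s ∉ T ∧ (x = M.φ s ∨ x = M.α (M.φ s)) := by
    obtain ⟨T, hT⟩ := side_of_not_returns (hall (M.φ s))
    by_cases hs : s ∈ T
    · exact ⟨Tᶜ, _, hT.compl, by simpa using hs, Or.inl (M.αα _)⟩
    · exact ⟨T, _, hT, hs, Or.inr rfl⟩
  have hpT : M.φ s ∉ T := fun h => hsT (by
    have := hT.φ_mem _ (hT.φ_mem _ h)
    rwa [M.φφφ] at this)
  obtain rfl : x = M.α (M.φ s) := hx.resolve_left fun h => hpT (h ▸ hT.mem)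
  have hTS : M.Side (T ∩ S) (M.α (M.φ s)) := by
    refine ⟨⟨hT.mem, hS.α_mem _ hp (M.φ_ne s)⟩, fun h => hpT (by rw [← M.αα (M.φ s)]; exact h.1), ?_,
      fun d hd => ⟨hT.φ_mem _ hd.1, hS.φ_mem _ hd.2⟩⟩
    exact fun d hd hde => ⟨hT.α_mem _ hd.1 hde, hS.α_mem _ hd.2 fun h => hsT (h ▸ hd.1)⟩
  have h1 := hmin (T ∩ S, _) hTS
  have h2 : (T ∩ S).ncard < S.ncard := Set.ncard_lt_ncard
    ⟨Set.inter_subset_right, fun h => hsT (h hS.mem).1⟩ (Set.toFinite _)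
  exact absurd h1 (not_le.2 h2)

/-- Cut surfaces meet if they are of the same type. -/
theorem Meet.of_sidePieces [Finite D] [Finite D'] (hM : M.Good) (hM' : M'.Good) {S : Set D} {s : D}
    {S' : Set D'} {s' : D'} {h₁ h₂ : ℕ} {L₁ L₂ : Finset V} (a1 : M.SidePiece S s z h₁ L₁)
    (a2 : M.SidePiece Sᶜ (M.α s) z h₂ L₂) (b1 : M'.SidePiece S' s' z h₁ L₁)
    (b2 : M'.SidePiece S'ᶜ (M'.α s') z h₂ L₂) (hL₁ : z ∉ L₁) (hL₂ : z ∉ L₂) {K k : ℕ}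
    (hK₁ : 4 * h₁ + 2 * L₁.card ≤ 2 ^ K) (hK₂ : 4 * h₂ + 2 * L₂.card ≤ 2 ^ K)
    (hk₁ : h₁ + L₁.card ≤ 2 ^ k) (hk₂ : h₂ + L₂.card ≤ 2 ^ k) :
    Meet (k * (72 * K + 2) + 24 * K) M M' ∅ :=
  Meet.of_sides a1.side b1.side
    (Piece.meet K k _ _ _ _ _ _ (a1.piece hM hL₁) (b1.piece hM' hL₁) hK₁ hk₁) rfl
    (Piece.meet K k _ _ _ _ _ _ (a2.piece hM hL₂) (b2.piece hM' hL₂) hK₂ hk₂) rfl (by simp)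

theorem Closed.pair_ne {N : ℕ} {a r : ℕ → D} (H : M.Closed g L) (hc : M.Comb N a r)
    (i : Fin (N + 1)) : hc.pair i ≠ i := fun h1 => by
  have h2 := hc.α_sd i
  rw [h1] at h2
  exact H.ne _ h2

/-- An edge with ends of different labels does not separate, because separating sides are loops
(`Side.lab_φ`); opening the surface there gives a fan with centre `z`. Once `z` dominates, the star
of `b` is a disc cut open along an edge `y`, and in a polygon extending it `y` and `α y` are
neighbouring sides. A triangle on these two sides encloses `b` in a loop at `z`. -/
theorem Closed.exists_cone [Finite D] [DecidableEq V] (H : M.Closed g L) {b : V} (hz : z ∈ L)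
    (hb : b ∈ L) (hzb : b ≠ z) (hg : 3 ≤ 2 * g + L.card) {K : ℕ} (hK : 4 * g + 2 * L.card ≤ 2 ^ K) :
    ∃ M' S s, Reach (72 * K + 1) M M' ∧ M'.SidePiece S s z g ((L.erase z).erase b) ∧
      M'.SidePiece Sᶜ (M'.α s) z 0 {b} := by
  have hL1 := Finset.card_erase_add_one hz
  have hL2 := Finset.card_erase_add_one (Finset.mem_erase.2 ⟨hzb, hb⟩)
  have hcard := H.card
  -- an edge from `z` to another label
  obtain ⟨e, he, hαe⟩ : ∃ e, M.lab e = z ∧ M.lab (M.α e) ≠ z := by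
    by_contra! hall
    obtain ⟨d, hd⟩ := (H.range z).2 hz
    have h1 := H.good.conn {d | M.lab d = z} ⟨d, hd⟩ hall (fun d hd => by
      rw [Set.mem_ofPred_eq, ← lab_α]; exact hall d hd)
    obtain ⟨d', hd'⟩ := (H.range b).2 hb
    have h2 : d' ∈ {d | M.lab d = z} := h1 ▸ Set.mem_univ _
    exact hzb (hd'.symm.trans h2)
  have hret : M.Returns e := by
    by_contra hr
    obtain ⟨S, hS⟩ := side_of_not_returns hr
    have h1 := hS.lab_φ
    rw [M.lab_ν, he] at h1
    exact hαe h1.symm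
  obtain ⟨t, ht⟩ := exists_span_of_returns H.good hret
  obtain ⟨N, hN⟩ : ∃ N, t.leaves.length = N := ⟨_, rfl⟩
  have hN' := ht.card
  obtain ⟨M₁, a, r, r1, hc, hr, -, -, hle⟩ := ht.exists_comb hN (k := K) (by omega)
  have H₁ := H.reach r1
  have hN2 : 2 ≤ N := by omega
  have hF : hc.IsCut {0, hc.pair 0} := ⟨by simp, by simp [hc.pair_pair hN2],
    fun i _ => H₁.pair_ne hc i⟩
  have hD := hc.dom_flip hN2 hF
  have ha1 : M₁.lab (a 1) = z := by
    rw [← hc.lab_αr (by omega) le_rfl, hr, r1.α_eq, M.αα, hle, he]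
  rw [ha1] at hD
  have r2 : Reach 1 M₁ (M₁.flip _ (hc.flippable_others hN2 hF)) := Reach.one ⟨_, _, rfl⟩
  have H₂ := H₁.reach r2
  set M₂ := M₁.flip _ (hc.flippable_others hN2 hF)
  obtain ⟨y, hy⟩ := (H₂.range b).2 hb
  obtain ⟨m, c1, c2, c3, c4, l, c5⟩ := exists_star H₂.good hD (y := y) (by rwa [hy])
  have lαy : M₂.lab (M₂.α y) = z := c4 _ (by simp [c5])
  have hang : M₂.Hang (M₂.α y) (.node (.leaf (M₂.φ y)) (M₂.chain m y)) := by
    refine ⟨?_, ?_⟩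
    · rw [M₂.αα]; rfl
    · rw [M₂.αα]; exact hang_chain M₂ m y
  have hdl : M₂.dl (M₂.α y) (.node (.leaf (M₂.φ y)) (M₂.chain m y)) = M₂.chainDarts m y := by
    simp [dl, M₂.αα, chainDarts]
  obtain ⟨t₂, l', m1, m2⟩ := hang.exists_span H₂.good (F := [M₂.α y])
    (l := M₂.φ y :: l) le_rfl (by rwa [hdl])
    (hang.mem_dl_of_mem_leaves (by simp [leaves, c5])) (by simp [leaves, c5]) (by
      intro f hf
      rw [List.mem_singleton.1 hf, M₂.αα, hdl]
      simp [chainDarts])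
  have hlen := m1.card
  have hlen' : t₂.leaves.length = l'.length + 1 := by rw [m2]; simp
  obtain ⟨tΛ, n1⟩ := exists_leaves_eq (l := l') (by rintro rfl; simp at hlen'; omega)
  obtain ⟨M', r3, m3, m4, m5, m6⟩ := m1.polygon (t' := .node tΛ (.leaf (M₂.α y))) (k := K)
    (by rw [m2]; simp [leaves, n1]) (by omega)
  have H₃ := H₂.reach r3
  have hα₃ : M'.α = M₂.α := r3.α_eq
  rw [← hα₃] at m3 m6
  have hyb : M'.lab y = b := by rw [M₂.αα] at m5; rw [m5, hy]
  rw [hα₃, lαy, ← hα₃] at m6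
  have hs := m3.side_left (by rw [n1]; omega) (by simp [leaves, M'.αα])
  have hnd := m3.nodup
  have hmem := m3.mem
  have hq : M'.φ (M'.φ y) = M'.α y := by
    have := m3.hang.2
    rwa [M'.αα] at this
  rw [M'.αα] at hs
  simp only [dl, M'.αα, List.nodup_cons, List.mem_cons, List.append_nil, not_or] at hnd hmem
  obtain ⟨⟨p1, p2, p3⟩, ⟨p4, p5⟩, p6, p7⟩ := hnd
  set S : Set D := {d | d ∈ M'.dl (M'.φ y) tΛ} with hS
  have lq : M'.lab (M'.φ (M'.φ y)) = z := by rw [hq, m6]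
  have lp : M'.lab (M'.φ y) = z := by rw [← lab_α, m6]
  have lαp : M'.lab (M'.α (M'.φ y)) = z := by rw [lab_α, lq]
  have hby : ∀ d, M'.lab d = b → d = y := fun d hd =>
    H₃.good.vconn {y} (fun x hx => by
      rw [Set.mem_singleton_iff.1 hx]; change M'.φ (M'.α y) = y; rw [← hq, M'.φφφ]) y rfl d
      (by rw [hd, hyb])
  have hcompl : ∀ d, d ∈ Sᶜ ↔ d = y ∨ d = M'.φ y ∨ d = M'.φ (M'.φ y) := by
    intro d
    constructor
    · intro hd
      rcases hmem d with h | h | h | h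
      · exact Or.inl h
      · exact Or.inr (Or.inl h)
      · exact Or.inr (Or.inr h)
      · exact absurd h hd
    · rintro (rfl | rfl | rfl)
      · exact p3
      · exact p5
      · exact p6
  have hc1 := ncard_dl p7
  rw [n1] at hc1
  have hc2 : S.ncard + Sᶜ.ncard = Nat.card D := Set.ncard_add_ncard_compl S
  refine ⟨M', S, _, ((r1.trans r2).trans r3).mono (by omega), ⟨hs, fun d _ => H₃.ne d, lαp, ?_, ?_⟩,
    hs.compl, fun d _ => H₃.ne d, by rw [M'.αα, lp], ?_, ?_⟩
  · intro v
    constructor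
    · rintro ⟨d, hd, rfl⟩
      by_cases hz : M'.lab d = z
      · exact Or.inl hz
      · exact Or.inr (Finset.mem_erase.2 ⟨fun h => p3 (show y ∈ S from hby d h ▸ hd),
          Finset.mem_erase.2 ⟨hz, (H₃.range _).1 ⟨d, rfl⟩⟩⟩)
    · rintro (rfl | hv)
      · exact ⟨_, hs.mem, lαp⟩
      · obtain ⟨h1, h2⟩ := Finset.mem_erase.1 hv
        obtain ⟨h3, h4⟩ := Finset.mem_erase.1 h2
        obtain ⟨d, rfl⟩ := (H₃.range v).2 h4
        refine ⟨d, ?_, rfl⟩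
        by_contra hd
        rcases (hcompl d).1 hd with rfl | rfl | rfl
        · exact h1 hyb
        · exact h3 lp
        · exact h3 lq
  · change S.ncard + 3 = _ at hc1
    omega
  · intro v
    rw [Finset.mem_singleton]
    constructor
    · rintro ⟨d, hd, rfl⟩
      rcases (hcompl d).1 hd with rfl | rfl | rfl
      · exact Or.inr hyb
      · exact Or.inl lp
      · exact Or.inl lq
    · rintro (rfl | rfl)
      · exact ⟨_, (hcompl _).2 (Or.inr (Or.inl rfl)), lp⟩
      · exact ⟨_, (hcompl _).2 (Or.inl rfl), hyb⟩
  · change S.ncard + 3 = _ at hc1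
    simp
    omega

/-- With a single vertex all corners form one orbit, so `Chain` holds with nothing opened. Opening a
handle that contains side 0 gives four letters: the root side and the three sides that one flip
gathers at the end of the leaves. -/
theorem Closed.exists_handle [Finite D] (H : M.Closed g {z}) (hg : 2 ≤ g) {K : ℕ}
    (hK : 4 * g + 2 ≤ 2 ^ K) :
    ∃ M' S s, Reach (72 * K + 1) M M' ∧ M'.SidePiece S s z (g - 1) ∅ ∧
      M'.SidePiece Sᶜ (M'.α s) z 1 ∅ := by
  have hcard := H.card
  have hne : Nonempty D := by
    by_contra h
    rw [not_nonempty_iff] at h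
    rw [Nat.card_of_isEmpty] at hcard
    simp at hcard
    omega
  obtain ⟨e, hret⟩ := exists_returns (M := M)
  obtain ⟨t, ht⟩ := exists_span_of_returns H.good hret
  obtain ⟨N, hN⟩ : ∃ N, t.leaves.length = N := ⟨_, rfl⟩
  have hN' := ht.card
  simp only [Finset.card_singleton] at hcard
  obtain ⟨M₁, a, r, r1, hc, hr, -⟩ := ht.exists_comb hN (k := K) (by omega)
  have H₁ := H.reach r1
  have hN2 : 2 ≤ N := by omega
  have hl₁ : ∀ d, M₁.lab d = z := fun d => by simpa using (H₁.range _).1 ⟨d, rfl⟩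
  have hconn : ∀ x, Conn (fun x => cut hc.pair ∅ (x + 1)) 0 x := fun x A hA h0 =>
    hc.mem_of_lab_eq hN2 H₁.good (fun i hi => by simpa [cut] using hA i hi) h0 (by rw [hl₁, hl₁])
  have hch : Chain hc.pair (· + 1) 0 ∅ := ⟨by simp, by simp, fun x hx => absurd (hconn x) hx⟩
  obtain ⟨F, -, f0, f1, f2, -⟩ := hch.exists_handle (hc.pair_pair hN2) (add_left_injective 1)
    add_one_transitive (i := 0) (by simp) (H₁.pair_ne hc 0) (hconn _) (hconn _)
  have hF : hc.IsCut F := ⟨f0, f1.g_mem, fun i _ => H₁.pair_ne hc i⟩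
  obtain ⟨g1, g2⟩ := chain_contour hc hN2 f1 f0
  obtain ⟨t, l, f, k1, k2, k3, k4, k5, k6, k7⟩ := hc.exists_contour hN2 hF g1 g2
    ⟨hc.pair 0, f1.g_mem 0 f0, H₁.pair_ne hc 0⟩
  have hfc : f.length + 1 = F.card := by
    classical
    rw [← List.toFinset_card_of_nodup k5, ← Finset.card_erase_add_one f0]
    congr 1
    symm
    refine Finset.card_bij (fun i _ => sd N a r i) ?_ ?_ ?_
    · intro i hi
      rw [List.mem_toFinset, k6]
      exact ⟨i, Finset.mem_of_mem_erase hi, Finset.ne_of_mem_erase hi, rfl⟩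
    · intro i _ j _ hij
      exact hc.sd_inj hN2 hij
    · intro d hd
      rw [List.mem_toFinset, k6] at hd
      obtain ⟨i, h1, h2, rfl⟩ := hd
      exact ⟨i, Finset.mem_erase.2 ⟨h2, h1⟩, rfl⟩
  have r2 : Reach 1 M₁ (M₁.flip _ (hc.flippable_others hN2 hF)) := Reach.one ⟨_, _, rfl⟩
  have H₂ := H₁.reach r2
  set M₂ := M₁.flip _ (hc.flippable_others hN2 hF)
  have hα₂ : M₂.α = M₁.α := rfl
  have fα : ∀ d ∈ r N :: f, M₁.α d ∈ r N :: f := by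
    have key : ∀ i ∈ F, sd N a r i ∈ r N :: f := by
      intro i hi
      by_cases h0 : i = 0
      · rw [h0, Comb.sd_zero]; simp
      · exact List.mem_cons_of_mem _ ((k6 _).2 ⟨i, hi, h0, rfl⟩)
    have key' : ∀ d ∈ r N :: f, ∃ i ∈ F, d = sd N a r i := by
      intro d hd
      rcases List.mem_cons.1 hd with rfl | hd
      · exact ⟨0, f0, Comb.sd_zero.symm⟩
      · obtain ⟨i, h1, -, h3⟩ := (k6 d).1 hd
        exact ⟨i, h1, h3⟩
    intro d hd
    obtain ⟨i, hi, rfl⟩ := key' d hd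
    rw [hc.α_sd]
    exact key _ (f1.g_mem i hi)
  have hef : M₁.α (r N) ∈ f := by
    rcases List.mem_cons.1 (fα (r N) (by simp)) with h | h
    · exact absurd h (H₁.ne _)
    · exact h
  obtain ⟨t₂, l', m1, m2⟩ := k1.exists_span H₂.good le_rfl k2 (k7 _ hef) k4 (by
    intro d hd
    rcases List.mem_cons.1 (fα d (List.mem_cons_of_mem _ hd)) with h | h
    · rw [hα₂, h]; exact k3
    · exact k7 _ h)
  have hlen := m1.card
  have hlen' : t₂.leaves.length = l'.length + f.length := by rw [m2]; simp
  simp only [Finset.card_empty] at f2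
  obtain ⟨tΛ, n1⟩ := exists_leaves_eq (l := l') (by rintro rfl; simp at hlen'; omega)
  obtain ⟨tF, n2⟩ := exists_leaves_eq (l := f) (by rintro rfl; simp at hfc; omega)
  obtain ⟨M', r3, m3, -⟩ := m1.polygon (t' := .node tΛ tF) (k := K)
    (by rw [m2]; simp [leaves, n1, n2]) (by omega)
  have H₃ := H₂.reach r3
  have hα₃ : M'.α = M₁.α := r3.α_eq
  have hs := m3.side_left (by rw [n1]; omega) (by rw [n2, hα₃, M₁.αα]; exact fα)
  have hnd := m3.nodup
  simp only [dl, List.nodup_cons, List.mem_cons, List.mem_append, not_or, List.nodup_append] at hnd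
  obtain ⟨-, -, -, p10, -⟩ := hnd
  set S : Set D := {d | d ∈ M'.dl (M'.φ (M'.α (M₁.α (r N)))) tΛ} with hS
  have hl : ∀ d, M'.lab d = z := fun d => by simpa using (H₃.range _).1 ⟨d, rfl⟩
  have hc1 := ncard_dl p10
  rw [n1] at hc1
  change S.ncard + 3 = _ at hc1
  have hc2 : S.ncard + Sᶜ.ncard = Nat.card D := Set.ncard_add_ncard_compl S
  have hrange : ∀ (T : Set D) (x : D), x ∈ T → ∀ v, (∃ d ∈ T, M'.lab d = v) ↔ v = z ∨ v ∈ (∅ : Finset V) := by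
    intro T x hx v
    simp only [Finset.notMem_empty, or_false]
    exact ⟨fun ⟨d, _, hd⟩ => hd ▸ hl d, fun h => ⟨x, hx, by rw [hl, h]⟩⟩
  refine ⟨M', S, _, ((r1.trans r2).trans r3).mono (by omega), ⟨hs, fun d _ => H₃.ne d, hl _,
    hrange _ _ hs.mem, ?_⟩, hs.compl, fun d _ => H₃.ne d, hl _, hrange _ _ hs.α_notMem, ?_⟩
  · simp; omega
  · simp; omega

/-- The one-vertex triangulation of the torus is unique. -/
theorem Closed.meet_torus [Finite D] [Finite D'] (H : M.Closed 1 {z}) (H' : M'.Closed 1 {z}) :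
    Meet 48 M M' ∅ := by
  have key : ∀ {D : Type} [Finite D] (M : TriSurf V D) (_ : M.Closed 1 {z}), ∃ M' a r, Reach 48 M M' ∧
      ∃ hc : M'.Comb 3 a r, (∀ d, M'.lab d = z) ∧ hc.pair 0 = 2 ∧ hc.pair 1 = 3 ∧ hc.pair 2 = 0 ∧
        hc.pair 3 = 1 := by
    intro D _ M H
    have hcard := H.card
    have hne : Nonempty D := by
      by_contra h
      rw [not_nonempty_iff] at h
      rw [Nat.card_of_isEmpty] at hcard
      simp at hcard
    obtain ⟨e, hret⟩ := exists_returns (M := M)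
    obtain ⟨t, ht⟩ := exists_span_of_returns H.good hret
    have hN' := ht.card
    simp only [Finset.card_singleton] at hcard
    obtain ⟨M₁, a, r, r1, hc, hr, -⟩ := ht.exists_comb (N := 3) (k := 2) (by omega) (by norm_num)
    have H₁ := H.reach r1
    have hl : ∀ d, M₁.lab d = z := fun d => by simpa using (H₁.range _).1 ⟨d, rfl⟩
    -- A folded pair would enclose a second vertex, so opposite sides of the square are matched.
    have hs : ∀ i, hc.pair (i + 1) ≠ i := by
      intro i hi
      have := hc.mem_of_lab_eq (by norm_num) H₁.good (Q := {i}) (by rintro _ rfl; exact hi)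
        (i := i) (j := i + 1) rfl (by rw [hl, hl])
      have h2 : i + 1 = i := this
      simp at h2
    have n0 := H₁.pair_ne hc 0
    have n1 := H₁.pair_ne hc 1
    have s0 := hs 0
    have s1 := hs 1
    have s3 := hs 3
    have g0 := hc.pair_pair (by norm_num) 0
    have g1 := hc.pair_pair (by norm_num) 1
    have g2 := hc.pair_pair (by norm_num) 2
    have g3 := hc.pair_pair (by norm_num) 3
    simp only [show (0 : Fin 4) + 1 = 1 by decide, show (1 : Fin 4) + 1 = 2 by decide,
      show (3 : Fin 4) + 1 = 0 by decide] at s0 s1 s3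
    refine ⟨M₁, a, r, r1, hc, hl, ?_⟩
    generalize hx : hc.pair 0 = x at *
    generalize hy : hc.pair 1 = y at *
    fin_cases x <;> fin_cases y <;> simp_all
  obtain ⟨M₁, a, r, r1, hc, l1, p0, p1, p2, p3⟩ := key M H
  obtain ⟨M₁', a', r', r1', hc', l1', p0', p1', p2', p3'⟩ := key M' H'
  obtain ⟨e, h1, -⟩ := hc.exists_iso hc' (by norm_num) (by
    intro i
    fin_cases i
    · exact p0.trans p0'.symm
    · exact p1.trans p1'.symm
    · exact p2.trans p2'.symm
    · exact p3.trans p3'.symm) (fun i => by rw [l1, l1'])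
  exact ⟨M₁, M₁', e, r1, r1', h1, by simp⟩

/-- Closed surfaces of the same type are related by few flips. -/
theorem Closed.meet [Finite D] [Finite D'] (H : M.Closed g L) (H' : M'.Closed g L) (hL : L.Nonempty)
    (hg : 3 ≤ 2 * g + L.card) {K k : ℕ} (hK : 4 * g + 4 * L.card ≤ 2 ^ K) (hk : g + L.card ≤ 2 ^ k) :
    Meet (k * (72 * K + 2) + 96 * K + 1) M M' ∅ := by
  classical
  have hB : k * (72 * K + 2) + 96 * K + 1 = (72 * K + 1) + (k * (72 * K + 2) + 24 * K) := by ring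
  -- The first loop goes around a second vertex or, if there is only one vertex, around a handle.
  -- What remains is the torus with one vertex.
  rcases Nat.lt_or_ge 1 L.card with h1 | h1
  · obtain ⟨z, b, hz, hb, hzb⟩ := Finset.one_lt_card_iff.1 h1
    obtain ⟨N, S, s, r, a1, a2⟩ := H.exists_cone hz hb hzb.symm hg (K := K) (by omega)
    obtain ⟨N', S', s', r', b1, b2⟩ := H'.exists_cone hz hb hzb.symm hg (K := K) (by omega)
    have h2 := Finset.card_erase_add_one hz
    have h3 := Finset.card_erase_add_one (Finset.mem_erase.2 ⟨hzb.symm, hb⟩)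
    rw [hB]
    exact Meet.of_reach r r' (Meet.of_sidePieces (H.reach r).good (H'.reach r').good a1 a2 b1 b2
      (by simp) (by simpa using hzb) (by omega) (by simp; omega) (by omega) (by simp; omega))
  · obtain ⟨z, rfl⟩ := Finset.card_eq_one.1 (le_antisymm h1 hL.card_pos)
    simp only [Finset.card_singleton] at hg hK hk
    rcases Nat.lt_or_ge 1 g with h2 | h2
    · obtain ⟨N, S, s, r, a1, a2⟩ := H.exists_handle (by omega) (K := K) (by omega)
      obtain ⟨N', S', s', r', b1, b2⟩ := H'.exists_handle (by omega) (K := K) (by omega)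
      rw [hB]
      exact Meet.of_reach r r' (Meet.of_sidePieces (H.reach r).good (H'.reach r').good a1 a2 b1 b2
        (by simp) (by simp) (by simp; omega) (by simp; omega) (by simp; omega) (by simp; omega))
    · obtain rfl : g = 1 := by omega
      have hK3 : 1 ≤ K := by
        rcases Nat.eq_zero_or_pos K with rfl | h
        · simp at hK
        · exact h
      exact (Closed.meet_torus H H').mono (by nlinarith)

end TriSurf

end SimFlip

/-! ### From topological triangulations to combinatorial surfaces. -/

namespace SimFlip

theorem sidePoint_self (i : Fin 3) (t : I) : (sidePoint i t).1 i = 1 - t := by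
  fin_cases i <;> simp [sidePoint]

theorem sidePoint_succ (i : Fin 3) (t : I) : (sidePoint i t).1 (i + 1) = t := by
  fin_cases i <;> simp [sidePoint]

theorem sidePoint_succ_succ (i : Fin 3) (t : I) : (sidePoint i t).1 (i + 1 + 1) = 0 := by
  fin_cases i <;> simp [sidePoint]

theorem fin_three (i j : Fin 3) : j = i ∨ j = i + 1 ∨ j = i + 1 + 1 := by
  revert i j; decide

theorem triangle_ext (i : Fin 3) {p q : Triangle} (h0 : p.1 i = q.1 i) (h1 : p.1 (i + 1) = q.1 (i + 1)) :
    p = q := by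
  have hs : ∀ p : Triangle, p.1 i + p.1 (i + 1) + p.1 (i + 1 + 1) = 1 := fun p => by
    have := p.2.2
    rw [Fin.sum_univ_three] at this
    fin_cases i <;> simp <;> linarith
  apply Subtype.ext
  funext j
  rcases fin_three i j with rfl | rfl | rfl
  · exact h0
  · exact h1
  · have := hs p
    have := hs q
    linarith

theorem triangle_sum (p : Triangle) : p.1 0 + p.1 1 + p.1 2 = 1 := by
  have := p.2.2
  rwa [Fin.sum_univ_three] at this

theorem sidePoint_one (i : Fin 3) : sidePoint i 1 = sidePoint (i + 1) 0 := by
  refine triangle_ext (i + 1) ?_ ?_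
  · rw [sidePoint_succ, sidePoint_self]; simp
  · rw [sidePoint_succ_succ, sidePoint_succ]; simp

theorem sidePoint_injective {i j : Fin 3} {s t : I} (h : sidePoint i s = sidePoint j t)
    (h0 : (0 : ℝ) < s) (h1 : (s : ℝ) < 1) : i = j ∧ s = t := by
  have h2 : i = j := by
    have e := sidePoint_succ_succ j t
    rw [← h] at e
    rcases fin_three i (j + 1 + 1) with h3 | h3 | h3
    · rw [h3, sidePoint_self] at e; linarith
    · rw [h3, sidePoint_succ] at e; linarith
    · exact (add_right_cancel (add_right_cancel h3)).symm
  subst h2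
  refine ⟨rfl, Subtype.ext ?_⟩
  rw [← sidePoint_succ i s, h, sidePoint_succ]

theorem sidePoint_eq_vertex {i j : Fin 3} {t : I} (h : sidePoint i t = vertex j) :
    t = 0 ∧ i = j ∨ t = 1 ∧ j = i + 1 := by
  have e : (sidePoint i t).1 j = 1 := by rw [h, vertex, sidePoint_self]; simp
  rcases fin_three i j with h3 | h3 | h3
  · rw [h3, sidePoint_self] at e
    exact Or.inl ⟨Subtype.ext (by simpa using e), h3.symm⟩
  · rw [h3, sidePoint_succ] at e
    exact Or.inr ⟨Subtype.ext e, h3⟩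
  · rw [h3, sidePoint_succ_succ] at e
    norm_num at e

/-- The point at time `t` of a side. -/
def pt {F : ℕ} (d : Fin F × Fin 3) (t : I) : Fin F × Triangle := (d.1, sidePoint d.2 t)

/-- The next side of the same triangle. -/
def next {F : ℕ} (d : Fin F × Fin 3) : Fin F × Fin 3 := (d.1, d.2 + 1)

section glued

variable {F : ℕ} {glue : Fin F × Fin 3 → Fin F × Fin 3}

theorem pt_one (d : Fin F × Fin 3) : pt d 1 = pt (next d) 0 :=
  Prod.ext rfl (sidePoint_one _)

theorem pt_injective {d d' : Fin F × Fin 3} {s t : I} (h : pt d s = pt d' t)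
    (h0 : (0 : ℝ) < s) (h1 : (s : ℝ) < 1) : d = d' ∧ s = t := by
  have h4 : (pt d s).1 = (pt d' t).1 := by rw [h]
  obtain ⟨h2, h3⟩ := sidePoint_injective (congrArg Prod.snd h) h0 h1
  exact ⟨Prod.ext h4 h2, h3⟩

theorem pt_eq_zero {d d' : Fin F × Fin 3} {t : I} (h : pt d t = pt d' 0) :
    t = 0 ∧ d = d' ∨ t = 1 ∧ d' = next d := by
  have h0 : (pt d t).1 = (pt d' 0).1 := by rw [h]
  rcases sidePoint_eq_vertex (congrArg Prod.snd h) with ⟨h1, h2⟩ | ⟨h1, h2⟩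
  · exact Or.inl ⟨h1, Prod.ext h0 h2⟩
  · exact Or.inr ⟨h1, Prod.ext h0.symm h2⟩

theorem glued_pt (d : Fin F × Fin 3) (t : I) : Glued glue (pt d t) (pt (glue d) (σ t)) :=
  ⟨d, t, rfl, rfl⟩

theorem Glued.symm (hg : ∀ d, glue (glue d) = d) {x y : Fin F × Triangle} (h : Glued glue x y) :
    Glued glue y x := by
  obtain ⟨d, t, rfl, rfl⟩ := h
  exact ⟨glue d, σ t, rfl, by rw [hg, unitInterval.symm_symm]⟩

theorem mem_iff_of_eqvGen (hg : ∀ d, glue (glue d) = d) {A : Set (Fin F × Triangle)}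
    (hA : ∀ x y, Glued glue x y → x ∈ A → y ∈ A) {x y : Fin F × Triangle}
    (h : Relation.EqvGen (Glued glue) x y) : x ∈ A ↔ y ∈ A := by
  induction h with
  | rel x y h => exact ⟨hA x y h, hA y x (h.symm hg)⟩
  | refl => rfl
  | symm _ _ _ ih => exact ih.symm
  | trans _ _ _ _ _ ih ih' => exact ih.trans ih'

/-- Inner points are not identified with other points. -/
theorem eq_of_eqvGen_interior (hg : ∀ d, glue (glue d) = d) {x y : Fin F × Triangle}
    (h : Relation.EqvGen (Glued glue) x y) (hx : ∀ i, x.2.1 i ≠ 0) : y = x := by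
  refine (mem_iff_of_eqvGen (A := {x}) hg ?_ h).1 rfl
  rintro u v ⟨d, t, rfl, -⟩ rfl
  exact absurd (sidePoint_succ_succ d.2 t) (hx _)

/-- Inner points of a side are only identified with one other point. -/
theorem eq_of_eqvGen_pt (hg : ∀ d, glue (glue d) = d) {d : Fin F × Fin 3} {t : I}
    {y : Fin F × Triangle} (h : Relation.EqvGen (Glued glue) (pt d t) y) (h0 : (0 : ℝ) < t)
    (h1 : (t : ℝ) < 1) : y = pt d t ∨ y = pt (glue d) (σ t) := by
  refine (mem_iff_of_eqvGen (A := {pt d t, pt (glue d) (σ t)}) hg ?_ h).1 (Or.inl rfl)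
  rintro u v ⟨d', t', rfl, rfl⟩ (h2 | h2)
  · obtain ⟨rfl, rfl⟩ := pt_injective h2.symm h0 h1
    exact Or.inr rfl
  · obtain ⟨h3, h4⟩ := pt_injective (Eq.symm h2) (by simpa using h1) (by simpa using h0)
    left
    rw [← h3, ← h4, hg, unitInterval.symm_symm]
    rfl

/-- Vertices are only identified with vertices. -/
theorem exists_of_eqvGen_vertex (hg : ∀ d, glue (glue d) = d) {d : Fin F × Fin 3}
    {y : Fin F × Triangle} (h : Relation.EqvGen (Glued glue) (pt d 0) y) :
    ∃ d', y = pt d' 0 ∧ Conn (fun d => next (glue d)) d d' := by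
  have hn : Function.Injective (next : Fin F × Fin 3 → _) := fun a b hab => by
    simp only [next, Prod.mk.injEq, add_left_inj] at hab
    exact Prod.ext hab.1 hab.2
  have hi : Function.Injective fun d => next (glue d) :=
    hn.comp (Function.LeftInverse.injective hg)
  refine (mem_iff_of_eqvGen (A := {y | ∃ d', y = pt d' 0 ∧ Conn (fun d => next (glue d)) d d'})
    hg ?_ h).1 ⟨d, rfl, Conn.refl _ _⟩
  rintro u v ⟨d₁, t, rfl, rfl⟩ ⟨d', h1, h2⟩
  rcases pt_eq_zero h1 with ⟨rfl, rfl⟩ | ⟨rfl, rfl⟩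
  · refine ⟨next (glue d₁), ?_, h2.trans (Conn.step _ _)⟩
    rw [← pt_one, unitInterval.symm_zero]
    rfl
  · refine ⟨glue d₁, by rw [unitInterval.symm_one]; rfl, h2.trans (Conn.symm hi ?_)⟩
    have := Conn.step (fun d => next (glue d)) (glue d₁)
    simp only [hg] at this
    exact this

theorem eqvGen_next (d : Fin F × Fin 3) :
    Relation.EqvGen (Glued glue) (pt d 0) (pt (next (glue d)) 0) := by
  rw [← pt_one, ← unitInterval.symm_zero]
  exact .rel _ _ (glued_pt d 0)

end glued

namespace Triangulation

variable {n : ℕ} {S : MarkedSpace n} (T : Triangulation S)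

/-- The characteristic map. -/
def map (x : Fin T.faces × Triangle) : S.carrier := T.chart x.1 x.2

theorem continuous_map : Continuous T.map := by
  unfold map
  exact continuous_prod_of_discrete_left.2 fun f => (T.chart f).continuous

theorem map_surjective : Function.Surjective T.map := fun x => by
  obtain ⟨f, y, h⟩ := T.chart_surjective x
  exact ⟨(f, y), h⟩

theorem map_eq_iff {x y : Fin T.faces × Triangle} :
    T.map x = T.map y ↔ Relation.EqvGen (Glued T.glue) x y := T.chart_eq_iff x y

theorem map_pt (d : Fin T.faces × Fin 3) (t : I) : T.map (pt d t) = T.map (pt (T.glue d) (σ t)) :=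
  T.map_eq_iff.2 (.rel _ _ (glued_pt d t))

theorem exists_label (d : Fin T.faces × Fin 3) : ∃ i, S.mark i = T.map (pt d 0) := by
  have h : T.map (pt d 0) ∈ Set.range S.mark := by
    rw [← T.range_vertices]
    exact ⟨d, rfl⟩
  exact h

/-- The combinatorial surface of a triangulation. -/
noncomputable def comb : TriSurf (Fin n) (Fin T.faces × Fin 3) where
  α := T.glue
  φ := next
  lab d := (T.exists_label d).choose
  αα := T.glue_glue
  φφφ d := by
    refine Prod.ext rfl ?_
    simp only [next]
    have : ∀ i : Fin 3, i + 1 + 1 + 1 = i := by decide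
    exact this _
  φ_ne d h := by
    have : ∀ i : Fin 3, i + 1 ≠ i := by decide
    exact this _ (congrArg Prod.snd h)
  lab_ν d := by
    apply S.mark_injective
    rw [(T.exists_label d).choose_spec, (T.exists_label _).choose_spec]
    exact (T.map_eq_iff.2 (eqvGen_next d)).symm

theorem mark_lab (d : Fin T.faces × Fin 3) : S.mark (T.comb.lab d) = T.map (pt d 0) :=
  (T.exists_label d).choose_spec

theorem lab_eq_iff {d : Fin T.faces × Fin 3} {i : Fin n} :
    T.comb.lab d = i ↔ T.map (pt d 0) = S.mark i := by
  rw [← T.mark_lab, S.mark_injective.eq_iff]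

theorem exists_lab (i : Fin n) : ∃ d, T.comb.lab d = i := by
  have h : S.mark i ∈ Set.range S.mark := ⟨i, rfl⟩
  rw [← T.range_vertices] at h
  obtain ⟨d, hd⟩ := h
  exact ⟨d, T.lab_eq_iff.2 hd⟩

/-- The triangles of a set of darts closed under `α` and `φ` have a clopen image, as there are
finitely many compact ones. For the vertices, corners with the same image are related by turning, by
the description of the gluing relation at vertices. -/
theorem good : T.comb.Good where
  conn A hA hα hφ := by
    have hn : ∀ d, next d ∈ A ↔ d ∈ A := TriSurf.mem_iff_of_closed T.comb.φ_inj hφ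
    have hf : ∀ f i, (f, i) ∈ A ↔ (f, (0 : Fin 3)) ∈ A := by
      intro f i
      have h1 := hn (f, 0)
      have h2 := hn (f, 1)
      fin_cases i
      · rfl
      · exact h1
      · exact h2.trans h1
    have hclosed : ∀ B : Set (Fin T.faces), IsClosed (T.map '' (B ×ˢ Set.univ)) := fun B =>
      ((Set.toFinite B).isCompact.prod isCompact_univ).image T.continuous_map |>.isClosed
    set B : Set (Fin T.faces) := {f | (f, (0 : Fin 3)) ∈ A} with hB
    have hu : T.map '' (B ×ˢ Set.univ) ∪ T.map '' (Bᶜ ×ˢ Set.univ) = Set.univ := by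
      rw [← Set.image_union, ← Set.union_prod, Set.union_compl_self, Set.univ_prod_univ,
        Set.image_univ, T.map_surjective.range_eq]
    have hd : Disjoint (T.map '' (B ×ˢ Set.univ)) (T.map '' (Bᶜ ×ˢ Set.univ)) := by
      rw [Set.disjoint_left]
      rintro _ ⟨x, hx, rfl⟩ ⟨y, hy, hxy⟩
      have h1 := (mem_iff_of_eqvGen (A := {x : Fin T.faces × Triangle | x.1 ∈ B}) T.glue_glue (by
        rintro u v ⟨d, t, rfl, rfl⟩ hu
        have h2 : d ∈ A := (hf d.1 d.2).2 hu
        exact (hf _ (T.glue d).2).1 (hα d h2)) (T.map_eq_iff.1 hxy)).2 hx.1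
      exact hy.1 h1
    have hclopen : IsClopen (T.map '' (B ×ˢ Set.univ)) := by
      refine ⟨hclosed B, ?_⟩
      rw [← isClosed_compl_iff]
      have : (T.map '' (B ×ˢ Set.univ))ᶜ = T.map '' (Bᶜ ×ˢ Set.univ) :=
        (IsCompl.of_eq (Set.disjoint_iff_inter_eq_empty.1 hd) hu).compl_eq
      rw [this]
      exact hclosed _
    rcases isClopen_iff.1 hclopen with h | h
    · obtain ⟨d, hd⟩ := hA
      have h1 : T.map (pt d 0) ∈ T.map '' (B ×ˢ Set.univ) :=
        ⟨pt d 0, ⟨show d.1 ∈ B from (hf d.1 d.2).1 hd, trivial⟩, rfl⟩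
      rw [h] at h1
      exact absurd h1 (Set.notMem_empty _)
    · ext d
      refine ⟨fun _ => trivial, fun _ => ?_⟩
      by_contra hdA
      have h1 : T.map (pt d 0) ∈ T.map '' (B ×ˢ Set.univ) := h ▸ Set.mem_univ _
      refine Set.disjoint_left.1 hd h1 ⟨pt d 0,
        ⟨fun h2 : d.1 ∈ B => hdA ((hf d.1 d.2).2 h2), trivial⟩, rfl⟩
  vconn A hA d hd d' hl := by
    have h1 : T.map (pt d 0) = T.map (pt d' 0) := by rw [← T.mark_lab, ← T.mark_lab, hl]
    obtain ⟨d'', h2, h3⟩ := exists_of_eqvGen_vertex T.glue_glue (T.map_eq_iff.1 h1)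
    have h4 : d' = d'' := by
      rcases pt_eq_zero h2 with h5 | h5
      · exact h5.2
      · exact absurd h5.1 (by simp)
    exact h4 ▸ h3 A hA hd

/-- The arc that a side is mapped to. -/
def arc (d : Fin T.faces × Fin 3) : Set S.carrier := Set.range fun t => T.map (pt d t)

theorem arc_glue (d : Fin T.faces × Fin 3) : T.arc (T.glue d) = T.arc d := by
  ext x
  constructor
  · rintro ⟨t, rfl⟩
    refine ⟨σ t, ?_⟩
    simp only
    rw [T.map_pt d, unitInterval.symm_symm]
  · rintro ⟨t, rfl⟩
    exact ⟨σ t, (T.map_pt d t).symm⟩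

/-- The midpoint of a side is identified with the midpoint of its partner only, so an arc determines
its two darts. -/
theorem arc_eq_iff {d d' : Fin T.faces × Fin 3} : T.arc d' = T.arc d ↔ d' = d ∨ d' = T.glue d := by
  constructor
  · intro h
    let t : I := ⟨1 / 2, by norm_num, by norm_num⟩
    have h0 : (0 : ℝ) < t := by norm_num [t]
    have h1 : (t : ℝ) < 1 := by norm_num [t]
    have h2 : T.map (pt d t) ∈ T.arc d' := h ▸ ⟨t, rfl⟩
    obtain ⟨s, hs⟩ := h2
    rcases eq_of_eqvGen_pt T.glue_glue (T.map_eq_iff.1 hs.symm) h0 h1 with h3 | h3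
    · exact Or.inl (pt_injective h3.symm h0 h1).1.symm
    · exact Or.inr (pt_injective h3.symm (by simpa using h1) (by simpa using h0)).1.symm
  · rintro (rfl | rfl)
    · rfl
    · exact T.arc_glue d

theorem arcs_eq : T.arcs = Set.range T.arc := rfl

theorem two_mul_ncard_arcs : 2 * T.arcs.ncard = 3 * T.faces := by
  classical
  have h1 : T.arcs = ((Finset.univ.image T.arc : Finset (Set S.carrier)) : Set (Set S.carrier)) := by
    rw [arcs_eq]; simp
  rw [h1, Set.ncard_coe_finset]
  have h2 := Finset.card_eq_sum_card_image T.arc Finset.univ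
  rw [Finset.card_univ, Fintype.card_prod, Fintype.card_fin, Fintype.card_fin] at h2
  rw [Finset.sum_const_nat (m := 2)] at h2
  · omega
  · intro a ha
    obtain ⟨d, -, rfl⟩ := Finset.mem_image.1 ha
    have : (Finset.univ.filter fun x => T.arc x = T.arc d) = {d, T.glue d} := by
      ext x
      simp [T.arc_eq_iff]
    rw [this, Finset.card_pair (T.glue_ne d).symm]

/-- With three arcs for every two triangles, the Euler characteristic yields `4 * g + 2 * n - 4`
triangles. -/
theorem closed {g : ℕ} (hT : T.eulerChar = 2 - 2 * (g : ℤ)) : T.comb.Closed g Finset.univ where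
  good := T.good
  ne := T.glue_ne
  range v := by simpa using T.exists_lab v
  card := by
    have h := T.two_mul_ncard_arcs
    unfold eulerChar at hT
    rw [Nat.card_eq_fintype_card, Fintype.card_prod, Fintype.card_fin, Fintype.card_fin,
      Finset.card_univ, Fintype.card_fin]
    omega

end Triangulation

end SimFlip

/-! ### Isomorphisms as homeomorphisms; changes of presentation. -/

namespace SimFlip

theorem eqvGen_map {X Y : Type} {r : X → X → Prop} {s : Y → Y → Prop} {f : X → Y}
    (hf : ∀ x y, r x y → Relation.EqvGen s (f x) (f y)) {x y : X} (h : Relation.EqvGen r x y) :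
    Relation.EqvGen s (f x) (f y) := by
  induction h with
  | rel x y h => exact hf x y h
  | refl => exact .refl _
  | symm _ _ _ ih => exact .symm _ _ ih
  | trans _ _ _ _ _ ih ih' => exact .trans _ _ _ ih ih'

/-- The triangle with its vertices permuted cyclically. -/
def rotate (s : Fin 3) (p : Triangle) : Triangle :=
  ⟨fun j => p.1 (j - s), fun j => p.2.1 _, by
    rw [← p.2.2]
    exact (Equiv.subRight s).sum_comp p.1⟩

theorem rotate_sidePoint (s i : Fin 3) (t : I) : rotate s (sidePoint i t) = sidePoint (s + i) t := by
  refine triangle_ext (s + i) ?_ ?_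
  · rw [sidePoint_self]
    change (sidePoint i t).1 (s + i - s) = _
    rw [add_sub_cancel_left, sidePoint_self]
  · rw [sidePoint_succ]
    change (sidePoint i t).1 (s + i + 1 - s) = _
    rw [add_assoc, add_sub_cancel_left, sidePoint_succ]

theorem continuous_rotate (s : Fin 3) : Continuous (rotate s) :=
  Continuous.subtype_mk (continuous_pi fun j =>
    (continuous_apply (A := fun _ : Fin 3 => ℝ) (j - s)).comp continuous_subtype_val) _

section faceMap

variable {F F' : ℕ} {e : Fin F × Fin 3 → Fin F' × Fin 3} {e' : Fin F' × Fin 3 → Fin F × Fin 3}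

/-- The map of the triangles given by a map of the sides. -/
def faceMap (e : Fin F × Fin 3 → Fin F' × Fin 3) (x : Fin F × Triangle) : Fin F' × Triangle :=
  ((e (x.1, 0)).1, rotate (e (x.1, 0)).2 x.2)

theorem apply_eq_of_next (he : ∀ d, e (next d) = next (e d)) (d : Fin F × Fin 3) :
    e d = ((e (d.1, 0)).1, (e (d.1, 0)).2 + d.2) := by
  obtain ⟨f, i⟩ := d
  have h1 : e (f, 1) = next (e (f, 0)) := he (f, 0)
  have h2 : e (f, 2) = next (e (f, 1)) := he (f, 1)
  fin_cases i
  · simp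
  · exact h1
  · simp only [Fin.reduceFinMk]
    rw [h2, h1]
    simp only [next, add_assoc]
    rfl

theorem faceMap_pt (he : ∀ d, e (next d) = next (e d)) (d : Fin F × Fin 3) (t : I) :
    faceMap e (pt d t) = pt (e d) t := by
  rw [apply_eq_of_next he d]
  exact Prod.ext rfl (rotate_sidePoint _ _ _)

theorem faceMap_faceMap (he' : ∀ d, e' (next d) = next (e' d))
    (h : ∀ d, e' (e d) = d) (x : Fin F × Triangle) : faceMap e' (faceMap e x) = x := by
  have h1 := h (x.1, 0)
  rw [apply_eq_of_next he' (e (x.1, 0))] at h1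
  have h2 := congrArg Prod.snd h1
  refine Prod.ext (congrArg Prod.fst h1 :) (Subtype.ext (funext fun j => ?_))
  change x.2.1 (j - (e' ((e (x.1, 0)).1, 0)).2 - (e (x.1, 0)).2) = x.2.1 j
  simp only at h2
  rw [sub_sub, h2, sub_zero]

theorem continuous_faceMap (e : Fin F × Fin 3 → Fin F' × Fin 3) : Continuous (faceMap e) := by
  refine continuous_prod_of_discrete_left.2 fun f => ?_
  change Continuous fun p : Triangle => ((e (f, 0)).1, rotate (e (f, 0)).2 p)
  exact continuous_const.prodMk (continuous_rotate _)

theorem eqvGen_faceMap {glue : Fin F × Fin 3 → Fin F × Fin 3} {glue' : Fin F' × Fin 3 → Fin F' × Fin 3}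
    (he : ∀ d, e (next d) = next (e d)) (hg : ∀ d, e (glue d) = glue' (e d))
    {x y : Fin F × Triangle} (h : Relation.EqvGen (Glued glue) x y) :
    Relation.EqvGen (Glued glue') (faceMap e x) (faceMap e y) := by
  refine eqvGen_map ?_ h
  rintro _ _ ⟨d, t, rfl, rfl⟩
  change Relation.EqvGen _ (faceMap e (pt d t)) (faceMap e (pt (glue d) (σ t)))
  rw [faceMap_pt he, faceMap_pt he, hg]
  exact .rel _ _ (glued_pt _ _)

end faceMap

namespace Triangulation

variable {n : ℕ} {S S' : MarkedSpace n} (T : Triangulation S) (T' : Triangulation S')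

theorem isQuotientMap_map : Topology.IsQuotientMap T.map :=
  T.continuous_map.isClosedMap.isQuotientMap T.continuous_map T.map_surjective

theorem exists_continuous_lift {e : Fin T.faces × Fin 3 → Fin T'.faces × Fin 3}
    (he : ∀ d, e (next d) = next (e d)) (hg : ∀ d, e (T.glue d) = T'.glue (e d)) :
    ∃ h : S.carrier → S'.carrier, Continuous h ∧ ∀ x, h (T.map x) = T'.map (faceMap e x) := by
  have key : ∀ x, T'.map (faceMap e (Function.surjInv T.map_surjective (T.map x))) =
      T'.map (faceMap e x) := fun x => T'.map_eq_iff.2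
    (eqvGen_faceMap he hg (T.map_eq_iff.1 (Function.surjInv_eq T.map_surjective _)))
  refine ⟨fun y => T'.map (faceMap e (Function.surjInv T.map_surjective y)), ?_, key⟩
  rw [T.isQuotientMap_map.continuous_iff]
  have : ((fun y => T'.map (faceMap e (Function.surjInv T.map_surjective y))) ∘ T.map) =
      T'.map ∘ faceMap e := funext key
  rw [this]
  exact T'.continuous_map.comp (continuous_faceMap e)

/-- Isomorphic triangulations are homeomorphic. -/
theorem exists_homeomorph {e : Fin T.faces × Fin 3 ≃ Fin T'.faces × Fin 3}
    (he : T.comb.Iso T'.comb e) : ∃ h : S.carrier ≃ₜ S'.carrier,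
      (∀ i, h (S.mark i) = S'.mark i) ∧ (fun a : Set S.carrier => h '' a) '' T.arcs = T'.arcs := by
  have n1 : ∀ d, e (next d) = next (e d) := he.φ
  have n2 : ∀ d, e.symm (next d) = next (e.symm d) := he.symm.φ
  obtain ⟨h, h1, h2⟩ := T.exists_continuous_lift T' n1 he.α
  obtain ⟨h', h1', h2'⟩ := T'.exists_continuous_lift T n2 he.symm.α
  let H : S.carrier ≃ₜ S'.carrier :=
    { toFun := h
      invFun := h'
      left_inv := fun y => by
        obtain ⟨x, rfl⟩ := T.map_surjective y
        rw [h2, h2', faceMap_faceMap n2 e.symm_apply_apply]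
      right_inv := fun y => by
        obtain ⟨x, rfl⟩ := T'.map_surjective y
        rw [h2', h2, faceMap_faceMap n1 e.apply_symm_apply]
      continuous_toFun := h1
      continuous_invFun := h1' }
  have hH : ∀ d t, H (T.map (pt d t)) = T'.map (pt (e d) t) := fun d t => by
    rw [← faceMap_pt n1]; exact h2 _
  refine ⟨H, fun i => ?_, ?_⟩
  · obtain ⟨d, rfl⟩ := T.exists_lab i
    rw [T.mark_lab, hH, ← T'.mark_lab, he.lab]
  · have harc : ∀ d, H '' T.arc d = T'.arc (e d) := by
      intro d
      rw [arc, arc, ← Set.range_comp]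
      exact congrArg Set.range (funext (hH d))
    rw [arcs_eq, arcs_eq, ← Set.range_comp]
    ext a
    constructor
    · rintro ⟨d, rfl⟩
      exact ⟨e d, (harc d).symm⟩
    · rintro ⟨d, rfl⟩
      exact ⟨e.symm d, by simp [harc]⟩

variable {T}

/-- Another presentation of the same space. -/
abbrev transport (T : Triangulation S) (glue : Fin T.faces × Fin 3 → Fin T.faces × Fin 3)
    (hgg : ∀ d, glue (glue d) = d) (hne : ∀ d, glue d ≠ d) (Θ Ψ : Fin T.faces × Triangle → Fin T.faces × Triangle)
    (hΘ : ∀ f, Continuous fun p => T.map (Θ (f, p)))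
    (h1 : ∀ d t, Relation.EqvGen (Glued T.glue) (Θ (pt d t)) (Θ (pt (glue d) (σ t))))
    (h2 : ∀ d t, Relation.EqvGen (Glued glue) (Ψ (pt d t)) (Ψ (pt (T.glue d) (σ t))))
    -- `Θ` and `Ψ` act on the disjoint triangles, and are inverse to each other only modulo the
    -- gluings.
    (h3 : ∀ x, Relation.EqvGen (Glued glue) (Ψ (Θ x)) x)
    (h4 : ∀ x, Relation.EqvGen (Glued T.glue) (Θ (Ψ x)) x)
    (hv : Set.range (fun d => T.map (Θ (pt d 0))) = Set.range fun d => T.map (pt d 0)) :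
    Triangulation S where
  faces := T.faces
  chart f := ⟨fun p => T.map (Θ (f, p)), hΘ f⟩
  glue := glue
  glue_glue := hgg
  glue_ne := hne
  chart_surjective x := by
    obtain ⟨y, rfl⟩ := T.map_surjective x
    exact ⟨(Ψ y).1, (Ψ y).2, T.map_eq_iff.2 (h4 y)⟩
  chart_eq_iff x y := by
    refine T.map_eq_iff.trans ⟨fun h => ?_, fun h => ?_⟩
    · have h5 : Relation.EqvGen (Glued glue) (Ψ (Θ x)) (Ψ (Θ y)) := by
        refine eqvGen_map ?_ h
        rintro _ _ ⟨d, t, rfl, rfl⟩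
        exact h2 d t
      exact .trans _ _ _ (.symm _ _ (h3 x)) (.trans _ _ _ h5 (h3 y))
    · refine eqvGen_map (f := Θ) ?_ h
      rintro _ _ ⟨d, t, rfl, rfl⟩
      exact h1 d t
  range_vertices := by
    rw [← T.range_vertices]
    exact hv

/-- The presentation after renaming the sides of the triangles. -/
theorem exists_rotate (T : Triangulation S) {X : Set (Fin T.faces × Fin 3)}
    (hX : ∀ f i j, (f, i) ∈ X → (f, j) ∈ X → i = j) :
    ∃ (T' : Triangulation S) (e : Fin T'.faces × Fin 3 ≃ Fin T.faces × Fin 3),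
      T'.comb.Iso T.comb e ∧ T'.arcs = T.arcs ∧ ∀ d, e d ∈ X → d.2 = 0 := by
  -- Each triangle is rotated so that its only side in `X`, if there is one, gets the index 0.
  have hs : ∀ f, ∃ s, ∀ i, (f, i) ∈ X → i = s := by
    intro f
    by_cases h : ∃ i, (f, i) ∈ X
    · obtain ⟨i, hi⟩ := h
      exact ⟨i, fun j hj => hX f j i hj hi⟩
    · exact ⟨0, fun i hi => absurd ⟨i, hi⟩ h⟩
  choose s hs using hs
  let e : Fin T.faces × Fin 3 ≃ Fin T.faces × Fin 3 :=
    { toFun := fun d => (d.1, s d.1 + d.2)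
      invFun := fun d => (d.1, d.2 - s d.1)
      left_inv := fun d => Prod.ext rfl (add_sub_cancel_left _ _)
      right_inv := fun d => Prod.ext rfl (add_sub_cancel _ _) }
  have he : ∀ d, e (next d) = next (e d) := fun d => Prod.ext rfl (add_assoc _ _ _).symm
  have he' : ∀ d, e.symm (next d) = next (e.symm d) := fun d => by
    rw [Equiv.symm_apply_eq, he, e.apply_symm_apply]
  let T' : Triangulation S := T.transport (fun d => e.symm (T.glue (e d)))
    (fun d => by simp [T.glue_glue]) (fun d h => T.glue_ne (e d) (by rwa [Equiv.symm_apply_eq] at h))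
    (faceMap e) (faceMap e.symm)
    (fun f => T.continuous_map.comp ((continuous_faceMap e).comp (Continuous.prodMk_right f)))
    (fun d t => by
      rw [faceMap_pt he, faceMap_pt he, e.apply_symm_apply]
      exact .rel _ _ (glued_pt _ _))
    (fun d t => by
      rw [faceMap_pt he', faceMap_pt he']
      have h := glued_pt (glue := fun d => e.symm (T.glue (e d))) (e.symm d) t
      simp only [e.apply_symm_apply] at h
      exact .rel _ _ h)
    (fun x => by rw [faceMap_faceMap he' e.symm_apply_apply]; exact .refl _)
    (fun x => by rw [faceMap_faceMap he e.apply_symm_apply]; exact .refl _)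
    (by
      simp only [faceMap_pt he]
      exact e.surjective.range_comp fun d => T.map (pt d 0))
  have hm : ∀ d t, T'.map (pt d t) = T.map (pt (e d) t) := fun d t =>
    congrArg T.map (faceMap_pt he d t)
  refine ⟨T', e, ⟨fun d => e.apply_symm_apply _, he, fun d => ?_⟩, ?_, fun d hd => ?_⟩
  · rw [T.lab_eq_iff, T'.mark_lab, hm]
  · rw [T.arcs_eq, T'.arcs_eq]
    have : T'.arc = T.arc ∘ e := funext fun d => congrArg Set.range (funext (hm d))
    rw [this]
    exact e.surjective.range_comp _
  · have h1 := hs d.1 _ hd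
    simpa using h1

end Triangulation

end SimFlip

/-! ### A flip as a quarter turn of a square. -/

namespace SimFlip

/-- The lower half of the square. -/
def lowerHalf (u : I × I) : Triangle :=
  -- The minimum makes the map total; below the diagonal it is just `u.2`.
  ⟨![1 - (u.1 : ℝ), min (u.1 : ℝ) u.2, u.1 - min (u.1 : ℝ) u.2], by
    constructor
    · intro i
      have h0 := u.1.2.2
      have h1 := u.1.2.1
      have h2 := u.2.2.1
      fin_cases i
      · simpa using h0
      · simpa using ⟨h1, h2⟩
      · simp
    · simp [Fin.sum_univ_three]⟩

theorem continuous_lowerHalf : Continuous lowerHalf := by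
  refine Continuous.subtype_mk (continuous_pi fun i => ?_) _
  fin_cases i <;> simp <;> fun_prop

/-- The position of a point of the triangle in the lower half of the square. -/
def squarePos (p : Triangle) : I × I :=
  (⟨1 - p.1 0, by
      have := triangle_sum p
      have := p.2.1 1
      have := p.2.1 2
      constructor <;> linarith [p.2.1 0]⟩,
    ⟨p.1 1, p.2.1 1, by
      have := triangle_sum p
      linarith [p.2.1 0, p.2.1 2]⟩)

theorem continuous_squarePos : Continuous squarePos := by
  have h : ∀ i, Continuous fun p : Triangle => p.1 i := fun i =>
    (continuous_apply (A := fun _ : Fin 3 => ℝ) i).comp continuous_subtype_val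
  exact (Continuous.subtype_mk (continuous_const.sub (h 0)) _).prodMk
    (Continuous.subtype_mk (h 1) _)

theorem squarePos_le (p : Triangle) : (squarePos p).2 ≤ (squarePos p).1 := by
  change p.1 1 ≤ 1 - p.1 0
  linarith [triangle_sum p, p.2.1 2]

theorem lowerHalf_squarePos (p : Triangle) : lowerHalf (squarePos p) = p := by
  have h : p.1 1 ≤ 1 - p.1 0 := squarePos_le p
  refine triangle_ext 0 ?_ ?_
  · simp [lowerHalf, squarePos]
  · simp [lowerHalf, squarePos, h]

theorem squarePos_lowerHalf {u : I × I} (h : u.2 ≤ u.1) : squarePos (lowerHalf u) = u := by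
  have h' : (u.2 : ℝ) ≤ u.1 := h
  refine Prod.ext (Subtype.ext ?_) (Subtype.ext ?_)
  · simp [lowerHalf, squarePos]
  · simp [lowerHalf, squarePos, h']

theorem lowerHalf_diag (t : I) : lowerHalf (t, t) = sidePoint 0 t :=
  triangle_ext 0 (by rw [sidePoint_self]; simp [lowerHalf]) (by rw [sidePoint_succ]; simp [lowerHalf])

theorem lowerHalf_right (t : I) : lowerHalf (1, σ t) = sidePoint 1 t := by
  have h := t.2.1
  refine triangle_ext 1 (by rw [sidePoint_self]; simp [lowerHalf, h]) ?_
  rw [sidePoint_succ]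
  change (lowerHalf (1, σ t)).1 2 = t
  simp [lowerHalf, h]

theorem lowerHalf_bottom (t : I) : lowerHalf (σ t, 0) = sidePoint 2 t := by
  have h := t.2.2
  refine triangle_ext 2 ?_ ?_
  · rw [sidePoint_self]
    simp [lowerHalf, h]
  · rw [sidePoint_succ]
    change (lowerHalf (σ t, 0)).1 0 = t
    simp [lowerHalf]

/-- The half turn of the square. -/
def halfTurn (u : I × I) : I × I := (σ u.1, σ u.2)

theorem halfTurn_halfTurn (u : I × I) : halfTurn (halfTurn u) = u := by
  simp [halfTurn]

/-- The pairs of faces that are adjacent along their sides with index 0. -/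
structure FacePairs {F : ℕ} (glue : Fin F × Fin 3 → Fin F × Fin 3) (Y : Finset (Fin F))
    (β : Fin F → Fin F) : Prop where
  glue_zero : ∀ f ∈ Y, glue (f, 0) = (β f, 0)
  mem : ∀ f ∈ Y, β f ∈ Y
  ne : ∀ f ∈ Y, β f ≠ f
  ββ : ∀ f ∈ Y, β (β f) = f

section square

variable {F : ℕ} {glue : Fin F × Fin 3 → Fin F × Fin 3} {Y : Finset (Fin F)} {β : Fin F → Fin F}

/-- The square made from two triangles. -/
noncomputable def square (β : Fin F → Fin F) (f : Fin F) (u : I × I) : Fin F × Triangle :=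
  if u.2 ≤ u.1 then (f, lowerHalf u) else (β f, lowerHalf (halfTurn u))

theorem square_of_le {f : Fin F} {u : I × I} (h : u.2 ≤ u.1) : square β f u = (f, lowerHalf u) :=
  if_pos h

theorem square_of_lt {f : Fin F} {u : I × I} (h : u.1 < u.2) :
    square β f u = (β f, lowerHalf (halfTurn u)) := if_neg (not_le.2 h)

theorem square_squarePos (f : Fin F) (p : Triangle) : square β f (squarePos p) = (f, p) := by
  rw [square_of_le (squarePos_le p), lowerHalf_squarePos]

theorem square_diag (f : Fin F) (t : I) : square β f (t, t) = pt (f, 0) t := by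
  rw [square_of_le le_rfl, lowerHalf_diag]; rfl

theorem square_right (f : Fin F) (t : I) : square β f (1, σ t) = pt (f, 1) t := by
  rw [square_of_le unitInterval.le_one', lowerHalf_right]; rfl

theorem square_bottom (f : Fin F) (t : I) : square β f (σ t, 0) = pt (f, 2) t := by
  rw [square_of_le unitInterval.nonneg', lowerHalf_bottom]; rfl

namespace FacePairs

variable (H : FacePairs glue Y β) {f : Fin F} (hf : f ∈ Y)
include H hf

/-- The two triangles of a pair describe the same square, up to a half turn. -/
theorem eqvGen_square (u : I × I) :
    Relation.EqvGen (Glued glue) (square β f u) (square β (β f) (halfTurn u)) := by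
  rcases lt_trichotomy u.1 u.2 with h | h | h
  · rw [square_of_lt h, square_of_le (unitInterval.symm_le_symm.2 h.le)]
    exact .refl _
  · obtain ⟨s, t⟩ := u
    obtain rfl : s = t := h
    change Relation.EqvGen _ _ (square β (β f) (σ s, σ s))
    rw [square_diag, square_diag, ← H.glue_zero f hf]
    exact .rel _ _ (glued_pt _ _)
  · rw [square_of_le h.le, square_of_lt (unitInterval.symm_lt_symm.2 h), H.ββ f hf,
      halfTurn_halfTurn]
    exact .refl _

theorem eqvGen_left (t : I) : Relation.EqvGen (Glued glue) (square β f (0, t)) (pt (β f, 1) t) := by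
  rw [← square_right (β := β)]
  have := H.eqvGen_square hf (0, t)
  rwa [halfTurn, unitInterval.symm_zero] at this

theorem eqvGen_top (t : I) : Relation.EqvGen (Glued glue) (square β f (t, 1)) (pt (β f, 2) t) := by
  rw [← square_bottom (β := β)]
  have := H.eqvGen_square hf (t, 1)
  rwa [halfTurn, unitInterval.symm_one] at this

end FacePairs

/-- Turn all squares by `r`. -/
noncomputable def turnSquares (Y : Finset (Fin F)) (β : Fin F → Fin F) (r : I × I → I × I)
    (x : Fin F × Triangle) : Fin F × Triangle :=
  if x.1 ∈ Y then square β x.1 (r (squarePos x.2)) else x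

/-- The sides after turning the squares. -/
def turnSide (Y : Finset (Fin F)) (β : Fin F → Fin F) (d : Fin F × Fin 3) : Fin F × Fin 3 :=
  if d.1 ∈ Y then ![(d.1, 0), (d.1, 2), (β d.1, 1)] d.2 else d

/-- The sides after turning the squares backwards. -/
def turnSide' (Y : Finset (Fin F)) (β : Fin F → Fin F) (d : Fin F × Fin 3) : Fin F × Fin 3 :=
  if d.1 ∈ Y then ![(d.1, 0), (β d.1, 2), (d.1, 1)] d.2 else d

variable {r r' : I × I → I × I}

theorem turn_diag {f : Fin F} (hf : f ∈ Y) (t : I) :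
    turnSquares Y β r (pt (f, 0) t) = square β f (r (t, t)) := by
  rw [← square_diag (β := β), square_of_le le_rfl, turnSquares, if_pos hf, squarePos_lowerHalf le_rfl]

theorem turn_pt {f : Fin F} (hf : f ∈ Y) {i : Fin 3} {t : I} {u : I × I}
    (hu : square β f u = pt (f, i) t) (hle : u.2 ≤ u.1) :
    turnSquares Y β r (pt (f, i) t) = square β f (r u) := by
  rw [← hu, square_of_le hle, turnSquares, if_pos hf, squarePos_lowerHalf hle]

namespace FacePairs

section
variable (H : FacePairs glue Y β)
include H

/-- A map that commutes with the half turn is well defined on the square, whichever of the two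
triangles is used to name a point. -/
theorem eqvGen_turn_square {f : Fin F} (hf : f ∈ Y) (hr : ∀ u, r (halfTurn u) = halfTurn (r u))
    (u : I × I) :
    Relation.EqvGen (Glued glue) (turnSquares Y β r (square β f u)) (square β f (r u)) := by
  rcases le_or_gt u.2 u.1 with hu | hu
  · rw [square_of_le hu, turnSquares, if_pos hf, squarePos_lowerHalf hu]
    exact .refl _
  · have hu' : (halfTurn u).2 ≤ (halfTurn u).1 := unitInterval.symm_le_symm.2 hu.le
    rw [square_of_lt hu, turnSquares, if_pos (H.mem f hf), squarePos_lowerHalf hu', hr]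
    exact .symm _ _ (H.eqvGen_square hf _)

theorem eqvGen_turn_turn (hr' : ∀ u, r' (halfTurn u) = halfTurn (r' u)) (hrr : ∀ u, r' (r u) = u)
    (x : Fin F × Triangle) :
    Relation.EqvGen (Glued glue) (turnSquares Y β r' (turnSquares Y β r x)) x := by
  by_cases hf : x.1 ∈ Y
  · have h1 : turnSquares Y β r x = square β x.1 (r (squarePos x.2)) := if_pos hf
    rw [h1]
    have h2 := H.eqvGen_turn_square hf hr' (r (squarePos x.2))
    rwa [hrr, square_squarePos] at h2
  · have h1 : turnSquares Y β r x = x := if_neg hf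
    rw [h1, turnSquares, if_neg hf]
    exact .refl _

theorem turnSide_turnSide' (d : Fin F × Fin 3) : turnSide Y β (turnSide' Y β d) = d := by
  obtain ⟨f, i⟩ := d
  by_cases hf : f ∈ Y
  · fin_cases i <;> simp [turnSide, turnSide', hf, H.mem f hf, H.ββ f hf]
  · simp [turnSide, turnSide', hf]

theorem turnSide'_turnSide (d : Fin F × Fin 3) : turnSide' Y β (turnSide Y β d) = d := by
  obtain ⟨f, i⟩ := d
  by_cases hf : f ∈ Y
  · fin_cases i <;> simp [turnSide, turnSide', hf, H.mem f hf, H.ββ f hf]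
  · simp [turnSide, turnSide', hf]

/-- The quarter turn takes the right side to the bottom and the bottom to the left side, which is
the right side seen from the partner. Only the diagonal does not go to an old side. -/
theorem eqvGen_turn_forward {d : Fin F × Fin 3} (hd : ¬ (d.1 ∈ Y ∧ d.2 = 0)) (t : I) :
    Relation.EqvGen (Glued glue) (turnSquares Y β (fun u => (u.2, σ u.1)) (pt d t))
      (pt (turnSide Y β d) t) := by
  obtain ⟨f, i⟩ := d
  by_cases hf : f ∈ Y
  · have hi : i = 0 ∨ i = 1 ∨ i = 2 := fin_three 0 i
    rcases hi with rfl | rfl | rfl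
    · exact absurd ⟨hf, rfl⟩ hd
    · rw [turn_pt hf (square_right f t) unitInterval.le_one', turnSide, if_pos hf]
      change Relation.EqvGen _ (square β f (σ t, σ 1)) (pt (f, 2) t)
      rw [unitInterval.symm_one, square_bottom]
      exact .refl _
    · rw [turn_pt hf (square_bottom f t) unitInterval.nonneg', turnSide, if_pos hf]
      change Relation.EqvGen _ (square β f (0, σ (σ t))) (pt (β f, 1) t)
      rw [unitInterval.symm_symm]
      exact H.eqvGen_left hf t
  · rw [turnSide, if_neg hf, turnSquares, if_neg (show (pt (f, i) t).1 ∉ Y from hf)]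
    exact .refl _

theorem eqvGen_turn_backward {d : Fin F × Fin 3} (hd : ¬ (d.1 ∈ Y ∧ d.2 = 0)) (t : I) :
    Relation.EqvGen (Glued glue) (turnSquares Y β (fun u => (σ u.2, u.1)) (pt d t))
      (pt (turnSide' Y β d) t) := by
  obtain ⟨f, i⟩ := d
  by_cases hf : f ∈ Y
  · have hi : i = 0 ∨ i = 1 ∨ i = 2 := fin_three 0 i
    rcases hi with rfl | rfl | rfl
    · exact absurd ⟨hf, rfl⟩ hd
    · rw [turn_pt hf (square_right f t) unitInterval.le_one', turnSide', if_pos hf]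
      change Relation.EqvGen _ (square β f (σ (σ t), 1)) (pt (β f, 2) t)
      rw [unitInterval.symm_symm]
      exact H.eqvGen_top hf t
    · rw [turn_pt hf (square_bottom f t) unitInterval.nonneg', turnSide', if_pos hf]
      change Relation.EqvGen _ (square β f (σ 0, σ t)) (pt (f, 1) t)
      rw [unitInterval.symm_zero, square_right]
      exact .refl _
  · rw [turnSide', if_neg hf, turnSquares, if_neg (show (pt (f, i) t).1 ∉ Y from hf)]
    exact .refl _

/-- Turning the squares respects the gluing. -/
theorem eqvGen_turn_glued {glue' τ : Fin F × Fin 3 → Fin F × Fin 3} (H' : FacePairs glue' Y β)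
    (hgg : ∀ d, glue' (glue' d) = d) (hτ : ∀ d, τ (glue' d) = glue (τ d))
    (hr : ∀ u, r (halfTurn u) = halfTurn (r u))
    (hs : ∀ d : Fin F × Fin 3, ¬ (d.1 ∈ Y ∧ d.2 = 0) → ∀ t,
      Relation.EqvGen (Glued glue) (turnSquares Y β r (pt d t)) (pt (τ d) t))
    (d : Fin F × Fin 3) (t : I) : Relation.EqvGen (Glued glue) (turnSquares Y β r (pt d t))
      (turnSquares Y β r (pt (glue' d) (σ t))) := by
  by_cases hd : d.1 ∈ Y ∧ d.2 = 0
  · obtain ⟨f, i⟩ := d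
    obtain ⟨hf, rfl⟩ : f ∈ Y ∧ i = 0 := hd
    rw [H'.glue_zero f hf, turn_diag hf, turn_diag (H.mem f hf)]
    have := H.eqvGen_square hf (r (t, t))
    rwa [← hr] at this
  · have hd' : ¬ ((glue' d).1 ∈ Y ∧ (glue' d).2 = 0) := by
      rintro ⟨h1, h2⟩
      have h3 : glue' d = ((glue' d).1, 0) := Prod.ext rfl h2
      have h4 := hgg d
      rw [h3, H'.glue_zero _ h1] at h4
      exact hd (by rw [← h4]; exact ⟨H'.mem _ h1, rfl⟩)
    refine .trans _ _ _ (hs d hd t) (.trans _ _ _ (.rel _ _ (glued_pt _ _)) ?_)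
    rw [← hτ]
    exact .symm _ _ (hs _ hd' _)

end

end FacePairs

end square

end SimFlip

/-! ### The triangulation after turning the squares. -/

namespace SimFlip

section turned

variable {F : ℕ} {glue : Fin F × Fin 3 → Fin F × Fin 3} {Y : Finset (Fin F)} {β : Fin F → Fin F}

/-- The pairing of the sides after turning the squares. -/
def turnGlue (glue : Fin F × Fin 3 → Fin F × Fin 3) (Y : Finset (Fin F)) (β : Fin F → Fin F)
    (d : Fin F × Fin 3) : Fin F × Fin 3 := turnSide' Y β (glue (turnSide Y β d))

theorem turnSide_zero {f : Fin F} : turnSide Y β (f, 0) = (f, 0) := by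
  unfold turnSide; split_ifs <;> rfl

theorem turnSide'_zero {f : Fin F} : turnSide' Y β (f, 0) = (f, 0) := by
  unfold turnSide'; split_ifs <;> rfl

theorem FacePairs.turnGlue (H : FacePairs glue Y β) : FacePairs (turnGlue glue Y β) Y β where
  glue_zero f hf := by
    rw [SimFlip.turnGlue, turnSide_zero, H.glue_zero f hf, turnSide'_zero]
  mem := H.mem
  ne := H.ne
  ββ := H.ββ

/-- The inverse of the square. -/
def squareInv (f : Fin F) (x : Fin F × Triangle) : I × I :=
  if x.1 = f then squarePos x.2 else halfTurn (squarePos x.2)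

theorem squareInv_square {f : Fin F} (h : β f ≠ f) (u : I × I) :
    squareInv f (square β f u) = u := by
  rcases le_or_gt u.2 u.1 with hu | hu
  · rw [square_of_le hu, squareInv, if_pos rfl, squarePos_lowerHalf hu]
  · have hu' : (halfTurn u).2 ≤ (halfTurn u).1 := unitInterval.symm_le_symm.2 hu.le
    rw [square_of_lt hu, squareInv, if_neg h, squarePos_lowerHalf hu', halfTurn_halfTurn]

theorem squareInv_square_halfTurn {f : Fin F} (h : β f ≠ f) (h' : β (β f) = f) (u : I × I) :
    squareInv f (square β (β f) (halfTurn u)) = u := by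
  rcases lt_or_ge u.2 u.1 with hu | hu
  · have hu' : (halfTurn u).1 < (halfTurn u).2 := unitInterval.symm_lt_symm.2 hu
    rw [square_of_lt hu', halfTurn_halfTurn, h', squareInv, if_pos rfl, squarePos_lowerHalf hu.le]
  · have hu' : (halfTurn u).2 ≤ (halfTurn u).1 := unitInterval.symm_le_symm.2 hu
    rw [square_of_le hu', squareInv, if_neg h, squarePos_lowerHalf hu', halfTurn_halfTurn]

theorem lowerHalf_ne_zero {u : I × I} (hu : u ∈ openSquare) (h : u.2 < u.1) (i : Fin 3) :
    (lowerHalf u).1 i ≠ 0 := by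
  have h1 : (u.1 : ℝ) < 1 := hu.1.2
  have h2 : (0 : ℝ) < u.2 := hu.2.1
  have h3 : (u.2 : ℝ) < u.1 := h
  have hi : i = 0 ∨ i = 1 ∨ i = 2 := fin_three 0 i
  rcases hi with rfl | rfl | rfl
  · change (1 : ℝ) - u.1 ≠ 0
    linarith
  · change min (u.1 : ℝ) u.2 ≠ 0
    rw [min_eq_right h3.le]
    exact h2.ne'
  · change (u.1 : ℝ) - min (u.1 : ℝ) u.2 ≠ 0
    rw [min_eq_right h3.le]
    linarith

theorem halfTurn_mem_openSquare {u : I × I} (hu : u ∈ openSquare) : halfTurn u ∈ openSquare := by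
  obtain ⟨⟨h1, h2⟩, h3, h4⟩ := hu
  refine ⟨⟨?_, ?_⟩, ?_, ?_⟩
  · exact unitInterval.symm_one ▸ unitInterval.symm_lt_symm.2 h2
  · exact unitInterval.symm_zero ▸ unitInterval.symm_lt_symm.2 h1
  · exact unitInterval.symm_one ▸ unitInterval.symm_lt_symm.2 h4
  · exact unitInterval.symm_zero ▸ unitInterval.symm_lt_symm.2 h3

theorem square_ne_zero {f : Fin F} {u : I × I} (hu : u ∈ openSquare) (h : u.1 ≠ u.2) (i : Fin 3) :
    (square β f u).2.1 i ≠ 0 := by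
  rcases lt_or_gt_of_ne h with h | h
  · rw [square_of_lt h]
    exact lowerHalf_ne_zero (halfTurn_mem_openSquare hu) (unitInterval.symm_lt_symm.2 h) i
  · rw [square_of_le h.le]
    exact lowerHalf_ne_zero hu h i

theorem FacePairs.eq_of_eqvGen_square (H : FacePairs glue Y β) (hg : ∀ d, glue (glue d) = d)
    {f : Fin F} (hf : f ∈ Y) {u : I × I} (hu : u ∈ openSquare) {y : Fin F × Triangle}
    (h : Relation.EqvGen (Glued glue) (square β f u) y) :
    y = square β f u ∨ y = square β (β f) (halfTurn u) := by
  by_cases h1 : u.1 = u.2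
  · obtain ⟨s, t⟩ := u
    obtain rfl : s = t := h1
    rw [square_diag] at h ⊢
    change _ ∨ y = square β (β f) (σ s, σ s)
    rw [square_diag, ← H.glue_zero f hf]
    exact eq_of_eqvGen_pt hg h hu.1.1 hu.1.2
  · exact Or.inl (eq_of_eqvGen_interior hg h (square_ne_zero hu h1))

theorem square_fst (f : Fin F) (u : I × I) : (square β f u).1 = f ∨ (square β f u).1 = β f := by
  unfold square
  split_ifs
  · exact Or.inl rfl
  · exact Or.inr rfl

theorem corner_of_lowerHalf {u : I × I} (hu : u.2 ≤ u.1) {j : Fin 3}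
    (h : lowerHalf u = sidePoint j 0) : (u.1 = 0 ∨ u.1 = 1) ∧ (u.2 = 0 ∨ u.2 = 1) := by
  have hj : j = 0 ∨ j = 1 ∨ j = 2 := fin_three 0 j
  rw [← squarePos_lowerHalf hu, h]
  rcases hj with rfl | rfl | rfl
  · rw [← lowerHalf_diag, squarePos_lowerHalf le_rfl]
    exact ⟨Or.inl rfl, Or.inl rfl⟩
  · rw [← lowerHalf_right, squarePos_lowerHalf unitInterval.le_one', unitInterval.symm_zero]
    exact ⟨Or.inr rfl, Or.inr rfl⟩
  · rw [← lowerHalf_bottom, squarePos_lowerHalf unitInterval.nonneg', unitInterval.symm_zero]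
    exact ⟨Or.inr rfl, Or.inl rfl⟩

theorem corner_of_square {f : Fin F} {u : I × I} {d : Fin F × Fin 3} (h : square β f u = pt d 0) :
    (u.1 = 0 ∨ u.1 = 1) ∧ (u.2 = 0 ∨ u.2 = 1) := by
  rcases le_or_gt u.2 u.1 with hu | hu
  · rw [square_of_le hu] at h
    exact corner_of_lowerHalf hu (congrArg Prod.snd h)
  · rw [square_of_lt hu] at h
    have := corner_of_lowerHalf (unitInterval.symm_le_symm.2 hu.le) (congrArg Prod.snd h)
    have e0 : ∀ s : I, σ s = 0 ↔ s = 1 := fun s => by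
      rw [← unitInterval.symm_one, unitInterval.symm_inj]
    have e1 : ∀ s : I, σ s = 1 ↔ s = 0 := fun s => by
      rw [← unitInterval.symm_zero, unitInterval.symm_inj]
    simp only [halfTurn, e0, e1] at this
    exact ⟨this.1.symm, this.2.symm⟩

/-- Only one face of each pair is needed. -/
theorem FacePairs.image_pairs (H : FacePairs glue Y β) {X : Type} {g : Fin F → X}
    (hg : ∀ f ∈ Y, g (β f) = g f) : g '' {f | f ∈ Y ∧ f < β f} = g '' Y := by
  refine Set.Subset.antisymm (Set.image_mono fun f hf => hf.1) ?_
  rintro _ ⟨f, hf, rfl⟩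
  rcases lt_or_gt_of_ne (H.ne f hf) with h | h
  · exact ⟨β f, ⟨H.mem f hf, by rwa [H.ββ f hf]⟩, hg f hf⟩
  · exact ⟨f, ⟨hf, h⟩, rfl⟩

end turned

namespace Triangulation

variable {n : ℕ} {S : MarkedSpace n} {T : Triangulation S} {Y : Finset (Fin T.faces)}
  {β : Fin T.faces → Fin T.faces}

section
variable (H : FacePairs T.glue Y β)
include H

theorem continuous_square {f : Fin T.faces} (hf : f ∈ Y) :
    Continuous fun u => T.map (square β f u) := by
  have h1 : (fun u => T.map (square β f u)) = fun u : I × I =>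
      if u.2 ≤ u.1 then T.map (f, lowerHalf u) else T.map (β f, lowerHalf (halfTurn u)) :=
    funext fun u => apply_ite _ _ _ _
  rw [h1]
  refine Continuous.if_le ?_ ?_ continuous_snd continuous_fst ?_
  · exact T.continuous_map.comp (continuous_const.prodMk continuous_lowerHalf)
  · refine T.continuous_map.comp (continuous_const.prodMk (continuous_lowerHalf.comp ?_))
    unfold halfTurn
    fun_prop
  · rintro ⟨s, t⟩ (rfl : t = s)
    change T.map (f, lowerHalf (t, t)) = T.map (β f, lowerHalf (σ t, σ t))
    rw [lowerHalf_diag, lowerHalf_diag]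
    have := T.map_pt (f, 0) t
    rwa [H.glue_zero f hf] at this

theorem continuous_turnSquares {r : I × I → I × I} (hr : Continuous r) (f : Fin T.faces) :
    Continuous fun p => T.map (turnSquares Y β r (f, p)) := by
  unfold turnSquares
  by_cases hf : f ∈ Y
  · simp only [hf, if_true]
    exact (continuous_square H hf).comp (hr.comp continuous_squarePos)
  · simp only [hf, if_false]
    exact T.continuous_map.comp (continuous_const.prodMk continuous_id)

theorem map_turn_forward {d : Fin T.faces × Fin 3} (hd : ¬ (d.1 ∈ Y ∧ d.2 = 0)) (t : I) :
    T.map (turnSquares Y β (fun u => (u.2, σ u.1)) (pt d t)) = T.map (pt (turnSide Y β d) t) :=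
  T.map_eq_iff.2 (H.eqvGen_turn_forward hd t)

theorem turnSide'_notMem {d : Fin T.faces × Fin 3} (hd : ¬ (d.1 ∈ Y ∧ d.2 = 0)) :
    ¬ ((turnSide' Y β d).1 ∈ Y ∧ (turnSide' Y β d).2 = 0) := by
  rintro ⟨h1, h2⟩
  have h3 : turnSide' Y β d = ((turnSide' Y β d).1, 0) := Prod.ext rfl h2
  have h4 := H.turnSide_turnSide' d
  rw [h3, turnSide_zero] at h4
  exact hd (by rw [← h4]; exact ⟨h1, rfl⟩)

theorem range_turn_vertices :
    Set.range (fun d => T.map (turnSquares Y β (fun u => (u.2, σ u.1)) (pt d 0))) =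
      Set.range fun d => T.map (pt d 0) := by
  apply Set.Subset.antisymm
  · rintro _ ⟨d, rfl⟩
    by_cases hd : d.1 ∈ Y ∧ d.2 = 0
    · obtain ⟨f, i⟩ := d
      obtain ⟨hf, rfl⟩ : f ∈ Y ∧ i = 0 := hd
      -- The start of the diagonal is also the end of side 2, to which `map_turn_forward` applies.
      have h1 : pt (f, (0 : Fin 3)) 0 = pt (f, 2) 1 := (pt_one (f, 2)).symm
      refine ⟨next (turnSide Y β (f, 2)), ?_⟩
      simp only
      rw [h1, map_turn_forward H (by simp), pt_one]
    · exact ⟨turnSide Y β d, (map_turn_forward H hd 0).symm⟩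
  · rintro _ ⟨d, rfl⟩
    have key : ∀ d : Fin T.faces × Fin 3, ¬ (d.1 ∈ Y ∧ d.2 = 0) → T.map (pt d 0) ∈
        Set.range (fun d => T.map (turnSquares Y β (fun u => (u.2, σ u.1)) (pt d 0))) := by
      intro d hd
      refine ⟨turnSide' Y β d, ?_⟩
      simp only
      rw [map_turn_forward H (turnSide'_notMem H hd), H.turnSide_turnSide']
    by_cases hd : d.1 ∈ Y ∧ d.2 = 0
    · obtain ⟨f, i⟩ := d
      obtain ⟨hf, rfl⟩ : f ∈ Y ∧ i = 0 := hd
      simp only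
      rw [T.map_eq_iff.2 (eqvGen_next (f, 0)), H.glue_zero f hf]
      exact key _ (by simp [next])
    · exact key d hd

theorem turnGlue_turnGlue (d : Fin T.faces × Fin 3) :
    turnGlue T.glue Y β (turnGlue T.glue Y β d) = d := by
  rw [turnGlue, turnGlue, H.turnSide_turnSide', T.glue_glue, H.turnSide'_turnSide]

end

/-- The triangulation after turning the squares. -/
noncomputable abbrev turn (H : FacePairs T.glue Y β) : Triangulation S :=
  T.transport (turnGlue T.glue Y β) (turnGlue_turnGlue H)
    (fun d h => T.glue_ne (turnSide Y β d) (by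
      rw [← H.turnSide_turnSide' (T.glue (turnSide Y β d))]; exact congrArg _ h))
    (turnSquares Y β fun u => (u.2, σ u.1)) (turnSquares Y β fun u => (σ u.2, u.1))
    (continuous_turnSquares H (by fun_prop))
    (H.eqvGen_turn_glued H.turnGlue (turnGlue_turnGlue H)
      (fun d => H.turnSide_turnSide' _) (fun _ => rfl) fun _ => H.eqvGen_turn_forward)
    (H.turnGlue.eqvGen_turn_glued H T.glue_glue
      (fun d => by rw [turnGlue, H.turnSide_turnSide']) (fun _ => rfl)
      fun _ => H.turnGlue.eqvGen_turn_backward)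
    (H.turnGlue.eqvGen_turn_turn (fun _ => rfl) fun u => by simp)
    (H.eqvGen_turn_turn (fun _ => rfl) fun u => by simp)
    (range_turn_vertices H)

section
variable (H : FacePairs T.glue Y β)

theorem turn_map_pt {d : Fin T.faces × Fin 3} (hd : ¬ (d.1 ∈ Y ∧ d.2 = 0)) (t : I) :
    (turn H).map (pt d t) = T.map (pt (turnSide Y β d) t) := map_turn_forward H hd t

theorem turn_arc {d : Fin T.faces × Fin 3} (hd : ¬ (d.1 ∈ Y ∧ d.2 = 0)) :
    (turn H).arc d = T.arc (turnSide Y β d) :=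
  congrArg Set.range (funext (turn_map_pt H hd))

theorem turn_arc_zero {f : Fin T.faces} (hf : f ∈ Y) :
    (turn H).arc (f, 0) = Set.range fun t => T.map (square β f (t, σ t)) :=
  congrArg Set.range (funext fun t => congrArg T.map (turn_diag hf t))

end

end Triangulation

end SimFlip

/-! ### Combinatorial flips are simultaneous flips of quadrilaterals. -/

namespace SimFlip

namespace Triangulation

variable {n : ℕ} {S : MarkedSpace n} {T : Triangulation S} {Y : Finset (Fin T.faces)}
  {β : Fin T.faces → Fin T.faces}

/-- The quadrilateral formed by a pair of faces. -/
noncomputable def quad (H : FacePairs T.glue Y β) (f : {f // f ∈ Y}) : C(I × I, S.carrier) :=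
  ⟨fun u => T.map (square β f u), continuous_square H f.2⟩

section
variable (H : FacePairs T.glue Y β) (f : {f // f ∈ Y})

theorem quad_image {s : Set (I × I)} {p : I → I × I} (hs : Set.range p = s)
    {d : Fin T.faces × Fin 3} (h : ∀ t, T.map (square β f (p t)) = T.map (pt d t)) :
    quad H f '' s = T.arc d := by
  rw [← hs, ← Set.range_comp]
  exact congrArg Set.range (funext h)

theorem range_diagonal : Set.range (fun t : I => (t, t)) = diagonal := by
  ext ⟨s, t⟩
  constructor
  · rintro ⟨r, h⟩
    simp only [Prod.mk.injEq] at h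
    exact h.1.symm.trans h.2
  · rintro (rfl : s = t)
    exact ⟨s, rfl⟩

theorem range_antidiagonal : Set.range (fun t : I => (t, σ t)) = antidiagonal := by
  ext ⟨s, t⟩
  constructor
  · rintro ⟨r, h⟩
    simp only [Prod.mk.injEq] at h
    obtain ⟨rfl, rfl⟩ := h
    simp [antidiagonal]
  · intro h
    have h' : (s : ℝ) + t = 1 := h
    exact ⟨s, Prod.ext rfl (Subtype.ext (by simp; linarith))⟩

theorem range_prodMk_left (a : I) : Set.range (fun t : I => (a, t)) = {x : I × I | x.1 = a} := by
  ext ⟨s, t⟩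
  simp [eq_comm]

theorem range_prodMk_left_symm (a : I) :
    Set.range (fun t : I => (a, σ t)) = {x : I × I | x.1 = a} := by
  rw [← range_prodMk_left]
  exact unitInterval.symm_bijective.surjective.range_comp fun t => (a, t)

theorem range_prodMk_right (a : I) : Set.range (fun t : I => (t, a)) = {x : I × I | x.2 = a} := by
  ext ⟨s, t⟩
  simp [eq_comm]

theorem range_prodMk_right_symm (a : I) :
    Set.range (fun t : I => (σ t, a)) = {x : I × I | x.2 = a} := by
  rw [← range_prodMk_right]
  exact unitInterval.symm_bijective.surjective.range_comp fun t => (t, a)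

theorem quad_diagonal : quad H f '' diagonal = T.arc (f, 0) :=
  quad_image H f range_diagonal fun t => by rw [square_diag]

theorem map_pt_mem (d : Fin T.faces × Fin 3) : T.map (pt d 0) ∈ Set.range S.mark :=
  ⟨_, T.mark_lab d⟩

theorem map_pt_one_mem (d : Fin T.faces × Fin 3) : T.map (pt d 1) ∈ Set.range S.mark := by
  rw [pt_one]; exact map_pt_mem _

theorem mem_range_mark {x : S.carrier} :
    x ∈ Set.range S.mark ↔ ∃ d, x = T.map (pt d 0) := by
  constructor
  · rintro ⟨i, rfl⟩
    obtain ⟨d, rfl⟩ := T.exists_lab i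
    exact ⟨d, T.mark_lab d⟩
  · rintro ⟨d, rfl⟩
    exact map_pt_mem d

theorem quad_corners (x : I × I) :
    quad H f x ∈ Set.range S.mark ↔ (x.1 = 0 ∨ x.1 = 1) ∧ (x.2 = 0 ∨ x.2 = 1) := by
  constructor
  · intro h
    obtain ⟨d, hd⟩ := (mem_range_mark (T := T)).1 h
    obtain ⟨d', h1, -⟩ := exists_of_eqvGen_vertex T.glue_glue (T.map_eq_iff.1 hd.symm)
    exact corner_of_square h1
  · obtain ⟨x, y⟩ := x
    change _ → T.map (square β f (x, y)) ∈ _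
    rintro ⟨hx | hx, hy | hy⟩ <;> simp only at hx hy <;> subst hx hy
    · rw [square_diag]; exact map_pt_mem _
    · rw [T.map_eq_iff.2 (H.eqvGen_left f.2 1)]; exact map_pt_one_mem _
    · have := square_right (β := β) f.1 1
      rw [unitInterval.symm_one] at this
      rw [this]; exact map_pt_one_mem _
    · rw [square_diag]; exact map_pt_one_mem _

include H in
theorem eq_of_quad_eq {u : I × I} (hu : u ∈ openSquare) {y : Fin T.faces × Triangle}
    (h : T.map (square β f u) = T.map y) :
    y = square β f u ∨ y = square β (β f) (halfTurn u) :=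
  H.eq_of_eqvGen_square T.glue_glue f.2 hu (T.map_eq_iff.1 h)

theorem isQuadrilateral_quad : IsQuadrilateral T (quad H f) where
  injOn u hu v _ h := by
    have h1 : T.map (square β f u) = T.map (square β f v) := h
    rw [← squareInv_square (H.ne f f.2) v]
    rcases eq_of_quad_eq H f hu h1 with h2 | h2
    · rw [h2, squareInv_square (H.ne f f.2)]
    · rw [h2, squareInv_square_halfTurn (H.ne f f.2) (H.ββ f f.2)]
  corners := quad_corners H f
  left := ⟨(β f, 1), (quad_image H f (range_prodMk_left 0) fun t =>
    T.map_eq_iff.2 (H.eqvGen_left f.2 t)).symm⟩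
  right := ⟨(f, 1), (quad_image (d := (f.1, 1)) H f (range_prodMk_left_symm 1) fun t => by
    rw [square_right]).symm⟩
  bottom := ⟨(f, 2), (quad_image (d := (f.1, 2)) H f (range_prodMk_right_symm 0) fun t => by
    rw [square_bottom]).symm⟩
  top := ⟨(β f, 2), (quad_image H f (range_prodMk_right 1) fun t =>
    T.map_eq_iff.2 (H.eqvGen_top f.2 t)).symm⟩
  diag := ⟨(f, 0), (quad_diagonal H f).symm⟩
  avoids := by
    rintro u hu _ ⟨d, rfl⟩ ⟨t, ht⟩
    by_contra h
    have h1 := square_ne_zero (β := β) (f := f) hu h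
    have h3 : T.map (square β f u) = T.map (pt d t) := ht.symm
    have h2 := eq_of_eqvGen_interior T.glue_glue (T.map_eq_iff.1 h3) h1
    exact h1 (d.2 + 1 + 1) (by rw [← h2]; exact sidePoint_succ_succ _ _)

theorem disjoint_quad {f g : {f // f ∈ Y}} (hf : f.1 < β f) (hg : g.1 < β g) (hne : f ≠ g) :
    Disjoint (quad H f '' openSquare) (quad H g '' openSquare) := by
  rw [Set.disjoint_left]
  rintro _ ⟨u, hu, rfl⟩ ⟨v, -, h⟩
  have hne' : f.1 ≠ g.1 := fun h => hne (Subtype.ext h)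
  have h1 : (square β g v).1 = f.1 ∨ (square β g v).1 = β f := by
    rcases eq_of_quad_eq H f hu h.symm with h2 | h2
    · rw [h2]; exact square_fst _ _
    · rw [h2]
      have := square_fst (β := β) (β f) (halfTurn u)
      rw [H.ββ f f.2] at this
      exact this.symm
  have e1 : β (β f) = f := H.ββ f f.2
  have e2 : β (β g) = g := H.ββ g g.2
  rcases square_fst (β := β) g v with h3 | h3 <;> rcases h1 with h1 | h1 <;> rw [h3] at h1
  · exact hne' h1.symm
  · rw [h1, e1] at hg
    exact lt_asymm hf hg
  · rw [← h1, e2] at hf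
    exact lt_asymm hf hg
  · exact hne' (by rw [← e1, ← h1, e2])

theorem turn_arcs : (turn H).arcs = (T.arcs \ ((fun f => T.arc (f, 0)) '' (Y : Set _))) ∪
    (fun f : Fin T.faces => (turn H).arc (f, 0)) '' (Y : Set _) := by
  ext a
  constructor
  · rintro ⟨d, rfl⟩
    by_cases hd : d.1 ∈ Y ∧ d.2 = 0
    · exact Or.inr ⟨d.1, hd.1, by simp only [← hd.2]; rfl⟩
    · refine Or.inl ⟨⟨turnSide Y β d, (turn_arc H hd).symm⟩, ?_⟩
      rintro ⟨f, hf, h⟩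
      have h' : T.arc (f, 0) = T.arc (turnSide Y β d) := h.trans (turn_arc H hd)
      have key : ∀ f ∈ Y, turnSide Y β d ≠ (f, 0) := by
        intro f hf h1
        have h2 := H.turnSide'_turnSide d
        rw [h1, turnSide'_zero] at h2
        exact hd (by rw [← h2]; exact ⟨hf, rfl⟩)
      rcases T.arc_eq_iff.1 h'.symm with h1 | h1
      · exact key f hf h1
      · rw [H.glue_zero f hf] at h1
        exact key _ (H.mem f hf) h1
  · rintro (⟨⟨d, rfl⟩, hd⟩ | ⟨f, -, rfl⟩)
    · have hd' : ¬ (d.1 ∈ Y ∧ d.2 = 0) := fun h =>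
        hd ⟨d.1, h.1, by simp only [← h.2]; rfl⟩
      refine ⟨turnSide' Y β d, ?_⟩
      change (turn H).arc (turnSide' Y β d) = T.arc d
      rw [turn_arc H (turnSide'_notMem H hd'), H.turnSide_turnSide']
    · exact ⟨(f, 0), rfl⟩

theorem simultaneousFlip_turn : SimultaneousFlip T (turn H) := by
  -- One face from each pair, so that every quadrilateral is listed once.
  let Z : Set (Fin T.faces) := {f | f ∈ Y ∧ f < β f}
  let e : Fin (Nat.card Z) ≃ Z := (Finite.equivFin Z).symm
  have hr : ∀ {X : Type} (g : Fin T.faces → X), (∀ f ∈ Y, g (β f) = g f) →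
      (Set.range fun i => g (e i)) = g '' (Y : Set _) := by
    intro X g hg
    rw [← H.image_pairs hg]
    exact (e.surjective.range_comp fun f : Z => g f).trans (Set.image_eq_range g Z).symm
  refine ⟨Nat.card Z, fun i => quad H ⟨e i, (e i).2.1⟩, fun i => isQuadrilateral_quad H _,
    fun i j hij => disjoint_quad H (e i).2.2 (e j).2.2 fun h =>
      hij (e.injective (Subtype.ext (Subtype.mk.inj h))), ?_⟩
  have h1 : ∀ i, quad H ⟨e i, (e i).2.1⟩ '' diagonal = T.arc (e i, 0) := fun i =>
    quad_diagonal H _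
  have h2 : ∀ i, quad H ⟨e i, (e i).2.1⟩ '' antidiagonal = (turn H).arc ((e i).1, 0) := fun i => by
    rw [turn_arc_zero H (e i).2.1, ← range_antidiagonal, ← Set.range_comp]
    rfl
  simp only [h1, h2]
  rw [hr (fun f => T.arc (f, 0)), hr fun f => (turn H).arc (f, 0), turn_arcs]
  · intro f hf
    have := (turn H).arc_glue (f, 0)
    rwa [show (turn H).glue (f, 0) = (β f, 0) from H.turnGlue.glue_zero f hf] at this
  · intro f hf
    have := T.arc_glue (f, 0)
    rwa [H.glue_zero f hf] at this

theorem turn_eulerChar : (turn H).eulerChar = T.eulerChar := by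
  have h1 := (turn H).two_mul_ncard_arcs
  have h2 := T.two_mul_ncard_arcs
  have h3 : (turn H).faces = T.faces := rfl
  unfold eulerChar
  omega

/-- The sides after turning the squares. -/
noncomputable def turnEquiv : Fin T.faces × Fin 3 ≃ Fin T.faces × Fin 3 where
  toFun := turnSide Y β
  invFun := turnSide' Y β
  left_inv := H.turnSide'_turnSide
  right_inv := H.turnSide_turnSide'

/-- On darts the quarter turn is `turnSide`, and it carries the rotation of the triangles to
`flipφ`. Labels are compared away from the new diagonals; the label of a diagonal is that of the
next dart around its initial vertex. -/
theorem turn_iso {X : Set (Fin T.faces × Fin 3)} (hX : T.comb.Flippable X)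
    (hXY : ∀ d, d ∈ X ↔ d.1 ∈ Y ∧ d.2 = 0) :
    (turn H).comb.Iso (T.comb.flip X hX)
      (turnEquiv H : Fin T.faces × Fin 3 ≃ Fin T.faces × Fin 3) := by
  have hφ : ∀ d : Fin T.faces × Fin 3,
      turnSide Y β (next d) = T.comb.flipφ X (turnSide Y β d) := by
    intro d
    obtain ⟨f, i⟩ := d
    by_cases hf : f ∈ Y
    · have hi : i = 0 ∨ i = 1 ∨ i = 2 := fin_three 0 i
      have t0 : turnSide Y β (f, 0) = (f, 0) := turnSide_zero
      have t1 : turnSide Y β (f, 1) = (f, 2) := by rw [turnSide, if_pos hf]; rfl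
      have t2 : turnSide Y β (f, 2) = (β f, 1) := by rw [turnSide, if_pos hf]; rfl
      have m : ∀ f ∈ Y, ((f, 0) : Fin T.faces × Fin 3) ∈ X := fun f hf => (hXY _).2 ⟨hf, rfl⟩
      rcases hi with rfl | rfl | rfl
      · rw [t0, TriSurf.flipφ_of_mem (m f hf)]
        exact t1
      · rw [t1, hX.flipφ_of_φ_mem (x := (f, 2)) (m f hf)]
        refine t2.trans ?_
        change _ = next (T.glue (f, 0))
        rw [H.glue_zero f hf]
        rfl
      · have h1 : T.comb.φ (T.comb.φ (β f, 1)) = (β f, 0) :=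
          Prod.ext rfl (show (1 : Fin 3) + 1 + 1 = 0 by decide)
        rw [t2, hX.flipφ_of_φφ_mem (x := (β f, 1)) (by rw [h1]; exact m _ (H.mem f hf)), h1]
        refine t0.trans ?_
        change _ = T.glue (β f, 0)
        rw [H.glue_zero _ (H.mem f hf), H.ββ f hf]
    · have h1 : ∀ j, turnSide Y β (f, j) = (f, j) := fun j => by rw [turnSide, if_neg hf]
      have h2 : ∀ j, ((f, j) : Fin T.faces × Fin 3) ∉ X := fun j h => hf ((hXY _).1 h).1
      rw [h1 i, TriSurf.flipφ_of_notMem (h2 _) (h2 _) (h2 _)]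
      exact h1 _
  have hl : ∀ d : Fin T.faces × Fin 3, turnSide Y β d ∉ X →
      (T.comb.flip X hX).lab (turnSide Y β d) = (turn H).comb.lab d := by
    intro d hd
    rw [TriSurf.flip_lab hX hd, T.lab_eq_iff, (turn H).mark_lab, turn_map_pt H]
    rintro ⟨h1, h2⟩
    have h3 : d = (d.1, 0) := Prod.ext rfl h2
    apply hd
    rw [h3, turnSide_zero]
    exact (hXY _).2 ⟨h1, rfl⟩
  refine ⟨fun d => H.turnSide_turnSide' _, hφ, fun d => ?_⟩
  change (T.comb.flip X hX).lab (turnSide Y β d) = (turn H).comb.lab d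
  by_cases hd : turnSide Y β d ∈ X
  · have h1 : turnSide Y β ((turn H).comb.ν d) = (T.comb.flip X hX).ν (turnSide Y β d) := by
      refine (hφ _).trans (congrArg (T.comb.flipφ X) ?_)
      exact H.turnSide_turnSide' _
    rw [← (turn H).comb.lab_ν' d, ← (T.comb.flip X hX).lab_ν' (turnSide Y β d), ← h1]
    refine hl _ ?_
    rw [h1]
    exact hX.flipφ_α_notMem hd
  · exact hl d hd

end

/-- Every combinatorial step is realized by a simultaneous flip. -/
theorem exists_simultaneousFlip (T : Triangulation S) {X : Set (Fin T.faces × Fin 3)}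
    (hX : T.comb.Flippable X) :
    ∃ (T' : Triangulation S) (e : Fin T'.faces × Fin 3 ≃ Fin T.faces × Fin 3),
      SimultaneousFlip T T' ∧ T'.eulerChar = T.eulerChar ∧
        T'.comb.Iso (T.comb.flip X hX) e := by
  classical
  have hX' : ∀ f i j, (f, i) ∈ X → (f, j) ∈ X → i = j := by
    intro f i j hi hj
    by_contra h
    have h1 := hX.φ_notMem _ hi
    have h2 := hX.φφ_notMem hi
    have h3 : T.comb.φ (f, i) = (f, i + 1) := rfl
    have h4 : T.comb.φ (T.comb.φ (f, i)) = (f, i + 1 + 1) := rfl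
    rcases fin_three i j with rfl | rfl | rfl
    · exact h rfl
    · exact h1 hj
    · exact h2 hj
  obtain ⟨T₁, e₁, he₁, ha, h0⟩ := T.exists_rotate hX'
  set X₁ : Set (Fin T₁.faces × Fin 3) := e₁ ⁻¹' X with hX₁
  have hF₁ : T₁.comb.Flippable X₁ := by
    have := he₁.symm.flippable hX
    rwa [Equiv.symm_symm] at this
  let Y : Finset (Fin T₁.faces) := Finset.univ.filter fun f => (f, (0 : Fin 3)) ∈ X₁
  let β : Fin T₁.faces → Fin T₁.faces := fun f => (T₁.glue (f, 0)).1
  have hY : ∀ f, f ∈ Y ↔ (f, (0 : Fin 3)) ∈ X₁ := fun f => by simp [Y]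
  have hXY : ∀ d, d ∈ X₁ ↔ d.1 ∈ Y ∧ d.2 = 0 := by
    intro d
    rw [hY]
    constructor
    · intro h
      have h2 : d.2 = 0 := h0 d h
      exact ⟨by rw [← h2]; exact h, h2⟩
    · rintro ⟨h1, h2⟩
      rwa [← h2] at h1
  have hg : ∀ f ∈ Y, T₁.glue (f, 0) = (β f, 0) := fun f hf =>
    Prod.ext rfl ((hXY _).1 (hF₁.α_mem _ ((hY f).1 hf))).2
  have H : FacePairs T₁.glue Y β :=
    { glue_zero := hg
      mem := fun f hf => ((hXY _).1 (hF₁.α_mem _ ((hY f).1 hf))).1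
      ne := fun f hf h => T₁.glue_ne (f, 0) (by rw [hg f hf, h])
      ββ := fun f hf => by
        have h := T₁.glue_glue (f, 0)
        rw [hg f hf] at h
        exact congrArg Prod.fst h }
  obtain ⟨k, q, h1, h2, h3⟩ := simultaneousFlip_turn H
  have hchar : T₁.eulerChar = T.eulerChar := by
    have := T₁.two_mul_ncard_arcs
    have := T.two_mul_ncard_arcs
    unfold eulerChar
    rw [ha] at *
    omega
  refine ⟨turn H, (turnEquiv H).trans e₁, ⟨k, q, fun i => ?_, h2, by rw [h3, ha]⟩,
    (turn_eulerChar H).trans hchar, (turn_iso H hF₁ hXY).trans ?_⟩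
  · have hq := h1 i
    exact ⟨hq.injOn, hq.corners, ha ▸ hq.left, ha ▸ hq.right, ha ▸ hq.bottom, ha ▸ hq.top,
      ha ▸ hq.diag, ha ▸ hq.avoids⟩
  · have h4 := he₁.flip hF₁
    have h5 : e₁.symm ⁻¹' X₁ = X := by
      ext d
      simp [hX₁]
    simp only [h5] at h4
    exact h4

end Triangulation

end SimFlip

/-! ### Distances in the flip graph and the numerical bound. -/

namespace SimFlip

variable {g n : ℕ}

theorem edist_simultaneousFlip_le {S : MarkedSpace n} {T T' : Triangulation S}
    (hT : T.eulerChar = 2 - 2 * (g : ℤ)) (hT' : T'.eulerChar = 2 - 2 * (g : ℤ))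
    (h : SimultaneousFlip T T') :
    (modularSimultaneousFlipGraph g n).edist (Quotient.mk _ ⟨S, T, hT⟩)
      (Quotient.mk _ ⟨S, T', hT'⟩) ≤ 1 := by
  rw [SimpleGraph.edist_le_one_iff_adj_or_eq]
  by_cases he : (Quotient.mk _ ⟨S, T, hT⟩ : ModularVertex g n) = Quotient.mk _ ⟨S, T', hT'⟩
  · exact Or.inr he
  · exact Or.inl ((SimpleGraph.fromRel_adj _ _ _).2
      ⟨he, Or.inl ⟨S, T, T', hT, hT', rfl, rfl, h⟩⟩)

/-- Combinatorial moves are realized by simultaneous flips. -/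
theorem exists_edist_le (A : TriangulatedSurface g n) {k : ℕ}
    {M : TriSurf (Fin n) (Fin A.triang.faces × Fin 3)} (h : TriSurf.Reach k A.triang.comb M) :
    ∃ (B : TriangulatedSurface g n)
      (e : Fin B.triang.faces × Fin 3 ≃ Fin A.triang.faces × Fin 3),
      B.triang.comb.Iso M e ∧
        (modularSimultaneousFlipGraph g n).edist (Quotient.mk _ A) (Quotient.mk _ B) ≤ k := by
  generalize hC : A.triang.comb = C at h
  induction h with
  | zero =>
    subst hC
    exact ⟨A, Equiv.refl _, TriSurf.Iso.refl _, by simp⟩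
  | succ _ s ih =>
    obtain ⟨B, e, he, hd⟩ := ih hC
    obtain ⟨N, ⟨X, hX, rfl⟩, hN⟩ := he.symm.step s
    obtain ⟨T', e', h1, h2, h3⟩ := B.triang.exists_simultaneousFlip hX
    refine ⟨⟨B.surface, T', h2.trans B.genus_eq⟩, _, h3.trans hN.symm, ?_⟩
    refine (SimpleGraph.edist_triangle (v := Quotient.mk _ B)).trans ?_
    push_cast
    exact add_le_add hd (edist_simultaneousFlip_le B.genus_eq _ h1)

/-- The two sequences of moves end at the same vertex of the graph. Running the second one backwards
accounts for the factor 2. -/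
theorem edist_le_of_meet (A B : TriangulatedSurface g n) {k : ℕ}
    (h : TriSurf.Meet k A.triang.comb B.triang.comb ∅) :
    (modularSimultaneousFlipGraph g n).edist (Quotient.mk _ A) (Quotient.mk _ B) ≤
      (2 * k : ℕ) := by
  obtain ⟨M, M', e, h1, h2, he, -⟩ := h
  obtain ⟨A', a, ha, hA⟩ := exists_edist_le A h1
  obtain ⟨B', b, hb, hB⟩ := exists_edist_le B h2
  have h3 : (Quotient.mk _ A' : ModularVertex g n) = Quotient.mk _ B' :=
    Quotient.sound (A'.triang.exists_homeomorph B'.triang ((ha.trans he).trans hb.symm))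
  rw [h3] at hA
  rw [SimpleGraph.edist_comm] at hB
  refine SimpleGraph.edist_triangle.trans ((add_le_add hA hB).trans_eq ?_)
  push_cast
  ring

/-- The number of moves in terms of the complexity of the surface. -/
theorem moves_lt {p k : ℕ} (hp : 2 ≤ p) (hk : k = Nat.clog 2 p) :
    ((2 * (k * (72 * (k + 2) + 2) + 96 * (k + 2) + 1) : ℕ) : ℝ) < 4500 * Real.log p ^ 2 := by
  have hc : (0.69 : ℝ) < Real.log 2 := by linarith [Real.log_two_gt_d9]
  have h1 : Real.log 2 ≤ Real.log p := Real.log_le_log (by norm_num) (by exact_mod_cast hp)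
  have h2 : (k : ℝ) * Real.log 2 ≤ Real.log p + Real.log 2 := by
    have hk0 : 1 ≤ k := by
      rw [hk]; exact Nat.clog_pos one_lt_two hp
    have h3 : 2 ^ (k - 1) < p := by
      rw [hk]; exact Nat.pow_pred_clog_lt_self one_lt_two hp
    have h4 : ((2 : ℝ) ^ (k - 1)) ≤ p := by exact_mod_cast h3.le
    have h5 := Real.log_le_log (by positivity) h4
    rw [Real.log_pow, Nat.cast_sub hk0] at h5
    push_cast at h5
    linarith
  obtain ⟨l, hl⟩ : ∃ l, Real.log p = l * Real.log 2 := ⟨Real.log p / Real.log 2, by field_simp⟩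
  have hl1 : 1 ≤ l := by
    rw [hl] at h1
    by_contra h
    nlinarith
  have hkl : (k : ℝ) ≤ l + 1 := by
    rw [hl] at h2
    by_contra h
    nlinarith
  have hk0 : (0 : ℝ) ≤ k := k.cast_nonneg
  have hc2 : (0.47 : ℝ) ≤ Real.log 2 ^ 2 := by nlinarith
  have hk2 : (k : ℝ) ^ 2 ≤ (l + 1) ^ 2 := pow_le_pow_left₀ hk0 hkl 2
  rw [hl, mul_pow]
  push_cast
  have h6 : l ^ 2 * 0.47 ≤ l ^ 2 * Real.log 2 ^ 2 := mul_le_mul_of_nonneg_left hc2 (sq_nonneg l)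
  -- By `k ≤ l + 1` the left side is at most `144 * l ^ 2 + 772 * l + 1014`, which is at most `1930
  -- * l ^ 2` for `l ≥ 1`, while `4500 * 0.47 = 2115`.
  nlinarith

end SimFlip

theorem theorem5p1 (g n : ℕ) (hn : 1 ≤ n) (hgn : 3 ≤ 2 * g + n) :
    (SimFlip.modularSimultaneousFlipGraph g n).ediam ≠ ⊤ ∧
      ((SimFlip.modularSimultaneousFlipGraph g n).diam : ℝ) <
        4500 * (Real.log ((g : ℝ) + (n : ℝ))) ^ 2 := by
  set k := Nat.clog 2 (g + n) with hk
  have hk' : g + n ≤ 2 ^ k := Nat.le_pow_clog one_lt_two _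
  have key : (SimFlip.modularSimultaneousFlipGraph g n).ediam ≤
      (2 * (k * (72 * (k + 2) + 2) + 96 * (k + 2) + 1) : ℕ) := by
    refine SimpleGraph.ediam_le_of_edist_le fun u v => ?_
    induction u using Quotient.inductionOn with | _ A => ?_
    induction v using Quotient.inductionOn with | _ B => ?_
    have : NeZero n := ⟨by omega⟩
    refine SimFlip.edist_le_of_meet A B ((A.triang.closed A.genus_eq).meet
      (B.triang.closed B.genus_eq) ⟨0, Finset.mem_univ _⟩ (by simpa using hgn) ?_
      (by simpa using hk'))
    -- The bound `4 * (g + n) ≤ 2 ^ (k + 2)` for the number of polygon sides explains the choice `K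
    -- = k + 2`.
    rw [Finset.card_univ, Fintype.card_fin, pow_add]
    omega
  have hfin := ne_top_of_le_ne_top (ENat.natCast_ne_top _) key
  refine ⟨hfin, lt_of_le_of_lt ?_ ((SimFlip.moves_lt (p := g + n) (by omega) hk).trans_eq
    (by push_cast; rfl))⟩
  exact_mod_cast ENat.toNat_le_of_le_natCast key
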